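/- Let $K$ be an arbitrary field and $n\ge 2$. In $\mathbb P^2=\mathbb P^2_K$ with coordinates $(x:y:z)$ let $L$ be the line $z=0$, let $Q$ be the conic $xz=y^2$, and let $p_1=(0:0:1)$. Write $u=x/z$, $v=y/z$, $w=u-v^2$, $X=w/v^4$. Choose $a_1,\dots,a_n\in K$ with $a_1\neq 0$ such that two consecutive coefficients $a_j,a_{j+1}$ ($1\le j<n$) are both nonzero (for example $a_n=a_{n-1}=1$ together with $a_1\ne0$). Define points $p_1,\dots,p_{4+2n}$, with $p_{i+1}$ infinitely near to $p_i$ and lying on the exceptional curve of $p_i$, as the origins of the following local coordinate systems: - $(w/v^{i-1},\,v)$ for $1\le i\le 4$; - $(X,\,v/X^{i-5})$ for $5\le i\le 4+n$; - $\bigl(X,\ (v/X^n-\sum_{k=1}^{j}a_kX^{k-1})/X^{j-1}\bigr)$ for $i=4+n+j$, $1\le j\le n$. Let $\lambda,\mu\in K^*$ with $\lambda\neq 1$, let $f:\mathbb P^2\dashrightarrow\mathbb P^2$ be the birational map $$f(x:y:z)=\bigl(\mu^2(\lambda xz+(1-\lambda)y^2):\mu yz:z^2\bigr),$$ which preserves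 $Q$ and is a local isomorphism at $p_1=f(p_1)$, and put $p_i'=f(p_i)$. Say that a birational map $\varphi:\mathbb P^2\dashrightarrow\mathbb P^2$ is associated with the tower $(p_i)$ if $\varphi=\varepsilon\circ\Delta^{-1}$, where $\Delta:S\to\mathbb P^2$ is the blow-up of $p_1,\dots,p_{4+2n}$ and $\varepsilon:S\to\mathbb P^2$ is a birational morphism which contracts exactly the strict transforms of $Q$ and of the exceptional curves $E_1,\dots,E_{3+2n}$, and which sends $E_{4+2n}$ onto $Q$; similarly for the tower $(p_i')$. Then $(p_i)$ and $(p'_i)$ are towers of infinitely near points, and there exist birational maps $\varphi$ and $\varphi'$ associated with $(p_i)$ and $(p_i')$. For all such $\varphi,\varphi'$, the line $L$ has image curves $C=\varphi(L)$ and $D=\varphi'(L)$, and: 1. $C$ and $D$ are irreducible curves of degree $4n+1$. They are of type I: each becomes isomorphic to $\mathbb A^1$ over $K$ after removing one suitable point. They are unicuspidal: each has exactly one singular point, and this point is a cusp, i.e. a unibranch singularity. 2. The birational map $\psi=\varphi'\circ f\circ\varphi^{-1}$ restricts to an isomorphism $\mathbb P^2\setminus C\to\mathbb P^2\setminus D$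 over $K$. 3. No automorphism of $\mathbb P^2$ over $K$ sends $C$ onto $D$. Thus, for every $n\ge2$, such pairs $(C,D)$ (taking $K$ algebraically closed of characteristic $0$) are counterexamples in degree $4n+1$, in particular in degree $9$ for $n=2$, to Yoshihara's conjecture that two irreducible plane curves with isomorphic complements are projectively equivalent. -/

import Mathlib

open CategoryTheory AlgebraicGeometry

attribute [local instance] MvPolynomial.gradedAlgebra

noncomputable section

namespace PlaneBirational

universe u

/-! ### The projective plane and its function field -/

section Plane

variable (K : Type u) [Field K]

/-- The homogeneous coordinate ring `K[x, y, z]`, with `x = X 0`, `y = X 1`, `z = X 2`. -/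
abbrev HomRing : Type u := MvPolynomial (Fin 3) K

/-- The projective plane over `K`, as a scheme. -/
abbrev P2 : Scheme.{u} := Proj (MvPolynomial.homogeneousSubmodule (Fin 3) K)

/-- The structure morphism `ℙ² ⟶ Spec K`. -/
def P2.str : P2 K ⟶ Spec (CommRingCat.of K) :=
  Proj.toSpecZero (MvPolynomial.homogeneousSubmodule (Fin 3) K) ≫
    Spec.map (CommRingCat.ofHom
      (algebraMap K (MvPolynomial.homogeneousSubmodule (Fin 3) K 0)))

/-- The function field `K(u, v)` of `ℙ²`, where `u = x / z` and `v = y / z`. -/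
abbrev FunField : Type u := FractionRing (MvPolynomial (Fin 2) K)

/-- The rational function `u = x / z`. -/
def uFun : FunField K := algebraMap (MvPolynomial (Fin 2) K) (FunField K) (MvPolynomial.X 0)

/-- The rational function `v = y / z`. -/
def vFun : FunField K := algebraMap (MvPolynomial (Fin 2) K) (FunField K) (MvPolynomial.X 1)

/-- Dehomogenization `G(x, y, z) ↦ G(u, v, 1)`. For `A`, `B` homogeneous of the same degree,
`dehom K A / dehom K B` is the rational function `A / B` on `ℙ²`. -/
def dehom : HomRing K →ₐ[K] FunField K := MvPolynomial.aeval ![uFun K, vFun K, 1]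

variable {K}

theorem aeval_mul_of_isHomogeneous {T : Type*} [CommRing T] [Algebra K T] {B : HomRing K} {d : ℕ}
    (hB : B.IsHomogeneous d) (c : T) (g : Fin 3 → T) :
    MvPolynomial.aeval (R := K) (fun i => c * g i) B = c ^ d * MvPolynomial.aeval g B := by
  rw [MvPolynomial.aeval_def, MvPolynomial.aeval_def, MvPolynomial.eval₂_eq',
    MvPolynomial.eval₂_eq', Finset.mul_sum]
  refine Finset.sum_congr rfl fun e he => ?_
  have hd : ∑ i, e i = d := by
    have := hB (MvPolynomial.mem_support_iff.mp he)
    simpa [Finsupp.weight_apply, Finsupp.sum_fintype] using this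
  simp only [mul_pow, Finset.prod_mul_distrib, Finset.prod_pow_eq_pow_sum, hd]
  ring

theorem dehom_ne_zero {B : HomRing K} {d : ℕ} (hB : B.IsHomogeneous d) (h0 : B ≠ 0) :
    dehom K B ≠ 0 := by
  intro h
  apply h0
  let T := FractionRing (HomRing K)
  let X' : Fin 3 → T := fun i => algebraMap (HomRing K) T (MvPolynomial.X i)
  have hz : X' 2 ≠ 0 := by
    simp only [X', ne_eq, FaithfulSMul.algebraMap_eq_zero_iff]
    exact MvPolynomial.X_ne_zero _
  have h1 : MvPolynomial.aeval (R := K)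
      ![(MvPolynomial.X 0 : MvPolynomial (Fin 2) K), MvPolynomial.X 1, 1] B = 0 := by
    apply IsFractionRing.injective (MvPolynomial (Fin 2) K) (FunField K)
    rw [map_zero, ← h, dehom, ← MvPolynomial.aeval_algebraMap_apply]
    congr 2
    funext i
    fin_cases i <;> simp [uFun, vFun]
  have h2 := congrArg (MvPolynomial.aeval (R := K) ![X' 0 / X' 2, X' 1 / X' 2]) h1
  rw [map_zero, ← AlgHom.comp_apply, MvPolynomial.comp_aeval] at h2
  have h4 : X' = fun i => X' 2 * (fun j => MvPolynomial.aeval (R := K)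
      ![X' 0 / X' 2, X' 1 / X' 2]
      ((![(MvPolynomial.X 0 : MvPolynomial (Fin 2) K), MvPolynomial.X 1, 1] :
        Fin 3 → MvPolynomial (Fin 2) K) j)) i := by
    funext i
    fin_cases i <;> simp [mul_div_cancel₀, hz]
  have h5 : MvPolynomial.aeval (R := K) X' B = 0 := by
    rw [h4, aeval_mul_of_isHomogeneous hB, h2, mul_zero]
  apply IsFractionRing.injective (HomRing K) T
  rw [map_zero, ← h5]
  have h6 := MvPolynomial.aeval_algebraMap_apply (R := K) (A := HomRing K) T MvPolynomial.X B
  rw [MvPolynomial.aeval_X_left_apply] at h6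
  exact h6.symm

/-- A homogeneous fraction in `K[x, y, z]_(𝔭)`, read as a rational function on `ℙ²`. -/
def fracToFun (𝔭 : Ideal (HomRing K)) [𝔭.IsPrime] :
    HomogeneousLocalization.AtPrime (MvPolynomial.homogeneousSubmodule (Fin 3) K) 𝔭 →+*
      FunField K :=
  have den_ne (q : HomogeneousLocalization.AtPrime
      (MvPolynomial.homogeneousSubmodule (Fin 3) K) 𝔭) : dehom K q.den ≠ 0 :=
    dehom_ne_zero ((MvPolynomial.mem_homogeneousSubmodule _ _).mp q.den_mem_deg)
      (fun h => q.den_mem (h ▸ 𝔭.zero_mem))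
  have key (q : HomogeneousLocalization.AtPrime
      (MvPolynomial.homogeneousSubmodule (Fin 3) K) 𝔭) (a : HomRing K) (b : 𝔭.primeCompl)
      (hb : dehom K b ≠ 0) (h : q.val = Localization.mk a b) :
      dehom K q.num / dehom K q.den = dehom K a / dehom K b := by
    rw [q.eq_num_div_den, Localization.mk_eq_mk_iff, Localization.r_iff_exists] at h
    obtain ⟨c, hc⟩ := h
    have hc0 : (c : HomRing K) ≠ 0 := fun h0 => c.2 (h0 ▸ 𝔭.zero_mem)
    have h2 := congrArg (dehom K) (mul_left_cancel₀ hc0 hc)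
    rw [div_eq_div_iff (den_ne q) hb]
    simp only [map_mul] at h2
    linear_combination h2
  { toFun := fun q => dehom K q.num / dehom K q.den
    map_one' := by
      rw [key 1 1 1 (by simp) (by simp [Localization.mk_one])]
      simp
    map_zero' := by
      rw [key 0 0 1 (by simp) (by simp [Localization.mk_zero])]
      simp
    map_mul' := fun q r => by
      rw [key (q * r) (q.num * r.num) (⟨q.den, q.den_mem⟩ * ⟨r.den, r.den_mem⟩)
        (by simpa using ⟨den_ne q, den_ne r⟩)
        (by rw [HomogeneousLocalization.val_mul, q.eq_num_div_den, r.eq_num_div_den,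
              Localization.mk_mul])]
      simp [mul_div_mul_comm]
    map_add' := fun q r => by
      rw [key (q + r) (q.den * r.num + r.den * q.num) (⟨q.den, q.den_mem⟩ * ⟨r.den, r.den_mem⟩)
        (by simpa using ⟨den_ne q, den_ne r⟩)
        (by rw [HomogeneousLocalization.val_add, q.eq_num_div_den, r.eq_num_div_den,
              Localization.add_mk])]
      have h1 := den_ne q
      have h2 := den_ne r
      simp only [map_add, map_mul, Submonoid.coe_mul]
      field_simp
      ring }

/-- The embedding of the local ring of `ℙ²` at `x` into the function field. -/
def stalkToFun (x : P2 K) : (P2 K).presheaf.stalk x →+* FunField K :=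
  haveI : x.asHomogeneousIdeal.toIdeal.IsPrime := x.isPrime
  (fracToFun x.asHomogeneousIdeal.toIdeal).comp
    (Proj.stalkIso (MvPolynomial.homogeneousSubmodule (Fin 3) K) x).hom.hom

/-- The local ring of `ℙ²` at `x`, as a local subring of the function field. -/
def localRing (x : P2 K) : LocalSubring (FunField K) :=
  LocalSubring.range (stalkToFun x)

end Plane

/-! ### Birational self-maps of the plane -/

section Bir

variable (K : Type u) [Field K]

/-- A birational map `θ : ℙ² ⇢ ℙ²` over `K`, given by the field automorphism
`r ↦ r ∘ θ` of the function field (its comorphism). -/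
structure Bir where
  /-- The comorphism `r ↦ r ∘ θ`. -/
  pull : FunField K ≃ₐ[K] FunField K

variable {K}

/-- The composite `θ₂ ∘ θ₁`. -/
def Bir.comp (θ₂ θ₁ : Bir K) : Bir K := ⟨θ₂.pull.trans θ₁.pull⟩

/-- The inverse birational map. -/
def Bir.symm (θ : Bir K) : Bir K := ⟨θ.pull.symm⟩

/-- The image under `θ` of a (proper or infinitely near) point or curve, given by its local ring
`R`: it is the local ring `{r | r ∘ θ ∈ R}`. -/
def Bir.push (θ : Bir K) (R : LocalSubring (FunField K)) : LocalSubring (FunField K) :=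
  LocalSubring.map (θ.pull.symm : FunField K →+* FunField K) R

/-- `θ`, on a surface one of whose points (or curves) has local ring `R`, maps this point to
the point `y` of `ℙ²`: the pull-back by `θ` of the local ring at `y` is dominated by `R`. -/
def Bir.MapsTo (θ : Bir K) (R : LocalSubring (FunField K)) (y : P2 K) : Prop :=
  localRing y ≤ θ.push R

/-- The morphism `g`, from an open subset of `ℙ²` to `ℙ²`, is the restriction of the birational
map `θ`: functions are pulled back by `g` as they are by `θ`. -/
def Bir.RestrictsTo (θ : Bir K) {U : (P2 K).Opens} (g : U.toScheme ⟶ P2 K) : Prop :=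
  ∀ (x : U.toScheme) (s : (P2 K).presheaf.stalk (g x)),
    stalkToFun x.1 ((U.stalkIso x).hom (g.stalkMap x s)) = θ.pull (stalkToFun (g x) s)

end Bir

/-! ### Plane curves -/

section Curves

variable (K : Type u) [Field K]

/-- An irreducible plane curve, given by an equation. -/
structure PlaneCurve where
  /-- The homogeneous equation. -/
  poly : HomRing K
  /-- The degree. -/
  deg : ℕ
  isHomogeneous : poly.IsHomogeneous deg
  irreducible : Irreducible poly

variable {K}

namespace PlaneCurve

/-- The generic point of the curve, that is, the homogeneous prime ideal of its equation. -/
def genericPoint (C : PlaneCurve K) : P2 K where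
  asHomogeneousIdeal :=
    { toSubmodule := Ideal.span {C.poly}
      is_homogeneous' := Ideal.homogeneous_span _ _ (by
        rintro _ rfl
        exact ⟨C.deg, (MvPolynomial.mem_homogeneousSubmodule _ _).mpr C.isHomogeneous⟩) }
  isPrime := (Ideal.span_singleton_prime C.irreducible.ne_zero).mpr C.irreducible.prime
  not_irrelevant_le := by
    intro h
    have hX : ∀ i : Fin 3, C.poly ∣ MvPolynomial.X i := fun i => by
      refine Ideal.mem_span_singleton.mp (h ?_)
      rw [HomogeneousIdeal.mem_irrelevant_iff, GradedRing.proj_apply]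
      exact DirectSum.decompose_of_mem_ne _ (i := 1)
        ((MvPolynomial.mem_homogeneousSubmodule _ _).mpr (MvPolynomial.isHomogeneous_X K i))
        one_ne_zero
    have h0 : Associated C.poly (MvPolynomial.X (0 : Fin 3)) :=
      C.irreducible.associated_of_dvd (MvPolynomial.X_prime).irreducible (hX 0)
    have h1 := h0.symm.dvd.trans (hX 1)
    rw [MvPolynomial.X_dvd_X] at h1
    exact absurd h1 (by decide)

/-- The complement `ℙ² \ C`. -/
def compl (C : PlaneCurve K) : (P2 K).Opens :=
  Proj.basicOpen (MvPolynomial.homogeneousSubmodule (Fin 3) K) C.poly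

/-- The set of points of the curve. -/
def points (C : PlaneCurve K) : TopologicalSpace.Closeds (P2 K) := C.compl.compl

/-- The curve as an integral closed subscheme of `ℙ²`. -/
def scheme (C : PlaneCurve K) : Scheme.{u} :=
  (Scheme.IdealSheafData.vanishingIdeal C.points).subscheme

/-- The inclusion of the curve in `ℙ²`. -/
def ι (C : PlaneCurve K) : C.scheme ⟶ P2 K :=
  (Scheme.IdealSheafData.vanishingIdeal C.points).subschemeι

/-- `C` is of type I: for some point `p` of `C`, the curve `C \ p` is isomorphic to `𝔸¹`
over `K`. -/
def IsTypeI (C : PlaneCurve K) : Prop :=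
  ∃ (p : C.scheme) (U : C.scheme.Opens), (U : Set C.scheme) = {p}ᶜ ∧
    ∃ e : U.toScheme ≅ 𝔸(PUnit.{u + 1}; Spec (CommRingCat.of K)),
      e.hom ≫ (𝔸(PUnit.{u + 1}; Spec (CommRingCat.of K)) ↘ Spec (CommRingCat.of K)) =
        U.ι ≫ C.ι ≫ P2.str K

/-- `C` is unicuspidal: it has exactly one singular point, and this point is a cusp, that is, a
unibranch singularity (the integral closure of its local ring is again local). -/
def IsUnicuspidal (C : PlaneCurve K) : Prop :=
  ∃ p : C.scheme,
    (∀ x : C.scheme, IsRegularLocalRing (C.scheme.presheaf.stalk x) ↔ x ≠ p) ∧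
    IsLocalRing (integralClosure (C.scheme.presheaf.stalk p)
      (FractionRing (C.scheme.presheaf.stalk p)))

/-- The birational map `θ` restricts to an isomorphism `ℙ² \ C ≅ ℙ² \ D` over `K`. -/
def ComplIsoVia (θ : Bir K) (C D : PlaneCurve K) : Prop :=
  ∃ e : C.compl.toScheme ≅ D.compl.toScheme,
    e.hom ≫ D.compl.ι ≫ P2.str K = C.compl.ι ≫ P2.str K ∧
    θ.RestrictsTo (e.hom ≫ D.compl.ι)

/-- Some automorphism of `ℙ²` over `K` sends `C` onto `D`. -/
def ProjectivelyEquivalent (C D : PlaneCurve K) : Prop :=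
  ∃ α : P2 K ≅ P2 K, α.hom ≫ P2.str K = P2.str K ∧
    α.hom '' (C.points : Set (P2 K)) = (D.points : Set (P2 K))

/-- `D` is the image of the curve `C` by the birational map `θ`: the generic point of `C` is
mapped to the generic point of `D`. -/
def IsImage (θ : Bir K) (C D : PlaneCurve K) : Prop :=
  θ.MapsTo (localRing C.genericPoint) D.genericPoint

variable (K)

/-- The line `L : z = 0`. -/
def lineL : PlaneCurve K where
  poly := MvPolynomial.X 2
  deg := 1
  isHomogeneous := MvPolynomial.isHomogeneous_X K 2
  irreducible := (MvPolynomial.X_prime).irreducible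

/-- The conic `Q : x z = y ^ 2`. -/
def conicQ : PlaneCurve K where
  poly := MvPolynomial.X 0 * MvPolynomial.X 2 - MvPolynomial.X 1 ^ 2
  deg := 2
  isHomogeneous :=
    ((MvPolynomial.isHomogeneous_X K 0).mul (MvPolynomial.isHomogeneous_X K 2)).sub
      ((MvPolynomial.isHomogeneous_X K 1).pow 2)
  irreducible := by
    classical
    have h := MvPolynomial.irreducible_mul_X_add (R := K)
      (MvPolynomial.X (2 : Fin 3)) (-(MvPolynomial.X (1 : Fin 3)) ^ 2) 0
      (MvPolynomial.X_ne_zero _) (by simp) (by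
        intro h
        have h' := MvPolynomial.vars_pow (MvPolynomial.X (1 : Fin 3) : MvPolynomial (Fin 3) K) 2
          (by simpa [MvPolynomial.vars_neg] using h)
        simp [MvPolynomial.vars_X] at h') (by
        refine ((MvPolynomial.X_prime).irreducible.isRelPrime_iff_not_dvd.mpr ?_).neg_right
        intro h
        have h' := (MvPolynomial.X_prime).dvd_of_dvd_pow h
        rw [MvPolynomial.X_dvd_X] at h'
        exact absurd h' (by decide))
    convert h using 1
    ring

end PlaneCurve

end Curves

/-! ### Blow-ups and towers of infinitely near points

A surface birational to `ℙ²` is described, following Zariski, by the set of the local rings of its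
points inside the function field. A curve on it is given by its generic point, whose local ring is
a discrete valuation ring; this local ring does not change when one takes the strict transform of
the curve under the blow-up of a closed point. -/

section Surfaces

variable {K : Type u} [Field K]

/-- The local rings of the points of `ℙ²`. -/
def planeModel (K : Type u) [Field K] : Set (LocalSubring (FunField K)) :=
  Set.range (localRing (K := K))

/-- The ring `R[𝔪 / x]` generated by `R` and the quotients `y / x`, for `y` in the maximal
ideal `𝔪` of `R`. -/
def blowUpChart (R : LocalSubring (FunField K)) (x : FunField K) : Subring (FunField K) :=
  Subring.closure
    ((R.toSubring : Set (FunField K)) ∪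
      {r | ∃ y ∈ IsLocalRing.maximalIdeal R.toSubring, r = (y : FunField K) / x})

/-- The local rings of the points of the blow-up of the point with local ring `R` that lie over
this point: the localizations of the charts `R[𝔪 / x]`, for `x ∈ 𝔪` nonzero, which dominate `R`. -/
def exceptionalFibre (R : LocalSubring (FunField K)) : Set (LocalSubring (FunField K)) :=
  {S | R ≤ S ∧ ∃ x ∈ IsLocalRing.maximalIdeal R.toSubring, x ≠ 0 ∧
    ∃ (P : Ideal (blowUpChart R (x : FunField K))) (_ : P.IsPrime),
      S = LocalSubring.ofPrime (blowUpChart R (x : FunField K)) P}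

/-- The blow-up of the surface `X` at its closed point with local ring `R`. -/
def blowUp (X : Set (LocalSubring (FunField K))) (R : LocalSubring (FunField K)) :
    Set (LocalSubring (FunField K)) :=
  (X \ {R}) ∪ exceptionalFibre R

/-- `E` is the local ring at the generic point of the exceptional curve of the blow-up of the point
with local ring `R`. -/
def IsExceptionalCurve (R E : LocalSubring (FunField K)) : Prop :=
  E ∈ exceptionalFibre R ∧ ∀ S ∈ exceptionalFibre R, S.toSubring ≤ E.toSubring

/-- The surface obtained from `ℙ²` by blowing up `p 1, …, p m`. -/
def towerSurface (p : ℕ → LocalSubring (FunField K)) : ℕ → Set (LocalSubring (FunField K))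
  | 0 => planeModel K
  | m + 1 => blowUp (towerSurface p m) (p (m + 1))

/-- `p 1, …, p m` is a tower of points: `p 1` is a point of `ℙ²`, and each `p (i + 1)` is a
point of the exceptional curve of the blow-up of `p i`. -/
def IsTower (p : ℕ → LocalSubring (FunField K)) (m : ℕ) : Prop :=
  p 1 ∈ planeModel K ∧ ∀ i, 1 ≤ i → i < m → p (i + 1) ∈ exceptionalFibre (p i)

/-- `R ∈ X` is the local ring of a closed point of the surface `X`: no other point of `X` is a
specialization of it. -/
def IsClosedPoint (X : Set (LocalSubring (FunField K))) (R : LocalSubring (FunField K)) : Prop :=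
  R ∈ X ∧ ∀ S ∈ X, S.toSubring ≤ R.toSubring → S = R

/-- `R ∈ X` is the local ring of (the generic point of) a curve on the surface `X`. -/
def IsCurveOn (X : Set (LocalSubring (FunField K))) (R : LocalSubring (FunField K)) : Prop :=
  R ∈ X ∧ R.toSubring ≠ ⊤ ∧ ¬ IsClosedPoint X R

/-- The curve with local ring `R` is contracted by `θ` to a closed point of `ℙ²`. -/
def Bir.Contracts (θ : Bir K) (R : LocalSubring (FunField K)) : Prop :=
  ∃ y : P2 K, IsClosedPoint (planeModel K) (localRing y) ∧ θ.MapsTo R y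

/-- `φ = ε ∘ Δ⁻¹`, where `Δ : X ⟶ ℙ²` is the blow-up of the tower `p 1, …, p m` and
`ε : X ⟶ ℙ²` is a birational morphism which contracts exactly the strict transforms of `Q` and of
the exceptional curves of `p 1, …, p (m - 1)`, and which sends the exceptional curve of `p m`
onto `Q`. -/
structure IsTowerMap (p : ℕ → LocalSubring (FunField K)) (m : ℕ) (φ : Bir K) : Prop where
  /-- `ε` is a morphism: it is defined at each point of `X`. -/
  morphism : ∀ R ∈ towerSurface p m, ∃ y : P2 K, φ.MapsTo R y
  contracts_iff : ∀ R, IsCurveOn (towerSurface p m) R →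
    (φ.Contracts R ↔ R = localRing (PlaneCurve.conicQ K).genericPoint ∨
      ∃ i, 1 ≤ i ∧ i < m ∧ IsExceptionalCurve (p i) R)
  last_to_conic : ∀ E, IsExceptionalCurve (p m) E →
    φ.MapsTo E (PlaneCurve.conicQ K).genericPoint

end Surfaces

/-! ### The points `p₁, …, p_{4+2n}` and the map `f` -/

section Construction

variable {K : Type u} [Field K]

/-- The ideal `(s, t)` of `K[s, t]`. -/
def originIdeal (s t : FunField K) : Ideal (Algebra.adjoin K {s, t}).toSubring :=
  Ideal.span {r | (r : FunField K) = s ∨ (r : FunField K) = t}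

open Classical in
/-- The local ring at the origin of the affine plane with coordinates `s`, `t`, that is, the
localization of `K[s, t]` at the ideal `(s, t)`. (It is used for coordinates only, that is, when
`s`, `t` are algebraically independent; otherwise, when this ideal is not prime, the value is the
whole function field.) -/
def originRing (s t : FunField K) : LocalSubring (FunField K) :=
  if h : (originIdeal s t).IsPrime then
    haveI := h
    LocalSubring.ofPrime (Algebra.adjoin K {s, t}).toSubring (originIdeal s t)
  else ⟨⊤⟩

/-- The local equation `w = x z / z² - y² / z²` of the conic `Q` in the chart `z = 1`. -/
def wFun (K : Type u) [Field K] : FunField K := uFun K - vFun K ^ 2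

/-- The coordinate `X` of the chart `(X, Y) ↦ (X Y⁴ + Y² : Y : 1)`, in which `Y = v`. -/
def xFun (K : Type u) [Field K] : FunField K := wFun K / vFun K ^ 4

/-- The points `p_i`, for `1 ≤ i ≤ 4 + 2n`.

The points `p₁ = (0 : 0 : 1), p₂, …, p₅` are the first points of `Q`: the point `p_i` is the
origin of the chart `(w / v ^ (i-1), v)`. In the chart `(X, Y) = (w / v ^ 4, v)` obtained by
blowing up `p₁, …, p₄`, the conic is `X = 0` and the exceptional curve `E₄` is `Y = 0`. The points
`p₅, …, p_{4+n}` are the points of `E₄` given by the charts `(X, Y / X ^ (j-1))`. In the chart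
`(X, Y / X ^ n)` obtained by blowing up `p₅, …, p_{4+n}`, the point `p_{4+n+1}` is `(0, a₁)`; then,
after the blow-ups given by `y = a₁ + a₂ X + ⋯ + a_{j-1} X ^ (j-2) + X ^ (j-1) y'`, the point
`p_{4+n+j}` is `(0, a_j)` in the coordinates `(X, y')`. -/
def towerPoint (n : ℕ) (a : ℕ → K) (i : ℕ) : LocalSubring (FunField K) :=
  if i ≤ 4 then originRing (wFun K / vFun K ^ (i - 1)) (vFun K)
  else if i ≤ 4 + n then originRing (xFun K) (vFun K / xFun K ^ (i - 5))
  else originRing (xFun K)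
    ((vFun K / xFun K ^ n -
        ∑ k ∈ Finset.Icc 1 (i - (4 + n)),
          algebraMap K (FunField K) (a k) * xFun K ^ (k - 1)) /
      xFun K ^ (i - (4 + n) - 1))

theorem C_mul_C_inv (c : Kˣ) :
    (MvPolynomial.C (c : K) * MvPolynomial.C ((c : K)⁻¹) : MvPolynomial (Fin 2) K) = 1 := by
  rw [← MvPolynomial.C_mul, mul_inv_cancel₀ c.ne_zero, MvPolynomial.C_1]

open MvPolynomial in
/-- The automorphism `(u, v) ↦ (μ² (l u + (1 - l) v²), μ v)` of the affine plane `z = 1`, as an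
automorphism of its coordinate ring. -/
def affineMap (l μ : Kˣ) : MvPolynomial (Fin 2) K ≃ₐ[K] MvPolynomial (Fin 2) K :=
  AlgEquiv.ofAlgHom
    (aeval ![C (μ : K) ^ 2 * (C (l : K) * X 0 + (1 - C (l : K)) * X 1 ^ 2), C (μ : K) * X 1])
    (aeval ![C ((l : K)⁻¹) * (C ((μ : K)⁻¹) ^ 2 * (X 0 - (1 - C (l : K)) * X 1 ^ 2)),
      C ((μ : K)⁻¹) * X 1])
    (by
      have h1 := C_mul_C_inv μ
      have h2 := C_mul_C_inv l
      ext1 i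
      fin_cases i
      · simp only [AlgHom.comp_apply, AlgHom.id_apply, aeval_X, map_mul, map_sub, map_one,
          map_pow, algHom_C, algebraMap_eq, Fin.zero_eta, Fin.isValue,
          Matrix.cons_val_zero, Matrix.cons_val_one]
        linear_combination (C (μ : K) * C ((μ : K)⁻¹) + 1) * C (l : K) * C ((l : K)⁻¹) * X 0 * h1
          + X 0 * h2
      · simp only [AlgHom.comp_apply, AlgHom.id_apply, aeval_X, map_mul, algHom_C, algebraMap_eq,
          Fin.mk_one, Fin.isValue, Matrix.cons_val_zero, Matrix.cons_val_one]
        linear_combination X 1 * h1)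
    (by
      have h1 := C_mul_C_inv μ
      have h2 := C_mul_C_inv l
      ext1 i
      fin_cases i
      · simp only [AlgHom.comp_apply, AlgHom.id_apply, aeval_X, map_mul, map_sub, map_add, map_one,
          map_pow, algHom_C, algebraMap_eq, Fin.zero_eta, Fin.isValue,
          Matrix.cons_val_zero, Matrix.cons_val_one]
        linear_combination (C (μ : K) * C ((μ : K)⁻¹) + 1) *
          (C (l : K) * C ((l : K)⁻¹) * (X 0 - (1 - C (l : K)) * X 1 ^ 2)
            + (1 - C (l : K)) * X 1 ^ 2) * h1 + (X 0 - (1 - C (l : K)) * X 1 ^ 2) * h2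
      · simp only [AlgHom.comp_apply, AlgHom.id_apply, aeval_X, map_mul, algHom_C, algebraMap_eq,
          Fin.mk_one, Fin.isValue, Matrix.cons_val_zero, Matrix.cons_val_one]
        linear_combination X 1 * h1)

/-- The birational map
`f : (x : y : z) ↦ (μ² (l x z + (1 - l) y²) : μ y z : z²)`. -/
def fMap (l μ : Kˣ) : Bir K :=
  ⟨IsFractionRing.fieldEquivOfAlgEquiv K (FunField K) (FunField K) (affineMap l μ)⟩

open MvPolynomial in
/-- `x / z` and `y / z` are pulled back by `f` to the quotients of the components of `f`. -/
theorem fMap_pull (l μ : Kˣ) :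
    (fMap l μ).pull (uFun K) =
        dehom K (C (μ : K) ^ 2 * (C (l : K) * X 0 * X 2 + (1 - C (l : K)) * X 1 ^ 2)) /
          dehom K (X 2 ^ 2) ∧
      (fMap l μ).pull (vFun K) = dehom K (C (μ : K) * X 1 * X 2) / dehom K (X 2 ^ 2) := by
  constructor
  · simp [fMap, uFun, vFun, dehom, affineMap, MvPolynomial.algebraMap_eq,
      IsScalarTower.algebraMap_apply K (MvPolynomial (Fin 2) K) (FunField K)]
  · simp [fMap, uFun, vFun, dehom, affineMap, MvPolynomial.algebraMap_eq,
      IsScalarTower.algebraMap_apply K (MvPolynomial (Fin 2) K) (FunField K)]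

end Construction

end PlaneBirational

end

noncomputable section

namespace PlaneBirational

universe u

/-! ### Local subrings of a field -/

section LocalSubrings

variable {F : Type*} [Field F]

/-! The maps associated with the tower can be written down. On the complement of Q there are the
shears (x : y : z) ↦ (x : y - r x : z - 2 r y + r² x), where w = x z - y² and r = ∑_{k<n} b_k
(x²/w)^(n-k). A shear fixes x and w, hence r, so the shear by -r is its inverse and both are
isomorphisms off Q (`aeval_phiForm_wForm`, `isPairOff_phiForm`).

The shear belongs to the tower when b_0 + b_1 X + ⋯ inverts a_1 + a_2 X + ⋯ modulo X^n. Put e = 1 +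
X v² and let Y be the value of y/x on the image. Then e Y = 1/v - β/X^n with β congruent to b_0 +
b_1 X + ⋯ modulo X v². Write v/X^n = a_1 + ⋯ + a_n X^(n-1) + X^n G, where G is the coordinate on the
last exceptional curve. The poles cancel, and modulo the maximal ideal Y is an affine function of G
with slope -b_0². So the last exceptional curve goes onto Q, while the earlier ones, and Q itself,
go to (0 : 0 : 1) (`isTowerMap_of_givenBy`). Any other map associated with the tower differs from
this one by a birational map that contracts no curve, and such a map is linear
(`Bir.exists_isLinear`, `IsTowerMap.exists_isLinear`).

On L, parametrized by (t : 1 : 0), w equals -1. Up to a linear map, C is therefore the curve t ↦ (t,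
1 - t r, -2 r + t r²), with polynomials of degrees 1, 2n+1, 4n+1. Off the image of Q this is an
isomorphism from the affine line; the one remaining point is at t = ∞, and there the functions that
vanish have order at least two (`image_properties`).

The map f is an automorphism of the complement of L that preserves Q and carries one tower to the
other. Hence ψ matches the curves other than C with the curves other than D; the conic is matched
with the conic image of the last exceptional curve. A function is regular off C exactly when it is
regular along every other curve, so the coordinate rings of the two affine complements correspond
(`complIsoVia_of_isTowerMap`).

Finally, a linear map from C to D relates the two parametrizations by a polynomial substitution, and
comparison of degrees leaves only t ↦ α t. This forces a'_(k+1) = α^(2n+2k+1) a_(k+1) for the two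
towers (`coeff_eq_of_projectivelyEquivalent`), whereas f gives a'_j = μ (μ²/λ)^(n+j-1) a_j. Two
consecutive nonzero coefficients give μ²/λ = α² and μ = α, hence λ = 1 (`eq_one_of_mapCoeff_eq`). -/

/-- Membership in the maximal ideal of a local subring of a field. -/
def MM (R : LocalSubring F) (r : F) : Prop := r ∈ R.toSubring ∧ (r = 0 ∨ r⁻¹ ∉ R.toSubring)

theorem isUnit_iff_inv_mem {R : Subring F} (x : R) :
    IsUnit x ↔ (x : F) ≠ 0 ∧ (x : F)⁻¹ ∈ R := by
  constructor
  · rintro ⟨u, rfl⟩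
    have h : ((u : R) : F) * ((u⁻¹ : Rˣ) : R) = 1 := by
      rw [← Subring.coe_mul, Units.mul_inv, Subring.coe_one]
    refine ⟨left_ne_zero_of_mul_eq_one h, ?_⟩
    rw [← eq_inv_of_mul_eq_one_right h]
    exact ((u⁻¹ : Rˣ) : R).2
  · rintro ⟨h0, h⟩
    refine IsUnit.of_mul_eq_one ⟨_, h⟩ (Subtype.ext ?_)
    simp [mul_inv_cancel₀ h0]

theorem mem_maximalIdeal_iff {R : LocalSubring F} (x : R.toSubring) :
    x ∈ IsLocalRing.maximalIdeal R.toSubring ↔ MM R x := by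
  rw [IsLocalRing.mem_maximalIdeal, mem_nonunits_iff, isUnit_iff_inv_mem, MM]
  constructor
  · intro h
    exact ⟨x.2, by by_contra! h'; exact h ⟨h'.1, h'.2⟩⟩
  · rintro ⟨-, h⟩ ⟨h1, h2⟩
    exact h.elim h1 (fun h => h h2)

namespace MM

variable {R S : LocalSubring F} {r s : F}

theorem mem (h : MM R r) : r ∈ R.toSubring := h.1

theorem mk_mem (h : MM R r) : (⟨r, h.1⟩ : R.toSubring) ∈ IsLocalRing.maximalIdeal R.toSubring :=
  (mem_maximalIdeal_iff _).mpr h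

theorem zero (R : LocalSubring F) : MM R 0 := ⟨R.toSubring.zero_mem, Or.inl rfl⟩

theorem not_one (R : LocalSubring F) : ¬ MM R 1 := by
  rintro ⟨-, h⟩
  simp at h

theorem add (hr : MM R r) (hs : MM R s) : MM R (r + s) := by
  have := Ideal.add_mem _ hr.mk_mem hs.mk_mem
  exact (mem_maximalIdeal_iff _).mp this

theorem neg (hr : MM R r) : MM R (-r) := by
  have := Ideal.neg_mem_iff _ |>.mpr hr.mk_mem
  exact (mem_maximalIdeal_iff _).mp this

theorem sub (hr : MM R r) (hs : MM R s) : MM R (r - s) := by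
  rw [sub_eq_add_neg]
  exact hr.add hs.neg

theorem mul_left (hs : s ∈ R.toSubring) (hr : MM R r) : MM R (s * r) := by
  have := Ideal.mul_mem_left _ (⟨s, hs⟩ : R.toSubring) hr.mk_mem
  exact (mem_maximalIdeal_iff _).mp this

theorem mul_right (hr : MM R r) (hs : s ∈ R.toSubring) : MM R (r * s) := by
  rw [mul_comm]
  exact hr.mul_left hs

theorem pow {k : ℕ} (hr : MM R r) (hk : k ≠ 0) : MM R (r ^ k) := by
  obtain ⟨k, rfl⟩ := Nat.exists_eq_succ_of_ne_zero hk
  rw [pow_succ]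
  exact hr.mul_left (pow_mem hr.mem k)

theorem of_pow {k : ℕ} (hr : r ∈ R.toSubring) (h : MM R (r ^ k)) : MM R r := by
  refine ⟨hr, ?_⟩
  by_contra! h'
  rcases h.2 with h2 | h2
  · exact h'.1 (pow_eq_zero_iff (n := k) (by rintro rfl; simp at h2) |>.mp h2)
  · exact h2 (by rw [← inv_pow]; exact pow_mem h'.2 k)

theorem mul_iff (hr : r ∈ R.toSubring) (hs : s ∈ R.toSubring) :
    MM R (r * s) ↔ MM R r ∨ MM R s := by
  constructor
  · intro h
    have h1 := (mem_maximalIdeal_iff (R := R) (⟨r, hr⟩ * ⟨s, hs⟩)).mpr h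
    rcases (inferInstance : (IsLocalRing.maximalIdeal R.toSubring).IsPrime).mem_or_mem h1 with h | h
    · exact Or.inl ((mem_maximalIdeal_iff _).mp h)
    · exact Or.inr ((mem_maximalIdeal_iff _).mp h)
  · rintro (h | h)
    · exact h.mul_right hs
    · exact h.mul_left hr

end MM

variable {R S : LocalSubring F} {r s : F}

theorem inv_mem_of_not_MM (hr : r ∈ R.toSubring) (h : ¬ MM R r) :
    r ≠ 0 ∧ r⁻¹ ∈ R.toSubring := by
  by_contra! h'
  refine h ⟨hr, ?_⟩
  by_cases h0 : r = 0
  · exact Or.inl h0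
  · exact Or.inr (h' h0)

theorem not_MM_of_inv_mem (h0 : r ≠ 0) (h : r⁻¹ ∈ R.toSubring) : ¬ MM R r := by
  rintro ⟨-, h1 | h1⟩
  · exact h0 h1
  · exact h1 h

theorem not_MM_inv (h0 : r ≠ 0) (h : r ∈ R.toSubring) : ¬ MM R r⁻¹ :=
  not_MM_of_inv_mem (inv_ne_zero h0) (by rwa [inv_inv])

theorem not_MM_add_left (hr : ¬ MM R r) (hs : MM R s) : ¬ MM R (r + s) := fun h =>
  hr (by simpa using h.sub hs)

theorem not_MM_add_right (hr : MM R r) (hs : ¬ MM R s) : ¬ MM R (r + s) := fun h =>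
  hs (by simpa using h.sub hr)

theorem le_iff_MM :
    R ≤ S ↔ R.toSubring ≤ S.toSubring ∧ ∀ r, MM R r → MM S r := by
  rw [LocalSubring.le_def]
  constructor
  · rintro ⟨h, h'⟩
    refine ⟨h, fun r hr => ?_⟩
    have h1 := (IsLocalRing.maximalIdeal R.toSubring).mul_mem_left 1 hr.mk_mem
    rw [one_mul] at h1
    have h2 : Subring.inclusion h ⟨r, hr.1⟩ ∈ IsLocalRing.maximalIdeal S.toSubring := by
      rw [IsLocalRing.mem_maximalIdeal, mem_nonunits_iff] at h1 ⊢
      exact fun hu => h1 (h'.map_nonunit _ hu)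
    exact (mem_maximalIdeal_iff _).mp h2
  · rintro ⟨h, h'⟩
    refine ⟨h, ⟨fun a ha => ?_⟩⟩
    by_contra hn
    have := h' _ ((mem_maximalIdeal_iff a).mp
      ((IsLocalRing.mem_maximalIdeal _).mpr (mem_nonunits_iff.mpr hn)))
    exact (IsLocalRing.mem_maximalIdeal _).mp
      ((mem_maximalIdeal_iff (R := S) (Subring.inclusion h a)).mpr this) ha

theorem MM.of_le (h : R ≤ S) (hr : MM R r) : MM S r := (le_iff_MM.mp h).2 r hr

theorem MM.of_ge (h : R ≤ S) (hr : r ∈ R.toSubring) (hs : MM S r) : MM R r := by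
  by_contra hn
  obtain ⟨h0, h1⟩ := inv_mem_of_not_MM hr hn
  exact not_MM_of_inv_mem h0 (h.1 h1) hs

theorem le_of_not_MM (h : R.toSubring ≤ S.toSubring) (h' : ∀ r, MM R r → MM S r) : R ≤ S :=
  le_iff_MM.mpr ⟨h, h'⟩

end LocalSubrings

/-! ### Homogeneous forms -/

section Forms

variable {K : Type u} [Field K]

open MvPolynomial

/-- The polynomial `G(T x, T y, T z)` in `T`. -/
def spread (σ : Type*) : MvPolynomial σ K →ₐ[K] Polynomial (MvPolynomial σ K) :=
  aeval fun i => Polynomial.X * Polynomial.C (X i)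

theorem spread_of_isHomogeneous {σ : Type*} [Fintype σ] {G : MvPolynomial σ K} {d : ℕ}
    (hG : G.IsHomogeneous d) :
    spread σ G = Polynomial.C G * Polynomial.X ^ d := by
  have key : aeval (R := K) (fun i : σ => Polynomial.C (X i)) G
      = Polynomial.C (R := MvPolynomial σ K) G := by
    have h := aeval_algebraMap_apply (R := K) (A := MvPolynomial σ K)
      (Polynomial (MvPolynomial σ K)) X G
    rw [aeval_X_left_apply] at h
    exact h
  rw [spread, aeval_def, eval₂_eq', ← key, aeval_def, eval₂_eq', Finset.sum_mul]
  refine Finset.sum_congr rfl fun e he => ?_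
  have hd : ∑ i, e i = d := by
    have := hG (mem_support_iff.mp he)
    simpa [Finsupp.weight_apply, Finsupp.sum_fintype] using this
  simp only [mul_pow, Finset.prod_mul_distrib, Finset.prod_pow_eq_pow_sum, hd]
  ring

/-- The decomposition into homogeneous components becomes a ring homomorphism to polynomials in one
variable T; factors of forms can then be studied through degrees in T. -/
theorem coeff_spread {σ : Type*} [Fintype σ] (G : MvPolynomial σ K) (i : ℕ) :
    (spread σ G).coeff i = homogeneousComponent i G := by
  conv_lhs => rw [← sum_homogeneousComponent G]
  rw [map_sum, Polynomial.finsetSum_coeff]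
  have h1 : ∀ j ∈ Finset.range (G.totalDegree + 1),
      (spread σ (homogeneousComponent j G)).coeff i =
        if i = j then homogeneousComponent i G else 0 := by
    intro j _
    rw [spread_of_isHomogeneous (homogeneousComponent_isHomogeneous j G),
      Polynomial.coeff_C_mul_X_pow]
    split_ifs with h <;> simp [h]
  rw [Finset.sum_congr rfl h1, Finset.sum_ite_eq]
  split_ifs with h
  · rfl
  · exact (homogeneousComponent_eq_zero _ _ (by simpa [Nat.lt_succ_iff] using h)).symm

theorem spread_injective {σ : Type*} [Fintype σ] :
    Function.Injective (spread (K := K) σ) := by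
  intro a b h
  rw [← sum_homogeneousComponent a, ← sum_homogeneousComponent b]
  have h1 : ∀ i, homogeneousComponent i a = homogeneousComponent i b := fun i => by
    rw [← coeff_spread, ← coeff_spread, h]
  have h2 (c : MvPolynomial σ K) (m : ℕ) (hm : c.totalDegree ≤ m) :
      ∑ i ∈ Finset.range (c.totalDegree + 1), homogeneousComponent i c =
      ∑ i ∈ Finset.range (m + 1), homogeneousComponent i c := by
    refine Finset.sum_subset (Finset.range_mono (by omega)) fun i _ hi => ?_
    exact homogeneousComponent_eq_zero _ _ (by simpa [Nat.lt_succ_iff] using hi)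
  rw [h2 a (max a.totalDegree b.totalDegree) (le_max_left _ _),
    h2 b (max a.totalDegree b.totalDegree) (le_max_right _ _)]
  exact Finset.sum_congr rfl fun i _ => h1 i

/-- A factor of a nonzero form is a form. -/
theorem isHomogeneous_of_mul {σ : Type*} [Fintype σ] {a b : MvPolynomial σ K} {d : ℕ}
    (h : (a * b).IsHomogeneous d) (h0 : a * b ≠ 0) : ∃ m, a.IsHomogeneous m := by
  have ha : a ≠ 0 := left_ne_zero_of_mul h0
  have hb : b ≠ 0 := right_ne_zero_of_mul h0
  have hsa : spread σ a ≠ 0 := (map_ne_zero_iff _ spread_injective).mpr ha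
  have hsb : spread σ b ≠ 0 := (map_ne_zero_iff _ spread_injective).mpr hb
  have h1 := spread_of_isHomogeneous h
  rw [map_mul] at h1
  -- Degree and trailing degree in T are both additive and they agree on the product, which is a
  -- monomial in T. So they agree on each factor.
  have h2 := congrArg Polynomial.natDegree h1
  have h3 := congrArg Polynomial.natTrailingDegree h1
  rw [Polynomial.natDegree_mul hsa hsb, Polynomial.natDegree_C_mul_X_pow _ _ h0] at h2
  rw [Polynomial.natTrailingDegree_mul hsa hsb, Polynomial.natTrailingDegree_mul_X_pow
    (by simpa using ⟨ha, hb⟩), Polynomial.natTrailingDegree_C, zero_add] at h3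
  have h4 := Polynomial.natTrailingDegree_le_natDegree (spread σ a)
  have h5 := Polynomial.natTrailingDegree_le_natDegree (spread σ b)
  refine ⟨(spread σ a).natDegree, ?_⟩
  have h6 : ∀ i, i ≠ (spread σ a).natDegree → homogeneousComponent i a = 0 := by
    intro i hi
    rw [← coeff_spread]
    rcases lt_or_gt_of_ne hi with hi | hi
    · exact Polynomial.coeff_eq_zero_of_lt_natTrailingDegree (by omega)
    · exact Polynomial.coeff_eq_zero_of_natDegree_lt hi
  have h7 : a = homogeneousComponent (spread σ a).natDegree a := by
    apply spread_injective
    ext1 i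
    rw [coeff_spread, coeff_spread]
    by_cases hi : i = (spread σ a).natDegree
    · rw [hi, homogeneousComponent_eq_self (homogeneousComponent_isHomogeneous _ _)]
    · rw [h6 i hi, homogeneousComponent_of_mem (homogeneousComponent_isHomogeneous _ a), if_neg hi]
  exact (congrArg (IsHomogeneous · _) h7).mpr (homogeneousComponent_isHomogeneous _ _)

theorem isHomogeneous_of_dvd {σ : Type*} [Fintype σ] {a b : MvPolynomial σ K} {d : ℕ}
    (hb : b.IsHomogeneous d) (h0 : b ≠ 0) (h : a ∣ b) : ∃ m, a.IsHomogeneous m := by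
  obtain ⟨c, rfl⟩ := h
  exact isHomogeneous_of_mul hb h0

/-- A factorization of a form into forms. -/
theorem exists_isHomogeneous_of_dvd {σ : Type*} [Fintype σ] {a b : MvPolynomial σ K} {d m : ℕ}
    (hb : b.IsHomogeneous d) (h0 : b ≠ 0) (ha : a.IsHomogeneous m) (h : a ∣ b) :
    ∃ c e, b = a * c ∧ c.IsHomogeneous e ∧ d = m + e := by
  obtain ⟨c, rfl⟩ := h
  obtain ⟨e, he⟩ := isHomogeneous_of_mul (mul_comm a c ▸ hb) (mul_comm a c ▸ h0)
  exact ⟨c, e, rfl, he, hb.inj_right (ha.mul he) h0⟩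

/-- A prime ideal that contains a nonzero form contains an irreducible factor of the form. -/
theorem exists_planeCurve_mem {P : Ideal (HomRing K)} [hP : P.IsPrime] {G : HomRing K} {d : ℕ}
    (hG : G.IsHomogeneous d) (h0 : G ≠ 0) (hGP : G ∈ P) :
    ∃ C : PlaneCurve K, C.poly ∈ P ∧ C.poly ∣ G := by
  have h1 : (UniqueFactorizationMonoid.factors G).prod ∈ P := by
    obtain ⟨v, hv⟩ := UniqueFactorizationMonoid.factors_prod h0
    rw [← hv] at hGP
    exact (hP.mem_or_mem hGP).resolve_right fun h => hP.ne_top (Ideal.eq_top_of_isUnit_mem _ h v.isUnit)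
  rw [hP.multiset_prod_mem_iff_exists_mem] at h1
  obtain ⟨p, hp, hpP⟩ := h1
  have hd := UniqueFactorizationMonoid.dvd_of_mem_factors hp
  obtain ⟨m, hm⟩ := isHomogeneous_of_dvd hG h0 hd
  exact ⟨⟨p, m, hm, UniqueFactorizationMonoid.irreducible_of_factor p hp⟩, hpP, hd⟩

/-- A nonzero form that is not constant has an irreducible factor. -/
theorem exists_planeCurve_dvd {G : HomRing K} {d : ℕ}
    (hG : G.IsHomogeneous d) (h0 : G ≠ 0) (hd : d ≠ 0) :
    ∃ C : PlaneCurve K, C.poly ∣ G := by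
  have hu : ¬ IsUnit G := by
    intro h
    obtain ⟨r, hr, h⟩ := MvPolynomial.isUnit_iff_eq_C_of_isReduced.mp h
    exact hd (hG.inj_right (h ▸ isHomogeneous_C _ _) h0)
  obtain ⟨p, hp, hpd⟩ := WfDvdMonoid.exists_irreducible_factor hu h0
  obtain ⟨m, hm⟩ := isHomogeneous_of_dvd hG h0 hpd
  exact ⟨⟨p, m, hm, hp⟩, hpd⟩

theorem PlaneCurve.deg_ne_zero (C : PlaneCurve K) : C.deg ≠ 0 := by
  intro h
  have h1 := C.isHomogeneous
  rw [h] at h1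
  have h2 := (totalDegree_eq_zero_iff_eq_C).mp
    (Nat.le_zero.mp h1.totalDegree_le)
  have h3 : coeff 0 C.poly ≠ 0 := fun h4 => C.irreducible.ne_zero (by rw [h2, h4, map_zero])
  exact C.irreducible.not_isUnit (h2 ▸ (isUnit_iff_ne_zero.mpr h3).map (MvPolynomial.C (σ := Fin 3)))

theorem PlaneCurve.prime (C : PlaneCurve K) : Prime C.poly := C.irreducible.prime

end Forms

/-! ### Rational functions as quotients of forms -/

section Fractions

variable {K : Type u} [Field K]

open MvPolynomial

@[simp] theorem dehom_X_zero : dehom K (X 0) = uFun K := by simp [dehom]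

@[simp] theorem dehom_X_one : dehom K (X 1) = vFun K := by simp [dehom]

@[simp] theorem dehom_X_two : dehom K (X 2) = 1 := by simp [dehom]

theorem dehom_C (c : K) : dehom K (C c) = algebraMap K (FunField K) c := by
  rw [dehom, algHom_C]

theorem dehom_injOn {A B : HomRing K} {d : ℕ} (hA : A.IsHomogeneous d) (hB : B.IsHomogeneous d)
    (h : dehom K A = dehom K B) : A = B := by
  by_contra hne
  exact dehom_ne_zero (hA.sub hB) (sub_ne_zero.mpr hne) (by rw [map_sub, h, sub_self])

/-- Dehomogenization is injective on forms of one degree. An equality of fractions thus becomes,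
after cross-multiplication, an equality of forms to which divisibility applies. -/
theorem eq_of_dehom_mul_eq {A B C D : HomRing K} {a b c d : ℕ} (hA : A.IsHomogeneous a)
    (hB : B.IsHomogeneous b) (hC : C.IsHomogeneous c) (hD : D.IsHomogeneous d)
    (hdeg : a + b = c + d) (h : dehom K A * dehom K B = dehom K C * dehom K D) :
    A * B = C * D :=
  dehom_injOn (hA.mul hB) (hdeg ▸ hC.mul hD) (by rw [map_mul, map_mul, h])

/-- Every polynomial in `u`, `v` is the dehomogenization of a form. -/
theorem exists_dehom_eq (f : MvPolynomial (Fin 2) K) :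
    ∃ (d : ℕ) (A : HomRing K), A.IsHomogeneous d ∧
      dehom K A = algebraMap (MvPolynomial (Fin 2) K) (FunField K) f := by
  induction f using MvPolynomial.induction_on with
  | C c =>
    refine ⟨0, C c, isHomogeneous_C _ _, ?_⟩
    rw [dehom_C]
    rfl
  | add p q hp hq =>
    obtain ⟨d, A, hA, hA'⟩ := hp
    obtain ⟨e, B, hB, hB'⟩ := hq
    refine ⟨d + e, A * X 2 ^ e + B * X 2 ^ d, ?_, ?_⟩
    · exact (hA.mul (isHomogeneous_X_pow _ _)).add
        (add_comm e d ▸ hB.mul (isHomogeneous_X_pow _ _))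
    · simp [hA', hB']
  | mul_X p i hp =>
    obtain ⟨d, A, hA, hA'⟩ := hp
    refine ⟨d + 1, A * X i.castSucc, hA.mul (isHomogeneous_X _ _), ?_⟩
    rw [map_mul, map_mul, hA']
    fin_cases i
    · simp [uFun]
    · simp [vFun]

theorem exists_fraction (r : FunField K) :
    ∃ (d : ℕ) (A B : HomRing K), A.IsHomogeneous d ∧ B.IsHomogeneous d ∧ B ≠ 0 ∧
      r = dehom K A / dehom K B := by
  obtain ⟨f, g, hg, rfl⟩ := IsFractionRing.div_surjective (A := MvPolynomial (Fin 2) K) r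
  obtain ⟨d, A, hA, hA'⟩ := exists_dehom_eq f
  obtain ⟨e, B, hB, hB'⟩ := exists_dehom_eq g
  have hB0 : B ≠ 0 := by
    rintro rfl
    rw [map_zero] at hB'
    exact nonZeroDivisors.ne_zero hg
      (IsFractionRing.injective (MvPolynomial (Fin 2) K) (FunField K) (by rw [← hB', map_zero]))
  refine ⟨d + e, A * X 2 ^ e, B * X 2 ^ d, hA.mul (isHomogeneous_X_pow _ _),
    add_comm e d ▸ hB.mul (isHomogeneous_X_pow _ _), mul_ne_zero hB0 (pow_ne_zero _ (X_ne_zero _)),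
    ?_⟩
  simp [hA', hB']

end Fractions

/-! ### Local rings of the plane -/

section LocalRings

variable {K : Type u} [Field K]

open MvPolynomial

/-- The homogeneous prime ideal of a point of the plane. -/
abbrev pIdeal (y : P2 K) : Ideal (HomRing K) := y.asHomogeneousIdeal.toIdeal

instance (y : P2 K) : (pIdeal y).IsPrime := y.isPrime

theorem pIdeal_injective : Function.Injective (pIdeal (K := K)) := fun _ _ h =>
  ProjectiveSpectrum.ext (HomogeneousIdeal.toIdeal_injective h)

/-- `fracToFun` evaluates a chosen numerator and denominator; this frees it from the choice. -/
theorem fracToFun_mk (P : Ideal (HomRing K)) [P.IsPrime] {d : ℕ} {A B : HomRing K}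
    (hA : A.IsHomogeneous d) (hB : B.IsHomogeneous d) (h : B ∉ P) :
    fracToFun P (HomogeneousLocalization.mk ⟨d, ⟨A, (mem_homogeneousSubmodule _ _).mpr hA⟩,
      ⟨B, (mem_homogeneousSubmodule _ _).mpr hB⟩, h⟩) = dehom K A / dehom K B := by
  set q : HomogeneousLocalization.AtPrime (homogeneousSubmodule (Fin 3) K) P :=
    HomogeneousLocalization.mk ⟨d, ⟨A, (mem_homogeneousSubmodule _ _).mpr hA⟩,
      ⟨B, (mem_homogeneousSubmodule _ _).mpr hB⟩, h⟩ with hq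
  change dehom K q.num / dehom K q.den = _
  have hden : dehom K q.den ≠ 0 :=
    dehom_ne_zero ((mem_homogeneousSubmodule _ _).mp q.den_mem_deg)
      (fun h => q.den_mem (h ▸ P.zero_mem))
  have hB0 : dehom K B ≠ 0 := dehom_ne_zero hB (fun h0 => h (h0 ▸ P.zero_mem))
  have h1 : q.val = Localization.mk A (⟨B, h⟩ : P.primeCompl) := rfl
  rw [q.eq_num_div_den, Localization.mk_eq_mk_iff, Localization.r_iff_exists] at h1
  obtain ⟨c, hc⟩ := h1
  have hc0 : (c : HomRing K) ≠ 0 := fun h0 => c.2 (h0 ▸ P.zero_mem)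
  have h2 := congrArg (dehom K) (mul_left_cancel₀ hc0 hc)
  rw [div_eq_div_iff hden hB0]
  simp only [map_mul] at h2
  linear_combination h2

theorem mem_localRing {y : P2 K} {r : FunField K} :
    r ∈ (localRing y).toSubring ↔ ∃ (d : ℕ) (A B : HomRing K), A.IsHomogeneous d ∧
      B.IsHomogeneous d ∧ B ∉ pIdeal y ∧ r = dehom K A / dehom K B := by
  constructor
  · rintro ⟨s, rfl⟩
    set q := (Proj.stalkIso (homogeneousSubmodule (Fin 3) K) y).hom.hom s
    exact ⟨q.deg, q.num, q.den, (mem_homogeneousSubmodule _ _).mp q.num_mem_deg,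
      (mem_homogeneousSubmodule _ _).mp q.den_mem_deg, q.den_mem, rfl⟩
  · rintro ⟨d, A, B, hA, hB, hBy, rfl⟩
    refine ⟨(Proj.stalkIso (homogeneousSubmodule (Fin 3) K) y).inv.hom
      (HomogeneousLocalization.mk ⟨d, ⟨A, (mem_homogeneousSubmodule _ _).mpr hA⟩,
      ⟨B, (mem_homogeneousSubmodule _ _).mpr hB⟩, hBy⟩), ?_⟩
    rw [← fracToFun_mk (pIdeal y) hA hB hBy, stalkToFun]
    simp only [RingHom.comp_apply]
    congr 1
    rw [← CommRingCat.comp_apply, Iso.inv_hom_id]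
    rfl

theorem ne_zero_of_notMem {y : P2 K} {B : HomRing K} (h : B ∉ pIdeal y) : B ≠ 0 := fun h0 =>
  h (h0 ▸ (pIdeal y).zero_mem)

theorem div_mem_localRing {y : P2 K} {d : ℕ} {A B : HomRing K} (hA : A.IsHomogeneous d)
    (hB : B.IsHomogeneous d) (h : B ∉ pIdeal y) :
    dehom K A / dehom K B ∈ (localRing y).toSubring :=
  mem_localRing.mpr ⟨d, A, B, hA, hB, h, rfl⟩

/-- A fraction with numerator outside of the prime has a denominator outside if it is regular. -/
theorem notMem_of_div_mem {y : P2 K} {d : ℕ} {A B : HomRing K} (hA : A.IsHomogeneous d)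
    (hB : B.IsHomogeneous d) (hB0 : B ≠ 0) (hAy : A ∉ pIdeal y)
    (h : dehom K A / dehom K B ∈ (localRing y).toSubring) : B ∉ pIdeal y := by
  obtain ⟨e, N, D, hN, hD, hDy, h⟩ := mem_localRing.mp h
  rw [div_eq_div_iff (dehom_ne_zero hB hB0) (dehom_ne_zero hD (ne_zero_of_notMem hDy))] at h
  have h1 := eq_of_dehom_mul_eq hA hD hN hB (add_comm _ _) h
  intro hBy
  have h2 : A * D ∈ pIdeal y := h1 ▸ Ideal.mul_mem_left _ _ hBy
  exact (y.isPrime.mem_or_mem h2).elim hAy hDy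

theorem MM_localRing {y : P2 K} {d : ℕ} {A B : HomRing K} (hA : A.IsHomogeneous d)
    (hB : B.IsHomogeneous d) (h : B ∉ pIdeal y) :
    MM (localRing y) (dehom K A / dehom K B) ↔ A ∈ pIdeal y := by
  have hB0 := dehom_ne_zero hB (ne_zero_of_notMem h)
  constructor
  · rintro ⟨-, h1⟩
    by_contra hA'
    have hA0 := dehom_ne_zero hA (ne_zero_of_notMem hA')
    rcases h1 with h1 | h1
    · exact (div_ne_zero hA0 hB0) h1
    · exact h1 (by rw [inv_div]; exact div_mem_localRing hB hA hA')
  · intro hA'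
    refine ⟨div_mem_localRing hA hB h, ?_⟩
    by_cases hA0 : A = 0
    · left; simp [hA0]
    · right
      rw [inv_div]
      intro h1
      exact notMem_of_div_mem hB hA hA0 h h1 hA'

theorem exists_X_notMem (y : P2 K) : ∃ i : Fin 3, X i ∉ pIdeal y := by
  by_contra! h
  apply y.not_irrelevant_le
  intro G hG
  rw [HomogeneousIdeal.mem_irrelevant_iff, GradedRing.proj_apply] at hG
  have h1 : coeff 0 G = 0 := by
    have h2 : homogeneousComponent 0 G = 0 := by
      rw [← decomposition.decompose'_apply]
      exact hG
    rw [homogeneousComponent_zero] at h2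
    simpa using h2
  change G ∈ pIdeal y
  have h3 : G ∈ Ideal.span (Set.range (X : Fin 3 → HomRing K)) := by
    rw [← Set.image_univ, mem_ideal_span_X_image]
    intro m hm
    by_contra! h4
    have : m = 0 := by
      ext i
      simpa using h4 i (Set.mem_univ _)
    subst this
    exact mem_support_iff.mp hm h1
  refine (Ideal.span_le.mpr ?_) h3
  rintro _ ⟨i, rfl⟩
  exact h i

/-- Two points whose local rings are dominated by the same local ring are equal. -/
theorem point_eq_of_le {R : LocalSubring (FunField K)} {y z : P2 K} (hy : localRing y ≤ R)
    (hz : localRing z ≤ R) : y = z := by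
  -- Take X j nonzero at z and X i nonzero at y. If X j vanished at y, then X j / X i would lie in
  -- the maximal ideal of R while its inverse is regular at z, hence in R.
  have key : ∀ {y z : P2 K}, localRing y ≤ R → localRing z ≤ R → ∃ j : Fin 3,
      X j ∉ pIdeal y ∧ X j ∉ pIdeal z := by
    intro y z hy hz
    obtain ⟨i, hi⟩ := exists_X_notMem y
    obtain ⟨j, hj⟩ := exists_X_notMem z
    refine ⟨j, fun hjy => ?_, hj⟩
    have h1 := (MM_localRing (isHomogeneous_X K j) (isHomogeneous_X K i) hi).mpr hjy
    have h2 := (hz.1 (div_mem_localRing (isHomogeneous_X K i) (isHomogeneous_X K j) hj))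
    rcases (h1.of_le hy).2 with h3 | h3
    · exact div_ne_zero (dehom_ne_zero (isHomogeneous_X K j) (X_ne_zero j))
        (dehom_ne_zero (isHomogeneous_X K i) (X_ne_zero i)) h3
    · exact h3 (by rwa [inv_div])
  have key2 : ∀ {y z : P2 K}, localRing y ≤ R → localRing z ≤ R → pIdeal y ≤ pIdeal z := by
    intro y z hy hz
    obtain ⟨j, hjy, hjz⟩ := key hy hz
    intro A hA
    rw [mem_iff_homogeneousComponent_mem (y.asHomogeneousIdeal.isHomogeneous)] at hA
    rw [mem_iff_homogeneousComponent_mem (z.asHomogeneousIdeal.isHomogeneous)]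
    intro d
    -- The fraction A_d / X_j^d is regular at both points, and whether it vanishes can be decided in
    -- R.
    have h1 := (MM_localRing (homogeneousComponent_isHomogeneous d A) (isHomogeneous_X_pow j d)
      (fun h => hjy (y.isPrime.mem_of_pow_mem _ h))).mpr (hA d)
    have h2 := div_mem_localRing (y := z) (homogeneousComponent_isHomogeneous d A)
      (isHomogeneous_X_pow j d) (fun h => hjz (z.isPrime.mem_of_pow_mem _ h))
    exact (MM_localRing (homogeneousComponent_isHomogeneous d A) (isHomogeneous_X_pow j d)
      (fun h => hjz (z.isPrime.mem_of_pow_mem _ h))).mp (MM.of_ge hz h2 (h1.of_le hy))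
  exact pIdeal_injective (le_antisymm (key2 hy hz) (key2 hz hy))

theorem localRing_injective : Function.Injective (localRing (K := K)) := fun _ _ h =>
  point_eq_of_le h.le le_rfl

/-- An ideal membership can be tested on homogeneous elements. -/
theorem pIdeal_le_iff {y : P2 K} {I : Ideal (HomRing K)} :
    pIdeal y ≤ I ↔ ∀ (d : ℕ) (A : HomRing K), A.IsHomogeneous d → A ∈ pIdeal y → A ∈ I := by
  refine ⟨fun h d A _ hA => h hA, fun h A hA => ?_⟩
  rw [← sum_homogeneousComponent A]
  rw [mem_iff_homogeneousComponent_mem (y.asHomogeneousIdeal.isHomogeneous)] at hA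
  exact Ideal.sum_mem _ fun d _ => h d _ (homogeneousComponent_isHomogeneous d A) (hA d)

/-- Plain inclusion, not domination, encodes specialization: a form A vanishing at y but not at z
makes X_i^d / A regular at z and not at y. -/
theorem localRing_toSubring_le_iff {y z : P2 K} :
    (localRing z).toSubring ≤ (localRing y).toSubring ↔ pIdeal y ≤ pIdeal z := by
  constructor
  · intro h
    rw [pIdeal_le_iff]
    intro d A hA hAy
    by_contra hAz
    obtain ⟨i, hi⟩ := exists_X_notMem y
    have hi' : X i ^ d ∉ pIdeal y := fun h => hi (y.isPrime.mem_of_pow_mem _ h)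
    exact notMem_of_div_mem (isHomogeneous_X_pow i d) hA (ne_zero_of_notMem hAz) hi'
      (h (div_mem_localRing (isHomogeneous_X_pow i d) hA hAz)) hAy
  · intro h r hr
    obtain ⟨d, A, B, hA, hB, hBz, rfl⟩ := mem_localRing.mp hr
    exact div_mem_localRing hA hB fun hB' => hBz (h hB')

theorem algebraMap_mem_localRing (y : P2 K) (c : K) :
    algebraMap K (FunField K) c ∈ (localRing y).toSubring := by
  have h1 : (1 : HomRing K) ∉ pIdeal y := fun h => y.isPrime.ne_top ((Ideal.eq_top_iff_one _).mpr h)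
  have := div_mem_localRing (y := y) (isHomogeneous_C (Fin 3) c) (isHomogeneous_one (Fin 3) K) h1
  simpa [dehom_C] using this

theorem isClosedPoint_iff {y : P2 K} :
    IsClosedPoint (planeModel K) (localRing y) ↔ ∀ z : P2 K, pIdeal y ≤ pIdeal z → z = y := by
  constructor
  · rintro ⟨-, h⟩ z hz
    exact localRing_injective (h _ ⟨z, rfl⟩ (localRing_toSubring_le_iff.mpr hz))
  · intro h
    refine ⟨⟨y, rfl⟩, ?_⟩
    rintro _ ⟨z, rfl⟩ hz
    rw [h z (localRing_toSubring_le_iff.mp hz)]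

end LocalRings

/-! ### Points of the plane -/

section Points

variable {K : Type u} [Field K]

open MvPolynomial

/-- The homogeneous core of the kernel of a ring homomorphism. -/
def homKer {κ : Type*} [CommRing κ] (χ : HomRing K →+* κ) : Ideal (HomRing K) :=
  RingHom.ker ((Polynomial.mapRingHom χ).comp (spread (K := K) (Fin 3)).toRingHom)

theorem mem_homKer {κ : Type*} [CommRing κ] {χ : HomRing K →+* κ} {G : HomRing K} :
    G ∈ homKer χ ↔ ∀ d, χ (homogeneousComponent d G) = 0 := by
  rw [homKer, RingHom.mem_ker, Polynomial.ext_iff]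
  refine forall_congr' fun d => ?_
  simp [← coeff_spread]

theorem mem_homKer_of_isHomogeneous {κ : Type*} [CommRing κ] {χ : HomRing K →+* κ}
    {G : HomRing K} {d : ℕ} (hG : G.IsHomogeneous d) : G ∈ homKer χ ↔ χ G = 0 := by
  rw [mem_homKer]
  constructor
  · intro h
    have := h d
    rwa [homogeneousComponent_eq_self hG] at this
  · intro h e
    rw [homogeneousComponent_of_mem hG]
    split_ifs
    · exact h
    · exact map_zero χ

/-- The point of the plane given by a ring homomorphism from the homogeneous coordinate ring to a
domain. -/
def pointOf {κ : Type*} [CommRing κ] [IsDomain κ] (χ : HomRing K →+* κ)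
    (h : ∃ i : Fin 3, χ (X i) ≠ 0) : P2 K where
  asHomogeneousIdeal :=
    { toSubmodule := homKer χ
      is_homogeneous' := by
        intro i G hG
        have h1 : ((DirectSum.decompose (homogeneousSubmodule (Fin 3) K) G) i : HomRing K) =
            homogeneousComponent i G := decomposition.decompose'_apply G i
        rw [h1, mem_homKer_of_isHomogeneous (homogeneousComponent_isHomogeneous i G)]
        exact mem_homKer.mp hG i }
  -- This is the kernel of a homomorphism to polynomials over a domain; the kernel of χ itself need
  -- not be homogeneous.
  isPrime := RingHom.ker_isPrime _
  not_irrelevant_le := by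
    intro hle
    obtain ⟨i, hi⟩ := h
    apply hi
    rw [← mem_homKer_of_isHomogeneous (isHomogeneous_X K i)]
    refine hle ?_
    rw [HomogeneousIdeal.mem_irrelevant_iff, GradedRing.proj_apply]
    exact DirectSum.decompose_of_mem_ne _ (i := 1)
      ((mem_homogeneousSubmodule _ _).mpr (isHomogeneous_X K i)) one_ne_zero

theorem mem_pointOf {κ : Type*} [CommRing κ] [IsDomain κ] {χ : HomRing K →+* κ}
    {h : ∃ i : Fin 3, χ (X i) ≠ 0} {G : HomRing K} {d : ℕ} (hG : G.IsHomogeneous d) :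
    G ∈ pIdeal (pointOf χ h) ↔ χ G = 0 :=
  mem_homKer_of_isHomogeneous hG

theorem mem_genericPoint {C : PlaneCurve K} {G : HomRing K} :
    G ∈ pIdeal C.genericPoint ↔ C.poly ∣ G := Ideal.mem_span_singleton

theorem pIdeal_genericPoint_le {C : PlaneCurve K} {y : P2 K} :
    pIdeal C.genericPoint ≤ pIdeal y ↔ C.poly ∈ pIdeal y := by
  constructor
  · intro h
    exact h (mem_genericPoint.mpr dvd_rfl)
  · intro h G hG
    obtain ⟨A, rfl⟩ := mem_genericPoint.mp hG
    exact Ideal.mul_mem_right _ _ h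

/-- The vertex ideal `(x, y, z)` contains the ideal of each point. -/
theorem pIdeal_lt_ker (y : P2 K) :
    pIdeal y < RingHom.ker (constantCoeff (σ := Fin 3) (R := K)) := by
  refine lt_of_le_of_ne ?_ ?_
  · rw [pIdeal_le_iff]
    intro d A hA hAy
    rcases Nat.eq_zero_or_pos d with rfl | hd
    · have h1 := totalDegree_eq_zero_iff_eq_C.mp (Nat.le_zero.mp hA.totalDegree_le)
      rw [RingHom.mem_ker, constantCoeff_eq]
      by_contra h0
      refine y.isPrime.ne_top (Ideal.eq_top_of_isUnit_mem _ hAy ?_)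
      rw [h1]
      exact (isUnit_iff_ne_zero.mpr h0).map (C (σ := Fin 3))
    · rw [RingHom.mem_ker, constantCoeff_eq]
      exact hA.coeff_eq_zero (by simpa using hd.ne)
  · intro h
    obtain ⟨i, hi⟩ := exists_X_notMem y
    apply hi
    rw [h, RingHom.mem_ker, constantCoeff_X]

/-- A point of the plane that strictly specializes a curve is closed. -/
theorem eq_of_genericPoint_lt {C : PlaneCurve K} {y z : P2 K}
    (h1 : pIdeal C.genericPoint < pIdeal y) (h2 : pIdeal y ≤ pIdeal z) : z = y := by
  by_contra hne
  have h2' : pIdeal y < pIdeal z := lt_of_le_of_ne h2 fun h => hne (pIdeal_injective h.symm)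
  have h0 : (⊥ : Ideal (HomRing K)) < pIdeal C.genericPoint := by
    rw [bot_lt_iff_ne_bot]
    intro h
    have : C.poly ∈ pIdeal C.genericPoint := mem_genericPoint.mpr dvd_rfl
    rw [h] at this
    exact C.irreducible.ne_zero this
  have h3 := pIdeal_lt_ker z
  have : (RingHom.ker (constantCoeff (σ := Fin 3) (R := K))).IsPrime := RingHom.ker_isPrime _
  -- If z were a proper specialization of y, then 0, C, y, z and the vertex would form a chain of
  -- five primes in a ring of dimension three.
  let s : LTSeries (PrimeSpectrum (HomRing K)) :=
    { length := 4
      toFun := ![⟨⊥, Ideal.isPrime_bot⟩, ⟨pIdeal C.genericPoint, inferInstance⟩,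
        ⟨pIdeal y, inferInstance⟩, ⟨pIdeal z, inferInstance⟩,
        ⟨RingHom.ker (constantCoeff (σ := Fin 3) (R := K)), inferInstance⟩]
      step := by
        intro i
        fin_cases i
        · exact h0
        · exact h1
        · exact h2'
        · exact h3 }
  have h4 : ringKrullDim (HomRing K) = 3 := by
    rw [MvPolynomial.ringKrullDim_of_isNoetherianRing, ringKrullDim_eq_zero_of_field]
    simp
  have h5 := Order.LTSeries.length_le_krullDim s
  change ((4 : ℕ) : WithBot ℕ∞) ≤ ringKrullDim (HomRing K) at h5
  rw [h4] at h5
  exact absurd (show (4 : ℕ) ≤ 3 by exact_mod_cast h5) (by norm_num)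

theorem pIdeal_eq_bot_iff {y : P2 K} : pIdeal y = ⊥ ↔ (localRing y).toSubring = ⊤ := by
  constructor
  · intro h
    rw [eq_top_iff]
    rintro r -
    obtain ⟨d, A, B, hA, hB, hB0, rfl⟩ := exists_fraction r
    exact div_mem_localRing hA hB (by rwa [h, Ideal.mem_bot])
  · intro h
    rw [eq_bot_iff, pIdeal_le_iff]
    intro d A hA hAy
    by_contra h0
    obtain ⟨i, hi⟩ := exists_X_notMem y
    refine notMem_of_div_mem (y := y) (isHomogeneous_X_pow i d) hA h0
      (fun h => hi (y.isPrime.mem_of_pow_mem _ h)) ?_ hAy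
    rw [h]
    exact Subring.mem_top _

/-- The points of the plane: the generic point, the generic points of the curves and the closed
points. -/
theorem point_cases (y : P2 K) : (localRing y).toSubring = ⊤ ∨
    (∃ C : PlaneCurve K, y = C.genericPoint) ∨ IsClosedPoint (planeModel K) (localRing y) := by
  by_cases h : pIdeal y = ⊥
  · exact Or.inl (pIdeal_eq_bot_iff.mp h)
  refine Or.inr ?_
  have h1 : ∃ d A, A.IsHomogeneous d ∧ A ∈ pIdeal y ∧ A ≠ 0 := by
    by_contra! h'
    exact h (eq_bot_iff.mpr (pIdeal_le_iff.mpr fun d A hA hAy => h' d A hA hAy))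
  obtain ⟨d, A, hA, hAy, hA0⟩ := h1
  obtain ⟨C, hC, -⟩ := exists_planeCurve_mem hA hA0 hAy
  rw [← pIdeal_genericPoint_le] at hC
  by_cases hCy : pIdeal C.genericPoint = pIdeal y
  · exact Or.inl ⟨C, (pIdeal_injective hCy).symm⟩
  · exact Or.inr (isClosedPoint_iff.mpr fun z hz =>
      eq_of_genericPoint_lt (lt_of_le_of_ne hC hCy) hz)

/-- A rational function is a quotient of forms without common factor. -/
theorem exists_coprime_fraction (r : FunField K) :
    ∃ (d : ℕ) (A B : HomRing K), A.IsHomogeneous d ∧ B.IsHomogeneous d ∧ B ≠ 0 ∧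
      r = dehom K A / dehom K B ∧ ∀ C : PlaneCurve K, C.poly ∣ A → ¬ C.poly ∣ B := by
  obtain ⟨d, A, B, hA, hB, hB0, hr⟩ := exists_fraction r
  induction d using Nat.strong_induction_on generalizing A B with
  | _ d ih =>
    by_cases h : ∀ C : PlaneCurve K, C.poly ∣ A → ¬ C.poly ∣ B
    · exact ⟨d, A, B, hA, hB, hB0, hr, h⟩
    · push Not at h
      obtain ⟨C, hCA, hCB⟩ := h
      obtain ⟨B', e, rfl, hB', rfl⟩ := exists_isHomogeneous_of_dvd hB hB0 C.isHomogeneous hCB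
      have hC0 := dehom_ne_zero C.isHomogeneous C.irreducible.ne_zero
      by_cases hA0 : A = 0
      · refine ih 0 (by have := C.deg_ne_zero; omega) 0 1 (isHomogeneous_zero _ _ _)
          (isHomogeneous_one _ _) one_ne_zero (by simp [hr, hA0])
      · obtain ⟨A', e', rfl, hA', he⟩ := exists_isHomogeneous_of_dvd hA hA0 C.isHomogeneous hCA
        obtain rfl : e' = e := by omega
        refine ih e' (by have := C.deg_ne_zero; omega) A' B' hA' hB' (right_ne_zero_of_mul hB0) ?_
        rw [hr, map_mul, map_mul, mul_div_mul_left _ _ hC0]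

/-- In a fraction without common factor, C fails to divide the numerator or the denominator. So the
local ring of a curve is a valuation ring. -/
theorem mem_or_inv_mem_localRing (C : PlaneCurve K) (r : FunField K) :
    r ∈ (localRing C.genericPoint).toSubring ∨ r⁻¹ ∈ (localRing C.genericPoint).toSubring := by
  obtain ⟨d, A, B, hA, hB, hB0, rfl, h⟩ := exists_coprime_fraction r
  by_cases hCA : C.poly ∣ A
  · exact Or.inl (div_mem_localRing hA hB fun hCB => h C hCA (mem_genericPoint.mp hCB))
  · right
    rw [inv_div]
    exact div_mem_localRing hB hA fun hCA' => hCA (mem_genericPoint.mp hCA')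

/-- Valuation rings are maximal for domination. This turns "maps to the generic point of a curve"
into an equality of local rings. -/
theorem eq_of_le_of_mem_or_inv_mem {F : Type*} [Field F] {R S : LocalSubring F}
    (hR : ∀ r, r ∈ R.toSubring ∨ r⁻¹ ∈ R.toSubring) (h : R ≤ S) : R = S := by
  refine LocalSubring.toSubring_injective (le_antisymm h.1 fun s hs => ?_)
  rcases hR s with h1 | h1
  · exact h1
  · by_contra h2
    have h3 : MM R s⁻¹ := ⟨h1, Or.inr (by rwa [inv_inv])⟩
    refine not_MM_inv ?_ hs (h3.of_le h)
    rintro rfl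
    exact h2 R.toSubring.zero_mem

theorem localRing_genericPoint_eq_of_le {C : PlaneCurve K} {S : LocalSubring (FunField K)}
    (h : localRing C.genericPoint ≤ S) : localRing C.genericPoint = S :=
  eq_of_le_of_mem_or_inv_mem (mem_or_inv_mem_localRing C) h

theorem localRing_genericPoint_ne_top (C : PlaneCurve K) :
    (localRing C.genericPoint).toSubring ≠ ⊤ := by
  rw [Ne, ← pIdeal_eq_bot_iff]
  intro h
  have : C.poly ∈ pIdeal C.genericPoint := mem_genericPoint.mpr dvd_rfl
  rw [h] at this
  exact C.irreducible.ne_zero this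

theorem genericPoint_eq_iff {C D : PlaneCurve K} :
    C.genericPoint = D.genericPoint ↔ Associated C.poly D.poly := by
  constructor
  · intro h
    exact associated_of_dvd_dvd (mem_genericPoint.mp (h ▸ mem_genericPoint.mpr dvd_rfl))
      (mem_genericPoint.mp (h ▸ mem_genericPoint.mpr dvd_rfl))
  · intro h
    refine pIdeal_injective (le_antisymm ?_ ?_)
    · exact pIdeal_genericPoint_le.mpr (mem_genericPoint.mpr h.symm.dvd)
    · exact pIdeal_genericPoint_le.mpr (mem_genericPoint.mpr h.dvd)

theorem PlaneCurve.genericPoint_eq_of_dvd {C D : PlaneCurve K} (h : C.poly ∣ D.poly) :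
    C.genericPoint = D.genericPoint :=
  genericPoint_eq_iff.mpr (C.irreducible.associated_of_dvd D.irreducible h)

theorem PlaneCurve.deg_eq_of_associated {C : PlaneCurve K} {G : HomRing K} {d : ℕ}
    (hG : G.IsHomogeneous d) (h : Associated C.poly G) : C.deg = d := by
  obtain ⟨v, rfl⟩ := h
  obtain ⟨r, hr, hv⟩ := MvPolynomial.isUnit_iff_eq_C_of_isReduced.mp v.isUnit
  have h1 := C.isHomogeneous.mul (isHomogeneous_C (Fin 3) r)
  rw [← hv] at h1
  exact h1.inj_right hG (mul_ne_zero C.irreducible.ne_zero v.ne_zero)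

/-- A form all of whose irreducible factors divide the irreducible form `G` is a power of `G`. -/
theorem eq_C_mul_pow {G : HomRing K} {e : ℕ} (hG : G.IsHomogeneous e) (hG1 : Irreducible G)
    {B : HomRing K} {m : ℕ} (hB : B.IsHomogeneous m) (hB0 : B ≠ 0)
    (h : ∀ D : PlaneCurve K, D.poly ∣ B → D.poly ∣ G) :
    ∃ (k : ℕ) (c : K), c ≠ 0 ∧ m = e * k ∧ B = C c * G ^ k := by
  have he : e ≠ 0 := PlaneCurve.deg_ne_zero ⟨G, e, hG, hG1⟩
  induction m using Nat.strong_induction_on generalizing B with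
  | _ m ih =>
    rcases Nat.eq_zero_or_pos m with rfl | hm
    · have h2 := totalDegree_eq_zero_iff_eq_C.mp (Nat.le_zero.mp hB.totalDegree_le)
      exact ⟨0, coeff 0 B, fun h4 => hB0 (by rw [h2, h4, map_zero]), by simp,
        by rw [pow_zero, mul_one]; exact h2⟩
    · obtain ⟨D, hD⟩ := exists_planeCurve_dvd hB hB0 hm.ne'
      have hDG : Associated D.poly G := D.irreducible.associated_of_dvd hG1 (h D hD)
      obtain ⟨B', f, rfl, hB', rfl⟩ :=
        exists_isHomogeneous_of_dvd hB hB0 hG (hDG.symm.dvd.trans hD)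
      obtain ⟨k, c, hc, rfl, rfl⟩ := ih f (by omega) hB' (right_ne_zero_of_mul hB0)
        fun D hD => h D (hD.mul_left _)
      exact ⟨k + 1, c, hc, by ring, by ring⟩

/-- A rational function that is regular at the generic points of all curves except possibly `G = 0`
is a quotient whose denominator is a power of `G`. -/
theorem exists_eq_div_pow {G : HomRing K} {e : ℕ} (hG : G.IsHomogeneous e) (hG1 : Irreducible G)
    {r : FunField K} (h : ∀ D : PlaneCurve K, ¬ D.poly ∣ G →
      r ∈ (localRing D.genericPoint).toSubring) :
    ∃ (k : ℕ) (A : HomRing K), A.IsHomogeneous (e * k) ∧ r = dehom K A / dehom K (G ^ k) := by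
  obtain ⟨d, A, B, hA, hB, hB0, rfl, hco⟩ := exists_coprime_fraction r
  -- In lowest terms, a factor D of the denominator that does not divide G would be a pole of r
  -- along D.
  obtain ⟨k, c, hc, rfl, rfl⟩ := eq_C_mul_pow hG hG1 hB hB0 fun D hD => by
    by_contra hDG
    have hA' : A ∉ pIdeal D.genericPoint := fun h => hco D (mem_genericPoint.mp h) hD
    exact notMem_of_div_mem hA hB hB0 hA' (h D hDG) (mem_genericPoint.mpr hD)
  refine ⟨k, A * C c⁻¹, by simpa using hA.mul (isHomogeneous_C _ _), ?_⟩
  rw [map_mul, map_mul, dehom_C, dehom_C, map_inv₀, ← div_div]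
  simp only [div_eq_mul_inv]

/-- A curve of the plane has a closed point other than `(0 : 0 : 1)`. -/
theorem exists_lt_point (C : PlaneCurve K) : ∃ y : P2 K, pIdeal C.genericPoint < pIdeal y ∧
    (X 0 ∉ pIdeal y ∨ X 1 ∉ pIdeal y) := by
  -- The point is sought on the line z = 0: it is (1 : 0 : 0) if that lies on the curve, and
  -- otherwise (ξ : 1 : 0) for a root ξ in the algebraic closure.
  by_cases h0 : aeval (R := K) ![(1 : K), 0, 0] C.poly = 0
  · let y : P2 K := pointOf (aeval (R := K) ![(1 : K), 0, 0]).toRingHom ⟨0, by simp⟩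
    have hy : C.poly ∈ pIdeal y := (mem_pointOf C.isHomogeneous).mpr h0
    have h1 : X 1 ∈ pIdeal y := (mem_pointOf (isHomogeneous_X K 1)).mpr (by simp)
    have h2 : X 2 ∈ pIdeal y := (mem_pointOf (isHomogeneous_X K 2)).mpr (by simp)
    have h3 : X 0 ∉ pIdeal y := fun h => by
      simpa using (mem_pointOf (isHomogeneous_X K 0)).mp h
    refine ⟨y, lt_of_le_of_ne (pIdeal_genericPoint_le.mpr hy) ?_, Or.inl h3⟩
    intro h
    rw [← h] at h1 h2
    have h4 := C.irreducible.associated_of_dvd (X_prime).irreducible (mem_genericPoint.mp h1)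
    have h5 := h4.symm.dvd.trans (mem_genericPoint.mp h2)
    rw [X_dvd_X] at h5
    exact absurd h5 (by decide)
  · -- a root of `C.poly (T, 1, 0)`
    let f : Polynomial K := aeval (R := K) ![Polynomial.X, 1, 0] C.poly
    -- The coefficient of T^deg in C(T, 1, 0) is C(1, 0, 0), nonzero in this case, so the polynomial
    -- is not constant.
    have hlead : f.coeff C.deg = aeval (R := K) ![(1 : K), 0, 0] C.poly := by
      simp only [f, aeval_def, eval₂_eq', Polynomial.finsetSum_coeff]
      refine Finset.sum_congr rfl fun e he => ?_
      have hd : ∑ i, e i = C.deg := by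
        have := C.isHomogeneous (mem_support_iff.mp he)
        simpa [Finsupp.weight_apply, Finsupp.sum_fintype] using this
      rw [Fin.sum_univ_three] at hd
      simp only [Fin.prod_univ_three, Polynomial.algebraMap_eq, Polynomial.coeff_C_mul]
      simp only [Matrix.cons_val_zero, Matrix.cons_val_one, Matrix.cons_val_two, one_pow, mul_one,
        Algebra.algebraMap_self, RingHom.id_apply, one_mul]
      by_cases h2 : e 2 = 0
      · by_cases h1 : e 1 = 0
        · simp [h1, h2, Polynomial.coeff_X_pow, ← hd]
        · have : C.deg ≠ e 0 := by omega
          simp [h1, h2, Polynomial.coeff_X_pow, this]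
      · simp [h2]
    have hf : f.degree ≠ 0 := by
      have h1 : f.coeff C.deg ≠ 0 := hlead ▸ h0
      have h2 := Polynomial.le_degree_of_ne_zero h1
      intro h3
      rw [h3] at h2
      exact C.deg_ne_zero (by exact_mod_cast (Nat.le_zero.mp (by exact_mod_cast h2)))
    obtain ⟨ξ, hξ⟩ := IsAlgClosed.exists_aeval_eq_zero (AlgebraicClosure K) f hf
    let y : P2 K := pointOf (aeval (R := K) ![ξ, 1, 0]).toRingHom ⟨1, by simp⟩
    have hy : C.poly ∈ pIdeal y := by
      rw [mem_pointOf C.isHomogeneous]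
      change aeval (R := K) ![ξ, 1, 0] C.poly = 0
      have h1 : (fun i => Polynomial.aeval ξ ((![Polynomial.X, 1, 0] : Fin 3 → Polynomial K) i)) =
          ![ξ, 1, 0] := by
        funext i
        fin_cases i <;> simp
      refine Eq.trans ?_ hξ
      rw [← h1, ← comp_aeval]
      rfl
    have h2 : X 2 ∈ pIdeal y := (mem_pointOf (isHomogeneous_X K 2)).mpr (by simp)
    have h3 : X 1 ∉ pIdeal y := fun h => by
      simpa using (mem_pointOf (isHomogeneous_X K 1)).mp h
    refine ⟨y, lt_of_le_of_ne (pIdeal_genericPoint_le.mpr hy) ?_, Or.inr h3⟩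
    intro h
    rw [← h] at h2
    obtain ⟨v, hv⟩ := C.irreducible.associated_of_dvd (X_prime).irreducible (mem_genericPoint.mp h2)
    apply h0
    have h4 := congrArg (aeval (R := K) ![(1 : K), 0, 0]) hv
    rw [map_mul, aeval_X] at h4
    exact (mul_eq_zero.mp h4).resolve_right (v.isUnit.map _).ne_zero

end Points

/-! ### Birational maps given by triples of forms -/

section Triples

variable {K : Type u} [Field K]

open MvPolynomial

theorem Bir.mem_push {θ : Bir K} {R : LocalSubring (FunField K)} {r : FunField K} :
    r ∈ (θ.push R).toSubring ↔ θ.pull r ∈ R.toSubring := by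
  constructor
  · rintro ⟨s, hs, rfl⟩
    simpa using hs
  · intro h
    exact ⟨_, h, by simp⟩

theorem Bir.MM_push {θ : Bir K} {R : LocalSubring (FunField K)} {r : FunField K} :
    MM (θ.push R) r ↔ MM R (θ.pull r) := by
  rw [MM, MM, Bir.mem_push, Bir.mem_push, map_inv₀, map_eq_zero_iff _ θ.pull.injective]

theorem Bir.mapsTo_iff {θ : Bir K} {R : LocalSubring (FunField K)} {y : P2 K} :
    θ.MapsTo R y ↔ (∀ r ∈ (localRing y).toSubring, θ.pull r ∈ R.toSubring) ∧
      ∀ r, MM (localRing y) r → MM R (θ.pull r) := by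
  rw [Bir.MapsTo, le_iff_MM]
  exact and_congr (forall₂_congr fun r _ => Bir.mem_push) (forall₂_congr fun r _ => Bir.MM_push)

theorem Bir.push_mono {θ : Bir K} {R S : LocalSubring (FunField K)} (h : R ≤ S) :
    θ.push R ≤ θ.push S :=
  le_of_not_MM (fun _ hr => Bir.mem_push.mpr (h.1 (Bir.mem_push.mp hr)))
    fun _ hr => Bir.MM_push.mpr ((Bir.MM_push.mp hr).of_le h)

theorem Bir.push_comp (θ τ : Bir K) (R : LocalSubring (FunField K)) :
    (τ.comp θ).push R = τ.push (θ.push R) := by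
  apply LocalSubring.toSubring_injective
  ext r
  rw [Bir.mem_push, Bir.mem_push, Bir.mem_push]
  rfl

theorem Bir.push_symm_push (θ : Bir K) (R : LocalSubring (FunField K)) :
    θ.symm.push (θ.push R) = R := by
  apply LocalSubring.toSubring_injective
  ext r
  rw [Bir.mem_push, Bir.mem_push]
  simp [Bir.symm]

theorem Bir.push_push_symm (θ : Bir K) (R : LocalSubring (FunField K)) :
    θ.push (θ.symm.push R) = R := θ.symm.push_symm_push R

theorem Bir.symm_pull_pull (θ : Bir K) (r : FunField K) : θ.symm.pull (θ.pull r) = r := by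
  simp [Bir.symm]

theorem Bir.pull_symm_pull (θ : Bir K) (r : FunField K) : θ.pull (θ.symm.pull r) = r := by
  simp [Bir.symm]

theorem Bir.ext_pull {θ τ : Bir K} (h : ∀ r, θ.pull r = τ.pull r) : θ = τ := by
  cases θ; cases τ
  congr
  exact AlgEquiv.ext h

theorem aeval_dehom_X (G : HomRing K) :
    aeval (R := K) (fun i => dehom K (X i)) G = dehom K G := by
  rw [← comp_aeval, aeval_X_left, AlgHom.comp_id]

theorem isHomogeneous_aeval {A : Fin 3 → HomRing K} {d : ℕ} (hA : ∀ i, (A i).IsHomogeneous d)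
    {G : HomRing K} {m : ℕ} (hG : G.IsHomogeneous m) :
    (aeval A G).IsHomogeneous (d * m) :=
  hG.aeval A hA

/-- The birational map `θ` is `(x : y : z) ↦ (A₀ : A₁ : A₂)`, for forms `A₀`, `A₁`, `A₂` of
degree `d`. -/
structure Bir.GivenBy (θ : Bir K) (A : Fin 3 → HomRing K) (d : ℕ) : Prop where
  isHomogeneous : ∀ i, (A i).IsHomogeneous d
  exists_factor : ∃ h : FunField K, h ≠ 0 ∧ ∀ i, dehom K (A i) = h * θ.pull (dehom K (X i))

namespace Bir.GivenBy

variable {θ τ : Bir K} {A B : Fin 3 → HomRing K} {d e : ℕ}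

/-- The common factor h of the three components enters a form of degree m as h^m, and therefore
disappears from quotients of forms of equal degree. -/
theorem dehom_aeval_of_factor {h : FunField K}
    (hh : ∀ i, dehom K (A i) = h * θ.pull (dehom K (X i))) {G : HomRing K} {m : ℕ}
    (hG : G.IsHomogeneous m) :
    dehom K (aeval A G) = h ^ m * θ.pull (dehom K G) := by
  rw [← AlgHom.comp_apply, comp_aeval]
  simp only [hh]
  rw [aeval_mul_of_isHomogeneous hG, ← aeval_dehom_X G]
  congr 1
  have := congrArg (fun f : HomRing K →ₐ[K] FunField K => f G)
    (comp_aeval (fun i => dehom K (X i)) (θ.pull : FunField K →ₐ[K] FunField K))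
  exact this.symm

theorem aeval_ne_zero (hθ : θ.GivenBy A d) {G : HomRing K} {m : ℕ} (hG : G.IsHomogeneous m)
    (h0 : G ≠ 0) : aeval A G ≠ 0 := by
  obtain ⟨h, hh0, hh⟩ := hθ.exists_factor
  intro h1
  have h2 := dehom_aeval_of_factor hh hG
  rw [h1, map_zero, eq_comm, mul_eq_zero, map_eq_zero_iff _ θ.pull.injective] at h2
  exact h2.elim (pow_ne_zero _ hh0) (dehom_ne_zero hG h0)

theorem pull_div (hθ : θ.GivenBy A d) {G H : HomRing K} {m : ℕ} (hG : G.IsHomogeneous m)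
    (hH : H.IsHomogeneous m) :
    θ.pull (dehom K G / dehom K H) = dehom K (aeval A G) / dehom K (aeval A H) := by
  obtain ⟨h, hh0, hh⟩ := hθ.exists_factor
  rw [dehom_aeval_of_factor hh hG, dehom_aeval_of_factor hh hH,
    mul_div_mul_left _ _ (pow_ne_zero _ hh0), map_div₀]

theorem comp (hτ : τ.GivenBy B e) (hθ : θ.GivenBy A d) :
    (τ.comp θ).GivenBy (fun i => aeval A (B i)) (d * e) := by
  refine ⟨fun i => isHomogeneous_aeval hθ.isHomogeneous (hτ.isHomogeneous i), ?_⟩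
  obtain ⟨h, hh0, hh⟩ := hθ.exists_factor
  obtain ⟨k, hk0, hk⟩ := hτ.exists_factor
  refine ⟨h ^ e * θ.pull k, mul_ne_zero (pow_ne_zero _ hh0)
    ((map_ne_zero_iff _ θ.pull.injective).mpr hk0), fun i => ?_⟩
  rw [dehom_aeval_of_factor hh (hτ.isHomogeneous i), hk, map_mul, mul_assoc]
  rfl

/-- The forms that define the identity are multiples of `x`, `y`, `z`. -/
theorem eq_mul_X_of_id (hθ : θ.GivenBy A d) (hid : ∀ r, θ.pull r = r) :
    ∃ (H : HomRing K) (m : ℕ), H.IsHomogeneous m ∧ d = m + 1 ∧ H ≠ 0 ∧ ∀ i, A i = H * X i := by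
  obtain ⟨h, hh0, hh⟩ := hθ.exists_factor
  simp only [hid] at hh
  have h1 : ∀ i, A i * X 2 = A 2 * X i := fun i => by
    refine eq_of_dehom_mul_eq (hθ.isHomogeneous i) (isHomogeneous_X K 2) (hθ.isHomogeneous 2)
      (isHomogeneous_X K i) rfl ?_
    rw [hh, hh 2]
    ring
  have hA2 : A 2 ≠ 0 := by
    intro h0
    have h2 := hh 2
    simp [h0] at h2
    exact hh0 h2.symm
  -- From A_0 z = A_2 x it follows that z divides A_2; the quotient serves for all three components.
  have h2 : (X 2 : HomRing K) ∣ A 2 * X 0 := h1 0 ▸ dvd_mul_left _ _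
  have h3 : (X 2 : HomRing K) ∣ A 2 := by
    refine ((X_prime).dvd_or_dvd h2).resolve_right fun h => ?_
    rw [X_dvd_X] at h
    exact absurd h (by decide)
  obtain ⟨H, m, hH, hm, hd⟩ := exists_isHomogeneous_of_dvd (hθ.isHomogeneous 2) hA2
    (isHomogeneous_X K 2) h3
  refine ⟨H, m, hm, by omega, fun h0 => hA2 (by rw [hH, h0, mul_zero]), fun i => ?_⟩
  have h4 := h1 i
  rw [hH] at h4
  exact mul_right_cancel₀ (X_ne_zero 2) (h4.trans (by ring))

theorem mapsTo_of_mem_iff (hθ : θ.GivenBy A d) {y z : P2 K}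
    (h : ∀ (m : ℕ) (G : HomRing K), G.IsHomogeneous m →
      (G ∈ pIdeal z ↔ aeval A G ∈ pIdeal y)) : θ.MapsTo (localRing y) z := by
  rw [Bir.mapsTo_iff]
  constructor
  · intro r hr
    obtain ⟨m, G, H, hG, hH, hHz, rfl⟩ := mem_localRing.mp hr
    rw [hθ.pull_div hG hH]
    exact div_mem_localRing (isHomogeneous_aeval hθ.isHomogeneous hG)
      (isHomogeneous_aeval hθ.isHomogeneous hH) (fun h' => hHz ((h m H hH).mpr h'))
  · intro r hr
    obtain ⟨m, G, H, hG, hH, hHz, rfl⟩ := mem_localRing.mp hr.mem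
    rw [MM_localRing hG hH hHz] at hr
    rw [hθ.pull_div hG hH, MM_localRing (isHomogeneous_aeval hθ.isHomogeneous hG)
      (isHomogeneous_aeval hθ.isHomogeneous hH) (fun h' => hHz ((h m H hH).mpr h'))]
    exact (h m G hG).mp hr

/-- A birational map is defined where the forms do not all vanish. -/
theorem exists_mapsTo (hθ : θ.GivenBy A d) {y : P2 K} (hy : ∃ i, A i ∉ pIdeal y) :
    ∃ z, θ.MapsTo (localRing y) z ∧ ∀ (m : ℕ) (G : HomRing K), G.IsHomogeneous m →
      (G ∈ pIdeal z ↔ aeval A G ∈ pIdeal y) := by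
  let z : P2 K := pointOf ((Ideal.Quotient.mk (pIdeal y)).comp (aeval A).toRingHom) (by
    obtain ⟨i, hi⟩ := hy
    refine ⟨i, ?_⟩
    change Ideal.Quotient.mk (pIdeal y) (aeval A (X i)) ≠ 0
    rw [aeval_X, Ne, Ideal.Quotient.eq_zero_iff_mem]
    exact hi)
  have hz : ∀ (m : ℕ) (G : HomRing K), G.IsHomogeneous m →
      (G ∈ pIdeal z ↔ aeval A G ∈ pIdeal y) := fun m G hG => by
    rw [mem_pointOf hG]
    exact Ideal.Quotient.eq_zero_iff_mem
  exact ⟨z, hθ.mapsTo_of_mem_iff hz, hz⟩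

/-- The forms that vanish at the image of a curve. -/
theorem dvd_of_mapsTo (hθ : θ.GivenBy A d) (hA : ∀ C : PlaneCurve K, ∃ i, ¬ C.poly ∣ A i)
    {C D : PlaneCurve K} (h : θ.MapsTo (localRing C.genericPoint) D.genericPoint)
    {G : HomRing K} {m : ℕ} (hG : G.IsHomogeneous m) (hC : C.poly ∣ aeval A G) : D.poly ∣ G := by
  by_contra hD
  obtain ⟨i, hi⟩ := exists_X_notMem D.genericPoint
  have hi' : X i ^ m ∉ pIdeal D.genericPoint := fun h =>
    hi ((D.genericPoint).isPrime.mem_of_pow_mem _ h)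
  rw [Bir.mapsTo_iff] at h
  -- If D does not divide G, then X_i^m / G is regular along D, so A_i^m / G(A) is regular along C
  -- although C divides its denominator. Hence C divides A_i. For a component A_j prime to C, the
  -- fraction A_j / A_i then has a pole along C, while X_j / X_i is regular along D.
  have h1 := h.1 _ (div_mem_localRing (isHomogeneous_X_pow i m) hG
    (fun h => hD (mem_genericPoint.mp h)))
  rw [hθ.pull_div (isHomogeneous_X_pow i m) hG, map_pow, aeval_X] at h1
  have hAi : C.poly ∣ A i := by
    by_contra hAi
    refine notMem_of_div_mem (y := C.genericPoint) ?_ (isHomogeneous_aeval hθ.isHomogeneous hG)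
      (hθ.aeval_ne_zero hG ?_) ?_ h1 (mem_genericPoint.mpr hC)
    · exact (hθ.isHomogeneous i).pow m
    · rintro rfl
      exact hD (dvd_zero _)
    · rw [mem_genericPoint]
      exact fun h => hAi (C.prime.dvd_of_dvd_pow h)
  obtain ⟨j, hj⟩ := hA C
  have hAj : A j ∉ pIdeal C.genericPoint := fun h => hj (mem_genericPoint.mp h)
  have h2 := h.1 _ (div_mem_localRing (isHomogeneous_X K j) (isHomogeneous_X K i) hi)
  rw [hθ.pull_div (isHomogeneous_X K j) (isHomogeneous_X K i), aeval_X, aeval_X] at h2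
  have h3 := hθ.aeval_ne_zero (isHomogeneous_X K i) (X_ne_zero i)
  rw [aeval_X] at h3
  exact notMem_of_div_mem (hθ.isHomogeneous j) (hθ.isHomogeneous i) h3 hAj h2
    (mem_genericPoint.mpr hAi)

end Bir.GivenBy

/-- Every birational map is given by forms without common factor. -/
theorem Bir.exists_givenBy (θ : Bir K) : ∃ (A : Fin 3 → HomRing K) (d : ℕ), θ.GivenBy A d ∧
    ∀ C : PlaneCurve K, ∃ i, ¬ C.poly ∣ A i := by
  obtain ⟨a, A, A', hA, hA', hA0, h1⟩ := exists_fraction (θ.pull (uFun K))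
  obtain ⟨b, B, B', hB, hB', hB0, h2⟩ := exists_fraction (θ.pull (vFun K))
  have h3 : ∃ (A : Fin 3 → HomRing K) (d : ℕ), θ.GivenBy A d := by
    refine ⟨![A * B', B * A', A' * B'], a + b, ?_, dehom K (A' * B'), ?_, ?_⟩
    · intro i
      fin_cases i
      · exact hA.mul hB'
      · exact add_comm b a ▸ hB.mul hA'
      · exact hA'.mul hB'
    · exact dehom_ne_zero (hA'.mul hB') (mul_ne_zero hA0 hB0)
    · have hA0' := dehom_ne_zero hA' hA0
      have hB0' := dehom_ne_zero hB' hB0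
      intro i
      fin_cases i
      · simp only [Fin.zero_eta, Matrix.cons_val_zero, dehom_X_zero, h1, map_mul]
        field_simp
      · simp only [Fin.mk_one, Matrix.cons_val_one, Matrix.cons_val_zero, dehom_X_one, h2, map_mul]
        field_simp
      · simp
  obtain ⟨A, d, hθ⟩ := h3
  induction d using Nat.strong_induction_on generalizing A with
  | _ d ih =>
    by_cases h : ∀ C : PlaneCurve K, ∃ i, ¬ C.poly ∣ A i
    · exact ⟨A, d, hθ, h⟩
    · push Not at h
      obtain ⟨C, hC⟩ := h
      have hA0 : ∀ i, A i ≠ 0 := fun i => by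
        have := hθ.aeval_ne_zero (isHomogeneous_X K i) (X_ne_zero i)
        rwa [aeval_X] at this
      choose A' e hAA' hA' hd using fun i =>
        exists_isHomogeneous_of_dvd (hθ.isHomogeneous i) (hA0 i) C.isHomogeneous (hC i)
      have hC0 := dehom_ne_zero C.isHomogeneous C.irreducible.ne_zero
      refine ih (e 0) (by have := C.deg_ne_zero; have := hd 0; omega) A' ⟨fun i => ?_, ?_⟩
      · have : e i = e 0 := by have := hd 0; have := hd i; omega
        exact this ▸ hA' i
      · obtain ⟨h, hh0, hh⟩ := hθ.exists_factor
        refine ⟨h / dehom K C.poly, div_ne_zero hh0 hC0, fun i => ?_⟩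
        have h1 := hh i
        rw [hAA' i, map_mul] at h1
        field_simp
        linear_combination h1

/-! ### Linear maps -/

/-- A linear change of coordinates: `θ` is given by the linear forms `A`, and its inverse by the
linear forms `B`. -/
structure Bir.IsLinear (θ : Bir K) (A B : Fin 3 → HomRing K) : Prop where
  givenBy : θ.GivenBy A 1
  symm_givenBy : θ.symm.GivenBy B 1
  aeval_left : ∀ i, aeval A (B i) = X i
  aeval_right : ∀ i, aeval B (A i) = X i

/-- A birational map of the plane that contracts no curve is linear. -/
theorem Bir.exists_isLinear (θ : Bir K)
    (h : ∀ C : PlaneCurve K, ∃ D : PlaneCurve K,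
      θ.MapsTo (localRing C.genericPoint) D.genericPoint) :
    ∃ A B, θ.IsLinear A B := by
  obtain ⟨A, d, hA, hA1⟩ := θ.exists_givenBy
  obtain ⟨B, e, hB, hB1⟩ := θ.symm.exists_givenBy
  obtain ⟨H, m, hH, hm, hH0, hAB⟩ := (hB.comp hA).eq_mul_X_of_id fun r => θ.pull_symm_pull r
  -- The composite of B and A is multiplication by a form H. A component C of H = 0 is mapped to a
  -- curve D, and then every B_i would be divisible by D, against the choice of B without common
  -- factor.
  have hm0 : m = 0 := by
    by_contra hm0
    obtain ⟨C, hC⟩ := exists_planeCurve_dvd hH hH0 hm0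
    obtain ⟨D, hD⟩ := h C
    obtain ⟨i, hi⟩ := hB1 D
    exact hi (hA.dvd_of_mapsTo hA1 hD (hB.isHomogeneous i) (by
      rw [hAB i]
      exact hC.mul_right _))
  subst hm0
  rw [zero_add] at hm
  obtain ⟨rfl, rfl⟩ : d = 1 ∧ e = 1 := ⟨Nat.eq_one_of_mul_eq_one_right hm,
    Nat.eq_one_of_mul_eq_one_left hm⟩
  have hHC := totalDegree_eq_zero_iff_eq_C.mp (Nat.le_zero.mp hH.totalDegree_le)
  set c := coeff 0 H with hc
  have hc0 : c ≠ 0 := fun h0 => hH0 (by rw [hHC, h0, map_zero])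
  -- Division of B by the constant H makes the composite the identity on forms and does not change
  -- the birational map.
  have hB' : θ.symm.GivenBy (fun i => C c⁻¹ * B i) 1 := by
    refine ⟨fun i => by simpa using (isHomogeneous_C (Fin 3) c⁻¹).mul (hB.isHomogeneous i), ?_⟩
    obtain ⟨k, hk0, hk⟩ := hB.exists_factor
    refine ⟨algebraMap K (FunField K) c⁻¹ * k, mul_ne_zero (by simpa using hc0) hk0, fun i => ?_⟩
    rw [map_mul, dehom_C, hk, mul_assoc]
  have h1 : ∀ i, aeval A (C c⁻¹ * B i) = X i := fun i => by
    rw [map_mul, hAB i, algHom_C, hHC, algebraMap_eq, ← mul_assoc, ← C_mul, inv_mul_cancel₀ hc0,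
      C_1, one_mul]
  refine ⟨A, _, hA, hB', h1, ?_⟩
  obtain ⟨H', m', hH', hm', hH0', hBA⟩ := (hA.comp hB').eq_mul_X_of_id fun r => θ.symm_pull_pull r
  obtain rfl : m' = 0 := by omega
  have hHC' := totalDegree_eq_zero_iff_eq_C.mp (Nat.le_zero.mp hH'.totalDegree_le)
  have hcomp : ∀ G : HomRing K, aeval A (aeval (fun i => C c⁻¹ * B i) G) = G := fun G => by
    rw [← AlgHom.comp_apply, comp_aeval]
    simp only [h1]
    exact aeval_X_left_apply G
  -- In the other order the composite is also multiplication by a constant; substitution of A shows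
  -- that the constant fixes A_2.
  have h2 : coeff 0 H' = 1 := by
    have h3 := congrArg (aeval A) (hBA 2)
    rw [hcomp, map_mul, aeval_X, hHC', algHom_C, algebraMap_eq] at h3
    have hA2 := hA.aeval_ne_zero (isHomogeneous_X K 2) (X_ne_zero 2)
    rw [aeval_X] at hA2
    have h4 : C (coeff 0 H') = (1 : HomRing K) :=
      mul_right_cancel₀ hA2 (by rw [one_mul]; exact h3.symm)
    rw [← C_1] at h4
    exact C_injective _ _ h4
  intro i
  rw [hBA i, hHC', h2, C_1, one_mul]

/-! ### Isomorphisms outside of a curve -/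

/-- Two triples of forms that define mutually inverse birational maps, isomorphisms outside of the
curve `g = 0`. -/
structure IsPairOff (A B : Fin 3 → HomRing K) (d e : ℕ) (g : HomRing K) : Prop where
  left_isHomogeneous : ∀ i, (A i).IsHomogeneous d
  right_isHomogeneous : ∀ i, (B i).IsHomogeneous e
  left_pos : d ≠ 0
  right_pos : e ≠ 0
  ne_zero : g ≠ 0
  comp_left : ∃ k, ∀ i, aeval A (B i) = g ^ k * X i
  comp_right : ∃ k, ∀ i, aeval B (A i) = g ^ k * X i
  aeval_left : ∃ k, aeval A g = g ^ k
  aeval_right : ∃ k, aeval B g = g ^ k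

namespace IsPairOff

variable {A B : Fin 3 → HomRing K} {d e : ℕ} {g : HomRing K}

theorem symm (h : IsPairOff A B d e g) : IsPairOff B A e d g :=
  ⟨h.right_isHomogeneous, h.left_isHomogeneous, h.right_pos, h.left_pos, h.ne_zero, h.comp_right,
    h.comp_left, h.aeval_right, h.aeval_left⟩

theorem exists_aeval_aeval (h : IsPairOff A B d e g) : ∃ k, ∀ (m : ℕ) (G : HomRing K),
    G.IsHomogeneous m → aeval A (aeval B G) = g ^ (k * m) * G := by
  obtain ⟨k, hk⟩ := h.comp_left
  refine ⟨k, fun m G hG => ?_⟩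
  rw [← AlgHom.comp_apply, comp_aeval]
  simp only [hk]
  rw [aeval_mul_of_isHomogeneous hG, aeval_X_left_apply, pow_mul]

theorem aeval_injOn (h : IsPairOff A B d e g) {G : HomRing K} {m : ℕ} (hG : G.IsHomogeneous m)
    (h0 : aeval A G = 0) : G = 0 := by
  obtain ⟨k, hk⟩ := h.symm.exists_aeval_aeval
  have h1 := hk m G hG
  rw [h0, map_zero, eq_comm, mul_eq_zero] at h1
  exact h1.resolve_left (pow_ne_zero _ h.ne_zero)

/-- Dehomogenization with values in the polynomials. -/
def dehomPoly : HomRing K →ₐ[K] MvPolynomial (Fin 2) K := aeval ![X 0, X 1, 1]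

theorem algebraMap_dehomPoly (G : HomRing K) :
    algebraMap (MvPolynomial (Fin 2) K) (FunField K) (dehomPoly G) = dehom K G := by
  rw [dehom, dehomPoly, ← aeval_algebraMap_apply]
  congr 2
  funext i
  fin_cases i <;> simp [uFun, vFun]

/-- The comorphism of `(A₀ : A₁ : A₂)` on polynomials. -/
def polyPull (A : Fin 3 → HomRing K) : MvPolynomial (Fin 2) K →ₐ[K] FunField K :=
  aeval ![dehom K (A 0) / dehom K (A 2), dehom K (A 1) / dehom K (A 2)]

theorem polyPull_dehomPoly (hA2 : dehom K (A 2) ≠ 0) {G : HomRing K} {m : ℕ}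
    (hG : G.IsHomogeneous m) :
    polyPull A (dehomPoly G) = dehom K (aeval A G) / dehom K (A 2) ^ m := by
  rw [eq_div_iff (pow_ne_zero _ hA2), ← AlgHom.comp_apply, ← AlgHom.comp_apply, comp_aeval,
    dehomPoly, comp_aeval, mul_comm, ← aeval_mul_of_isHomogeneous hG]
  congr 2
  funext i
  fin_cases i <;> simp [polyPull, mul_div_cancel₀, hA2]

theorem dehom_ne_zero (h : IsPairOff A B d e g) (i : Fin 3) : dehom K (A i) ≠ 0 := by
  refine PlaneBirational.dehom_ne_zero (h.left_isHomogeneous i) fun h0 => ?_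
  exact X_ne_zero (R := K) i (h.aeval_injOn (isHomogeneous_X K i) (by rw [aeval_X, h0]))

theorem polyPull_injective (h : IsPairOff A B d e g) : Function.Injective (polyPull A) := by
  rw [injective_iff_map_eq_zero]
  intro f hf
  obtain ⟨m, G, hG, hGf⟩ := exists_dehom_eq f
  rw [← algebraMap_dehomPoly] at hGf
  have h1 := IsFractionRing.injective _ _ hGf
  rw [← h1, polyPull_dehomPoly (h.dehom_ne_zero 2) hG, div_eq_zero_iff] at hf
  have h2 := hf.resolve_right (pow_ne_zero _ (h.dehom_ne_zero 2))
  have h3 : aeval A G = 0 := by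
    by_contra h0
    exact PlaneBirational.dehom_ne_zero (isHomogeneous_aeval h.left_isHomogeneous hG) h0 h2
  rw [← h1, h.aeval_injOn hG h3, map_zero]

/-- The comorphism of `(A₀ : A₁ : A₂)`. -/
def fieldPull (h : IsPairOff A B d e g) : FunField K →ₐ[K] FunField K :=
  IsFractionRing.liftAlgHom (A := MvPolynomial (Fin 2) K) (K := FunField K) h.polyPull_injective

theorem fieldPull_dehom (h : IsPairOff A B d e g) {G : HomRing K} {m : ℕ}
    (hG : G.IsHomogeneous m) :
    h.fieldPull (dehom K G) = dehom K (aeval A G) / dehom K (A 2) ^ m := by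
  rw [← algebraMap_dehomPoly, ← polyPull_dehomPoly (h.dehom_ne_zero 2) hG]
  exact IsFractionRing.lift_algebraMap h.polyPull_injective _

theorem fieldPull_div (h : IsPairOff A B d e g) {G H : HomRing K} {m : ℕ} (hG : G.IsHomogeneous m)
    (hH : H.IsHomogeneous m) :
    h.fieldPull (dehom K G / dehom K H) = dehom K (aeval A G) / dehom K (aeval A H) := by
  rw [map_div₀, h.fieldPull_dehom hG, h.fieldPull_dehom hH, div_div_div_cancel_right₀
    (pow_ne_zero _ (h.dehom_ne_zero 2))]

theorem fieldPull_fieldPull (h : IsPairOff A B d e g) (r : FunField K) :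
    h.fieldPull (h.symm.fieldPull r) = r := by
  obtain ⟨m, G, H, hG, hH, hH0, rfl⟩ := exists_fraction r
  obtain ⟨k, hk⟩ := h.exists_aeval_aeval
  have hg : dehom K (g ^ (k * m)) ≠ 0 := by
    intro h0
    have h1 := PlaneBirational.dehom_ne_zero (isHomogeneous_aeval h.left_isHomogeneous
      (isHomogeneous_aeval h.right_isHomogeneous hH)) (by
        rw [hk m H hH]
        exact mul_ne_zero (pow_ne_zero _ h.ne_zero) hH0)
    rw [hk m H hH, map_mul, h0, zero_mul] at h1
    exact h1 rfl
  rw [h.symm.fieldPull_div hG hH, h.fieldPull_div (isHomogeneous_aeval h.right_isHomogeneous hG)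
    (isHomogeneous_aeval h.right_isHomogeneous hH), hk m G hG, hk m H hH, map_mul, map_mul,
    mul_div_mul_left _ _ hg]

/-- The birational map `(x : y : z) ↦ (A₀ : A₁ : A₂)`. -/
def toBir (h : IsPairOff A B d e g) : Bir K :=
  ⟨AlgEquiv.ofAlgHom h.fieldPull h.symm.fieldPull (AlgHom.ext h.fieldPull_fieldPull)
    (AlgHom.ext h.symm.fieldPull_fieldPull)⟩

theorem toBir_givenBy (h : IsPairOff A B d e g) : h.toBir.GivenBy A d := by
  refine ⟨h.left_isHomogeneous, dehom K (A 2), h.dehom_ne_zero 2, fun i => ?_⟩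
  change _ = _ * h.fieldPull _
  rw [h.fieldPull_dehom (isHomogeneous_X K i), aeval_X, pow_one,
    mul_div_cancel₀ _ (h.dehom_ne_zero 2)]

/-- An isomorphism outside of `g = 0` maps curves to curves. -/
theorem exists_push_eq (h : IsPairOff A B d e g) {θ : Bir K} (hθ : θ.GivenBy A d)
    {C : PlaneCurve K} (hC : ¬ C.poly ∣ g) :
    ∃ D : PlaneCurve K, ¬ D.poly ∣ g ∧ D.poly ∣ aeval B C.poly ∧
      θ.push (localRing C.genericPoint) = localRing D.genericPoint := by
  obtain ⟨k, hk⟩ := h.exists_aeval_aeval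
  obtain ⟨l, hl⟩ := h.symm.exists_aeval_aeval
  have hCg : ∀ j, ¬ C.poly ∣ g ^ j := fun j hj => hC (C.prime.dvd_of_dvd_pow hj)
  -- If C divided all the A_i, it would divide every B_i(A) = g^j X_i, because the B_i have positive
  -- degree. But C does not divide g.
  have hAC : ∃ i, A i ∉ pIdeal C.genericPoint := by
    by_contra! hA
    simp only [mem_genericPoint] at hA
    obtain ⟨i, hi⟩ := exists_X_notMem C.genericPoint
    rw [mem_genericPoint] at hi
    obtain ⟨j, hj⟩ := h.comp_left
    have h1 : C.poly ∣ aeval A (B i) := by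
      rw [aeval_def, eval₂_eq']
      refine Finset.dvd_sum fun m hm => Dvd.dvd.mul_left ?_ _
      have hd : ∑ i, m i = e := by
        have := h.right_isHomogeneous i (mem_support_iff.mp hm)
        simpa [Finsupp.weight_apply, Finsupp.sum_fintype] using this
      obtain ⟨t, -, ht⟩ : ∃ t ∈ Finset.univ, m t ≠ 0 := by
        by_contra! h0
        exact h.right_pos (hd ▸ Finset.sum_eq_zero h0)
      exact ((hA t).trans (dvd_pow_self _ ht)).trans
        (Finset.dvd_prod_of_mem (fun i => A i ^ m i) (Finset.mem_univ t))
    rw [hj] at h1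
    exact (C.prime.dvd_or_dvd h1).elim (hCg j) hi
  obtain ⟨z, hz, hz'⟩ := hθ.exists_mapsTo hAC
  obtain ⟨j, hj⟩ := h.aeval_left
  have hBC := isHomogeneous_aeval h.right_isHomogeneous C.isHomogeneous
  -- The image z of the generic point lies on B(C) = 0, since A(B(C)) is a multiple of C. An
  -- irreducible factor D of B(C) through z is the candidate.
  have h1 : aeval B C.poly ∈ pIdeal z := by
    rw [hz' _ _ hBC, hk _ _ C.isHomogeneous, mem_genericPoint]
    exact dvd_mul_left _ _
  have h2 : aeval B C.poly ≠ 0 := fun h0 =>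
    C.irreducible.ne_zero (h.symm.aeval_injOn C.isHomogeneous h0)
  obtain ⟨D, hD, hDB⟩ := exists_planeCurve_mem hBC h2 h1
  have hDg : ¬ D.poly ∣ g := by
    intro hDg
    have h3 := hD
    rw [hz' _ _ D.isHomogeneous, mem_genericPoint] at h3
    obtain ⟨q, hq⟩ := hDg
    refine hCg j ?_
    rw [← hj, hq, map_mul]
    exact h3.mul_right _
  refine ⟨D, hDg, hDB, ?_⟩
  -- If G vanishes at z then C divides G(A), so D divides B(C), hence B(A(G)) = g^(l m) G, and D is
  -- prime to g.
  have hzD : D.genericPoint = z := by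
    refine pIdeal_injective (le_antisymm (pIdeal_genericPoint_le.mpr hD) (pIdeal_le_iff.mpr ?_))
    intro m G hG hGz
    rw [hz' m G hG, mem_genericPoint] at hGz
    obtain ⟨q, hq⟩ := hGz
    have h4 : D.poly ∣ g ^ (l * m) * G := by
      rw [← hl m G hG, hq, map_mul]
      exact hDB.mul_right _
    exact mem_genericPoint.mpr
      ((D.prime.dvd_or_dvd h4).resolve_left fun h => hDg (D.prime.dvd_of_dvd_pow h))
  rw [← hzD] at hz
  exact (localRing_genericPoint_eq_of_le hz).symm

end IsPairOff

end Triples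

/-! ### Sections of the structure sheaf of the plane -/

section Sections

variable {K : Type u} [Field K]

open MvPolynomial

variable (K) in
/-- The grading of the homogeneous coordinate ring. -/
abbrev gr : ℕ → Submodule K (HomRing K) := homogeneousSubmodule (Fin 3) K

/-- The fraction `A / f ^ k` as a section over the open set `f ≠ 0`. -/
def awayFrac {f : HomRing K} {m : ℕ} (hf : f.IsHomogeneous m) {A : HomRing K} (k : ℕ)
    (hA : A.IsHomogeneous (m * k)) : HomogeneousLocalization.Away (gr K) f :=
  HomogeneousLocalization.Away.mk (gr K) ((mem_homogeneousSubmodule _ _).mpr hf) k A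
    ((mem_homogeneousSubmodule _ _).mpr (by rwa [smul_eq_mul, mul_comm]))

theorem awayFrac_surjective {f : HomRing K} {m : ℕ} (hf : f.IsHomogeneous m)
    (q : HomogeneousLocalization.Away (gr K) f) :
    ∃ (k : ℕ) (A : HomRing K) (hA : A.IsHomogeneous (m * k)), q = awayFrac hf k hA := by
  obtain ⟨k, A, hA, rfl⟩ := HomogeneousLocalization.Away.mk_surjective (gr K)
    ((mem_homogeneousSubmodule _ _).mpr hf) q
  refine ⟨k, A, ?_, rfl⟩
  have := (mem_homogeneousSubmodule _ _).mp hA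
  rwa [smul_eq_mul, mul_comm] at this

theorem stalkIso_germ_away (f : HomRing K) (q : HomogeneousLocalization.Away (gr K) f)
    (x : P2 K) (hx : x ∈ Proj.basicOpen (gr K) f) :
    (Proj.stalkIso (gr K) x).hom.hom ((P2 K).presheaf.germ _ x hx
      ((Proj.awayToSection (gr K) f).hom q)) =
      HomogeneousLocalization.mapId (gr K) (Submonoid.powers_le.mpr hx) q := by
  have h := congrArg (fun g => (Proj.stalkIso (gr K) x).hom.hom (g.hom q))
    (ProjectiveSpectrum.Proj.awayToSection_germ (gr K) f x hx)
  refine h.trans ?_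
  change (Proj.stalkIso (gr K) x).hom.hom ((Proj.stalkIso (gr K) x).inv.hom _) = _
  rw [← CommRingCat.comp_apply, Iso.inv_hom_id]
  rfl

theorem stalkToFun_germ_away {f : HomRing K} {m : ℕ} (hf : f.IsHomogeneous m) {A : HomRing K}
    {k : ℕ} (hA : A.IsHomogeneous (m * k)) (x : P2 K) (hx : x ∈ Proj.basicOpen (gr K) f) :
    stalkToFun x ((P2 K).presheaf.germ _ x hx
      ((Proj.awayToSection (gr K) f).hom (awayFrac hf k hA))) = dehom K A / dehom K (f ^ k) := by
  have h1 : f ^ k ∉ pIdeal x := fun h => hx (x.isPrime.mem_of_pow_mem _ h)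
  rw [stalkToFun, RingHom.comp_apply]
  have h2 := stalkIso_germ_away f (awayFrac hf k hA) x hx
  refine (congrArg (fracToFun (pIdeal x)) h2).trans ?_
  rw [← fracToFun_mk (pIdeal x) hA (hf.pow k) h1]
  congr 1
  apply HomogeneousLocalization.val_injective
  simp only [awayFrac, HomogeneousLocalization.Away.mk, HomogeneousLocalization.val_mk]
  rfl

theorem stalkToFun_injective (x : P2 K) : Function.Injective (stalkToFun x) := by
  rw [injective_iff_map_eq_zero]
  intro s hs
  have h1 : (Proj.stalkIso (gr K) x).hom.hom s = 0 := by
    set q := (Proj.stalkIso (gr K) x).hom.hom s with hq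
    have h2 : dehom K q.num / dehom K q.den = 0 := hs
    have hden : dehom K q.den ≠ 0 :=
      dehom_ne_zero ((mem_homogeneousSubmodule _ _).mp q.den_mem_deg)
        (fun h => q.den_mem (h ▸ (pIdeal x).zero_mem))
    rw [div_eq_zero_iff] at h2
    have h3 : q.num = 0 := by
      by_contra h0
      exact dehom_ne_zero ((mem_homogeneousSubmodule _ _).mp q.num_mem_deg) h0
        (h2.resolve_right hden)
    apply HomogeneousLocalization.val_injective
    rw [q.eq_num_div_den, HomogeneousLocalization.val_zero, h3, Localization.mk_zero]
  have h2 : (Proj.stalkIso (gr K) x).inv.hom ((Proj.stalkIso (gr K) x).hom.hom s) = s := by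
    rw [← CommRingCat.comp_apply, Iso.hom_inv_id]
    rfl
  rw [← h2, h1, map_zero]

/-- Every germ is the germ of a fraction on an open set `f ≠ 0`. -/
theorem exists_germ_eq (x : P2 K) (s : (P2 K).presheaf.stalk x) :
    ∃ (m : ℕ) (f A : HomRing K) (hf : f.IsHomogeneous m) (hA : A.IsHomogeneous (m * 1))
      (hx : x ∈ Proj.basicOpen (gr K) f), 0 < m ∧ s = (P2 K).presheaf.germ _ x hx
        ((Proj.awayToSection (gr K) f).hom (awayFrac hf 1 hA)) := by
  obtain ⟨d, A, B, hA, hB, hBx, h⟩ := mem_localRing.mp (show stalkToFun x s ∈ (localRing x).toSubring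
    from ⟨s, rfl⟩)
  obtain ⟨i, hi⟩ := exists_X_notMem x
  have hBX : B * X i ∉ pIdeal x := fun h => (x.isPrime.mem_or_mem h).elim hBx hi
  refine ⟨d + 1, B * X i, A * X i, hB.mul (isHomogeneous_X K i),
    by simpa using hA.mul (isHomogeneous_X K i), hBX, Nat.succ_pos _, ?_⟩
  apply stalkToFun_injective
  refine Eq.trans ?_ (stalkToFun_germ_away _ _ x hBX).symm
  rw [h, pow_one, map_mul, map_mul, mul_div_mul_right]
  exact dehom_ne_zero (isHomogeneous_X K i) (X_ne_zero i)

theorem isUnit_iff_stalkToFun {x : P2 K} {s : (P2 K).presheaf.stalk x} :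
    IsUnit s ↔ ¬ MM (localRing x) (stalkToFun x s) := by
  constructor
  · rintro ⟨v, rfl⟩ h
    refine not_MM_of_inv_mem (R := localRing x) (r := stalkToFun x v) ?_ ?_ h
    · exact (v.isUnit.map (stalkToFun x)).ne_zero
    · refine ⟨((v⁻¹ : ((P2 K).presheaf.stalk x)ˣ) : (P2 K).presheaf.stalk x), ?_⟩
      exact (eq_inv_of_mul_eq_one_right (by rw [← map_mul, Units.mul_inv, map_one]))
  · intro h
    obtain ⟨h0, t, ht⟩ := inv_mem_of_not_MM (R := localRing x) (r := stalkToFun x s) ⟨s, rfl⟩ h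
    refine IsUnit.of_mul_eq_one t (stalkToFun_injective x ?_)
    rw [map_mul, map_one, ht, mul_inv_cancel₀ h0]

/-- The zeros of a section. -/
theorem mem_basicOpen_section {f : HomRing K} {m : ℕ} (hf : f.IsHomogeneous m) {A : HomRing K}
    {k : ℕ} (hA : A.IsHomogeneous (m * k)) {x : P2 K} (hx : x ∈ Proj.basicOpen (gr K) f) :
    x ∈ (P2 K).basicOpen ((Proj.awayToSection (gr K) f).hom (awayFrac hf k hA)) ↔
      A ∉ pIdeal x := by
  rw [Scheme.mem_basicOpen _ _ _ hx, isUnit_iff_stalkToFun, stalkToFun_germ_away hf hA x hx,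
    MM_localRing hA (hf.pow k) (fun h => hx (x.isPrime.mem_of_pow_mem _ h))]

theorem awayToSection_surjective {f : HomRing K} {m : ℕ} (hf : f.IsHomogeneous m) (hm : 0 < m)
    (s : Γ(P2 K, Proj.basicOpen (gr K) f)) : ∃ q, (Proj.awayToSection (gr K) f).hom q = s := by
  let i := Proj.basicOpenIsoAway (gr K) f ((mem_homogeneousSubmodule _ _).mpr hf) hm
  have hi : i.hom = Proj.awayToSection (gr K) f :=
    Proj.basicOpenIsoAway_hom (gr K) f ((mem_homogeneousSubmodule _ _).mpr hf) hm
  refine ⟨i.inv.hom s, ?_⟩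
  rw [← hi, ← CommRingCat.comp_apply, Iso.inv_hom_id]
  rfl

/-- The open set `f ≠ 0`, as an affine open set. -/
abbrev affineBasicOpen {f : HomRing K} {m : ℕ} (hf : f.IsHomogeneous m) (hm : 0 < m) :
    (P2 K).affineOpens :=
  ⟨Proj.basicOpen (gr K) f,
    Proj.isAffineOpen_basicOpen (gr K) f ((mem_homogeneousSubmodule _ _).mpr hf) hm⟩

theorem PlaneCurve.mem_points {C : PlaneCurve K} {x : P2 K} :
    x ∈ C.points ↔ C.poly ∈ pIdeal x := by
  change x ∈ ((C.compl : Set (P2 K)))ᶜ ↔ _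
  rw [Set.mem_compl_iff]
  exact not_not

/-- The ideal sheaf is defined through primes of the section ring over an affine open; `fromSpec`
translates these into points of the scheme. -/
theorem mem_vanishingIdeal_iff {Y : Scheme.{u}} (Z : TopologicalSpace.Closeds Y)
    (V : Y.affineOpens) (s : Γ(Y, V.1)) :
    s ∈ (Scheme.IdealSheafData.vanishingIdeal Z).ideal V ↔
      ∀ x ∈ V.1, x ∈ Z → x ∉ Y.basicOpen s := by
  have hV := V.2
  rw [Scheme.IdealSheafData.vanishingIdeal_ideal, PrimeSpectrum.mem_vanishingIdeal]
  constructor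
  · intro h x hx hxC hxs
    obtain ⟨q, rfl⟩ : x ∈ Set.range hV.fromSpec := by
      rw [hV.range_fromSpec]
      exact hx
    have h1 := h q hxC
    have h2 : q ∈ hV.fromSpec ⁻¹ᵁ (Y.basicOpen s) := hxs
    rw [hV.fromSpec_preimage_basicOpen] at h2
    exact h2 h1
  · intro h q hq
    by_contra h1
    have h2 : q ∈ hV.fromSpec ⁻¹ᵁ (Y.basicOpen s) := by
      rw [hV.fromSpec_preimage_basicOpen]
      exact h1
    have h3 : hV.fromSpec q ∈ (V.1 : Set Y) := by
      rw [← hV.range_fromSpec]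
      exact Set.mem_range_self q
    exact h _ h3 hq h2

/-- The ideal of the curve on the open set `f ≠ 0`. -/
theorem PlaneCurve.mem_vanishingIdeal {C : PlaneCurve K} {f : HomRing K} {m : ℕ}
    (hf : f.IsHomogeneous m) (hm : 0 < m) (hC : ¬ C.poly ∣ f) {A : HomRing K} {k : ℕ}
    (hA : A.IsHomogeneous (m * k)) :
    (Proj.awayToSection (gr K) f).hom (awayFrac hf k hA) ∈
      (Scheme.IdealSheafData.vanishingIdeal C.points).ideal (affineBasicOpen hf hm) ↔
      C.poly ∣ A := by
  set s := (Proj.awayToSection (gr K) f).hom (awayFrac hf k hA) with hs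
  have key := mem_vanishingIdeal_iff C.points (affineBasicOpen hf hm) s
  refine key.trans ?_
  change (∀ x ∈ Proj.basicOpen (gr K) f, _) ↔ _
  constructor
  · intro h
    -- Vanishing at the generic point of the curve already gives divisibility by its equation.
    have h1 := h C.genericPoint (fun h => hC (mem_genericPoint.mp h))
      (PlaneCurve.mem_points.mpr (mem_genericPoint.mpr dvd_rfl))
    exact mem_genericPoint.mp (not_not.mp fun hn => h1 ((mem_basicOpen_section hf hA fun h => hC (mem_genericPoint.mp h)).mpr hn))
  · intro h x hx hxC hxs
    obtain ⟨q, rfl⟩ := h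
    exact (mem_basicOpen_section hf hA hx).mp hxs
      (Ideal.mul_mem_right _ _ (PlaneCurve.mem_points.mp hxC))

end Sections

/-! ### Affine charts of a plane curve -/

section Charts

variable {K : Type u} [Field K]

open MvPolynomial

/-- The affine part `g ≠ 0` of the curve `C` has coordinate ring `S`: the homomorphism `χ` of the
homogeneous coordinate ring to `S` vanishes, among forms, on the multiples of the equation of `C`,
and each element of `S` is a quotient `χ A / χ g ^ k`. -/
structure PlaneCurve.Chart (C : PlaneCurve K) (S : Type u) [CommRing S] [Algebra K S] where
  /-- The denominator. -/
  g : HomRing K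
  /-- Its degree. -/
  m : ℕ
  isHomogeneous : g.IsHomogeneous m
  pos : 0 < m
  /-- The evaluation of forms. -/
  χ : HomRing K →ₐ[K] S
  isUnit : IsUnit (χ g)
  eq_zero_iff : ∀ (A : HomRing K) (d : ℕ), A.IsHomogeneous d → (χ A = 0 ↔ C.poly ∣ A)
  surjective : ∀ s : S, ∃ (k : ℕ) (A : HomRing K), A.IsHomogeneous (m * k) ∧ χ A = s * χ g ^ k

namespace PlaneCurve.Chart

variable {C : PlaneCurve K} {S : Type u} [CommRing S] [Algebra K S]

/-- The evaluation of fractions. -/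
def eval (c : C.Chart S) : HomogeneousLocalization.Away (gr K) c.g →+* S :=
  (Localization.awayLift (c.χ : HomRing K →+* S) c.g c.isUnit).comp
    (algebraMap (HomogeneousLocalization.Away (gr K) c.g) (Localization.Away c.g))

theorem eval_awayFrac (c : C.Chart S) {A : HomRing K} {k : ℕ} (hA : A.IsHomogeneous (c.m * k)) :
    c.eval (awayFrac c.isHomogeneous k hA) * c.χ c.g ^ k = c.χ A := by
  have h1 : (algebraMap (HomogeneousLocalization.Away (gr K) c.g) (Localization.Away c.g)
      (awayFrac c.isHomogeneous k hA)) * algebraMap (HomRing K) (Localization.Away c.g) (c.g ^ k) =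
      algebraMap (HomRing K) (Localization.Away c.g) A := by
    rw [HomogeneousLocalization.algebraMap_apply, awayFrac, HomogeneousLocalization.Away.val_mk,
      ← Localization.mk_one_eq_algebraMap, Localization.mk_mul, ← Localization.mk_one_eq_algebraMap,
      Localization.mk_eq_mk_iff, Localization.r_iff_exists]
    refine ⟨1, ?_⟩
    simp [mul_comm]
  have h2 := congrArg (Localization.awayLift (c.χ : HomRing K →+* S) c.g c.isUnit) h1
  rw [map_mul] at h2
  have h3 : ∀ B : HomRing K, Localization.awayLift (c.χ : HomRing K →+* S) c.g c.isUnit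
      (algebraMap (HomRing K) (Localization.Away c.g) B) = c.χ B := fun B =>
    IsLocalization.Away.lift_eq c.g c.isUnit B
  rw [h3, h3, map_pow] at h2
  exact h2

theorem eval_surjective (c : C.Chart S) : Function.Surjective c.eval := by
  intro s
  obtain ⟨k, A, hA, h⟩ := c.surjective s
  refine ⟨awayFrac c.isHomogeneous k hA, ?_⟩
  have h1 := c.eval_awayFrac hA
  rw [h] at h1
  exact (c.isUnit.pow k).mul_right_cancel h1

theorem eval_eq_zero_iff (c : C.Chart S) {A : HomRing K} {k : ℕ} (hA : A.IsHomogeneous (c.m * k)) :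
    c.eval (awayFrac c.isHomogeneous k hA) = 0 ↔ C.poly ∣ A := by
  rw [← c.eq_zero_iff A _ hA, ← c.eval_awayFrac hA, (c.isUnit.pow k).mul_left_eq_zero]

theorem not_dvd (c : C.Chart S) [Nontrivial S] : ¬ C.poly ∣ c.g := fun h =>
  c.isUnit.ne_zero ((c.eq_zero_iff _ _ c.isHomogeneous).mpr h)

/-- The affine open set `g ≠ 0`. -/
abbrev affineOpen (c : C.Chart S) : (P2 K).affineOpens := affineBasicOpen c.isHomogeneous c.pos

/-- The open part `g ≠ 0` of the curve. -/
abbrev opens (c : C.Chart S) : C.scheme.Opens := C.ι ⁻¹ᵁ c.affineOpen.1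

instance : IsClosedImmersion C.ι :=
  inferInstanceAs (IsClosedImmersion (Scheme.IdealSheafData.vanishingIdeal C.points).subschemeι)

theorem isAffineOpen_opens (c : C.Chart S) : IsAffineOpen c.opens :=
  c.affineOpen.2.preimage C.ι

/-- The restriction of fractions to the curve. -/
def restrict (c : C.Chart S) :
    HomogeneousLocalization.Away (gr K) c.g →+* Γ(C.scheme, c.opens) :=
  (C.ι.app c.affineOpen.1).hom.comp (Proj.awayToSection (gr K) c.g).hom

theorem restrict_surjective (c : C.Chart S) : Function.Surjective c.restrict := by
  intro s
  obtain ⟨t, rfl⟩ := (Scheme.IdealSheafData.vanishingIdeal C.points).subschemeι_app_surjective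
    c.affineOpen s
  obtain ⟨q, rfl⟩ := awayToSection_surjective c.isHomogeneous c.pos t
  exact ⟨q, rfl⟩

/-- Both maps are onto from the same ring of fractions, and each kills exactly the fractions whose
numerator is divisible by the equation of C. This is what identifies the functions on the affine
part with S. -/
theorem ker_restrict (c : C.Chart S) [Nontrivial S] :
    RingHom.ker c.restrict = RingHom.ker c.eval := by
  ext q
  obtain ⟨k, A, hA, rfl⟩ := awayFrac_surjective c.isHomogeneous q
  rw [RingHom.mem_ker, RingHom.mem_ker, c.eval_eq_zero_iff hA,
    ← PlaneCurve.mem_vanishingIdeal c.isHomogeneous c.pos c.not_dvd hA,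
    ← Scheme.IdealSheafData.ker_subschemeι_app]
  exact Iff.rfl

/-- The functions on the affine part of the curve. -/
def sectionEquiv (c : C.Chart S) [Nontrivial S] : Γ(C.scheme, c.opens) ≃+* S :=
  (RingHom.quotientKerEquivOfSurjective c.restrict_surjective).symm.trans
    ((Ideal.quotEquivOfEq c.ker_restrict).trans
      (RingHom.quotientKerEquivOfSurjective c.eval_surjective))

theorem sectionEquiv_restrict (c : C.Chart S) [Nontrivial S]
    (q : HomogeneousLocalization.Away (gr K) c.g) :
    c.sectionEquiv (c.restrict q) = c.eval q := by
  have h : (RingHom.quotientKerEquivOfSurjective c.restrict_surjective).symm (c.restrict q) =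
      Ideal.Quotient.mk _ q := by
    rw [RingEquiv.symm_apply_eq]
    rfl
  rw [sectionEquiv, RingEquiv.trans_apply, h]
  rfl

/-- The constants in the coordinate ring of the open set `g ≠ 0`. -/
def const (c : C.Chart S) : K →+* HomogeneousLocalization.Away (gr K) c.g :=
  (HomogeneousLocalization.fromZeroRingHom (gr K) _).comp (algebraMap K (gr K 0))

theorem eval_const (c : C.Chart S) (r : K) : c.eval (c.const r) = algebraMap K S r := by
  have h : algebraMap (HomogeneousLocalization.Away (gr K) c.g) (Localization.Away c.g)
      (c.const r) = algebraMap (HomRing K) (Localization.Away c.g) (algebraMap K _ r) := by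
    rw [← Localization.mk_one_eq_algebraMap]
    rfl
  rw [eval, RingHom.comp_apply, h]
  refine (IsLocalization.Away.lift_eq c.g c.isUnit _).trans ?_
  exact c.χ.commutes r

/-- The affine part of the curve is the spectrum of `S`. -/
def isoSpec (c : C.Chart S) [Nontrivial S] : c.opens.toScheme ≅ Spec (CommRingCat.of S) :=
  c.isAffineOpen_opens.isoSpec ≪≫ Scheme.Spec.mapIso (c.sectionEquiv.symm.toCommRingCatIso).op

theorem fromSpec_awayι {f : HomRing K} {m : ℕ} (hf : f ∈ gr K m) (hm : 0 < m) :
    (Proj.isAffineOpen_basicOpen (gr K) f hf hm).fromSpec =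
      Spec.map (Proj.awayToSection (gr K) f) ≫ Proj.awayι (gr K) f hf hm := by
  rw [← IsAffineOpen.isoSpec_inv_ι, Iso.inv_comp_eq, IsAffineOpen.isoSpec_hom,
    ← Category.assoc]
  change _ = Proj.basicOpenToSpec (gr K) f ≫ _
  rw [← Proj.basicOpenIsoSpec_hom (gr K) f hf hm, ← Proj.basicOpenIsoSpec_inv_ι,
    Iso.hom_inv_id_assoc]

theorem fromSpec_str {f : HomRing K} {m : ℕ} (hf : f ∈ gr K m) (hm : 0 < m) :
    (Proj.isAffineOpen_basicOpen (gr K) f hf hm).fromSpec ≫ P2.str K =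
      Spec.map (CommRingCat.ofHom ((HomogeneousLocalization.fromZeroRingHom (gr K) _).comp
        (algebraMap K (gr K 0))) ≫ Proj.awayToSection (gr K) f) := by
  rw [fromSpec_awayι hf hm, P2.str, Category.assoc, Proj.awayι_toSpecZero_assoc, ← Spec.map_comp,
    ← Spec.map_comp]
  rfl

theorem isoSpec_hom_comp (c : C.Chart S) [Nontrivial S] :
    c.isoSpec.hom ≫ Spec.map (CommRingCat.ofHom (algebraMap K S)) =
      c.opens.ι ≫ C.ι ≫ P2.str K := by
  have h1 : c.isAffineOpen_opens.fromSpec ≫ C.ι =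
      Spec.map (C.ι.app c.affineOpen.1) ≫ c.affineOpen.2.fromSpec := by
    rw [← Scheme.Hom.appLE_eq_app]
    exact (IsAffineOpen.SpecMap_appLE_fromSpec _ c.affineOpen.2 c.isAffineOpen_opens _).symm
  have h2 := fromSpec_str ((mem_homogeneousSubmodule _ _).mpr c.isHomogeneous) c.pos
  have h3 : c.opens.ι ≫ C.ι ≫ P2.str K = c.isAffineOpen_opens.isoSpec.hom ≫
      Spec.map (C.ι.app c.affineOpen.1) ≫ Spec.map (CommRingCat.ofHom
        ((HomogeneousLocalization.fromZeroRingHom (gr K) _).comp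
        (algebraMap K (gr K 0))) ≫ Proj.awayToSection (gr K) c.g) := by
    rw [← c.isAffineOpen_opens.isoSpec_hom_fromSpec, Category.assoc, reassoc_of% h1]
    exact congrArg (fun q => c.isAffineOpen_opens.isoSpec.hom ≫
      Spec.map (C.ι.app c.affineOpen.1) ≫ q) h2
  refine Eq.trans ?_ h3.symm
  refine (Category.assoc _ _ _).trans ?_
  refine congrArg (c.isAffineOpen_opens.isoSpec.hom ≫ ·) ?_
  refine (Spec.map_comp _ _).symm.trans (Eq.trans ?_ (Spec.map_comp _ _))
  refine congrArg Spec.map ?_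
  ext r
  change c.sectionEquiv.symm (algebraMap K S r) = c.restrict (c.const r)
  rw [RingEquiv.symm_apply_eq, sectionEquiv_restrict, eval_const]

end PlaneCurve.Chart

/-- A plane curve one of whose affine parts is a line, and which has just one more point, is of
type I. -/
theorem PlaneCurve.Chart.isTypeI {C : PlaneCurve K} (c : C.Chart (MvPolynomial PUnit.{u + 1} K))
    (p : C.scheme) (hp : ∀ x : C.scheme, x ∈ c.opens ↔ x ≠ p) : C.IsTypeI := by
  refine ⟨p, c.opens, ?_, c.isoSpec ≪≫ (AffineSpace.SpecIso PUnit (CommRingCat.of K)).symm, ?_⟩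
  · ext x
    exact hp x
  · rw [Iso.trans_hom, Category.assoc, Iso.symm_hom, AffineSpace.SpecIso_inv_over,
      ← c.isoSpec_hom_comp]
    rfl

/-- A localization of a principal ideal domain is a principal ideal domain, and a local one is
regular. It gives smoothness at all points of the affine-line part of the curve. -/
theorem isRegularLocalRing_of_isLocalization {A B : Type*} [CommRing A] [IsDomain A]
    [IsPrincipalIdealRing A] [CommRing B] [Algebra A B] (P : Ideal A) [P.IsPrime]
    [IsLocalization.AtPrime B P] [IsLocalRing B] : IsRegularLocalRing B := by
  have h1 : IsDomain B := IsLocalization.isDomain_of_atPrime B P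
  have h2 : IsPrincipalIdealRing B := ⟨fun I => by
    obtain ⟨a, ha⟩ := (IsPrincipalIdealRing.principal (I.comap (algebraMap A B))).principal
    refine ⟨algebraMap A B a, ?_⟩
    rw [← IsLocalization.map_under P.primeCompl B I, Ideal.under, ha]
    change Ideal.map _ (Ideal.span {a}) = Ideal.span _
    rw [Ideal.map_span, Set.image_singleton]⟩
  infer_instance

theorem PlaneCurve.Chart.isRegularLocalRing_stalk {C : PlaneCurve K} {S : Type u} [CommRing S]
    [Algebra K S] [IsDomain S] [IsPrincipalIdealRing S] (c : C.Chart S) (x : C.scheme)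
    (hx : x ∈ c.opens) : IsRegularLocalRing (C.scheme.presheaf.stalk x) := by
  have := c.sectionEquiv.isDomain_iff.mpr ‹IsDomain S›
  have : IsPrincipalIdealRing Γ(C.scheme, c.opens) :=
    IsPrincipalIdealRing.of_surjective (c.sectionEquiv.symm : S →+* _) c.sectionEquiv.symm.surjective
  let := TopCat.Presheaf.algebra_section_stalk C.scheme.presheaf (⟨x, hx⟩ : c.opens)
  have := c.isAffineOpen_opens.isLocalization_stalk ⟨x, hx⟩
  exact isRegularLocalRing_of_isLocalization (B := C.scheme.presheaf.stalk (⟨x, hx⟩ : c.opens).1)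
    (c.isAffineOpen_opens.primeIdealOf ⟨x, hx⟩).asIdeal

end Charts

/-! ### The local rings of a plane curve -/

section CurveStalks

variable {K : Type u} [Field K]

open MvPolynomial

/-- The evaluation of homogeneous fractions at a homomorphism `χ` to a field which does not vanish
on the forms outside the ideal. -/
def fracEval {L : Type*} [Field L] (𝔭 : Ideal (HomRing K)) [𝔭.IsPrime] (χ : HomRing K →+* L)
    (hχ : ∀ (A : HomRing K) (d : ℕ), A.IsHomogeneous d → A ∉ 𝔭 → χ A ≠ 0) :
    HomogeneousLocalization.AtPrime (gr K) 𝔭 →+* L :=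
  have den_ne (q : HomogeneousLocalization.AtPrime (gr K) 𝔭) : χ q.den ≠ 0 :=
    hχ _ _ ((mem_homogeneousSubmodule _ _).mp q.den_mem_deg) q.den_mem
  have key (q : HomogeneousLocalization.AtPrime (gr K) 𝔭) (a : HomRing K) (b : 𝔭.primeCompl)
      (hb : χ b ≠ 0) (h : q.val = Localization.mk a b) :
      χ q.num / χ q.den = χ a / χ b := by
    rw [q.eq_num_div_den, Localization.mk_eq_mk_iff, Localization.r_iff_exists] at h
    obtain ⟨c, hc⟩ := h
    have hc0 : (c : HomRing K) ≠ 0 := fun h0 => c.2 (h0 ▸ 𝔭.zero_mem)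
    have h2 := congrArg χ (mul_left_cancel₀ hc0 hc)
    rw [div_eq_div_iff (den_ne q) hb]
    simp only [map_mul] at h2
    linear_combination h2
  { toFun := fun q => χ q.num / χ q.den
    map_one' := by
      rw [key 1 1 1 (by simp) (by simp [Localization.mk_one])]
      simp
    map_zero' := by
      rw [key 0 0 1 (by simp) (by simp [Localization.mk_zero])]
      simp
    map_mul' := fun q r => by
      rw [key (q * r) (q.num * r.num) (⟨q.den, q.den_mem⟩ * ⟨r.den, r.den_mem⟩)
        (by simpa using ⟨den_ne q, den_ne r⟩)
        (by rw [HomogeneousLocalization.val_mul, q.eq_num_div_den, r.eq_num_div_den,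
              Localization.mk_mul])]
      simp [mul_div_mul_comm]
    map_add' := fun q r => by
      rw [key (q + r) (q.den * r.num + r.den * q.num) (⟨q.den, q.den_mem⟩ * ⟨r.den, r.den_mem⟩)
        (by simpa using ⟨den_ne q, den_ne r⟩)
        (by rw [HomogeneousLocalization.val_add, q.eq_num_div_den, r.eq_num_div_den,
              Localization.add_mk])]
      have h1 := den_ne q
      have h2 := den_ne r
      simp only [map_add, map_mul, Submonoid.coe_mul]
      field_simp
      ring }

theorem fracEval_mk {L : Type*} [Field L] (𝔭 : Ideal (HomRing K)) [𝔭.IsPrime] (χ : HomRing K →+* L)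
    (hχ : ∀ (A : HomRing K) (d : ℕ), A.IsHomogeneous d → A ∉ 𝔭 → χ A ≠ 0)
    (q : HomogeneousLocalization.AtPrime (gr K) 𝔭) {A B : HomRing K} {d : ℕ}
    (hB : B.IsHomogeneous d) (hB𝔭 : B ∉ 𝔭)
    (h : q.val = Localization.mk A (⟨B, hB𝔭⟩ : 𝔭.primeCompl)) :
    fracEval 𝔭 χ hχ q = χ A / χ B := by
  change χ q.num / χ q.den = _
  rw [q.eq_num_div_den, Localization.mk_eq_mk_iff, Localization.r_iff_exists] at h
  obtain ⟨c, hc⟩ := h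
  have hc0 : (c : HomRing K) ≠ 0 := fun h0 => c.2 (h0 ▸ 𝔭.zero_mem)
  have h2 := congrArg χ (mul_left_cancel₀ hc0 hc)
  rw [div_eq_div_iff (hχ _ _ ((mem_homogeneousSubmodule _ _).mp q.den_mem_deg) q.den_mem)
    (hχ _ _ hB hB𝔭)]
  simp only [map_mul] at h2
  linear_combination h2

/-- The evaluation of germs at a homomorphism `χ`. -/
def stalkEval {L : Type*} [Field L] (y : P2 K) (χ : HomRing K →+* L)
    (hχ : ∀ (A : HomRing K) (d : ℕ), A.IsHomogeneous d → A ∉ pIdeal y → χ A ≠ 0) :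
    (P2 K).presheaf.stalk y →+* L :=
  (fracEval (pIdeal y) χ hχ).comp (Proj.stalkIso (gr K) y).hom.hom

theorem stalkEval_germ_away {L : Type*} [Field L] (y : P2 K) (χ : HomRing K →+* L)
    (hχ : ∀ (A : HomRing K) (d : ℕ), A.IsHomogeneous d → A ∉ pIdeal y → χ A ≠ 0)
    {f : HomRing K} {m : ℕ} (hf : f.IsHomogeneous m) {A : HomRing K}
    {k : ℕ} (hA : A.IsHomogeneous (m * k)) (hy : y ∈ Proj.basicOpen (gr K) f) :
    stalkEval y χ hχ ((P2 K).presheaf.germ _ y hy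
      ((Proj.awayToSection (gr K) f).hom (awayFrac hf k hA))) = χ A / χ f ^ k := by
  have h1 : f ^ k ∉ pIdeal y := fun h => hy (y.isPrime.mem_of_pow_mem _ h)
  rw [stalkEval, RingHom.comp_apply, ← map_pow]
  have h2 := stalkIso_germ_away f (awayFrac hf k hA) y hy
  refine (congrArg (fracEval (pIdeal y) χ hχ) h2).trans ?_
  refine fracEval_mk (pIdeal y) χ hχ _ (hf.pow k) h1 ?_
  simp only [awayFrac, HomogeneousLocalization.Away.mk]
  rfl

namespace PlaneCurve

variable (C : PlaneCurve K)

/-- The restriction to the curve of the fractions `A / f ^ k`. -/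
def restrict (f : HomRing K) : HomogeneousLocalization.Away (gr K) f →+*
      Γ(C.scheme, C.ι ⁻¹ᵁ Proj.basicOpen (gr K) f) :=
  (C.ι.app (Proj.basicOpen (gr K) f)).hom.comp (Proj.awayToSection (gr K) f).hom

theorem restrict_surjective {f : HomRing K} {m : ℕ} (hf : f.IsHomogeneous m) (hm : 0 < m) :
    Function.Surjective (C.restrict f) := by
  intro s
  obtain ⟨t, rfl⟩ := (Scheme.IdealSheafData.vanishingIdeal C.points).subschemeι_app_surjective
    (affineBasicOpen hf hm) s
  obtain ⟨q, rfl⟩ := awayToSection_surjective hf hm t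
  exact ⟨q, rfl⟩

theorem restrict_eq_zero_iff {f : HomRing K} {m : ℕ} (hf : f.IsHomogeneous m) (hm : 0 < m)
    (hC : ¬ C.poly ∣ f) {A : HomRing K} {k : ℕ} (hA : A.IsHomogeneous (m * k)) :
    C.restrict f (awayFrac hf k hA) = 0 ↔ C.poly ∣ A := by
  rw [← PlaneCurve.mem_vanishingIdeal hf hm hC hA, ← Scheme.IdealSheafData.ker_subschemeι_app]
  exact Iff.rfl

theorem isDomain_section {f : HomRing K} {m : ℕ} (hf : f.IsHomogeneous m) (hm : 0 < m)
    (hC : ¬ C.poly ∣ f) : IsDomain Γ(C.scheme, C.ι ⁻¹ᵁ Proj.basicOpen (gr K) f) := by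
  have h1 : Nontrivial Γ(C.scheme, C.ι ⁻¹ᵁ Proj.basicOpen (gr K) f) := by
    refine ⟨1, 0, fun h => ?_⟩
    have hA : (1 : HomRing K).IsHomogeneous (m * 0) := isHomogeneous_one _ _
    have h2 : awayFrac hf 0 hA = 1 := by
      apply HomogeneousLocalization.val_injective
      rw [awayFrac, HomogeneousLocalization.Away.val_mk, HomogeneousLocalization.val_one,
        ← Localization.mk_one]
      congr 1
    rw [← map_one (C.restrict f), ← h2, C.restrict_eq_zero_iff hf hm hC] at h
    exact C.irreducible.not_isUnit (isUnit_of_dvd_one h)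
  have h2 : NoZeroDivisors Γ(C.scheme, C.ι ⁻¹ᵁ Proj.basicOpen (gr K) f) := by
    refine ⟨fun {a b} hab => ?_⟩
    obtain ⟨qa, rfl⟩ := C.restrict_surjective hf hm a
    obtain ⟨qb, rfl⟩ := C.restrict_surjective hf hm b
    obtain ⟨k, A, hA, rfl⟩ := awayFrac_surjective hf qa
    obtain ⟨j, B, hB, rfl⟩ := awayFrac_surjective hf qb
    have hAB : (A * B).IsHomogeneous (m * (k + j)) := by
      rw [mul_add]
      exact hA.mul hB
    have h3 : awayFrac hf k hA * awayFrac hf j hB = awayFrac hf (k + j) hAB := by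
      apply HomogeneousLocalization.val_injective
      rw [HomogeneousLocalization.val_mul, awayFrac, awayFrac, awayFrac,
        HomogeneousLocalization.Away.val_mk, HomogeneousLocalization.Away.val_mk,
        HomogeneousLocalization.Away.val_mk, Localization.mk_mul]
      congr 1
      exact Subtype.ext (pow_add f k j).symm
    rw [← map_mul, h3, C.restrict_eq_zero_iff hf hm hC] at hab
    rw [C.restrict_eq_zero_iff hf hm hC, C.restrict_eq_zero_iff hf hm hC]
    exact C.prime.dvd_or_dvd hab
  exact NoZeroDivisors.to_isDomain _

/-- The coordinate ring of the affine part is a domain, so it embeds in its localizations; vanishing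
of a germ can be tested on the affine part. -/
theorem germ_injective {f : HomRing K} {m : ℕ} (hf : f.IsHomogeneous m) (hm : 0 < m)
    (hC : ¬ C.poly ∣ f) (x : C.scheme) (hx : x ∈ C.ι ⁻¹ᵁ Proj.basicOpen (gr K) f) :
    Function.Injective (C.scheme.presheaf.germ _ x hx) := by
  have := C.isDomain_section hf hm hC
  have hW : IsAffineOpen (C.ι ⁻¹ᵁ Proj.basicOpen (gr K) f) := (affineBasicOpen hf hm).2.preimage C.ι
  let := TopCat.Presheaf.algebra_section_stalk C.scheme.presheaf
    (⟨x, hx⟩ : (C.ι ⁻¹ᵁ Proj.basicOpen (gr K) f : C.scheme.Opens))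
  have := hW.isLocalization_stalk ⟨x, hx⟩
  exact IsLocalization.injective (C.scheme.presheaf.stalk x)
    (hW.primeIdealOf ⟨x, hx⟩).asIdeal.primeCompl_le_nonZeroDivisors

theorem ι_mem_points (x : C.scheme) : C.ι x ∈ C.points := by
  have h : C.ι x ∈ Set.range C.ι := ⟨x, rfl⟩
  have h2 : Set.range C.ι = (C.points : Set (P2 K)) :=
    (Scheme.IdealSheafData.vanishingIdeal C.points).range_subschemeι.trans
      (Scheme.IdealSheafData.coe_support_vanishingIdeal C.points)
  rw [h2] at h
  exact h

theorem stalkMap_germ_eq_zero_iff (x : C.scheme) {f : HomRing K} {m : ℕ} (hf : f.IsHomogeneous m)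
    (hm : 0 < m) {A : HomRing K} {k : ℕ} (hA : A.IsHomogeneous (m * k))
    (hx : C.ι x ∈ Proj.basicOpen (gr K) f) :
    C.ι.stalkMap x ((P2 K).presheaf.germ _ (C.ι x) hx
      ((Proj.awayToSection (gr K) f).hom (awayFrac hf k hA))) = 0 ↔ C.poly ∣ A := by
  have hC : ¬ C.poly ∣ f := fun h => hx (by
    obtain ⟨q, rfl⟩ := h
    exact Ideal.mul_mem_right _ _ (PlaneCurve.mem_points.mp (C.ι_mem_points x)))
  rw [← C.restrict_eq_zero_iff hf hm hC hA]
  have h1 : C.ι.stalkMap x ((P2 K).presheaf.germ _ (C.ι x) hx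
      ((Proj.awayToSection (gr K) f).hom (awayFrac hf k hA))) =
      C.scheme.presheaf.germ _ x hx (C.restrict f (awayFrac hf k hA)) :=
    Scheme.Hom.germ_stalkMap_apply _ _ _ _ _
  rw [h1]
  constructor
  · intro h
    exact C.germ_injective hf hm hC x hx (h.trans (map_zero _).symm)
  · intro h
    rw [h, map_zero]

theorem stalkMap_surjective (x : C.scheme) : Function.Surjective (C.ι.stalkMap x) :=
  C.ι.stalkMap_surjective x

section Eval

variable {L : Type*} [Field L] (χ : HomRing K →+* L)
  (hχ : ∀ (A : HomRing K) (d : ℕ), A.IsHomogeneous d → (χ A = 0 ↔ C.poly ∣ A)) (x : C.scheme)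

include hχ in
theorem eval_ne_zero (A : HomRing K) (d : ℕ) (hA : A.IsHomogeneous d)
    (h : A ∉ pIdeal (C.ι x)) : χ A ≠ 0 := fun h0 => h (by
  obtain ⟨q, rfl⟩ := (hχ A d hA).mp h0
  exact Ideal.mul_mem_right _ _ (PlaneCurve.mem_points.mp (C.ι_mem_points x)))

/-- Both kernels consist of the germs A / f with A divisible by the equation. So the local ring of
the curve embeds in L, where degrees can be computed. -/
theorem ker_stalkMap : RingHom.ker (C.ι.stalkMap x).hom =
    RingHom.ker (stalkEval (C.ι x) χ (C.eval_ne_zero χ hχ x)) := by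
  ext s
  obtain ⟨m, f, A, hf, hA, hx, hm, rfl⟩ := exists_germ_eq _ s
  rw [RingHom.mem_ker, RingHom.mem_ker]
  refine (C.stalkMap_germ_eq_zero_iff x hf hm hA hx).trans ?_
  have h := C.eval_ne_zero χ hχ x f m hf hx
  have h2 := stalkEval_germ_away (C.ι x) χ (C.eval_ne_zero χ hχ x) hf hA hx
  rw [← hχ A _ hA]
  refine Iff.trans ?_ (Eq.congr_left h2.symm)
  simp [h]

/-- The local ring of the curve as a quotient of the local ring of the plane. -/
def stalkEquiv : C.scheme.presheaf.stalk x ≃+* (P2 K).presheaf.stalk (C.ι x) ⧸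
    RingHom.ker (PlaneBirational.stalkEval (C.ι x) χ (C.eval_ne_zero χ hχ x)) :=
  (RingHom.quotientKerEquivOfSurjective (f := (C.ι.stalkMap x).hom)
    (C.stalkMap_surjective x)).symm.trans (Ideal.quotEquivOfEq (C.ker_stalkMap χ hχ x))

/-- The evaluation at the generic point of the curve of the germs of functions on the curve. -/
def stalkEval : C.scheme.presheaf.stalk x →+* L :=
  (RingHom.kerLift (PlaneBirational.stalkEval (C.ι x) χ (C.eval_ne_zero χ hχ x))).comp
    (C.stalkEquiv χ hχ x : C.scheme.presheaf.stalk x →+* _)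

theorem stalkEval_injective : Function.Injective (C.stalkEval χ hχ x) := fun _ _ h =>
  (C.stalkEquiv χ hχ x).injective (RingHom.kerLift_injective _ h)

theorem stalkEval_stalkMap (s : (P2 K).presheaf.stalk (C.ι x)) :
    C.stalkEval χ hχ x (C.ι.stalkMap x s) =
      PlaneBirational.stalkEval (C.ι x) χ (C.eval_ne_zero χ hχ x) s := by
  have h : (RingHom.quotientKerEquivOfSurjective (f := (C.ι.stalkMap x).hom)
        (C.stalkMap_surjective x)).symm (C.ι.stalkMap x s) = Ideal.Quotient.mk _ s := by
    rw [RingEquiv.symm_apply_eq]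
    rfl
  have h2 : C.stalkEquiv χ hχ x (C.ι.stalkMap x s) = Ideal.Quotient.mk _ s := by
    rw [stalkEquiv, RingEquiv.trans_apply, h]
    rfl
  rw [stalkEval, RingHom.comp_apply]
  exact (congrArg (RingHom.kerLift _) h2).trans (RingHom.kerLift_mk _ _)

/-- The image of the local ring of the curve. -/
theorem mem_range_stalkEval (r : L) : r ∈ (C.stalkEval χ hχ x).range ↔
    ∃ (d : ℕ) (A B : HomRing K), A.IsHomogeneous d ∧ B.IsHomogeneous d ∧ B ∉ pIdeal (C.ι x) ∧
      r = χ A / χ B := by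
  constructor
  · rintro ⟨t, rfl⟩
    obtain ⟨s, rfl⟩ := C.stalkMap_surjective x t
    obtain ⟨m, f, A, hf, hA, hx, hm, rfl⟩ := exists_germ_eq _ s
    refine ⟨m, A, f, by simpa using hA, hf, hx, ?_⟩
    refine (C.stalkEval_stalkMap χ hχ x _).trans ?_
    refine (stalkEval_germ_away (C.ι x) χ (C.eval_ne_zero χ hχ x) hf hA hx).trans ?_
    rw [pow_one]
  · rintro ⟨d, A, B, hA, hB, hBx, rfl⟩
    obtain ⟨i, hi⟩ := exists_X_notMem (C.ι x)
    have hBX : B * X i ∉ pIdeal (C.ι x) := fun h =>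
      ((C.ι x).isPrime.mem_or_mem h).elim hBx hi
    have hA' : (A * X i).IsHomogeneous ((d + 1) * 1) := by
      simpa using hA.mul (isHomogeneous_X K i)
    refine ⟨C.ι.stalkMap x ((P2 K).presheaf.germ _ (C.ι x) hBX ((Proj.awayToSection (gr K) _).hom
      (awayFrac (hB.mul (isHomogeneous_X K i)) 1 hA'))), ?_⟩
    refine (C.stalkEval_stalkMap χ hχ x _).trans ?_
    refine (stalkEval_germ_away (C.ι x) χ (C.eval_ne_zero χ hχ x) _ hA' hBX).trans ?_
    rw [pow_one, map_mul, map_mul, mul_div_mul_right]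
    exact C.eval_ne_zero χ hχ x _ 1 (isHomogeneous_X K i) hi

end Eval

end PlaneCurve

end CurveStalks

/-! ### Cusps -/

section Cusps

variable {K : Type u} [Field K]

open Polynomial in
/-- A local ring of the rational function field which contains, in its maximal ideal, the inverse of
a polynomial is unibranch: it is centred at infinity. -/
theorem isLocalRing_integralClosure {B : Type*} [CommRing B] [IsDomain B] [IsLocalRing B]
    [Algebra B (RatFunc K)] [IsFractionRing B (RatFunc K)]
    (hK : ∀ c : K, ∃ b : B, algebraMap B (RatFunc K) b = RatFunc.C c) (q : K[X]) {b : B}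
    (hb : b ∈ IsLocalRing.maximalIdeal B)
    (hq : algebraMap B (RatFunc K) b * algebraMap K[X] (RatFunc K) q = 1) :
    IsLocalRing (integralClosure B (FractionRing B)) := by
  let T := integralClosure B (RatFunc K)
  have key : ∀ (M : Ideal T) [M.IsMaximal] (r : T),
      r ∈ M ↔ ((r : RatFunc K) = 0 ∨ (r : RatFunc K).intDegree < 0) := by
    intro M hM r
    let P : Ideal T.toSubring := M
    have hP : P.IsPrime := hM.isPrime
    -- Each maximal ideal of the integral closure is cut out by a dominating valuation ring W. The
    -- aim is to show that W is always the valuation at infinity, so that the maximal ideal is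
    -- unique.
    obtain ⟨W, hW⟩ := (LocalSubring.ofPrime T.toSubring P).exists_le_valuationSubring
    have hTW : ∀ s : T, (s : RatFunc K) ∈ W := fun s => hW.1 (LocalSubring.le_ofPrime _ _ s.2)
    have hMW : ∀ s : T, s ∈ M ↔ W.valuation (s : RatFunc K) < 1 := by
      intro s
      have h1 : (⟨(s : RatFunc K), hTW s⟩ : W) ∈ IsLocalRing.maximalIdeal W ↔ _ :=
        W.valuation_lt_one_iff ⟨(s : RatFunc K), hTW s⟩
      refine Iff.trans ?_ h1
      have h2 := (mem_maximalIdeal_iff (R := W.toLocalSubring) ⟨(s : RatFunc K), hTW s⟩)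
      refine Iff.trans ?_ h2.symm
      have h3 : MM (LocalSubring.ofPrime T.toSubring P) (s : RatFunc K) ↔ s ∈ M := by
        have h4 := IsLocalization.AtPrime.to_map_mem_maximal_iff
          (LocalSubring.ofPrime T.toSubring P).toSubring P (⟨s, s.2⟩ : T.toSubring)
        rw [mem_maximalIdeal_iff] at h4
        exact h4
      rw [← h3]
      constructor
      · intro h
        exact h.of_le hW
      · intro h
        exact h.of_ge hW (LocalSubring.le_ofPrime _ _ s.2)
    have hBT : ∀ a : B, algebraMap B (RatFunc K) a ∈ W := fun a => hTW (algebraMap B T a)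
    have hBM : W.valuation (algebraMap B (RatFunc K) b) < 1 := by
      refine (hMW (algebraMap B T b)).mp ?_
      have h1 : (M.comap (algebraMap B T)).IsMaximal :=
        Ideal.isMaximal_comap_of_isIntegral_of_isMaximal M
      rw [← IsLocalRing.eq_maximalIdeal h1] at hb
      exact hb
    have htriv : W.valuation.IsTrivialOn K := by
      refine Valuation.IsTrivialOn.of_le_one _ fun c => ?_
      obtain ⟨a, ha⟩ := hK c
      rw [W.valuation_le_one_iff]
      have := hBT a
      rwa [ha] at this
    -- The element b has positive order at W and b q = 1, so q has a pole there. A polynomial over K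
    -- has a pole only if X has one.
    have hX : 1 < W.valuation RatFunc.X := by
      by_contra h
      have h1 := Polynomial.valuation_le_one_of_valuation_X_le_one K (not_lt.mp h) q
      have h2 := congrArg W.valuation hq
      rw [map_mul, map_one] at h2
      have h3 : W.valuation (algebraMap B (RatFunc K) b) *
        W.valuation (algebraMap K[X] (RatFunc K) q) < 1 := mul_lt_one_of_lt_of_le hBM h1
      exact h3.ne h2
    rw [hMW]
    by_cases h0 : (r : RatFunc K) = 0
    · simp [h0]
    · rw [RatFunc.valuation_eq_valuation_X_zpow_intDegree_of_one_lt_valuation_X hX h0]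
      simp only [h0, false_or]
      exact zpow_lt_one_iff_right₀ hX
  have hT : IsLocalRing T := by
    obtain ⟨M, hM⟩ := Ideal.exists_maximal T
    refine IsLocalRing.of_unique_max_ideal ⟨M, hM, fun N hN => ?_⟩
    ext r
    exact (key N r).trans (key M r).symm
  exact ((FractionRing.algEquiv B (RatFunc K)).mapIntegralClosure.symm : T ≃+* _).isLocalRing

/-- A one-dimensional local ring of the rational function field, all of whose functions have order
zero or at least two at infinity, is not regular. -/
theorem not_isRegularLocalRing {B : Type*} [CommRing B] [IsDomain B] [IsLocalRing B]
    [Algebra B (RatFunc K)] [IsFractionRing B (RatFunc K)]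
    (h1 : ∀ b : B, (algebraMap B (RatFunc K) b).intDegree ≤ 0)
    (h2 : ∀ b ∈ IsLocalRing.maximalIdeal B, b = 0 ∨ (algebraMap B (RatFunc K) b).intDegree ≤ -2)
    (h3 : ∀ P : Ideal B, P ≠ ⊥ → P.IsPrime → P = IsLocalRing.maximalIdeal B) :
    ¬ IsRegularLocalRing B := by
  intro hreg
  have hdim : Ring.KrullDimLE 1 B := by
    rw [Ring.krullDimLE_one_iff_of_noZeroDivisors]
    intro I h hI
    rw [h3 I h hI]
    infer_instance
  have hle : ringKrullDim B ≤ 1 := Ring.krullDimLE_iff.mp hdim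
  rw [← (IsRegularLocalRing.iff_finrank_cotangentSpace B).mp hreg] at hle
  -- A regular local ring of dimension at most one is a valuation ring, so it contains X or X⁻¹. The
  -- first has a pole at infinity; the second has order one there, and if it is a unit then X lies
  -- in B as well.
  have hval : ValuationRing B :=
    ((tfae_of_isNoetherianRing_of_isLocalRing_of_isDomain B).out 5 1).mp (by exact_mod_cast hle)
  have hX : (RatFunc.X : RatFunc K).intDegree = 1 := RatFunc.intDegree_X
  rcases ValuationRing.isInteger_or_isInteger B (RatFunc.X : RatFunc K) with ⟨b, hb⟩ | ⟨b, hb⟩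
  · have := h1 b
    rw [hb, hX] at this
    omega
  · by_cases hu : IsUnit b
    · obtain ⟨c, hc⟩ := hu.exists_right_inv
      have h4 := congrArg (algebraMap B (RatFunc K)) hc
      rw [map_mul, hb, map_one, inv_mul_eq_iff_eq_mul₀ RatFunc.X_ne_zero, mul_one] at h4
      have := h1 c
      rw [h4, hX] at this
      omega
    · rcases h2 b hu with h | h
      · rw [h, map_zero] at hb
        exact inv_ne_zero RatFunc.X_ne_zero hb.symm
      · rw [hb, RatFunc.intDegree_inv, hX] at h
        omega

namespace PlaneCurve.Chart

variable {C : PlaneCurve K} (c : C.Chart (Polynomial K))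

/-- The evaluation of forms at the generic point of a rational curve. -/
def ratEval : HomRing K →ₐ[K] RatFunc K :=
  (IsScalarTower.toAlgHom K (Polynomial K) (RatFunc K)).comp c.χ

theorem ratEval_eq_zero_iff (A : HomRing K) (d : ℕ) (hA : A.IsHomogeneous d) :
    (c.ratEval : HomRing K →+* RatFunc K) A = 0 ↔ C.poly ∣ A := by
  rw [← c.eq_zero_iff A d hA]
  exact FaithfulSMul.algebraMap_eq_zero_iff (Polynomial K) (RatFunc K)

open MvPolynomial in
/-- A plane curve one of whose affine parts is a line, and which has at its last point no functions
of order one, is unicuspidal. -/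
theorem isUnicuspidal (p : C.scheme) (hp : ∀ x : C.scheme, x ∈ c.opens ↔ x ≠ p)
    {ℓ : HomRing K} (hℓ : ℓ.IsHomogeneous 1) (hℓp : ℓ ∉ pIdeal (C.ι p))
    (hgen : ∀ (d : ℕ) (A : HomRing K), A.IsHomogeneous d →
      ∃ α : K, A - MvPolynomial.C α * ℓ ^ d ∈ pIdeal (C.ι p))
    (hdeg : ∀ (d : ℕ) (A : HomRing K), A.IsHomogeneous d → A ∈ pIdeal (C.ι p) →
      c.χ A = 0 ∨ (c.χ A).natDegree + 2 ≤ d * (c.χ ℓ).natDegree) : C.IsUnicuspidal := by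
  let χ : HomRing K →+* RatFunc K := c.ratEval
  let B := C.scheme.presheaf.stalk p
  let ev : B →+* RatFunc K := C.stalkEval χ c.ratEval_eq_zero_iff p
  have hev : Function.Injective ev := C.stalkEval_injective χ c.ratEval_eq_zero_iff p
  have hmem : ∀ r : RatFunc K, r ∈ ev.range ↔ _ :=
    C.mem_range_stalkEval χ c.ratEval_eq_zero_iff p
  have hne : ∀ (A : HomRing K) (d : ℕ), A.IsHomogeneous d → A ∉ pIdeal (C.ι p) → χ A ≠ 0 :=
    C.eval_ne_zero χ c.ratEval_eq_zero_iff p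
  have hχ : ∀ A, χ A = algebraMap (Polynomial K) (RatFunc K) (c.χ A) := fun A => rfl
  let := ev.toAlgebra
  have hB : IsDomain B := hev.isDomain ev
  have hfs : FaithfulSMul B (RatFunc K) := (faithfulSMul_iff_algebraMap_injective _ _).mpr hev
  have hχ0 : c.χ ℓ ≠ 0 := fun h => hne ℓ 1 hℓ hℓp (by rw [hχ, h, map_zero])
  -- A form nonzero at p is α ℓ^d, α ≠ 0, plus a form vanishing at p, and the latter has strictly
  -- smaller degree in the parameter.
  have hdeg' : ∀ (d : ℕ) (A : HomRing K), A.IsHomogeneous d → A ∉ pIdeal (C.ι p) →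
      (c.χ A).natDegree = d * (c.χ ℓ).natDegree := by
    intro d A hA hAp
    obtain ⟨α, hα⟩ := hgen d A hA
    have hα0 : α ≠ 0 := by
      rintro rfl
      simp only [map_zero, zero_mul, sub_zero] at hα
      exact hAp hα
    have h1 : (MvPolynomial.C α * ℓ ^ d : HomRing K).IsHomogeneous d := by
      simpa using (isHomogeneous_C (Fin 3) α).mul (hℓ.pow d)
    have h2 := hdeg d _ (hA.sub h1) hα
    have h3 : c.χ A = c.χ (A - MvPolynomial.C α * ℓ ^ d) + Polynomial.C α * (c.χ ℓ) ^ d := by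
      rw [map_sub, map_mul, map_pow, MvPolynomial.algHom_C]
      exact (sub_add_cancel _ _).symm
    have h4 : (Polynomial.C α * (c.χ ℓ) ^ d).degree =
        ((d * (c.χ ℓ).natDegree : ℕ) : WithBot ℕ) := by
      rw [Polynomial.degree_C_mul hα0, Polynomial.degree_pow, Polynomial.degree_eq_natDegree hχ0]
      simp
    apply Polynomial.natDegree_eq_of_degree_eq_some
    rcases h2 with h2 | h2
    · rw [h3, h2, zero_add, h4]
    · rw [h3, Polynomial.degree_add_eq_right_of_degree_lt, h4]
      rw [h4]
      refine Polynomial.degree_le_natDegree.trans_lt ?_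
      rw [Nat.cast_lt]
      omega
  have hrep : ∀ b : B, ∃ (d : ℕ) (A H : HomRing K), A.IsHomogeneous d ∧ H.IsHomogeneous d ∧
      H ∉ pIdeal (C.ι p) ∧ algebraMap B (RatFunc K) b = χ A / χ H := fun b => (hmem _).mp ⟨b, rfl⟩
  have hex : ∀ (d : ℕ) (A H : HomRing K), A.IsHomogeneous d → H.IsHomogeneous d →
      H ∉ pIdeal (C.ι p) → ∃ b : B, algebraMap B (RatFunc K) b = χ A / χ H :=
    fun d A H hA hH hHp => (hmem _).mpr ⟨d, A, H, hA, hH, hHp, rfl⟩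
  have hunit : ∀ (b : B) (d : ℕ) (A H : HomRing K), A.IsHomogeneous d → H.IsHomogeneous d →
      H ∉ pIdeal (C.ι p) → A ∉ pIdeal (C.ι p) → algebraMap B (RatFunc K) b = χ A / χ H →
      IsUnit b := by
    intro b d A H hA hH hHp hAp hb
    obtain ⟨b', hb'⟩ := hex d H A hH hA hAp
    refine IsUnit.of_mul_eq_one b' (hev ?_)
    rw [map_mul, map_one]
    refine (congrArg₂ (· * ·) hb hb').trans ?_
    have h1 := hne A d hA hAp
    have h2 := hne H d hH hHp
    field_simp
  have hintDeg : ∀ (d : ℕ) (A H : HomRing K), A.IsHomogeneous d → H.IsHomogeneous d →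
      H ∉ pIdeal (C.ι p) → χ A ≠ 0 →
      (χ A / χ H).intDegree = (c.χ A).natDegree - (d * (c.χ ℓ).natDegree : ℕ) := by
    intro d A H hA hH hHp hA0
    rw [RatFunc.intDegree_div hA0 (hne H d hH hHp), hχ, hχ, RatFunc.intDegree_polynomial,
      RatFunc.intDegree_polynomial, hdeg' d H hH hHp]
  -- Both a and b are quotients of forms by powers of g. Brought to a common power of g, and divided
  -- by the same power of ℓ, they become fractions regular at p with quotient a / b.
  have hfrac : IsFractionRing B (RatFunc K) := by
    refine IsFractionRing.of_field _ _ fun z => ?_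
    induction z using RatFunc.induction_on with
    | f a b hb =>
      obtain ⟨k, A, hA, hAe⟩ := c.surjective a
      obtain ⟨j, H, hH, hHe⟩ := c.surjective b
      have hg := c.isHomogeneous
      have hA' : (A * c.g ^ j).IsHomogeneous (c.m * (k + j)) := by
        rw [mul_add]
        exact hA.mul (hg.pow j)
      have hH' : (H * c.g ^ k).IsHomogeneous (c.m * (k + j)) := by
        rw [add_comm k, mul_add]
        exact hH.mul (hg.pow k)
      have hℓ' : (ℓ ^ (c.m * (k + j))).IsHomogeneous (c.m * (k + j)) := by
        simpa using hℓ.pow (c.m * (k + j))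
      have hℓp' : ℓ ^ (c.m * (k + j)) ∉ pIdeal (C.ι p) := fun h =>
        hℓp ((C.ι p).isPrime.mem_of_pow_mem _ h)
      obtain ⟨x, hx⟩ := hex _ _ _ hA' hℓ' hℓp'
      obtain ⟨y, hy⟩ := hex _ _ _ hH' hℓ' hℓp'
      refine ⟨x, y, ?_⟩
      have h0 := hne _ _ hℓ' hℓp'
      have e1 : χ (A * c.g ^ j) = algebraMap (Polynomial K) (RatFunc K) a *
          algebraMap (Polynomial K) (RatFunc K) (c.χ c.g) ^ (k + j) := by
        rw [hχ, map_mul, hAe, map_pow, mul_assoc, ← pow_add, map_mul, map_pow]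
      have e2 : χ (H * c.g ^ k) = algebraMap (Polynomial K) (RatFunc K) b *
          algebraMap (Polynomial K) (RatFunc K) (c.χ c.g) ^ (k + j) := by
        rw [hχ, map_mul, hHe, map_pow, mul_assoc, ← pow_add, map_mul, map_pow, add_comm j]
      rw [hx, hy, div_div_div_cancel_right₀ h0, e1, e2, mul_div_mul_right]
      refine pow_ne_zero _ ?_
      rw [ne_eq, FaithfulSMul.algebraMap_eq_zero_iff]
      exact c.isUnit.ne_zero
  have hgp : c.g ∈ pIdeal (C.ι p) := by
    by_contra h
    exact ((hp p).mp h) rfl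
  have hbm : ∀ (b : B) (d : ℕ) (A H : HomRing K), A.IsHomogeneous d → H.IsHomogeneous d →
      H ∉ pIdeal (C.ι p) → A ∈ pIdeal (C.ι p) → algebraMap B (RatFunc K) b = χ A / χ H →
      b ∈ IsLocalRing.maximalIdeal B := by
    intro b d A H hA hH hHp hAp hb hu
    obtain ⟨b', hb'⟩ := hu.exists_right_inv
    obtain ⟨e, A', H', hA', hH', hHp', hbb⟩ := hrep b'
    have h1 := congrArg (algebraMap B (RatFunc K)) hb'
    have h2 := hne H d hH hHp
    have h3 := hne H' e hH' hHp'
    rw [map_mul, map_one, hb, hbb, div_mul_div_comm, div_eq_one_iff_eq (mul_ne_zero h2 h3),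
      ← map_mul, ← map_mul, ← sub_eq_zero, ← map_sub] at h1
    have h4 := (c.ratEval_eq_zero_iff _ (d + e) ((hA.mul hA').sub (hH.mul hH'))).mp h1
    have h5 : A * A' - H * H' ∈ pIdeal (C.ι p) := by
      obtain ⟨q, hq⟩ := h4
      rw [hq]
      exact Ideal.mul_mem_right _ _ (PlaneCurve.mem_points.mp (C.ι_mem_points p))
    have h6 : H * H' ∈ pIdeal (C.ι p) := by
      have := Ideal.sub_mem _ (Ideal.mul_mem_right A' _ hAp) h5
      rwa [sub_sub_cancel] at this
    exact ((C.ι p).isPrime.mem_or_mem h6).elim hHp hHp'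
  have hprime : ∀ P : Ideal B, P ≠ ⊥ → P.IsPrime → P = IsLocalRing.maximalIdeal B := by
    intro P hP0 hP
    -- Dehomogenization by ℓ sends forms into B. Followed by B → B/P it defines a point y of the
    -- plane.
    let T : HomRing K →ₐ[K] RatFunc K :=
      MvPolynomial.aeval fun i => (χ ℓ)⁻¹ * χ (MvPolynomial.X i)
    have hT : ∀ (d : ℕ) (A : HomRing K), A.IsHomogeneous d → T A = χ A / χ (ℓ ^ d) := by
      intro d A hA
      have h1 : MvPolynomial.aeval (R := K) (fun i => χ (MvPolynomial.X i)) A = χ A := by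
        have h2 := MvPolynomial.aeval_unique c.ratEval
        exact (congrArg (fun φ => φ A) h2).symm
      rw [map_pow, div_eq_inv_mul, ← inv_pow, ← h1]
      exact aeval_mul_of_isHomogeneous hA _ _
    have hℓd : ∀ d : ℕ, (ℓ ^ d).IsHomogeneous d := fun d => by simpa using hℓ.pow d
    have hℓdp : ∀ d : ℕ, ℓ ^ d ∉ pIdeal (C.ι p) := fun d h =>
      hℓp ((C.ι p).isPrime.mem_of_pow_mem _ h)
    have hTr : ∀ A : HomRing K, T A ∈ ev.range := by
      intro A
      rw [← sum_homogeneousComponent A, map_sum]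
      refine Subring.sum_mem _ fun d _ => ?_
      rw [hT d _ (homogeneousComponent_isHomogeneous d A)]
      exact hex d _ _ (homogeneousComponent_isHomogeneous d A) (hℓd d) (hℓdp d)
    let e : B ≃+* ev.range := RingEquiv.ofBijective ev.rangeRestrict
      ⟨fun a b h => hev (congrArg Subtype.val h), ev.rangeRestrict_surjective⟩
    let φ : HomRing K →+* B :=
      (e.symm : ev.range →+* B).comp ((T : HomRing K →+* RatFunc K).codRestrict ev.range hTr)
    have hφ : ∀ (d : ℕ) (A : HomRing K), A.IsHomogeneous d → ev (φ A) = χ A / χ (ℓ ^ d) := by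
      intro d A hA
      rw [← hT d A hA]
      exact congrArg Subtype.val (e.apply_symm_apply ⟨T A, hTr A⟩)
    have hφu : ∀ (d : ℕ) (A : HomRing K), A.IsHomogeneous d → A ∉ pIdeal (C.ι p) →
        IsUnit (φ A) := fun d A hA hAp =>
      hunit _ d A (ℓ ^ d) hA (hℓd d) (hℓdp d) hAp (hφ d A hA)
    have hφP : ∀ (b : B) (d : ℕ) (A H : HomRing K), A.IsHomogeneous d → H.IsHomogeneous d →
        H ∉ pIdeal (C.ι p) → algebraMap B (RatFunc K) b = χ A / χ H → φ A = b * φ H := by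
      intro b d A H hA hH hHp hb
      apply hev
      rw [map_mul, hφ d A hA, hφ d H hH]
      refine Eq.trans ?_ (congrArg (· * (χ H / χ (ℓ ^ d))) hb.symm)
      have h2 := hne H d hH hHp
      field_simp
    let y : P2 K := pointOf ((Ideal.Quotient.mk P).comp φ) (by
      obtain ⟨i, hi⟩ := exists_X_notMem (C.ι p)
      refine ⟨i, fun h => hP.ne_top ?_⟩
      rw [RingHom.comp_apply, Ideal.Quotient.eq_zero_iff_mem] at h
      exact Ideal.eq_top_of_isUnit_mem _ h (hφu 1 _ (isHomogeneous_X K i) hi))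
    have hy : ∀ (d : ℕ) (A : HomRing K), A.IsHomogeneous d → (A ∈ pIdeal y ↔ φ A ∈ P) := by
      intro d A hA
      rw [mem_pointOf hA, RingHom.comp_apply, Ideal.Quotient.eq_zero_iff_mem]
    have h1 : C.poly ∈ pIdeal y := by
      rw [hy _ _ C.isHomogeneous]
      have : φ C.poly = 0 := by
        apply hev
        rw [hφ _ _ C.isHomogeneous, (c.ratEval_eq_zero_iff _ _ C.isHomogeneous).mpr dvd_rfl,
          zero_div, map_zero]
      rw [this]
      exact P.zero_mem
    obtain ⟨b, hbP, hb0⟩ := Submodule.exists_mem_ne_zero_of_ne_bot hP0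
    -- A nonzero element of P gives a form vanishing at y but not on C. Thus y strictly specializes
    -- C; since p specializes y, the two points coincide, and P is maximal.
    have h2 : pIdeal C.genericPoint < pIdeal y := by
      refine lt_of_le_of_ne (pIdeal_genericPoint_le.mpr h1) fun h => ?_
      obtain ⟨d, A, H, hA, hH, hHp, hb⟩ := hrep b
      have h3 : A ∈ pIdeal y := by
        rw [hy d A hA, hφP b d A H hA hH hHp hb]
        exact P.mul_mem_right _ hbP
      rw [← h, mem_genericPoint, ← c.ratEval_eq_zero_iff A d hA] at h3
      apply hb0
      apply hev
      rw [map_zero]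
      refine hb.trans ?_
      rw [show χ A = 0 from h3, zero_div]
    have h3 : C.ι p = y := by
      refine eq_of_genericPoint_lt h2 (pIdeal_le_iff.mpr fun d A hA hAy => ?_)
      by_contra hAp
      exact hP.ne_top (Ideal.eq_top_of_isUnit_mem _ ((hy d A hA).mp hAy) (hφu d A hA hAp))
    refine le_antisymm (IsLocalRing.le_maximalIdeal hP.ne_top) fun b hb => ?_
    obtain ⟨d, A, H, hA, hH, hHp, hbe⟩ := hrep b
    have hAp : A ∈ pIdeal (C.ι p) := by
      by_contra hAp
      exact hb (hunit b d A H hA hH hHp hAp hbe)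
    rw [h3, hy d A hA, hφP b d A H hA hH hHp hbe] at hAp
    refine (hP.mem_or_mem hAp).resolve_right fun h => ?_
    exact hP.ne_top (Ideal.eq_top_of_isUnit_mem _ h (hφu d H hH hHp))
  refine ⟨p, fun x => ⟨?_, fun hx => c.isRegularLocalRing_stalk x ((hp x).mpr hx)⟩, ?_⟩
  · rintro hreg rfl
    refine not_isRegularLocalRing (K := K) (B := B) ?_ ?_ hprime hreg
    · intro b
      obtain ⟨d, A, H, hA, hH, hHp, hb⟩ := hrep b
      rw [hb]
      by_cases h0 : χ A = 0
      · rw [h0, zero_div, RatFunc.intDegree_zero]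
      · rw [hintDeg d A H hA hH hHp h0]
        by_cases hAp : A ∈ pIdeal (C.ι x)
        · rcases hdeg d A hA hAp with h | h
          · exact absurd (by rw [hχ, h, map_zero]) h0
          · omega
        · rw [hdeg' d A hA hAp]
          omega
    · intro b hb
      obtain ⟨d, A, H, hA, hH, hHp, hbe⟩ := hrep b
      by_cases h0 : χ A = 0
      · left
        apply hev
        rw [map_zero]
        refine hbe.trans ?_
        rw [h0, zero_div]
      · right
        rw [hbe, hintDeg d A H hA hH hHp h0]
        by_cases hAp : A ∈ pIdeal (C.ι x)
        · rcases hdeg d A hA hAp with h | h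
          · exact absurd (by rw [hχ, h, map_zero]) h0
          · omega
        · exact absurd (hunit b d A H hA hH hHp hAp hbe) hb
  · have hℓm : (ℓ ^ c.m).IsHomogeneous c.m := by simpa using hℓ.pow c.m
    have hℓmp : ℓ ^ c.m ∉ pIdeal (C.ι p) := fun h => hℓp ((C.ι p).isPrime.mem_of_pow_mem _ h)
    obtain ⟨b, hb⟩ := hex c.m c.g (ℓ ^ c.m) c.isHomogeneous hℓm hℓmp
    -- On the curve g is a nonzero constant of K, as a unit of K[t]. So g / ℓ^m, which vanishes at
    -- p, is the inverse of a polynomial.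
    refine isLocalRing_integralClosure (fun α => ?_)
      (Polynomial.C ((c.χ c.g).coeff 0)⁻¹ * (c.χ ℓ) ^ c.m)
      (hbm b c.m c.g (ℓ ^ c.m) c.isHomogeneous hℓm hℓmp hgp hb) ?_
    · obtain ⟨b, hb⟩ := hex 0 (MvPolynomial.C α) 1 (isHomogeneous_C _ _) (isHomogeneous_one _ _)
        (fun h => (C.ι p).isPrime.ne_top ((Ideal.eq_top_iff_one _).mpr h))
      refine ⟨b, ?_⟩
      rw [hb, hχ, hχ, MvPolynomial.algHom_C, map_one, map_one, div_one]
      rfl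
    · rw [hb, hχ, hχ, map_mul, map_pow]
      obtain ⟨α, hα, hαe⟩ := Polynomial.isUnit_iff.mp c.isUnit
      rw [← hαe, Polynomial.coeff_C_zero]
      have h1 : algebraMap (Polynomial K) (RatFunc K) (c.χ ℓ) ≠ 0 := by
        rwa [ne_eq, FaithfulSMul.algebraMap_eq_zero_iff]
      have h2 : algebraMap (Polynomial K) (RatFunc K) (Polynomial.C α) *
          algebraMap (Polynomial K) (RatFunc K) (Polynomial.C α⁻¹) = 1 := by
        rw [← map_mul, ← Polynomial.C_mul, mul_inv_cancel₀ hα.ne_zero, map_one, map_one]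
      rw [div_mul_eq_mul_div, ← mul_assoc, h2, one_mul, map_pow, div_self (pow_ne_zero _ h1)]

end PlaneCurve.Chart

end Cusps

/-! ### Morphisms of the plane and birational maps -/

section Morphisms

variable {K : Type u} [Field K]

open MvPolynomial

theorem iso_hom_inv_apply {A B : CommRingCat.{u}} (e : A ≅ B) (b : B) : e.hom (e.inv b) = b :=
  congrArg (fun q => q.hom b) e.inv_hom_id

theorem iso_inv_hom_apply {A B : CommRingCat.{u}} (e : A ≅ B) (a : A) : e.inv (e.hom a) = a :=
  congrArg (fun q => q.hom a) e.hom_inv_id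

theorem germ_topIso_inv {Y : Scheme.{u}} (V : Y.Opens) (x : V.toScheme) (t : Γ(Y, V)) :
    (V.stalkIso x).hom (V.toScheme.presheaf.germ ⊤ x trivial (V.topIso.inv t)) =
      Y.presheaf.germ V x.1 x.2 t := by
  have h := congrArg (fun q => q.hom (V.topIso.inv t))
    (V.germ_stalkIso_hom (V := ⊤) x trivial)
  refine h.trans ?_
  rw [Scheme.Opens.topIso_inv]
  exact TopCat.Presheaf.germ_res_apply _ _ _ _ _

theorem germ_ι_appTop {Y : Scheme.{u}} (V : Y.Opens) (x : V.toScheme) (t : Γ(Y, ⊤)) :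
    (V.stalkIso x).hom (V.toScheme.presheaf.germ ⊤ x trivial (V.ι.appTop t)) =
      Y.presheaf.germ ⊤ x.1 trivial t := by
  have h := Scheme.Hom.germ_stalkMap_apply V.ι ⊤ x trivial t
  have h1 := (congrArg (fun q => q.hom (Y.presheaf.germ ⊤ x.1 trivial t))
    (V.stalkIso_inv x)).trans h
  have h2 := congrArg (V.stalkIso x).hom h1
  exact h2.symm.trans (iso_hom_inv_apply (V.stalkIso x) _)

/-- The constants in the coordinate ring of the open set `f ≠ 0`. -/
def awayConst (f : HomRing K) : K →+* HomogeneousLocalization.Away (gr K) f :=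
  (HomogeneousLocalization.fromZeroRingHom (gr K) _).comp (algebraMap K (gr K 0))

theorem awayConst_eq {f : HomRing K} {m : ℕ} (hf : f.IsHomogeneous m) (c : K) :
    awayConst f c = awayFrac hf 0 (A := MvPolynomial.C c) (isHomogeneous_C _ _) := by
  apply HomogeneousLocalization.val_injective
  rw [awayFrac, HomogeneousLocalization.Away.val_mk]
  change Localization.mk _ _ = _
  congr 1

/-- The constants as global functions on the plane. -/
def globalConst (c : K) : Γ(P2 K, ⊤) :=
  (P2.str K).appTop ((Scheme.ΓSpecIso (CommRingCat.of K)).inv c)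

theorem ι_appTop_globalConst {f : HomRing K} {m : ℕ} (hf : f.IsHomogeneous m) (hm : 0 < m) (c : K) :
    (Proj.basicOpen (gr K) f).ι.appTop (globalConst c) =
      (Proj.basicOpen (gr K) f).topIso.inv (Proj.awayToSection (gr K) f (awayConst f c)) := by
  have hf' := (mem_homogeneousSubmodule _ _).mpr hf
  have h1 : (Proj.basicOpen (gr K) f).ι ≫ P2.str K = (Proj.basicOpen (gr K) f).toSpecΓ ≫
      Spec.map (CommRingCat.ofHom (awayConst f) ≫ Proj.awayToSection (gr K) f) := by
    rw [← (Proj.isAffineOpen_basicOpen (gr K) f hf' hm).toSpecΓ_fromSpec, Category.assoc,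
      PlaneCurve.Chart.fromSpec_str hf' hm]
    rfl
  have h2 := congrArg (fun q => q.appTop ((Scheme.ΓSpecIso (CommRingCat.of K)).inv c)) h1
  simp only [Scheme.Hom.comp_appTop, CommRingCat.comp_apply] at h2
  refine h2.trans ?_
  have h3 := congrArg (fun q => q.hom c) (Scheme.ΓSpecIso_inv_naturality
    (CommRingCat.ofHom (awayConst f) ≫ Proj.awayToSection (gr K) f))
  simp only at h3
  refine (congrArg _ h3.symm).trans ?_
  rw [Scheme.Opens.toSpecΓ_appTop, CommRingCat.comp_apply]
  exact congrArg _ (iso_hom_inv_apply (Scheme.ΓSpecIso _) _)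

theorem stalkToFun_globalConst (x : P2 K) (c : K) :
    stalkToFun x ((P2 K).presheaf.germ ⊤ x trivial (globalConst c)) =
      algebraMap K (FunField K) c := by
  obtain ⟨i, hi⟩ := exists_X_notMem x
  have hf := isHomogeneous_X K i
  let V := Proj.basicOpen (gr K) (X i)
  have h1 := germ_ι_appTop V ⟨x, hi⟩ (globalConst c)
  rw [ι_appTop_globalConst hf one_pos] at h1
  refine (congrArg (stalkToFun x) h1.symm).trans ?_
  refine (congrArg (stalkToFun x) (germ_topIso_inv V ⟨x, hi⟩ _)).trans ?_
  rw [awayConst_eq hf]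
  refine (stalkToFun_germ_away hf _ x hi).trans ?_
  rw [pow_zero, map_one, div_one, dehom, MvPolynomial.aeval_C]

theorem specializes_iff_pIdeal_le {y z : P2 K} : y ⤳ z ↔ pIdeal y ≤ pIdeal z := by
  rw [specializes_iff_mem_closure]
  exact (ProjectiveSpectrum.le_iff_mem_closure (gr K) y z).symm

/-- The comorphism of an automorphism of the plane, at the generic point. -/
theorem exists_bir_of_iso (α : P2 K ≅ P2 K) (hα : α.hom ≫ P2.str K = P2.str K) :
    ∃ θ : Bir K, ∀ y, θ.MapsTo (localRing y) (α.hom y) := by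
  -- The local ring at the generic point is the whole function field, so the stalk map there is the
  -- comorphism.
  obtain ⟨η, hη⟩ : ∃ η : P2 K, pIdeal η = ⊥ := by
    refine ⟨pointOf (RingHom.id (HomRing K)) ⟨0, X_ne_zero _⟩, ?_⟩
    rw [eq_bot_iff, pIdeal_le_iff]
    intro d A hA hAy
    exact (mem_pointOf hA).mp hAy
  have hspec : ∀ y : P2 K, η ⤳ y := by
    intro y
    rw [specializes_iff_pIdeal_le, hη]
    exact bot_le
  have hbij : ∀ y : P2 K, (∀ z, y ⤳ z) → Function.Bijective (stalkToFun y) := by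
    refine fun y hy => ⟨stalkToFun_injective y, fun r => ?_⟩
    have hy' : pIdeal y = ⊥ := by
      rw [eq_bot_iff, ← hη]
      exact specializes_iff_pIdeal_le.mp (hy η)
    obtain ⟨d, A, B, hA, hB, hB0, rfl⟩ := exists_fraction r
    refine mem_localRing.mpr ⟨d, A, B, hA, hB, ?_, rfl⟩
    rw [hy']
    exact hB0
  have hαη : ∀ z, α.hom η ⤳ z := by
    intro z
    obtain ⟨w, rfl⟩ := α.hom.homeomorph.surjective z
    exact (hspec w).map α.hom.continuous
  let e1 := RingEquiv.ofBijective _ (hbij η hspec)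
  let e2 := RingEquiv.ofBijective _ (hbij (α.hom η) hαη)
  let e3 := (asIso (α.hom.stalkMap η)).commRingCatIsoToRingEquiv
  let E : FunField K ≃+* FunField K := (e2.symm.trans e3).trans e1
  have hE : ∀ s, E (stalkToFun (α.hom η) s) = stalkToFun η (α.hom.stalkMap η s) := by
    intro s
    change e1 (e3 (e2.symm (e2 s))) = _
    rw [RingEquiv.symm_apply_apply]
    rfl
  have hspecialize : ∀ (y z : P2 K) (h : y ⤳ z) (s : (P2 K).presheaf.stalk z),
      stalkToFun y ((P2 K).presheaf.stalkSpecializes h s) = stalkToFun z s := by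
    intro y z h s
    obtain ⟨m, f, A, hf, hA, hx, hm, rfl⟩ := exists_germ_eq _ s
    have hy : y ∈ Proj.basicOpen (gr K) f := h.mem_open (Proj.basicOpen (gr K) f).isOpen hx
    refine Eq.trans (congrArg (stalkToFun y)
      (TopCat.Presheaf.germ_stalkSpecializes_apply _ hx h _)) ?_
    exact (stalkToFun_germ_away hf hA y hy).trans (stalkToFun_germ_away hf hA z hx).symm
  -- Stalk maps commute with specialization, so the comorphism at the generic point restricts to the
  -- stalk map at every point.
  have hE' : ∀ (y : P2 K) (s : (P2 K).presheaf.stalk (α.hom y)),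
      E (stalkToFun (α.hom y) s) = stalkToFun y (α.hom.stalkMap y s) := by
    intro y s
    have h := (hspec y)
    rw [← hspecialize (α.hom η) (α.hom y) (h.map α.hom.continuous), hE,
      ← hspecialize η y h]
    exact congrArg _ (Scheme.Hom.stalkSpecializes_stalkMap_apply α.hom η y h s)
  -- Constants are global functions pulled back from Spec K, and α commutes with the structure
  -- morphism.
  have hconst : ∀ c : K, E (algebraMap K (FunField K) c) = algebraMap K (FunField K) c := by
    intro c
    refine (congrArg E (stalkToFun_globalConst (α.hom η) c).symm).trans ?_
    refine Eq.trans ?_ (stalkToFun_globalConst η c)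
    rw [hE]
    refine congrArg (stalkToFun η) ?_
    refine (Scheme.Hom.germ_stalkMap_apply α.hom ⊤ η trivial _).trans ?_
    have h1 := congrArg (fun q => q.appTop ((Scheme.ΓSpecIso (CommRingCat.of K)).inv c)) hα
    simp only [Scheme.Hom.comp_appTop, CommRingCat.comp_apply] at h1
    exact congrArg ((P2 K).presheaf.germ ⊤ η trivial) h1
  refine ⟨⟨AlgEquiv.ofRingEquiv hconst⟩, fun y => ?_⟩
  rw [Bir.mapsTo_iff]
  constructor
  · rintro _ ⟨s, rfl⟩
    exact ⟨α.hom.stalkMap y s, (hE' y s).symm⟩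
  · rintro _ ⟨⟨s, rfl⟩, hs⟩
    change MM _ (E _)
    rw [hE']
    have h1 : ¬ IsUnit s := fun h => isUnit_iff_stalkToFun.mp h ⟨⟨s, rfl⟩, hs⟩
    have h2 : ¬ IsUnit (α.hom.stalkMap y s) := fun h => h1 ((isUnit_map_iff _ s).mp h)
    rw [isUnit_iff_stalkToFun, not_not] at h2
    exact h2

/-- An automorphism of the plane permutes the curves. -/
theorem exists_genericPoint_of_iso (α : P2 K ≅ P2 K) (C : PlaneCurve K) :
    ∃ D : PlaneCurve K, α.hom C.genericPoint = D.genericPoint := by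
  have hback : ∀ y z : P2 K, α.hom y ⤳ α.hom z → y ⤳ z := fun y z h =>
    (α.hom.homeomorph.isInducing.specializes_iff).mp h
  obtain ⟨y, hy, -⟩ := exists_lt_point C
  -- A homeomorphism preserves specialization. The generic point of a curve does not specialize to
  -- everything, and it has a proper specialization; so its image is neither the generic point of
  -- the plane nor a closed point.
  rcases point_cases (α.hom C.genericPoint) with h | ⟨D, h⟩ | h
  · exfalso
    have h1 : ∀ z : P2 K, pIdeal C.genericPoint ≤ pIdeal z := fun z =>
      specializes_iff_pIdeal_le.mp (hback _ _ 
        (specializes_iff_pIdeal_le.mpr ((pIdeal_eq_bot_iff.mpr h) ▸ bot_le)))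
    obtain ⟨z, hz⟩ : ∃ z : P2 K, pIdeal z = ⊥ := by
      refine ⟨pointOf (RingHom.id (HomRing K)) ⟨0, X_ne_zero _⟩, ?_⟩
      rw [eq_bot_iff, pIdeal_le_iff]
      intro d A hA hAy
      exact (mem_pointOf hA).mp hAy
    exact C.irreducible.ne_zero ((Ideal.mem_bot).mp (hz ▸ pIdeal_genericPoint_le.mp (h1 z)))
  · exact ⟨D, h⟩
  · exfalso
    have h1 : C.genericPoint ⤳ y := specializes_iff_pIdeal_le.mpr hy.le
    have h2 := specializes_iff_pIdeal_le.mp (h1.map α.hom.continuous)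
    have h3 := localRing_injective (h.2 _ ⟨_, rfl⟩ (localRing_toSubring_le_iff.mpr h2))
    have h4 := α.hom.homeomorph.injective h3
    exact hy.ne (by rw [h4])

/-- A projective equivalence of plane curves is a linear map that sends one curve to the other. -/
theorem PlaneCurve.ProjectivelyEquivalent.exists_isLinear {C D : PlaneCurve K}
    (h : C.ProjectivelyEquivalent D) : ∃ (θ : Bir K) (A B : Fin 3 → HomRing K), θ.IsLinear A B ∧
      θ.MapsTo (localRing C.genericPoint) D.genericPoint := by
  obtain ⟨α, hα, hCD⟩ := h
  obtain ⟨θ, hθ⟩ := exists_bir_of_iso α hα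
  obtain ⟨A, B, hAB⟩ := Bir.exists_isLinear θ fun C => by
    obtain ⟨D, hD⟩ := exists_genericPoint_of_iso α C
    exact ⟨D, hD ▸ hθ _⟩
  refine ⟨θ, A, B, hAB, ?_⟩
  have h1 : α.hom C.genericPoint = D.genericPoint := by
    apply pIdeal_injective
    apply le_antisymm
    · have hD : D.genericPoint ∈ (D.points : Set (P2 K)) :=
        PlaneCurve.mem_points.mpr (mem_genericPoint.mpr dvd_rfl)
      rw [← hCD] at hD
      obtain ⟨z, hz, hzD⟩ := hD
      rw [← hzD]
      exact specializes_iff_pIdeal_le.mp ((specializes_iff_pIdeal_le.mpr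
        (pIdeal_genericPoint_le.mpr (PlaneCurve.mem_points.mp hz))).map α.hom.continuous)
    · rw [pIdeal_genericPoint_le, ← PlaneCurve.mem_points]
      change α.hom C.genericPoint ∈ (D.points : Set (P2 K))
      rw [← hCD]
      exact ⟨_, PlaneCurve.mem_points.mpr (mem_genericPoint.mpr dvd_rfl), rfl⟩
  exact h1 ▸ hθ _

/-! ### Isomorphisms of complements -/

/-- The fractions `A / f ^ k` as rational functions. -/
def awayToFun (f : HomRing K) (hf : dehom K f ≠ 0) :
    HomogeneousLocalization.Away (gr K) f →+* FunField K :=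
  (Localization.awayLift (dehom K : HomRing K →+* FunField K) f (IsUnit.mk0 _ hf)).comp
    (algebraMap (HomogeneousLocalization.Away (gr K) f) (Localization.Away f))

theorem awayToFun_awayFrac {f : HomRing K} (hf : dehom K f ≠ 0) {m : ℕ} (hfm : f.IsHomogeneous m)
    {A : HomRing K} {k : ℕ} (hA : A.IsHomogeneous (m * k)) :
    awayToFun f hf (awayFrac hfm k hA) = dehom K A / dehom K (f ^ k) := by
  have h1 : (algebraMap (HomogeneousLocalization.Away (gr K) f) (Localization.Away f)
      (awayFrac hfm k hA)) * algebraMap (HomRing K) (Localization.Away f) (f ^ k) =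
      algebraMap (HomRing K) (Localization.Away f) A := by
    rw [HomogeneousLocalization.algebraMap_apply, awayFrac, HomogeneousLocalization.Away.val_mk,
      ← Localization.mk_one_eq_algebraMap, Localization.mk_mul, ← Localization.mk_one_eq_algebraMap,
      Localization.mk_eq_mk_iff, Localization.r_iff_exists]
    refine ⟨1, ?_⟩
    simp [mul_comm]
  have h2 := congrArg (Localization.awayLift (dehom K : HomRing K →+* FunField K) f
    (IsUnit.mk0 _ hf)) h1
  rw [map_mul] at h2
  have h3 : ∀ B : HomRing K, Localization.awayLift (dehom K : HomRing K →+* FunField K) f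
      (IsUnit.mk0 _ hf) (algebraMap (HomRing K) (Localization.Away f) B) = dehom K B := fun B =>
    IsLocalization.Away.lift_eq f (IsUnit.mk0 _ hf) B
  rw [h3, h3] at h2
  rw [map_pow] at h2 ⊢
  exact (eq_div_iff (pow_ne_zero _ hf)).mpr h2

theorem awayToFun_injective {f : HomRing K} (hf : dehom K f ≠ 0) {m : ℕ} (hfm : f.IsHomogeneous m) :
    Function.Injective (awayToFun f hf) := by
  rw [injective_iff_map_eq_zero]
  intro q hq
  obtain ⟨k, A, hA, rfl⟩ := awayFrac_surjective hfm q
  rw [awayToFun_awayFrac hf hfm, div_eq_zero_iff, map_pow] at hq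
  have h1 : A = 0 := by
    by_contra h0
    exact dehom_ne_zero hA h0 (hq.resolve_right (pow_ne_zero _ hf))
  apply HomogeneousLocalization.val_injective
  rw [awayFrac, HomogeneousLocalization.Away.val_mk, HomogeneousLocalization.val_zero, h1,
    Localization.mk_zero]

theorem ι_str_eq {f : HomRing K} {m : ℕ} (hf : f.IsHomogeneous m) (hm : 0 < m) :
    (Proj.basicOpen (gr K) f).ι ≫ P2.str K =
      Proj.basicOpenToSpec (gr K) f ≫ Spec.map (CommRingCat.ofHom (awayConst f)) := by
  have hf' := (mem_homogeneousSubmodule _ _).mpr hf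
  rw [← (Proj.isAffineOpen_basicOpen (gr K) f hf' hm).toSpecΓ_fromSpec, Category.assoc,
    PlaneCurve.Chart.fromSpec_str hf' hm, Proj.basicOpenToSpec, Category.assoc, ← Spec.map_comp]
  rfl

theorem appTop_basicOpenToSpec (f : HomRing K) (q : HomogeneousLocalization.Away (gr K) f) :
    (Proj.basicOpenToSpec (gr K) f).appTop ((Scheme.ΓSpecIso (CommRingCat.of (HomogeneousLocalization.Away (gr K) f))).inv q) =
      (Proj.basicOpen (gr K) f).topIso.inv (Proj.awayToSection (gr K) f q) := by
  have h := congrArg (fun φ => φ.hom ((Scheme.ΓSpecIso (CommRingCat.of (HomogeneousLocalization.Away (gr K) f))).inv q))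
    (Proj.basicOpenToSpec_app_top (gr K) f)
  refine h.trans ?_
  exact congrArg (fun t => (Proj.basicOpen (gr K) f).topIso.inv (Proj.awayToSection (gr K) f t))
    (iso_hom_inv_apply (Scheme.ΓSpecIso (CommRingCat.of (HomogeneousLocalization.Away (gr K) f))) q)

theorem ringHom_eq_of_mul_eq {R F : Type*} [CommRing R] [Field F] {φ ψ : R →+* F} {a b s : R}
    (h : b * s = a) (ha : φ a = ψ a) (hb : φ b = ψ b) (hb0 : ψ b ≠ 0) : φ s = ψ s := by
  have h2 := congrArg φ h
  rw [ha, ← h, map_mul, map_mul, hb] at h2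
  exact mul_left_cancel₀ hb0 h2

/-- Germs at a point of the open set `g ≠ 0` are quotients of functions on this open set. -/
theorem exists_mul_germ_eq {g : HomRing K} {m : ℕ} (hg : g.IsHomogeneous m) (hm : 0 < m)
    (y : P2 K) (hy : y ∈ Proj.basicOpen (gr K) g) (s : (P2 K).presheaf.stalk y) :
    ∃ a b : HomogeneousLocalization.Away (gr K) g,
      (P2 K).presheaf.germ _ y hy (Proj.awayToSection (gr K) g b) ≠ 0 ∧
      (P2 K).presheaf.germ _ y hy (Proj.awayToSection (gr K) g b) * s =
        (P2 K).presheaf.germ _ y hy (Proj.awayToSection (gr K) g a) := by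
  obtain ⟨d, A, B, hA, hB, hBy, h⟩ := mem_localRing.mp (show stalkToFun y s ∈ (localRing y).toSubring
    from ⟨s, rfl⟩)
  -- Writing A / B as A B^(m-1) / B^m makes the degree a multiple of deg g = m, so that both can be
  -- divided by g^d.
  have hB' : (B ^ m).IsHomogeneous (m * d) := by
    rw [mul_comm]
    exact hB.pow m
  have hA' : (A * B ^ (m - 1)).IsHomogeneous (m * d) := by
    have := hA.mul (hB.pow (m - 1))
    rwa [show d + d * (m - 1) = m * d by
      obtain ⟨k, rfl⟩ := Nat.exists_eq_succ_of_ne_zero hm.ne'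
      simp
      ring] at this
  have hB0 := dehom_ne_zero hB (ne_zero_of_notMem hBy)
  have hg0 := dehom_ne_zero hg (ne_zero_of_notMem hy)
  have h1 := stalkToFun_germ_away hg hB' y hy
  have h2 := stalkToFun_germ_away hg hA' y hy
  refine ⟨awayFrac hg d hA', awayFrac hg d hB', fun h0 => ?_, stalkToFun_injective y ?_⟩
  · have h3 := (congrArg (stalkToFun y) h0).symm.trans h1
    rw [map_zero] at h3
    rw [map_pow, map_pow] at h3
    exact div_ne_zero (pow_ne_zero _ hB0) (pow_ne_zero _ hg0) h3.symm
  · rw [map_mul]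
    refine (congrArg₂ (· * ·) h1 h).trans (Eq.trans ?_ h2.symm)
    obtain ⟨k, rfl⟩ := Nat.exists_eq_succ_of_ne_zero hm.ne'
    simp only [map_mul, map_pow, Nat.succ_eq_add_one, Nat.add_sub_cancel]
    field_simp
    ring

/-- Complements of curves are affine, so an isomorphism of coordinate rings suffices. Its agreement
with θ is checked on functions and then extended to germs. -/
theorem exists_iso_of_away {f g : HomRing K} {m k : ℕ} (hf : f.IsHomogeneous m)
    (hg : g.IsHomogeneous k) (hm : 0 < m) (hk : 0 < k) (hf0 : dehom K f ≠ 0) (hg0 : dehom K g ≠ 0)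
    {θ : Bir K}
    (E : HomogeneousLocalization.Away (gr K) g ≃+* HomogeneousLocalization.Away (gr K) f)
    (hE : ∀ q, awayToFun f hf0 (E q) = θ.pull (awayToFun g hg0 q)) :
    ∃ e : (Proj.basicOpen (gr K) f).toScheme ≅ (Proj.basicOpen (gr K) g).toScheme,
      e.hom ≫ (Proj.basicOpen (gr K) g).ι ≫ P2.str K = (Proj.basicOpen (gr K) f).ι ≫ P2.str K ∧
      θ.RestrictsTo (e.hom ≫ (Proj.basicOpen (gr K) g).ι) := by
  have hEc : ∀ c : K, E (awayConst g c) = awayConst f c := by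
    intro c
    apply awayToFun_injective hf0 hf
    rw [hE, awayConst_eq hg, awayConst_eq hf, awayToFun_awayFrac,
      awayToFun_awayFrac]
    simp [dehom]
  have hf' := (mem_homogeneousSubmodule _ _).mpr hf
  have hg' := (mem_homogeneousSubmodule _ _).mpr hg
  let E' : CommRingCat.of (HomogeneousLocalization.Away (gr K) g) ⟶
    CommRingCat.of (HomogeneousLocalization.Away (gr K) f) := E.toCommRingCatIso.hom
  let e : (Proj.basicOpen (gr K) f).toScheme ≅ (Proj.basicOpen (gr K) g).toScheme :=
    Proj.basicOpenIsoSpec (gr K) f hf' hm ≪≫ Scheme.Spec.mapIso E.toCommRingCatIso.op ≪≫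
      (Proj.basicOpenIsoSpec (gr K) g hg' hk).symm
  have he : e.hom ≫ Proj.basicOpenToSpec (gr K) g =
      Proj.basicOpenToSpec (gr K) f ≫ Spec.map E' := by
    rw [← Proj.basicOpenIsoSpec_hom (gr K) f hf' hm,
      ← Proj.basicOpenIsoSpec_hom (gr K) g hg' hk]
    simp only [e, Iso.trans_hom, Iso.symm_hom, Category.assoc, Iso.inv_hom_id, Category.comp_id]
    rfl
  refine ⟨e, ?_, ?_⟩
  · rw [ι_str_eq hf hm, ι_str_eq hg hk, reassoc_of% he, ← Spec.map_comp]
    congr 2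
    ext c
    exact congrArg HomogeneousLocalization.val (hEc c)
  · intro x s
    let U := Proj.basicOpen (gr K) f
    let V := Proj.basicOpen (gr K) g
    let y : V.toScheme := e.hom x
    let Ψ : (P2 K).presheaf.stalk y.1 →+* FunField K :=
      (stalkToFun x.1).comp ((U.stalkIso x).hom.hom.comp ((e.hom ≫ V.ι).stalkMap x).hom)
    let Ψ' : (P2 K).presheaf.stalk y.1 →+* FunField K :=
      (θ.pull : FunField K →+* FunField K).comp (stalkToFun y.1)
    change Ψ s = Ψ' s
    have key : ∀ q, Ψ ((P2 K).presheaf.germ V y.1 y.2 (Proj.awayToSection (gr K) g q)) =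
        Ψ' ((P2 K).presheaf.germ V y.1 y.2 (Proj.awayToSection (gr K) g q)) := by
      intro q
      have h1 : V.ι.stalkMap y ((P2 K).presheaf.germ V y.1 y.2 (Proj.awayToSection (gr K) g q)) =
          V.toScheme.presheaf.germ ⊤ y trivial (V.topIso.inv (Proj.awayToSection (gr K) g q)) := by
        have h2 := congrArg (V.stalkIso y).inv (germ_topIso_inv V y (Proj.awayToSection (gr K) g q))
        have h3 := (iso_inv_hom_apply (V.stalkIso y) _).symm.trans h2
        refine Eq.trans ?_ h3.symm
        exact congrArg (fun φ => φ.hom ((P2 K).presheaf.germ V y.1 y.2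
          (Proj.awayToSection (gr K) g q))) (V.stalkIso_inv y).symm
      have h2 : e.hom.appTop (V.topIso.inv (Proj.awayToSection (gr K) g q)) =
          U.topIso.inv (Proj.awayToSection (gr K) f (E q)) := by
        rw [← appTop_basicOpenToSpec, ← appTop_basicOpenToSpec]
        have h3 := congrArg (fun φ => φ.appTop ((Scheme.ΓSpecIso (CommRingCat.of _)).inv q)) he
        simp only [Scheme.Hom.comp_appTop, CommRingCat.comp_apply] at h3
        refine h3.trans (congrArg _ ?_)
        exact (congrArg (fun φ => φ.hom q) (Scheme.ΓSpecIso_inv_naturality E')).symm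
      have h3 : (e.hom ≫ V.ι).stalkMap x
          ((P2 K).presheaf.germ V y.1 y.2 (Proj.awayToSection (gr K) g q)) =
          U.toScheme.presheaf.germ ⊤ x trivial
            (U.topIso.inv (Proj.awayToSection (gr K) f (E q))) := by
        have h4 := congrArg (fun φ => φ.hom ((P2 K).presheaf.germ V y.1 y.2
          (Proj.awayToSection (gr K) g q))) (Scheme.Hom.stalkMap_comp e.hom V.ι x)
        refine h4.trans ((congrArg (e.hom.stalkMap x) h1).trans ?_)
        refine (Scheme.Hom.germ_stalkMap_apply e.hom ⊤ x trivial _).trans ?_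
        exact congrArg (U.toScheme.presheaf.germ ⊤ x trivial) h2
      have h4 : Ψ ((P2 K).presheaf.germ V y.1 y.2 (Proj.awayToSection (gr K) g q)) =
          stalkToFun x.1 ((P2 K).presheaf.germ U x.1 x.2 (Proj.awayToSection (gr K) f (E q))) :=
        congrArg (stalkToFun x.1) ((congrArg (U.stalkIso x).hom h3).trans (germ_topIso_inv U x _))
      have h5 : ∀ (f : HomRing K) (m : ℕ) (_ : f.IsHomogeneous m) (hf0 : dehom K f ≠ 0) (z : P2 K)
          (hz : z ∈ Proj.basicOpen (gr K) f) (q : HomogeneousLocalization.Away (gr K) f),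
          stalkToFun z ((P2 K).presheaf.germ _ z hz (Proj.awayToSection (gr K) f q)) =
            awayToFun f hf0 q := by
        intro f m hf hf0 z hz q
        obtain ⟨k, A, hA, rfl⟩ := awayFrac_surjective hf q
        exact (stalkToFun_germ_away hf hA z hz).trans (awayToFun_awayFrac hf0 hf hA).symm
      rw [h4, h5 f m hf hf0, hE]
      exact congrArg θ.pull (h5 g k hg hg0 y.1 y.2 q).symm
    -- A germ is a quotient of functions on the open set, so two homomorphisms to a field that agree
    -- on functions agree on germs.
    obtain ⟨a, b, hb, hab⟩ := exists_mul_germ_eq hg hk y.1 y.2 s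
    have h1 : Ψ' ((P2 K).presheaf.germ V y.1 y.2 (Proj.awayToSection (gr K) g b)) ≠ 0 := by
      refine (map_ne_zero_iff Ψ' ?_).mpr hb
      exact θ.pull.injective.comp (stalkToFun_injective y.1)
    exact ringHom_eq_of_mul_eq hab (key a) (key b) h1

namespace PlaneCurve

theorem dehom_poly_ne_zero (C : PlaneCurve K) : dehom K C.poly ≠ 0 :=
  dehom_ne_zero C.isHomogeneous C.irreducible.ne_zero

/-- The functions that are regular off the curve. -/
abbrev regular (C : PlaneCurve K) : Subring (FunField K) :=
  (awayToFun C.poly C.dehom_poly_ne_zero).range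

theorem mem_regular {C : PlaneCurve K} {r : FunField K} : r ∈ C.regular ↔
    ∃ (k : ℕ) (A : HomRing K), A.IsHomogeneous (C.deg * k) ∧
      r = dehom K A / dehom K (C.poly ^ k) := by
  constructor
  · rintro ⟨q, rfl⟩
    obtain ⟨k, A, hA, rfl⟩ := awayFrac_surjective C.isHomogeneous q
    exact ⟨k, A, hA, awayToFun_awayFrac _ _ _⟩
  · rintro ⟨k, A, hA, rfl⟩
    exact ⟨awayFrac C.isHomogeneous k hA, awayToFun_awayFrac _ _ _⟩

/-- Regular functions off the curve, as the elements of a subring of the function field. -/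
def awayEquivRegular (C : PlaneCurve K) :
    HomogeneousLocalization.Away (gr K) C.poly ≃+* C.regular :=
  RingEquiv.ofBijective (awayToFun C.poly C.dehom_poly_ne_zero).rangeRestrict
    ⟨fun _ _ h => awayToFun_injective C.dehom_poly_ne_zero C.isHomogeneous
      (congrArg Subtype.val h), RingHom.rangeRestrict_surjective _⟩

/-- Reduces the isomorphism of complements to a statement inside the function field: the comorphism
matches the two rings of regular functions. -/
theorem complIsoVia {C D : PlaneCurve K} {θ : Bir K}
    (h : ∀ r, r ∈ D.regular ↔ θ.pull r ∈ C.regular) : ComplIsoVia θ C D := by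
  let E0 : D.regular ≃+* C.regular :=
    (θ.pull : FunField K ≃+* FunField K).restrict D.regular C.regular h
  let E : HomogeneousLocalization.Away (gr K) D.poly ≃+*
      HomogeneousLocalization.Away (gr K) C.poly :=
    (D.awayEquivRegular.trans E0).trans C.awayEquivRegular.symm
  exact exists_iso_of_away C.isHomogeneous D.isHomogeneous (Nat.pos_of_ne_zero C.deg_ne_zero)
    (Nat.pos_of_ne_zero D.deg_ne_zero) C.dehom_poly_ne_zero D.dehom_poly_ne_zero E fun q =>
    congrArg Subtype.val (C.awayEquivRegular.apply_symm_apply (E0 (D.awayEquivRegular q)))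

end PlaneCurve

end Morphisms

/-! ### Exceptional fibres -/

section Exceptional

variable {K : Type u} [Field K]

theorem mem_ofPrime {F : Type*} [Field F] {A : Subring F} {P : Ideal A} [P.IsPrime] {r : F} :
    r ∈ (LocalSubring.ofPrime A P).toSubring ↔ ∃ a b : A, b ∉ P ∧ r = a / b := by
  constructor
  · intro hr
    obtain ⟨⟨a, b⟩, h⟩ := IsLocalization.surj P.primeCompl (⟨r, hr⟩ : (LocalSubring.ofPrime A P).toSubring)
    refine ⟨a, b, b.2, ?_⟩
    have hb : ((b : A) : F) ≠ 0 := fun h0 => b.2 (by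
      rw [show (b : A) = 0 from Subtype.ext h0]
      exact P.zero_mem)
    rw [eq_div_iff hb]
    exact congrArg Subtype.val h
  · rintro ⟨a, b, hb, rfl⟩
    have hb0 : (b : F) ≠ 0 := fun h0 => hb (by
      rw [show b = 0 from Subtype.ext h0]
      exact P.zero_mem)
    have hA : (a : F) ∈ (LocalSubring.ofPrime A P).toSubring := LocalSubring.le_ofPrime A P a.2
    have hB : (b : F) ∈ (LocalSubring.ofPrime A P).toSubring := LocalSubring.le_ofPrime A P b.2
    have hu := IsLocalization.map_units (LocalSubring.ofPrime A P).toSubring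
      (⟨b, hb⟩ : P.primeCompl)
    have hbi : (b : F)⁻¹ ∈ (LocalSubring.ofPrime A P).toSubring := by
      obtain ⟨c, hc⟩ := hu.exists_right_inv
      have h1 : (b : F)⁻¹ = c := inv_eq_of_mul_eq_one_right (congrArg Subtype.val hc)
      rw [h1]
      exact c.2
    rw [div_eq_mul_inv]
    exact Subring.mul_mem _ hA hbi

theorem MM_ofPrime {F : Type*} [Field F] {A : Subring F} {P : Ideal A} [P.IsPrime] (a : A) :
    MM (LocalSubring.ofPrime A P) (a : F) ↔ a ∈ P := by
  have h4 := IsLocalization.AtPrime.to_map_mem_maximal_iff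
    (LocalSubring.ofPrime A P).toSubring P a
  rw [mem_maximalIdeal_iff] at h4
  exact h4

theorem inv_mem_of_le {F : Type*} [Field F] {R S : LocalSubring F} (h : R ≤ S) {b : F}
    (hb : b ∈ R.toSubring) (h' : ¬ MM S b) : b ≠ 0 ∧ b⁻¹ ∈ R.toSubring :=
  inv_mem_of_not_MM hb fun h1 => h' (h1.of_le h)

theorem mem_blowUpChart_of_MM {R : LocalSubring (FunField K)} {x y : FunField K} (hy : MM R y) :
    y / x ∈ blowUpChart R x :=
  Subring.subset_closure (Or.inr ⟨⟨y, hy.mem⟩, hy.mk_mem, rfl⟩)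

theorem le_blowUpChart (R : LocalSubring (FunField K)) (x : FunField K) :
    R.toSubring ≤ blowUpChart R x := fun _ hr => Subring.subset_closure (Or.inl hr)

theorem blowUpChart_le {R : LocalSubring (FunField K)} {x : FunField K} {S : Subring (FunField K)}
    (h : R.toSubring ≤ S) (h' : ∀ y, MM R y → y / x ∈ S) : blowUpChart R x ≤ S := by
  refine Subring.closure_le.mpr (Set.union_subset h ?_)
  rintro _ ⟨y, hy, rfl⟩
  exact h' y ((mem_maximalIdeal_iff y).mp hy)

/-- The points of the exceptional fibre are the local rings of fractions of the charts. -/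
theorem mem_exceptionalFibre_iff {R S : LocalSubring (FunField K)} :
    S ∈ exceptionalFibre R ↔ R ≤ S ∧ ∃ x, MM R x ∧ x ≠ 0 ∧ (∀ y, MM R y → y / x ∈ S.toSubring) ∧
      ∀ r ∈ S.toSubring, ∃ a ∈ blowUpChart R x, ∃ b ∈ blowUpChart R x, b ≠ 0 ∧
        b⁻¹ ∈ S.toSubring ∧ r = a / b := by
  constructor
  · rintro ⟨hRS, x, hx, hx0, P, hP, rfl⟩
    refine ⟨hRS, x, (mem_maximalIdeal_iff x).mp hx, fun h => hx0 (Subtype.ext h), fun y hy => ?_,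
      fun r hr => ?_⟩
    · exact LocalSubring.le_ofPrime _ _ (mem_blowUpChart_of_MM hy)
    · obtain ⟨a, b, hb, rfl⟩ := mem_ofPrime.mp hr
      have h1 := inv_mem_of_not_MM (LocalSubring.le_ofPrime _ P b.2) (fun h => hb ((MM_ofPrime b).mp h))
      exact ⟨a, a.2, b, b.2, h1.1, h1.2, rfl⟩
  · rintro ⟨hRS, x, hx, hx0, hchart, hfrac⟩
    have hle : blowUpChart R x ≤ S.toSubring := blowUpChart_le hRS.1 hchart
    let P : Ideal (blowUpChart R x) :=
      (IsLocalRing.maximalIdeal S.toSubring).comap (Subring.inclusion hle)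
    have hP : P.IsPrime := Ideal.comap_isPrime _ _
    have hPm : ∀ a : blowUpChart R x, a ∈ P ↔ MM S a := fun a =>
      mem_maximalIdeal_iff (⟨a, hle a.2⟩ : S.toSubring)
    refine ⟨hRS, ⟨x, hx.mem⟩, hx.mk_mem, fun h => hx0 (congrArg Subtype.val h), P, hP, ?_⟩
    refine LocalSubring.toSubring_injective (le_antisymm (fun r hr => ?_) fun r hr => ?_)
    · obtain ⟨a, ha, b, hb, hb0, hbi, rfl⟩ := hfrac r hr
      exact mem_ofPrime.mpr ⟨⟨a, ha⟩, ⟨b, hb⟩, fun h =>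
        not_MM_of_inv_mem hb0 hbi ((hPm ⟨b, hb⟩).mp h), rfl⟩
    · obtain ⟨a, b, hb, rfl⟩ := mem_ofPrime.mp hr
      rw [div_eq_mul_inv]
      exact S.toSubring.mul_mem (hle a.2)
        (inv_mem_of_not_MM (hle b.2) fun h => hb ((hPm b).mpr h)).2

/-- Let S and S' come from the charts of x and x'. The quotient x / x' lies in S', and it is a unit
of T since x' / x lies in S. Domination makes it a unit of S', so S' contains the chart of x, and
the denominators used for S are units of S' for the same reason. -/
theorem toSubring_le_of_exceptionalFibre {R S S' T : LocalSubring (FunField K)}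
    (hS : S ∈ exceptionalFibre R) (hS' : S' ∈ exceptionalFibre R) (h : S ≤ T) (h' : S' ≤ T) :
    S.toSubring ≤ S'.toSubring := by
  obtain ⟨hRS, x, hx, hx0, hchart, hfrac⟩ := mem_exceptionalFibre_iff.mp hS
  obtain ⟨hRS', x', hx', hx0', hchart', -⟩ := mem_exceptionalFibre_iff.mp hS'
  have h1 : x / x' ∈ S'.toSubring := hchart' x hx
  have h2 : x' / x ∈ S'.toSubring := by
    have h3 : ¬ MM T (x / x') := by
      refine not_MM_of_inv_mem (div_ne_zero hx0 hx0') ?_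
      rw [inv_div]
      exact h.1 (hchart x' hx')
    have h4 := (inv_mem_of_le h' h1 h3).2
    rwa [inv_div] at h4
  have hle : blowUpChart R x ≤ S'.toSubring := by
    refine blowUpChart_le hRS'.1 fun y hy => ?_
    have h3 := S'.toSubring.mul_mem (hchart' y hy) h2
    rwa [div_mul_div_cancel₀ hx0'] at h3
  intro r hr
  obtain ⟨a, ha, b, hb, hb0, hbi, rfl⟩ := hfrac r hr
  rw [div_eq_mul_inv]
  exact S'.toSubring.mul_mem (hle ha) (inv_mem_of_le h' (hle hb)
    (not_MM_of_inv_mem hb0 (h.1 hbi))).2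

/-- Blow-ups are separated. -/
theorem eq_of_exceptionalFibre {R S S' T : LocalSubring (FunField K)}
    (hS : S ∈ exceptionalFibre R) (hS' : S' ∈ exceptionalFibre R) (h : S ≤ T) (h' : S' ≤ T) :
    S = S' :=
  LocalSubring.toSubring_injective (le_antisymm (toSubring_le_of_exceptionalFibre hS hS' h h')
    (toSubring_le_of_exceptionalFibre hS' hS h' h))

/-- The points of a surface obtained by blowing up points. -/
theorem mem_towerSurface {p : ℕ → LocalSubring (FunField K)} {m : ℕ} {R : LocalSubring (FunField K)}
    (h : R ∈ towerSurface p m) : (R ∈ planeModel K ∧ (1 ≤ m → R ≠ p 1)) ∨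
      ∃ i, 1 ≤ i ∧ i ≤ m ∧ R ∈ exceptionalFibre (p i) ∧ (i < m → R ≠ p (i + 1)) := by
  induction m with
  | zero => exact Or.inl ⟨h, by omega⟩
  | succ m ih =>
    rcases h with ⟨h, hne⟩ | h
    · have hne' : R ≠ p (m + 1) := hne
      rcases ih h with ⟨h1, h2⟩ | ⟨i, hi1, him, hi, h2⟩
      · refine Or.inl ⟨h1, fun _ => ?_⟩
        rcases Nat.eq_zero_or_pos m with rfl | hm
        · exact hne'
        · exact h2 hm
      · refine Or.inr ⟨i, hi1, by omega, hi, fun _ => ?_⟩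
        rcases Nat.lt_or_ge i m with him' | him'
        · exact h2 him'
        · rw [show i = m by omega]
          exact hne'
    · exact Or.inr ⟨m + 1, by omega, le_rfl, h, by omega⟩

/-- Successive blow-ups of the plane are separated. -/
theorem towerSurface_separated (p : ℕ → LocalSubring (FunField K)) (m : ℕ)
    (hp : ∀ i, i < m → p (i + 1) ∈ towerSurface p i)
    {R S T : LocalSubring (FunField K)} (hR : R ∈ towerSurface p m) (hS : S ∈ towerSurface p m)
    (hRT : R ≤ T) (hST : S ≤ T) : R = S := by
  induction m generalizing R S with
  | zero =>
    obtain ⟨y, rfl⟩ := hR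
    obtain ⟨z, rfl⟩ := hS
    rw [point_eq_of_le hRT hST]
  | succ m ih =>
    have hp' : ∀ i, i < m → p (i + 1) ∈ towerSurface p i := fun i hi => hp i (by omega)
    -- A point of the exceptional fibre dominates the blown-up point, so T would dominate both that
    -- point and another point of the previous surface.
    have key : ∀ {R S}, R ∈ towerSurface p m → R ≠ p (m + 1) → S ∈ exceptionalFibre (p (m + 1)) →
        R ≤ T → S ≤ T → False := fun {R S} hR hne hS hRT hST =>
      hne (ih hp' hR (hp m (by omega)) hRT (hS.1.trans hST))
    rcases hR with ⟨hR, hne⟩ | hR <;> rcases hS with ⟨hS, hne'⟩ | hS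
    · exact ih hp' hR hS hRT hST
    · exact (key hR hne hS hRT hST).elim
    · exact (key hS hne' hR hST hRT).elim
    · exact eq_of_exceptionalFibre hR hS hRT hST

theorem IsTower.mem_towerSurface {p : ℕ → LocalSubring (FunField K)} {m : ℕ} (h : IsTower p m)
    {i : ℕ} (hi : i < m) : p (i + 1) ∈ towerSurface p i := by
  cases i with
  | zero => exact h.1
  | succ i => exact Or.inr (h.2 (i + 1) (by omega) hi)

end Exceptional

/-! ### Coordinates -/

section Coordinates

variable {K : Type u} [Field K]

open MvPolynomial

/-- `s` and `t` generate the function field. -/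
def IsCoord (s t : FunField K) : Prop := IntermediateField.adjoin K {s, t} = ⊤

theorem isCoord_uv : IsCoord (uFun K) (vFun K) := by
  rw [IsCoord, eq_top_iff]
  intro r _
  obtain ⟨A, B, -, rfl⟩ := IsFractionRing.div_surjective (A := MvPolynomial (Fin 2) K) r
  have key : ∀ A : MvPolynomial (Fin 2) K, algebraMap _ (FunField K) A ∈
      IntermediateField.adjoin K {uFun K, vFun K} := by
    intro A
    induction A using MvPolynomial.induction_on with
    | C c => exact IntermediateField.algebraMap_mem _ c
    | add p q hp hq => rw [map_add]; exact add_mem hp hq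
    | mul_X p i hp =>
      rw [map_mul]
      refine mul_mem hp (IntermediateField.subset_adjoin _ _ ?_)
      fin_cases i
      · exact Or.inl rfl
      · exact Or.inr rfl
  exact div_mem (key A) (key B)

theorem IsCoord.of_mem {s t s' t' : FunField K} (h : IsCoord s t)
    (hs : s ∈ IntermediateField.adjoin K {s', t'}) (ht : t ∈ IntermediateField.adjoin K {s', t'}) :
    IsCoord s' t' := by
  rw [IsCoord, eq_top_iff, ← show _ = _ from h, IntermediateField.adjoin_le_iff]
  rintro r (rfl | rfl)
  exacts [hs, ht]

/-- The field has transcendence degree at least two and is algebraic over the field generated by s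
and t; two such generators are independent. -/
theorem IsCoord.algebraicIndependent {s t : FunField K} (h : IsCoord s t) :
    AlgebraicIndependent K ![s, t] := by
  have hrange : Set.range ![s, t] = {s, t} := by simp [Set.pair_comm]
  have h2 : (2 : Cardinal.{u}) ≤ Algebra.trdeg K (FunField K) := by
    have h3 : AlgebraicIndependent K (X : Fin 2 → MvPolynomial (Fin 2) K) := by
      rw [algebraicIndependent_iff_injective_aeval, aeval_X_left]
      exact Function.injective_id
    have h4 := h3.map' (f := IsScalarTower.toAlgHom K (MvPolynomial (Fin 2) K) (FunField K))
      (IsFractionRing.injective (MvPolynomial (Fin 2) K) (FunField K))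
    have h5 := h4.lift_cardinalMk_le_trdeg
    simpa using h5
  have : Algebra.IsAlgebraic (Algebra.adjoin K (Set.range ![s, t])) (FunField K) := by
    refine ⟨fun r => ?_⟩
    have hr : r ∈ IntermediateField.adjoin K {s, t} := by
      rw [show _ = _ from h]
      trivial
    rw [← hrange] at hr
    obtain ⟨a, ha, b, hb, rfl⟩ := IntermediateField.mem_adjoin_iff_div.mp hr
    by_cases hb0 : b = 0
    · simpa [hb0] using isAlgebraic_zero
    refine ⟨Polynomial.C ⟨b, hb⟩ * Polynomial.X - Polynomial.C ⟨a, ha⟩, fun h0 => hb0 ?_, ?_⟩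
    · have := congrArg (fun q => Polynomial.coeff q 1) h0
      exact congrArg Subtype.val (show (⟨b, hb⟩ : Algebra.adjoin K (Set.range ![s, t])) = 0 by
        simpa [Polynomial.coeff_C] using this)
    · simp only [map_sub, map_mul, Polynomial.aeval_X, Polynomial.aeval_C]
      rw [show (algebraMap (Algebra.adjoin K (Set.range ![s, t])) (FunField K)) ⟨b, hb⟩ = b from rfl,
        show (algebraMap (Algebra.adjoin K (Set.range ![s, t])) (FunField K)) ⟨a, ha⟩ = a from rfl]
      field_simp
      simp
  exact (Algebra.IsAlgebraic.isTranscendenceBasis_of_lift_le_trdeg_of_finite K ![s, t]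
    (by simpa using h2)).1

theorem IsCoord.symm {s t : FunField K} (h : IsCoord s t) : IsCoord t s := by
  rw [IsCoord, Set.pair_comm]
  exact h

theorem IsCoord.aeval_ne_zero {s t : FunField K} (h : IsCoord s t) {A : MvPolynomial (Fin 2) K}
    (hA : A ≠ 0) : aeval (R := K) ![s, t] A ≠ 0 := fun h0 => hA
  ((algebraicIndependent_iff_injective_aeval.mp h.algebraicIndependent) (h0.trans (map_zero _).symm))

theorem IsCoord.ne_zero {s t : FunField K} (h : IsCoord s t) : s ≠ 0 := by
  simpa using h.aeval_ne_zero (X_ne_zero (R := K) (0 : Fin 2))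

/-- The coordinates `s`, `t / s - c` of the blow-up of the origin. -/
theorem IsCoord.div_sub {s t : FunField K} (h : IsCoord s t) (c : K) :
    IsCoord s (t / s - algebraMap K _ c) := by
  have h1 : s ∈ IntermediateField.adjoin K {s, t / s - algebraMap K (FunField K) c} :=
    IntermediateField.mem_adjoin_pair_left _ _ _
  have h2 : t / s - algebraMap K (FunField K) c ∈
      IntermediateField.adjoin K {s, t / s - algebraMap K (FunField K) c} :=
    IntermediateField.mem_adjoin_pair_right _ _ _
  refine h.of_mem h1 ?_
  have h3 := mul_mem (add_mem h2 (IntermediateField.algebraMap_mem _ c)) h1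
  rwa [sub_add_cancel, div_mul_cancel₀ _ h.ne_zero] at h3

theorem IsCoord.div {s t : FunField K} (h : IsCoord s t) : IsCoord s (t / s) := by
  simpa using h.div_sub 0

/-- The isomorphism of the polynomial ring with `K[s, t]`. -/
def IsCoord.equiv {s t : FunField K} (h : IsCoord s t) :
    MvPolynomial (Fin 2) K ≃+* (Algebra.adjoin K {s, t}).toSubring :=
  (h.algebraicIndependent.aevalEquiv.trans (Subalgebra.equivOfEq _ _ (by
    rw [show Set.range ![s, t] = {s, t} by simp [Set.pair_comm]]))).toRingEquiv

theorem IsCoord.coe_equiv {s t : FunField K} (h : IsCoord s t) (A : MvPolynomial (Fin 2) K) :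
    (h.equiv A : FunField K) = aeval (R := K) ![s, t] A := rfl

/-- The localization of `K[s, t]` at a prime ideal. -/
def IsCoord.ring {s t : FunField K} (h : IsCoord s t) (𝔮 : Ideal (MvPolynomial (Fin 2) K))
    [h𝔮 : 𝔮.IsPrime] : LocalSubring (FunField K) :=
  haveI : (𝔮.comap h.equiv.symm).IsPrime := Ideal.comap_isPrime _ _
  LocalSubring.ofPrime (Algebra.adjoin K {s, t}).toSubring (𝔮.comap h.equiv.symm)

theorem IsCoord.mem_ring {s t : FunField K} (h : IsCoord s t)
    {𝔮 : Ideal (MvPolynomial (Fin 2) K)} [h𝔮 : 𝔮.IsPrime] {r : FunField K} :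
    r ∈ (h.ring 𝔮).toSubring ↔ ∃ A B, B ∉ 𝔮 ∧ r = aeval (R := K) ![s, t] A / aeval (R := K) ![s, t] B := by
  have : (𝔮.comap h.equiv.symm).IsPrime := Ideal.comap_isPrime _ _
  refine mem_ofPrime.trans ⟨?_, ?_⟩
  · rintro ⟨a, b, hb, rfl⟩
    refine ⟨h.equiv.symm a, h.equiv.symm b, hb, ?_⟩
    rw [← h.coe_equiv, ← h.coe_equiv, RingEquiv.apply_symm_apply, RingEquiv.apply_symm_apply]
  · rintro ⟨A, B, hB, rfl⟩
    refine ⟨h.equiv A, h.equiv B, ?_, ?_⟩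
    · rwa [Ideal.mem_comap, RingEquiv.symm_apply_apply]
    · rw [h.coe_equiv, h.coe_equiv]

theorem IsCoord.MM_ring {s t : FunField K} (h : IsCoord s t)
    {𝔮 : Ideal (MvPolynomial (Fin 2) K)} [h𝔮 : 𝔮.IsPrime] {A : MvPolynomial (Fin 2) K} :
    MM (h.ring 𝔮) (aeval (R := K) ![s, t] A) ↔ A ∈ 𝔮 := by
  have : (𝔮.comap h.equiv.symm).IsPrime := Ideal.comap_isPrime _ _
  rw [← h.coe_equiv]
  refine (MM_ofPrime _).trans ?_
  rw [Ideal.mem_comap, RingEquiv.symm_apply_apply]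

theorem IsCoord.aeval_mem_ring {s t : FunField K} (h : IsCoord s t)
    {𝔮 : Ideal (MvPolynomial (Fin 2) K)} [h𝔮 : 𝔮.IsPrime] (A : MvPolynomial (Fin 2) K) :
    aeval (R := K) ![s, t] A ∈ (h.ring 𝔮).toSubring :=
  h.mem_ring.mpr ⟨A, 1, fun h1 => h𝔮.ne_top ((Ideal.eq_top_iff_one _).mpr h1), by simp⟩

theorem ker_constantCoeff_eq : RingHom.ker (constantCoeff : MvPolynomial (Fin 2) K →+* K) =
    Ideal.span {X 0, X 1} := by
  have h := pow_idealOfVars_eq_span (σ := Fin 2) (R := K) 1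
  ext A
  have h2 := mem_pow_idealOfVars_iff' (σ := Fin 2) (R := K) 1 A
  rw [pow_one] at h2
  have h3 : idealOfVars (Fin 2) K = Ideal.span {X 0, X 1} := by
    rw [idealOfVars]
    congr 1
    ext B
    simp [eq_comm]
  rw [← h3, h2, RingHom.mem_ker, constantCoeff_eq]
  constructor
  · intro h0 e he
    have : e = 0 := by
      rw [← Finsupp.degree_eq_zero_iff]
      omega
    rw [this, h0]
  · intro h0
    exact h0 0 (by simp)

instance isPrime_ker_constantCoeff :
    (RingHom.ker (constantCoeff : MvPolynomial (Fin 2) K →+* K)).IsPrime := RingHom.ker_isPrime _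

/-- For coordinates, (s, t) corresponds to the kernel of the constant coefficient and is prime, so
the default value ⊤ of `originRing` does not occur. -/
theorem IsCoord.originRing_eq {s t : FunField K} (h : IsCoord s t) :
    originRing s t = h.ring (RingHom.ker constantCoeff) := by
  have h1 : originIdeal s t = (RingHom.ker constantCoeff).comap h.equiv.symm := by
    rw [ker_constantCoeff_eq, ← Ideal.map_symm, RingEquiv.symm_symm, Ideal.map_span, originIdeal]
    congr 1
    ext r
    have hX0 : (h.equiv (X 0) : FunField K) = s := by simp [h.coe_equiv]
    have hX1 : (h.equiv (X 1) : FunField K) = t := by simp [h.coe_equiv]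
    rw [Set.image_pair, Set.mem_ofPred_eq, Set.mem_insert_iff, Set.mem_singleton_iff,
      Subtype.ext_iff, Subtype.ext_iff, hX0, hX1]
  have h2 : (originIdeal s t).IsPrime := by
    rw [h1]
    exact Ideal.comap_isPrime _ _
  rw [originRing, dif_pos h2, IsCoord.ring]
  congr 1

theorem IsCoord.mem_originRing {s t : FunField K} (h : IsCoord s t) {r : FunField K} :
    r ∈ (originRing s t).toSubring ↔
      ∃ A B, constantCoeff B ≠ 0 ∧ r = aeval (R := K) ![s, t] A / aeval (R := K) ![s, t] B := by
  rw [h.originRing_eq]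
  exact h.mem_ring

theorem IsCoord.MM_originRing {s t : FunField K} (h : IsCoord s t)
    {A : MvPolynomial (Fin 2) K} :
    MM (originRing s t) (aeval (R := K) ![s, t] A) ↔ constantCoeff A = 0 := by
  rw [h.originRing_eq]
  exact h.MM_ring

theorem IsCoord.aeval_mem_originRing {s t : FunField K} (h : IsCoord s t)
    (A : MvPolynomial (Fin 2) K) : aeval (R := K) ![s, t] A ∈ (originRing s t).toSubring := by
  rw [h.originRing_eq]
  exact h.aeval_mem_ring A

theorem IsCoord.MM_left {s t : FunField K} (h : IsCoord s t) : MM (originRing s t) s := by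
  simpa using h.MM_originRing.mpr (constantCoeff_X (R := K) (0 : Fin 2))

theorem IsCoord.MM_right {s t : FunField K} (h : IsCoord s t) : MM (originRing s t) t := by
  simpa using h.MM_originRing.mpr (constantCoeff_X (R := K) (1 : Fin 2))

theorem IsCoord.algebraMap_mem {s t : FunField K} (h : IsCoord s t) (c : K) :
    algebraMap K _ c ∈ (originRing s t).toSubring := by
  simpa using h.aeval_mem_originRing (C c)

theorem not_MM_algebraMap {R : LocalSubring (FunField K)}
    (hK : ∀ c : K, algebraMap K _ c ∈ R.toSubring) {c : K} (hc : c ≠ 0) :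
    ¬ MM R (algebraMap K _ c) :=
  not_MM_of_inv_mem (by simpa using hc) (by rw [← map_inv₀]; exact hK _)

theorem aeval_mem_of_mem {σ : Type*} {R : Subring (FunField K)} (hK : ∀ c : K, algebraMap K _ c ∈ R)
    {f : σ → FunField K} (hf : ∀ i, f i ∈ R) (A : MvPolynomial σ K) : aeval f A ∈ R := by
  induction A using MvPolynomial.induction_on with
  | C c => rw [algHom_C]; exact hK c
  | add p q hp hq => rw [map_add]; exact R.add_mem hp hq
  | mul_X p i hp => rw [map_mul, aeval_X]; exact R.mul_mem hp (hf i)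

theorem exists_eq_constantCoeff_add (A : MvPolynomial (Fin 2) K) :
    ∃ A₀ A₁, A = C (constantCoeff A) + X 0 * A₀ + X 1 * A₁ := by
  have h : A - C (constantCoeff A) ∈ RingHom.ker (constantCoeff : MvPolynomial (Fin 2) K →+* K) := by
    simp [RingHom.mem_ker]
  rw [ker_constantCoeff_eq, Ideal.mem_span_pair] at h
  obtain ⟨a, b, h⟩ := h
  exact ⟨a, b, by linear_combination -h⟩

/-- The local ring at the origin is dominated by each local ring in whose maximal ideal the
coordinates lie. -/
theorem IsCoord.originRing_le {s t : FunField K} (h : IsCoord s t) {S : LocalSubring (FunField K)}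
    (hK : ∀ c : K, algebraMap K _ c ∈ S.toSubring) (hs : MM S s) (ht : MM S t) :
    originRing s t ≤ S := by
  have hmem : ∀ A, aeval (R := K) ![s, t] A ∈ S.toSubring := fun A => by
    refine aeval_mem_of_mem hK (fun i => ?_) A
    fin_cases i
    exacts [hs.mem, ht.mem]
  have hMM : ∀ A, constantCoeff A = 0 → MM S (aeval (R := K) ![s, t] A) := fun A hA => by
    obtain ⟨A₀, A₁, hA'⟩ := exists_eq_constantCoeff_add A
    rw [hA', hA]
    simp only [map_zero, map_add, zero_add, map_mul, aeval_X, Matrix.cons_val_zero,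
      Matrix.cons_val_one]
    exact (hs.mul_right (hmem A₀)).add (ht.mul_right (hmem A₁))
  have hinv : ∀ B, constantCoeff B ≠ 0 → (aeval (R := K) ![s, t] B)⁻¹ ∈ S.toSubring := fun B hB => by
    refine (inv_mem_of_not_MM (hmem B) fun h0 => ?_).2
    have h1 := hMM (B - C (constantCoeff B)) (by simp)
    have h2 := h0.sub h1
    rw [map_sub, sub_sub_cancel, algHom_C] at h2
    exact not_MM_algebraMap hK hB h2
  refine le_iff_MM.mpr ⟨fun r hr => ?_, fun r hr => ?_⟩
  · obtain ⟨A, B, hB, rfl⟩ := h.mem_originRing.mp hr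
    rw [div_eq_mul_inv]
    exact S.toSubring.mul_mem (hmem A) (hinv B hB)
  · obtain ⟨A, B, hB, rfl⟩ := h.mem_originRing.mp hr.mem
    rw [div_eq_mul_inv]
    refine (hMM A ?_).mul_right (hinv B hB)
    have h1 := hr.mul_right (h.aeval_mem_originRing B)
    rw [div_mul_cancel₀ _ (h.aeval_ne_zero (by rintro rfl; simp at hB))] at h1
    exact h.MM_originRing.mp h1

theorem IsCoord.originRing_comm {s t : FunField K} (h : IsCoord s t) :
    originRing s t = originRing t s :=
  le_antisymm (h.originRing_le h.symm.algebraMap_mem h.symm.MM_right h.symm.MM_left)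
    (h.symm.originRing_le h.algebraMap_mem h.MM_right h.MM_left)

/-- The residue field at the origin is K: the constant is the quotient of the constant coefficients.
-/
theorem IsCoord.exists_MM_sub {s t : FunField K} (h : IsCoord s t) {r : FunField K}
    (hr : r ∈ (originRing s t).toSubring) : ∃ c : K, MM (originRing s t) (r - algebraMap K _ c) := by
  obtain ⟨A, B, hB, rfl⟩ := h.mem_originRing.mp hr
  have hB0 : aeval (R := K) ![s, t] B ≠ 0 := h.aeval_ne_zero (by rintro rfl; simp at hB)
  refine ⟨constantCoeff A / constantCoeff B, ?_⟩
  have h1 : (aeval (R := K) ![s, t] B)⁻¹ ∈ (originRing s t).toSubring :=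
    h.mem_originRing.mpr ⟨1, B, hB, by simp⟩
  have h2 := ((h.MM_originRing (A := A - C (constantCoeff A / constantCoeff B) * B)).mpr
    (by simp [div_mul_cancel₀ _ hB])).mul_right h1
  convert h2 using 1
  rw [map_sub, map_mul, algHom_C, sub_mul, mul_assoc, mul_inv_cancel₀ hB0, mul_one, div_eq_mul_inv]

theorem IsCoord.exists_eq_of_MM {s t : FunField K} (h : IsCoord s t) {r : FunField K}
    (hr : MM (originRing s t) r) :
    ∃ a ∈ (originRing s t).toSubring, ∃ b ∈ (originRing s t).toSubring, r = s * a + t * b := by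
  obtain ⟨A, B, hB, rfl⟩ := h.mem_originRing.mp hr.mem
  have hB0 : aeval (R := K) ![s, t] B ≠ 0 := h.aeval_ne_zero (by rintro rfl; simp at hB)
  have h1 := hr.mul_right (h.aeval_mem_originRing B)
  rw [div_mul_cancel₀ _ hB0, h.MM_originRing] at h1
  obtain ⟨A₀, A₁, hA'⟩ := exists_eq_constantCoeff_add A
  refine ⟨_, h.mem_originRing.mpr ⟨A₀, B, hB, rfl⟩, _, h.mem_originRing.mpr ⟨A₁, B, hB, rfl⟩, ?_⟩
  rw [hA', h1]
  simp only [map_zero, map_add, zero_add, map_mul, aeval_X, Matrix.cons_val_zero,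
    Matrix.cons_val_one]
  ring

theorem IsCoord.algebraMap_mem_ring {s t : FunField K} (h : IsCoord s t)
    (𝔮 : Ideal (MvPolynomial (Fin 2) K)) [h𝔮 : 𝔮.IsPrime] (c : K) :
    algebraMap K _ c ∈ (h.ring 𝔮).toSubring := by
  simpa using h.aeval_mem_ring (C c)

/-- The points of the exceptional fibre with `t / s` regular, in coordinates. -/
theorem IsCoord.ring_mem_exceptionalFibre {s t : FunField K} (h : IsCoord s t) (c : K)
    (𝔮 : Ideal (MvPolynomial (Fin 2) K)) [h𝔮 : 𝔮.IsPrime] (h0 : X 0 ∈ 𝔮) :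
    (h.div_sub c).ring 𝔮 ∈ exceptionalFibre (originRing s t) := by
  have h' := h.div_sub c
  have hs : MM ((h.div_sub c).ring 𝔮) s := by simpa using (h.div_sub c).MM_ring.mpr h0
  have hts : t / s ∈ ((h.div_sub c).ring 𝔮).toSubring := by
    have h1 := Subring.add_mem _ ((h.div_sub c).aeval_mem_ring (X 1) (𝔮 := 𝔮))
      ((h.div_sub c).algebraMap_mem_ring 𝔮 c)
    simpa using h1
  have ht : MM ((h.div_sub c).ring 𝔮) t := by
    have h1 := hs.mul_right hts
    rwa [mul_div_cancel₀ _ h.ne_zero] at h1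
  have hle := h.originRing_le ((h.div_sub c).algebraMap_mem_ring 𝔮) hs ht
  have hchart : ∀ A, aeval (R := K) ![s, t / s - algebraMap K _ c] A ∈
      blowUpChart (originRing s t) s := by
    intro A
    refine aeval_mem_of_mem (fun c => le_blowUpChart _ _ (h.algebraMap_mem c)) (fun i => ?_) A
    fin_cases i
    · exact le_blowUpChart _ _ h.MM_left.mem
    · exact Subring.sub_mem _ (mem_blowUpChart_of_MM h.MM_right)
        (le_blowUpChart _ _ (h.algebraMap_mem c))
  refine mem_exceptionalFibre_iff.mpr ⟨hle, s, h.MM_left, h.ne_zero, fun y hy => ?_, fun r hr => ?_⟩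
  · obtain ⟨a, ha, b, hb, rfl⟩ := h.exists_eq_of_MM hy
    rw [add_div, mul_div_cancel_left₀ _ h.ne_zero, mul_div_right_comm]
    exact Subring.add_mem _ (hle.1 ha) (Subring.mul_mem _ hts (hle.1 hb))
  · obtain ⟨A, B, hB, rfl⟩ := (h.div_sub c).mem_ring.mp hr
    have hB0 : aeval (R := K) ![s, t / s - algebraMap K _ c] B ≠ 0 :=
      h'.aeval_ne_zero (by rintro rfl; exact hB 𝔮.zero_mem)
    exact ⟨_, hchart A, _, hchart B, hB0, (h.div_sub c).mem_ring.mpr ⟨1, B, hB, by simp⟩, rfl⟩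

/-- The next point of a tower, in coordinates. -/
theorem IsCoord.originRing_mem_exceptionalFibre {s t : FunField K} (h : IsCoord s t) (c : K) :
    originRing s (t / s - algebraMap K _ c) ∈ exceptionalFibre (originRing s t) := by
  rw [(h.div_sub c).originRing_eq]
  exact h.ring_mem_exceptionalFibre c _ (by simp [RingHom.mem_ker])

end Coordinates

/-! ### The points of an exceptional fibre -/

section Fibre

variable {K : Type u} [Field K]

open Polynomial

/-- The residue field is algebraic over `K`. -/
def IsAlg (R : LocalSubring (FunField K)) : Prop :=
  (∀ c : K, algebraMap K _ c ∈ R.toSubring) ∧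
    ∀ r ∈ R.toSubring, ∃ π : K[X], π ≠ 0 ∧ MM R (aeval r π)

/-- The residue class of `g` is transcendental over `K`. -/
def IsGeneric (R : LocalSubring (FunField K)) (g : FunField K) : Prop :=
  g ∈ R.toSubring ∧ ∀ π : K[X], π ≠ 0 → ¬ MM R (aeval g π)

theorem polynomial_aeval_mem {R : Subring (FunField K)} (hK : ∀ c : K, algebraMap K _ c ∈ R)
    {g : FunField K} (hg : g ∈ R) (π : K[X]) : aeval g π ∈ R := by
  induction π using Polynomial.induction_on' with
  | add p q hp hq => rw [map_add]; exact R.add_mem hp hq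
  | monomial k c => rw [aeval_monomial]; exact R.mul_mem (hK c) (R.pow_mem hg k)

theorem IsCoord.isAlg {s t : FunField K} (h : IsCoord s t) : IsAlg (originRing s t) := by
  refine ⟨h.algebraMap_mem, fun r hr => ?_⟩
  obtain ⟨c, hc⟩ := h.exists_MM_sub hr
  exact ⟨X - C c, X_sub_C_ne_zero c, by simpa using hc⟩

/-- Suppose a is in the maximal ideal of S but a unit of R. It satisfies an algebraic relation
modulo the maximal ideal of R, and powers of a can be cancelled, which leaves q(a) with q(0) ≠ 0.
Such a q(a) is a unit of S, hence of R: a contradiction. This makes points with algebraic residue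
field closed on the blown-up surface. -/
theorem IsAlg.le {R S : LocalSubring (FunField K)} (hR : IsAlg R)
    (hK : ∀ c : K, algebraMap K _ c ∈ S.toSubring) (hSR : S.toSubring ≤ R.toSubring) : S ≤ R := by
  refine le_of_not_MM hSR fun a ha => ?_
  by_contra hna
  obtain ⟨π, h0, h1⟩ := hR.2 a (hSR ha.mem)
  obtain ⟨q, hq, hdvd⟩ := exists_eq_pow_rootMultiplicity_mul_and_not_dvd π h0 0
  have hq0 : q.coeff 0 ≠ 0 := by
    rw [C_0, sub_zero, X_dvd_iff] at hdvd
    exact hdvd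
  have hqS : aeval a q.divX ∈ S.toSubring := polynomial_aeval_mem hK ha.mem _
  have hqR : aeval a q ∈ R.toSubring := polynomial_aeval_mem hR.1 (hSR ha.mem) _
  rw [hq, map_mul, map_pow, C_0, sub_zero, aeval_X,
    MM.mul_iff (Subring.pow_mem _ (hSR ha.mem) _) hqR] at h1
  have h2 : MM R (aeval a q) := h1.resolve_left fun h => hna (MM.of_pow (hSR ha.mem) h)
  have h3 : aeval a q = aeval a q.divX * a + algebraMap K _ (q.coeff 0) := by
    conv_lhs => rw [← divX_mul_X_add q]
    simp
  have h4 : ¬ MM S (aeval a q) := by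
    rw [h3]
    exact not_MM_add_right (ha.mul_left hqS) (not_MM_algebraMap hK hq0)
  have h5 := inv_mem_of_not_MM (polynomial_aeval_mem hK ha.mem q) h4
  exact not_MM_of_inv_mem h5.1 (hSR h5.2) h2

theorem algebraMap_mem_towerSurface {p : ℕ → LocalSubring (FunField K)} {m : ℕ}
    (hp : ∀ i, i < m → ∀ c : K, algebraMap K _ c ∈ (p (i + 1)).toSubring)
    {R : LocalSubring (FunField K)} (hR : R ∈ towerSurface p m) (c : K) :
    algebraMap K _ c ∈ R.toSubring := by
  rcases mem_towerSurface hR with ⟨⟨y, rfl⟩, -⟩ | ⟨i, hi, him, h, -⟩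
  · exact algebraMap_mem_localRing y c
  · obtain ⟨j, rfl⟩ : ∃ j, i = j + 1 := ⟨i - 1, by omega⟩
    exact (mem_exceptionalFibre_iff.mp h).1.1 (hp j (by omega) c)

/-- A local ring of the exceptional fibre is a ring of fractions of each chart it contains. -/
theorem exists_eq_div_of_exceptionalFibre {R S : LocalSubring (FunField K)}
    (hS : S ∈ exceptionalFibre R) {x : FunField K} (hx : MM R x) (hx0 : x ≠ 0)
    (h : ∀ y, MM R y → y / x ∈ S.toSubring) {r : FunField K} (hr : r ∈ S.toSubring) :
    ∃ a ∈ blowUpChart R x, ∃ b ∈ blowUpChart R x, b ≠ 0 ∧ b⁻¹ ∈ S.toSubring ∧ r = a / b := by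
  have hRS := (mem_exceptionalFibre_iff.mp hS).1
  have hle : blowUpChart R x ≤ S.toSubring := blowUpChart_le hRS.1 h
  let P : Ideal (blowUpChart R x) :=
    (IsLocalRing.maximalIdeal S.toSubring).comap (Subring.inclusion hle)
  have hP : P.IsPrime := Ideal.comap_isPrime _ _
  have hPm : ∀ a : blowUpChart R x, a ∈ P ↔ MM S a := fun a =>
    mem_maximalIdeal_iff (⟨a, hle a.2⟩ : S.toSubring)
  let S' := LocalSubring.ofPrime (blowUpChart R x) P
  have hS'S : S' ≤ S := by
    refine le_iff_MM.mpr ⟨fun r hr => ?_, fun r hr => ?_⟩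
    · obtain ⟨a, b, hb, rfl⟩ := mem_ofPrime.mp hr
      rw [div_eq_mul_inv]
      exact S.toSubring.mul_mem (hle a.2)
        (inv_mem_of_not_MM (hle b.2) fun h => hb ((hPm b).mpr h)).2
    · obtain ⟨a, b, hb, rfl⟩ := mem_ofPrime.mp hr.mem
      have hbi := inv_mem_of_not_MM (hle b.2) fun h => hb ((hPm b).mpr h)
      have h1 := hr.mul_right (LocalSubring.le_ofPrime _ P b.2)
      rw [div_mul_cancel₀ _ hbi.1] at h1
      rw [div_eq_mul_inv]
      exact ((hPm a).mp ((MM_ofPrime a).mp h1)).mul_right hbi.2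
  have hRS' : R ≤ S' := by
    refine le_iff_MM.mpr ⟨fun r hr => LocalSubring.le_ofPrime _ P (le_blowUpChart R x hr),
      fun r hr => ?_⟩
    exact (MM_ofPrime (⟨r, le_blowUpChart R x hr.mem⟩ : blowUpChart R x)).mpr
      ((hPm _).mpr (hr.of_le hRS))
  have hS' : S' ∈ exceptionalFibre R :=
    ⟨hRS', ⟨x, hx.mem⟩, hx.mk_mem, fun h => hx0 (congrArg Subtype.val h), P, hP, rfl⟩
  -- The localization S' of the chart at the centre of S is itself a point of the fibre and is
  -- dominated by S; separatedness gives S' = S.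
  rw [← eq_of_exceptionalFibre hS' hS hS'S le_rfl] at hr
  obtain ⟨a, b, hb, rfl⟩ := mem_ofPrime.mp hr
  have hbi := inv_mem_of_not_MM (hle b.2) fun h => hb ((hPm b).mpr h)
  exact ⟨a, a.2, b, b.2, hbi.1, hbi.2, rfl⟩

namespace IsCoord

variable {s t : FunField K}

/-- Modulo s the chart is generated over K by t / s: the residue field at the origin is K, and (s a
+ t b) / s = a + (t / s) b. Elements of this shape form a subring containing the generators of the
chart. -/
theorem exists_eq_of_mem_blowUpChart (h : IsCoord s t) {a : FunField K}
    (ha : a ∈ blowUpChart (originRing s t) s) :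
    ∃ π : K[X], ∃ b ∈ blowUpChart (originRing s t) s, a = aeval (t / s) π + s * b := by
  have hg : t / s ∈ blowUpChart (originRing s t) s := mem_blowUpChart_of_MM h.MM_right
  have hK : ∀ c : K, algebraMap K _ c ∈ blowUpChart (originRing s t) s := fun c =>
    le_blowUpChart _ _ (h.algebraMap_mem c)
  have hs : s ∈ blowUpChart (originRing s t) s := le_blowUpChart _ _ h.MM_left.mem
  let A : Subring (FunField K) :=
    { carrier := {a | ∃ π : K[X], ∃ b ∈ blowUpChart (originRing s t) s,
        a = aeval (t / s) π + s * b}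
      mul_mem' := by
        rintro _ _ ⟨π, b, hb, rfl⟩ ⟨π', b', hb', rfl⟩
        refine ⟨π * π', _, Subring.add_mem _ (Subring.add_mem _
          (Subring.mul_mem _ (polynomial_aeval_mem hK hg π) hb')
          (Subring.mul_mem _ (polynomial_aeval_mem hK hg π') hb))
          (Subring.mul_mem _ hs (Subring.mul_mem _ hb hb')), ?_⟩
        rw [map_mul]
        ring
      one_mem' := ⟨1, 0, Subring.zero_mem _, by simp⟩
      add_mem' := by
        rintro _ _ ⟨π, b, hb, rfl⟩ ⟨π', b', hb', rfl⟩
        exact ⟨π + π', _, Subring.add_mem _ hb hb', by rw [map_add]; ring⟩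
      zero_mem' := ⟨0, 0, Subring.zero_mem _, by simp⟩
      neg_mem' := by
        rintro _ ⟨π, b, hb, rfl⟩
        exact ⟨-π, _, Subring.neg_mem _ hb, by rw [map_neg]; ring⟩ }
  have hgA : t / s ∈ A := ⟨X, 0, Subring.zero_mem _, by simp⟩
  have hdiv : ∀ y, MM (originRing s t) y → ∃ a ∈ (originRing s t).toSubring,
      ∃ b ∈ (originRing s t).toSubring, y = s * a + t * b ∧ y / s = a + t / s * b := by
    intro y hy
    obtain ⟨a, ha, b, hb, rfl⟩ := h.exists_eq_of_MM hy
    refine ⟨a, ha, b, hb, rfl, ?_⟩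
    rw [add_div, mul_div_cancel_left₀ _ h.ne_zero, mul_div_right_comm]
  have hRA : (originRing s t).toSubring ≤ A := by
    intro r hr
    obtain ⟨c, hc⟩ := h.exists_MM_sub hr
    refine ⟨C c, _, mem_blowUpChart_of_MM hc, ?_⟩
    rw [mul_div_cancel₀ _ h.ne_zero, aeval_C]
    ring
  refine blowUpChart_le (S := A) hRA (fun y hy => ?_) ha
  obtain ⟨a, ha, b, hb, -, he⟩ := hdiv y hy
  rw [he]
  exact A.add_mem (hRA ha) (A.mul_mem hgA (hRA hb))

/-- The charts of s and t cover the fibre: with x = s a + t b one has 1 = (s/x) a + (t/x) b, so s/x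
or t/x is a unit at S. -/
theorem div_mem_of_exceptionalFibre (h : IsCoord s t) {S : LocalSubring (FunField K)}
    (hS : S ∈ exceptionalFibre (originRing s t)) :
    t / s ∈ S.toSubring ∨ s / t ∈ S.toSubring := by
  obtain ⟨hRS, x, hx, hx0, hchart, -⟩ := mem_exceptionalFibre_iff.mp hS
  obtain ⟨a, ha, b, hb, he⟩ := h.exists_eq_of_MM hx
  have hs := hchart s h.MM_left
  have ht := hchart t h.MM_right
  by_cases h1 : MM S (s / x)
  · right
    have h2 : ¬ MM S (t / x) := fun h2 => by
      have h3 := (h1.mul_right (hRS.1 ha)).add (h2.mul_right (hRS.1 hb))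
      have h4 : s / x * a + t / x * b = 1 := by
        rw [div_mul_eq_mul_div, div_mul_eq_mul_div, ← add_div, ← he, div_self hx0]
      rw [h4] at h3
      exact MM.not_one S h3
    have h3 := S.toSubring.mul_mem hs (inv_mem_of_not_MM ht h2).2
    rwa [inv_div, div_mul_div_cancel₀ hx0] at h3
  · left
    have h3 := S.toSubring.mul_mem ht (inv_mem_of_not_MM hs h1).2
    rwa [inv_div, div_mul_div_cancel₀ hx0] at h3

theorem div_mem_of_MM (h : IsCoord s t) {S : LocalSubring (FunField K)}
    (hRS : originRing s t ≤ S) (hg : t / s ∈ S.toSubring) {y : FunField K}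
    (hy : MM (originRing s t) y) : y / s ∈ S.toSubring := by
  obtain ⟨a, ha, b, hb, rfl⟩ := h.exists_eq_of_MM hy
  rw [add_div, mul_div_cancel_left₀ _ h.ne_zero, mul_div_right_comm]
  exact Subring.add_mem _ (hRS.1 ha) (Subring.mul_mem _ hg (hRS.1 hb))

/-- The residue field at S consists of quotients of polynomials in the class of t / s, because s
vanishes there. It is algebraic as soon as that class is. -/
theorem isAlg_or_isGeneric_of_mem (h : IsCoord s t) {S : LocalSubring (FunField K)}
    (hS : S ∈ exceptionalFibre (originRing s t)) (hg : t / s ∈ S.toSubring) :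
    IsAlg S ∨ IsGeneric S (t / s) := by
  have hRS := (mem_exceptionalFibre_iff.mp hS).1
  have hK : ∀ c : K, algebraMap K _ c ∈ S.toSubring := fun c => hRS.1 (h.algebraMap_mem c)
  have hle : blowUpChart (originRing s t) s ≤ S.toSubring :=
    blowUpChart_le hRS.1 fun y hy => h.div_mem_of_MM hRS hg hy
  by_cases hgen : IsGeneric S (t / s)
  · exact Or.inr hgen
  left
  have hgen' : ∃ π : K[X], π ≠ 0 ∧ MM S (aeval (t / s) π) := by
    by_contra hcon
    push Not at hcon
    exact hgen ⟨hg, hcon⟩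
  obtain ⟨π₀, hπ₀, hM⟩ := hgen'
  refine ⟨hK, fun r hr => ?_⟩
  let A : Subalgebra K (FunField K) := { S.toSubring with algebraMap_mem' := hK }
  have : IsLocalRing A := S.isLocalRing
  have hres : ∀ a : A, algebraMap A (IsLocalRing.ResidueField A) a = 0 ↔ MM S a := fun a =>
    (IsLocalRing.residue_eq_zero_iff a).trans (mem_maximalIdeal_iff (⟨a, a.2⟩ : S.toSubring))
  have hcoe : ∀ (a : A) (π : K[X]), ((aeval a π : A) : FunField K) = aeval (a : FunField K) π :=
    fun a π => (aeval_algebraMap_apply (FunField K) a π).symm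
  let κ := IsLocalRing.ResidueField A
  let g : A := ⟨t / s, hg⟩
  have hgalg : IsAlgebraic K (algebraMap A κ g) := by
    refine ⟨π₀, hπ₀, ?_⟩
    rw [aeval_algebraMap_apply]
    refine (hres _).mpr ?_
    rw [hcoe]
    exact hM
  have halg : ∀ a : A, (a : FunField K) ∈ blowUpChart (originRing s t) s →
      IsAlgebraic K (algebraMap A κ a) := by
    intro a ha
    obtain ⟨π, b, hb, he⟩ := h.exists_eq_of_mem_blowUpChart ha
    have h1 : algebraMap A κ a = aeval (algebraMap A κ g) π := by
      rw [aeval_algebraMap_apply, ← sub_eq_zero, ← map_sub]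
      refine (hres _).mpr ?_
      have h2 : ((a - aeval g π : A) : FunField K) = s * b := by
        rw [Subalgebra.coe_sub, hcoe, he]
        ring
      rw [h2]
      exact (h.MM_left.of_le hRS).mul_right (hle hb)
    rw [h1]
    have h2 : aeval (algebraMap A κ g) π ∈ integralClosure K κ :=
      Algebra.adjoin_le (Set.singleton_subset_iff.mpr hgalg.isIntegral)
        (aeval_mem_adjoin_singleton K _)
    exact IsIntegral.isAlgebraic h2
  obtain ⟨a, ha, b, hb, hb0, hbi, rfl⟩ :=
    exists_eq_div_of_exceptionalFibre hS h.MM_left h.ne_zero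
      (fun y hy => h.div_mem_of_MM hRS hg hy) hr
  let r' : A := ⟨a / b, hr⟩
  have hb' : algebraMap A κ ⟨b, hle hb⟩ ≠ 0 := fun h0 =>
    not_MM_of_inv_mem hb0 hbi ((hres _).mp h0)
  have h1 : algebraMap A κ r' = algebraMap A κ ⟨a, hle ha⟩ / algebraMap A κ ⟨b, hle hb⟩ := by
    rw [eq_div_iff hb', ← map_mul]
    congr 1
    exact Subtype.ext (div_mul_cancel₀ a hb0)
  have h2 : IsAlgebraic K (algebraMap A κ r') := by
    rw [h1, div_eq_mul_inv]
    exact (halg _ ha).mul (halg _ hb).inv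
  obtain ⟨π, h0, h3⟩ := h2
  refine ⟨π, h0, ?_⟩
  rw [aeval_algebraMap_apply] at h3
  have h4 := (hres _).mp h3
  rwa [hcoe] at h4

end IsCoord

theorem IsGeneric.ne_zero {R : LocalSubring (FunField K)} {g : FunField K} (h : IsGeneric R g) :
    g ≠ 0 := by
  rintro rfl
  refine h.2 X X_ne_zero ?_
  rw [aeval_X]
  exact MM.zero R

theorem IsGeneric.inv {R : LocalSubring (FunField K)} {g : FunField K} (h : IsGeneric R g) :
    IsGeneric R g⁻¹ := by
  have h1 : ¬ MM R g := by simpa using h.2 X X_ne_zero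
  refine ⟨(inv_mem_of_not_MM h.1 h1).2, fun π hπ hM => ?_⟩
  -- A relation for g⁻¹, multiplied by a power of g, is the relation for g with reversed
  -- coefficients.
  refine h.2 π.reverse (by simpa using hπ) ?_
  have h2 : aeval g π.reverse = aeval g⁻¹ π * g ^ π.natDegree := by
    have h0 := inv_ne_zero h.ne_zero
    let := invertibleOfNonzero h0
    have h2 := eval₂_reverse_mul_pow (algebraMap K (FunField K)) g⁻¹ π
    rw [invOf_eq_inv, inv_inv] at h2
    rw [aeval_def, aeval_def, ← h2, mul_assoc, ← mul_pow, inv_mul_cancel₀ h.ne_zero, one_pow,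
      mul_one]
  rw [h2]
  exact hM.mul_right (Subring.pow_mem _ h.1 _)

namespace IsCoord

variable {s t : FunField K}

/-- A denominator at S has the form π(t/s) + s b'. Here π ≠ 0, since s b' alone vanishes at S; and
for π ≠ 0 the sum is a unit wherever t / s is transcendental and s vanishes. -/
theorem toSubring_le_of_isGeneric (h : IsCoord s t) {S T : LocalSubring (FunField K)}
    (hS : S ∈ exceptionalFibre (originRing s t)) (hg : t / s ∈ S.toSubring)
    (hRT : originRing s t ≤ T) (hT : IsGeneric T (t / s)) : S.toSubring ≤ T.toSubring := by
  have hRS := (mem_exceptionalFibre_iff.mp hS).1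
  have hleS : blowUpChart (originRing s t) s ≤ S.toSubring :=
    blowUpChart_le hRS.1 fun y hy => h.div_mem_of_MM hRS hg hy
  have hleT : blowUpChart (originRing s t) s ≤ T.toSubring :=
    blowUpChart_le hRT.1 fun y hy => h.div_mem_of_MM hRT hT.1 hy
  intro r hr
  obtain ⟨a, ha, b, hb, hb0, hbi, rfl⟩ :=
    exists_eq_div_of_exceptionalFibre hS h.MM_left h.ne_zero
      (fun y hy => h.div_mem_of_MM hRS hg hy) hr
  rw [div_eq_mul_inv]
  refine T.toSubring.mul_mem (hleT ha) (inv_mem_of_not_MM (hleT hb) ?_).2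
  obtain ⟨π, b', hb', rfl⟩ := h.exists_eq_of_mem_blowUpChart hb
  by_cases hπ : π = 0
  · subst hπ
    rw [map_zero, zero_add] at hbi hb0
    exact absurd ((h.MM_left.of_le hRS).mul_right (hleS hb')) (not_MM_of_inv_mem hb0 hbi)
  · exact not_MM_add_left (hT.2 π hπ) ((h.MM_left.of_le hRT).mul_right (hleT hb'))

theorem isExceptionalCurve_of_isGeneric (h : IsCoord s t) {E : LocalSubring (FunField K)}
    (hE : E ∈ exceptionalFibre (originRing s t)) (hg : IsGeneric E (t / s)) :
    IsExceptionalCurve (originRing s t) E := by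
  have hRE := (mem_exceptionalFibre_iff.mp hE).1
  refine ⟨hE, fun S hS => ?_⟩
  rcases h.div_mem_of_exceptionalFibre hS with h1 | h1
  · exact h.toSubring_le_of_isGeneric hS h1 hRE hg
  · rw [h.originRing_comm] at hS hRE
    refine h.symm.toSubring_le_of_isGeneric hS h1 hRE ?_
    rw [← inv_div]
    exact hg.inv

/-- The points of the exceptional fibre are closed points and the generic point. -/
theorem isAlg_or_isExceptionalCurve (h : IsCoord s t) {S : LocalSubring (FunField K)}
    (hS : S ∈ exceptionalFibre (originRing s t)) :
    IsAlg S ∨ IsExceptionalCurve (originRing s t) S := by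
  rcases h.div_mem_of_exceptionalFibre hS with h1 | h1
  · exact (h.isAlg_or_isGeneric_of_mem hS h1).imp_right (h.isExceptionalCurve_of_isGeneric hS)
  · have hS' := hS
    rw [h.originRing_comm] at hS' ⊢
    exact (h.symm.isAlg_or_isGeneric_of_mem hS' h1).imp_right
      (h.symm.isExceptionalCurve_of_isGeneric hS')

/-- The exceptional curve in coordinates. -/
theorem exists_isGeneric (h : IsCoord s t) :
    ∃ E ∈ exceptionalFibre (originRing s t), IsGeneric E (t / s) := by
  have hP : (Ideal.span {(MvPolynomial.X 0 : MvPolynomial (Fin 2) K)}).IsPrime :=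
    (Ideal.span_singleton_prime (MvPolynomial.X_ne_zero _)).mpr MvPolynomial.X_prime
  refine ⟨_, h.ring_mem_exceptionalFibre 0 _ (Ideal.mem_span_singleton_self _), ?_, ?_⟩
  · simpa using (h.div_sub 0).aeval_mem_ring (MvPolynomial.X 1)
      (𝔮 := Ideal.span {(MvPolynomial.X 0 : MvPolynomial (Fin 2) K)})
  · intro π hπ hM
    have h1 : aeval (t / s) π = MvPolynomial.aeval (R := K) ![s, t / s - algebraMap K _ 0]
        (aeval (MvPolynomial.X 1) π) := by
      rw [← aeval_algHom_apply]
      simp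
    rw [h1, (h.div_sub 0).MM_ring, Ideal.mem_span_singleton] at hM
    apply hπ
    obtain ⟨B, hB⟩ := hM
    have h2 := congrArg (MvPolynomial.aeval (R := K) ![(0 : K[X]), X]) hB
    rw [map_mul, MvPolynomial.aeval_X, ← aeval_algHom_apply, MvPolynomial.aeval_X] at h2
    simpa using h2

theorem isGeneric_of_isExceptionalCurve (h : IsCoord s t) {E : LocalSubring (FunField K)}
    (hE : IsExceptionalCurve (originRing s t) E) : IsGeneric E (t / s) := by
  obtain ⟨E₀, hE₀, hg⟩ := h.exists_isGeneric
  have hle := hE.2 E₀ hE₀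
  refine ⟨hle hg.1, fun π hπ => ?_⟩
  have hK : ∀ c : K, algebraMap K _ c ∈ E₀.toSubring := fun c =>
    (mem_exceptionalFibre_iff.mp hE₀).1.1 (h.algebraMap_mem c)
  have h1 := inv_mem_of_not_MM (polynomial_aeval_mem hK hg.1 π) (hg.2 π hπ)
  exact not_MM_of_inv_mem h1.1 (hle h1.2)

theorem exists_isExceptionalCurve (h : IsCoord s t) : ∃ E, IsExceptionalCurve (originRing s t) E :=
  let ⟨E, hE, hg⟩ := h.exists_isGeneric
  ⟨E, h.isExceptionalCurve_of_isGeneric hE hg⟩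

/-- Away from the next point of the tower, the inverse of its second coordinate is regular. -/
theorem inv_mem_of_ne (h : IsCoord s t) {S : LocalSubring (FunField K)}
    (hS : S ∈ exceptionalFibre (originRing s t)) (c : K)
    (hne : S ≠ originRing s (t / s - algebraMap K _ c)) :
    (t / s - algebraMap K _ c)⁻¹ ∈ S.toSubring := by
  have hRS := (mem_exceptionalFibre_iff.mp hS).1
  have hK : ∀ c : K, algebraMap K _ c ∈ S.toSubring := fun c => hRS.1 (h.algebraMap_mem c)
  by_cases h1 : t / s ∈ S.toSubring
  · refine (inv_mem_of_not_MM (Subring.sub_mem _ h1 (hK c)) fun hM => hne ?_).2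
    have hle := (h.div_sub c).originRing_le hK (h.MM_left.of_le hRS) hM
    exact eq_of_exceptionalFibre hS (h.originRing_mem_exceptionalFibre c) le_rfl hle
  -- The remaining point is that at infinity of the fibre, where s / t vanishes and (t/s - c)⁻¹ =
  -- (s/t) (1 - c s/t)⁻¹.
  · have h2 := (h.div_mem_of_exceptionalFibre hS).resolve_left h1
    have ht0 := h.symm.ne_zero
    have hs0 := h.ne_zero
    have h3 : MM S (s / t) := ⟨h2, Or.inr (by rwa [inv_div])⟩
    have h4 : ¬ MM S (1 - algebraMap K _ c * (s / t)) := fun h5 => by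
      have h6 := h5.add (h3.mul_left (hK c))
      rw [sub_add_cancel] at h6
      exact MM.not_one S h6
    have h5 := inv_mem_of_not_MM (Subring.sub_mem _ (Subring.one_mem _)
      (Subring.mul_mem _ (hK c) h2)) h4
    have h6 := Subring.mul_mem _ h2 h5.2
    have h7 : (t / s - algebraMap K (FunField K) c)⁻¹ =
        s / t * (1 - algebraMap K (FunField K) c * (s / t))⁻¹ := by
      rw [← inv_div t s, ← mul_inv]
      congr 1
      field_simp
    rwa [h7]

end IsCoord

end Fibre

/-! ### Unipotent maps of the complement of the conic -/

section Forms

variable {K : Type u} [Field K]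

open MvPolynomial

variable (K) in
/-- The equation `x z - y²` of the conic. -/
abbrev wForm : HomRing K := (PlaneCurve.conicQ K).poly

theorem wForm_eq : wForm K = X 0 * X 2 - X 1 ^ 2 := rfl

theorem wForm_isHomogeneous : (wForm K).IsHomogeneous 2 := (PlaneCurve.conicQ K).isHomogeneous

theorem wForm_ne_zero : wForm K ≠ 0 := (PlaneCurve.conicQ K).irreducible.ne_zero

/-- The form `∑ b_k x ^ (2 (n - k)) w ^ k`. -/
def sForm (n : ℕ) (b : ℕ → K) : HomRing K :=
  ∑ k ∈ Finset.range n, C (b k) * X 0 ^ (2 * (n - k)) * wForm K ^ k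

theorem sForm_isHomogeneous (n : ℕ) (b : ℕ → K) : (sForm n b).IsHomogeneous (2 * n) := by
  refine IsHomogeneous.sum _ _ _ fun k hk => ?_
  have hk' := Finset.mem_range.mp hk
  have h1 := ((isHomogeneous_C (Fin 3) (b k)).mul ((isHomogeneous_X K (0 : Fin 3)).pow
    (2 * (n - k)))).mul (wForm_isHomogeneous.pow k)
  rwa [show 0 + 1 * (2 * (n - k)) + 2 * k = 2 * n by omega] at h1

theorem sForm_neg (n : ℕ) (b : ℕ → K) : sForm n (-b) = -sForm n b := by
  simp [sForm, Finset.sum_neg_distrib]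

/-- The map `(x : y : z) ↦ (x : y - r x : z - 2 r y + r² x)` with `r = sForm n b / w ^ n`. -/
def phiForm (n : ℕ) (b : ℕ → K) : Fin 3 → HomRing K :=
  ![X 0 * wForm K ^ (2 * n), (X 1 * wForm K ^ n - X 0 * sForm n b) * wForm K ^ n,
    X 2 * wForm K ^ (2 * n) - C 2 * X 1 * wForm K ^ n * sForm n b + X 0 * sForm n b ^ 2]

theorem phiForm_zero (n : ℕ) (b : ℕ → K) : phiForm n b 0 = X 0 * wForm K ^ (2 * n) := rfl

theorem phiForm_one (n : ℕ) (b : ℕ → K) :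
    phiForm n b 1 = (X 1 * wForm K ^ n - X 0 * sForm n b) * wForm K ^ n := rfl

theorem phiForm_two (n : ℕ) (b : ℕ → K) :
    phiForm n b 2 = X 2 * wForm K ^ (2 * n) - 2 * X 1 * wForm K ^ n * sForm n b +
      X 0 * sForm n b ^ 2 := by
  rw [← map_ofNat C 2]
  rfl

theorem isHomogeneous_of_eq {G : HomRing K} {d e : ℕ} (h : G.IsHomogeneous d) (hde : d = e) :
    G.IsHomogeneous e := hde ▸ h

theorem phiForm_isHomogeneous (n : ℕ) (b : ℕ → K) (i : Fin 3) :
    (phiForm n b i).IsHomogeneous (4 * n + 1) := by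
  have hw := wForm_isHomogeneous (K := K)
  have hS := sForm_isHomogeneous n b
  have hX := fun i : Fin 3 => isHomogeneous_X K i
  have h2 : (2 : HomRing K).IsHomogeneous 0 := by
    rw [← map_ofNat C 2]
    exact isHomogeneous_C _ _
  fin_cases i
  · exact isHomogeneous_of_eq ((hX 0).mul (hw.pow (2 * n))) (by omega)
  · have h1 : (X 1 * wForm K ^ n - X 0 * sForm n b).IsHomogeneous (2 * n + 1) :=
      (isHomogeneous_of_eq ((hX 1).mul (hw.pow n)) (by omega)).sub
        (isHomogeneous_of_eq ((hX 0).mul hS) (by omega))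
    exact isHomogeneous_of_eq (h1.mul (hw.pow n)) (by omega)
  · change (phiForm n b 2).IsHomogeneous _
    rw [phiForm_two]
    exact ((isHomogeneous_of_eq ((hX 2).mul (hw.pow (2 * n))) (by omega)).sub
      (isHomogeneous_of_eq (((h2.mul (hX 1)).mul (hw.pow n)).mul hS) (by omega))).add
        (isHomogeneous_of_eq ((hX 0).mul (hS.pow 2)) (by omega))

/-- The shear preserves the quadratic form: x (z - 2 r y + r² x) - (y - r x)² = x z - y². The three
forms carry the common denominator w^(2n), whose square supplies w^(4n). -/
theorem aeval_phiForm_wForm (n : ℕ) (b : ℕ → K) :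
    aeval (phiForm n b) (wForm K) = wForm K ^ (4 * n + 1) := by
  have h : aeval (phiForm n b) (wForm K) = phiForm n b 0 * phiForm n b 2 - phiForm n b 1 ^ 2 := by
    simp [wForm_eq]
  have h2 : wForm K ^ (4 * n + 1) = (X 0 * X 2 - X 1 ^ 2) * wForm K ^ (4 * n) := by
    rw [pow_succ', wForm_eq]
  rw [h, h2, phiForm_zero, phiForm_one, phiForm_two]
  ring

/-- The function r depends on x² / w only, and both x and w are fixed by the shear up to the common
denominator. -/
theorem aeval_phiForm_sForm (n : ℕ) (b b' : ℕ → K) :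
    aeval (phiForm n b) (sForm n b') = wForm K ^ (4 * n * n) * sForm n b' := by
  rw [sForm, map_sum, Finset.mul_sum]
  refine Finset.sum_congr rfl fun k hk => ?_
  obtain ⟨j, rfl⟩ := Nat.exists_eq_add_of_lt (Finset.mem_range.mp hk)
  rw [map_mul, map_mul, map_pow, map_pow, aeval_phiForm_wForm, algHom_C, algebraMap_eq, aeval_X,
    show k + j + 1 - k = j + 1 by omega, phiForm_zero]
  ring

/-- Since r is invariant under the shear by r, the shear by -r undoes it. -/
theorem aeval_phiForm_phiForm (n : ℕ) (b : ℕ → K) (i : Fin 3) :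
    aeval (phiForm n b) (phiForm n (-b) i) = wForm K ^ (8 * n * n + 4 * n) * X i := by
  have hw := aeval_phiForm_wForm n b
  have hS := aeval_phiForm_sForm n b b
  fin_cases i
  · change aeval (phiForm n b) (phiForm n (-b) 0) = _ * X 0
    rw [phiForm_zero, map_mul, map_pow, hw, aeval_X, phiForm_zero]
    ring
  · change aeval (phiForm n b) (phiForm n (-b) 1) = _ * X 1
    simp only [phiForm_one n (-b), sForm_neg, map_mul, map_sub, map_neg, map_pow, hw, hS, aeval_X]
    rw [phiForm_zero, phiForm_one]
    ring
  · change aeval (phiForm n b) (phiForm n (-b) 2) = _ * X 2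
    simp only [phiForm_two n (-b), sForm_neg, map_mul, map_sub, map_add, map_neg, map_pow, hw, hS,
      aeval_X, map_ofNat]
    rw [phiForm_zero, phiForm_one, phiForm_two]
    ring

theorem isPairOff_phiForm (n : ℕ) (b : ℕ → K) :
    IsPairOff (phiForm n b) (phiForm n (-b)) (4 * n + 1) (4 * n + 1) (wForm K) where
  left_isHomogeneous := phiForm_isHomogeneous n b
  right_isHomogeneous := phiForm_isHomogeneous n (-b)
  left_pos := by omega
  right_pos := by omega
  ne_zero := wForm_ne_zero
  comp_left := ⟨_, aeval_phiForm_phiForm n b⟩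
  comp_right := ⟨_, fun i => by simpa using aeval_phiForm_phiForm n (-b) i⟩
  aeval_left := ⟨_, aeval_phiForm_wForm n b⟩
  aeval_right := ⟨_, aeval_phiForm_wForm n (-b)⟩

/-! ### Maps given by regular coordinates -/

/-- If the components of θ, after a common rescaling, are regular at S and not all zero there, their
classes in the residue field are the coordinates of the image. This evaluates θ at infinitely near
points. -/
theorem exists_mapsTo_of_coords {θ : Bir K} {S : LocalSubring (FunField K)}
    (hK : ∀ c : K, algebraMap K _ c ∈ S.toSubring) {f : Fin 3 → FunField K} {h : FunField K}
    (hf : ∀ i, f i ∈ S.toSubring) (hi : ∃ i, ¬ MM S (f i))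
    (hθ : ∀ i, f i = h * θ.pull (dehom K (X i))) :
    ∃ y : P2 K, θ.MapsTo S y ∧ ∀ (G : HomRing K) (d : ℕ), G.IsHomogeneous d →
      (G ∈ pIdeal y ↔ MM S (aeval f G)) := by
  have hmem : ∀ G : HomRing K, aeval f G ∈ S.toSubring := aeval_mem_of_mem hK hf
  let χ : HomRing K →+* IsLocalRing.ResidueField S.toSubring :=
    (IsLocalRing.residue S.toSubring).comp ((aeval f : HomRing K →ₐ[K] FunField K).toRingHom.codRestrict
      S.toSubring hmem)
  have hχ : ∀ G, χ G = 0 ↔ MM S (aeval f G) := fun G =>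
    (IsLocalRing.residue_eq_zero_iff _).trans (mem_maximalIdeal_iff (⟨aeval f G, hmem G⟩ : S.toSubring))
  let y : P2 K := pointOf χ (by
    obtain ⟨i, hi⟩ := hi
    exact ⟨i, fun h0 => hi (by simpa using (hχ _).mp h0)⟩)
  have hy : ∀ (G : HomRing K) (d : ℕ), G.IsHomogeneous d → (G ∈ pIdeal y ↔ MM S (aeval f G)) :=
    fun G d hG => (mem_pointOf hG).trans (hχ G)
  have hpull : ∀ (G : HomRing K) (d : ℕ), G.IsHomogeneous d →
      aeval f G = h ^ d * θ.pull (dehom K G) := fun G d hG => by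
    rw [show f = fun i => h * θ.pull (dehom K (X i)) from funext hθ, aeval_mul_of_isHomogeneous hG]
    congr 1
    rw [← aeval_dehom_X G]
    exact (congrArg (fun F : HomRing K →ₐ[K] FunField K => F G)
      (comp_aeval (fun i => dehom K (X i)) (θ.pull : FunField K →ₐ[K] FunField K))).symm
  have hh : h ≠ 0 := by
    rintro rfl
    obtain ⟨i, hi⟩ := hi
    rw [hθ i, zero_mul] at hi
    exact hi (MM.zero S)
  have hdiv : ∀ (G H : HomRing K) (d : ℕ), G.IsHomogeneous d → H.IsHomogeneous d →
      θ.pull (dehom K G / dehom K H) = aeval f G * (aeval f H)⁻¹ := fun G H d hG hH => by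
    rw [hpull G d hG, hpull H d hH, map_div₀, ← div_eq_mul_inv,
      mul_div_mul_left _ _ (pow_ne_zero d hh)]
  refine ⟨y, ?_, hy⟩
  rw [Bir.mapsTo_iff]
  refine ⟨fun r hr => ?_, fun r hr => ?_⟩
  · obtain ⟨d, G, H, hG, hH, hHy, rfl⟩ := mem_localRing.mp hr
    rw [hdiv G H d hG hH]
    exact Subring.mul_mem _ (hmem G) (inv_mem_of_not_MM (hmem H) fun h => hHy ((hy H d hH).mpr h)).2
  · obtain ⟨d, G, H, hG, hH, hHy, rfl⟩ := mem_localRing.mp hr.mem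
    rw [MM_localRing hG hH hHy] at hr
    rw [hdiv G H d hG hH]
    exact ((hy G d hG).mp hr).mul_right
      (inv_mem_of_not_MM (hmem H) fun h => hHy ((hy H d hH).mpr h)).2

variable (K) in
/-- The point `(0 : 0 : 1)`. -/
def basePoint : P2 K := pointOf (aeval (R := K) ![(0 : K), 0, 1]).toRingHom ⟨2, by simp⟩

theorem mem_basePoint {G : HomRing K} {d : ℕ} (hG : G.IsHomogeneous d) :
    G ∈ pIdeal (basePoint K) ↔ aeval (R := K) ![(0 : K), 0, 1] G = 0 := mem_pointOf hG

theorem X_mem_basePoint {i : Fin 3} (hi : i ≠ 2) : X i ∈ pIdeal (basePoint K) := by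
  rw [mem_basePoint (isHomogeneous_X K i), aeval_X]
  fin_cases i <;> simp at hi ⊢

/-- Modulo x and y, a form of degree d is its value at (0 : 0 : 1) times z^d. -/
theorem sub_mem_of_X_mem {I : Ideal (HomRing K)} (h0 : X 0 ∈ I) (h1 : X 1 ∈ I) {G : HomRing K}
    {d : ℕ} (hG : G.IsHomogeneous d) : G - C (aeval (R := K) ![(0 : K), 0, 1] G) * X 2 ^ d ∈ I := by
  have h2 : Ideal.Quotient.mk I (aeval ![0, 0, X 2] G) = Ideal.Quotient.mk I G := by
    conv_rhs => rw [← aeval_X_left_apply (R := K) G]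
    rw [aeval_def, aeval_def, hom_eval₂, hom_eval₂]
    congr 1
    funext i
    fin_cases i
    · exact (((Ideal.Quotient.eq_zero_iff_mem).mpr h0).trans (map_zero _).symm).symm
    · exact (((Ideal.Quotient.eq_zero_iff_mem).mpr h1).trans (map_zero _).symm).symm
    · rfl
  have h3 : aeval ![0, 0, X 2] G = C (aeval (R := K) ![(0 : K), 0, 1] G) * (X 2 : HomRing K) ^ d := by
    have h4 : (![0, 0, X 2] : Fin 3 → HomRing K) =
        fun i => X 2 * algebraMap K (HomRing K) ((![(0 : K), 0, 1] : Fin 3 → K) i) := by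
      funext i
      fin_cases i <;> simp
    rw [h4, aeval_mul_of_isHomogeneous hG, mul_comm]
    congr 1
    exact (aeval_algebraMap_apply (HomRing K) ![(0 : K), 0, 1] G)
  rw [← Ideal.Quotient.eq_zero_iff_mem, map_sub, ← h3, h2, sub_self]

theorem eq_basePoint {y : P2 K} (h0 : X 0 ∈ pIdeal y) (h1 : X 1 ∈ pIdeal y) : y = basePoint K := by
  have h2 : X 2 ∉ pIdeal y := fun h2 => by
    obtain ⟨i, hi⟩ := exists_X_notMem y
    fin_cases i
    exacts [hi h0, hi h1, hi h2]
  refine pIdeal_injective (le_antisymm ?_ ?_)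
  all_goals
    rw [pIdeal_le_iff]
    intro d G hG hGy
    have h3 := sub_mem_of_X_mem h0 h1 hG
  · rw [mem_basePoint hG]
    have h4 := (pIdeal y).sub_mem hGy h3
    rw [sub_sub_cancel] at h4
    have h5 := (y.isPrime.mem_or_mem h4).resolve_right fun h => h2 (y.isPrime.mem_of_pow_mem _ h)
    by_contra h6
    exact y.isPrime.ne_top (Ideal.eq_top_of_isUnit_mem _ h5 ((isUnit_iff_ne_zero.mpr h6).map C))
  · rw [mem_basePoint hG] at hGy
    simpa [hGy] using h3

theorem isClosedPoint_basePoint : IsClosedPoint (planeModel K) (localRing (basePoint K)) :=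
  isClosedPoint_iff.mpr fun _ h => eq_basePoint (h (X_mem_basePoint (by decide)))
    (h (X_mem_basePoint (by decide)))

end Forms

/-! ### Towers with coordinates -/

section CoordTower

variable {K : Type u} [Field K]

open MvPolynomial

/-- A tower over `(0 : 0 : 1)`, each of whose points is the origin of a coordinate system. -/
structure IsCoordTower (p : ℕ → LocalSubring (FunField K)) (m : ℕ) : Prop where
  isTower : IsTower p m
  base : p 1 = localRing (basePoint K)
  coord : ∀ i, 1 ≤ i → i ≤ m → ∃ s t, IsCoord s t ∧ p i = originRing s t

namespace IsCoordTower

variable {p : ℕ → LocalSubring (FunField K)} {m : ℕ}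

theorem isAlg (h : IsCoordTower p m) {i : ℕ} (h1 : 1 ≤ i) (hm : i ≤ m) : IsAlg (p i) := by
  obtain ⟨s, t, hst, he⟩ := h.coord i h1 hm
  rw [he]
  exact hst.isAlg

theorem algebraMap_mem (h : IsCoordTower p m) {R : LocalSubring (FunField K)}
    (hR : R ∈ towerSurface p m) (c : K) : algebraMap K _ c ∈ R.toSubring :=
  algebraMap_mem_towerSurface (fun i hi => (h.isAlg (by omega) (by omega)).1) hR c

theorem base_le (h : IsCoordTower p m) {i : ℕ} (h1 : 1 ≤ i) (hm : i ≤ m) :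
    localRing (basePoint K) ≤ p i := by
  induction i, h1 using Nat.le_induction with
  | base => exact h.base.ge
  | succ i h1 ih =>
    exact (ih (by omega)).trans (mem_exceptionalFibre_iff.mp (h.isTower.2 i h1 (by omega))).1

theorem base_le_of_mem (h : IsCoordTower p m) {i : ℕ} (h1 : 1 ≤ i) (hm : i ≤ m)
    {S : LocalSubring (FunField K)} (hS : S ∈ exceptionalFibre (p i)) :
    localRing (basePoint K) ≤ S :=
  (h.base_le h1 hm).trans (mem_exceptionalFibre_iff.mp hS).1

theorem separated (h : IsCoordTower p m) {R S T : LocalSubring (FunField K)}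
    (hR : R ∈ towerSurface p m) (hS : S ∈ towerSurface p m) (hRT : R ≤ T) (hST : S ≤ T) : R = S :=
  towerSurface_separated p m (fun _ hi => h.isTower.mem_towerSurface hi) hR hS hRT hST

theorem isClosedPoint_of_isAlg (h : IsCoordTower p m) {R : LocalSubring (FunField K)}
    (hR : R ∈ towerSurface p m) (ha : IsAlg R) : IsClosedPoint (towerSurface p m) R :=
  ⟨hR, fun _ hS hSR => h.separated hS hR (ha.le (h.algebraMap_mem hS) hSR) le_rfl⟩

theorem isClosedPoint_of_plane (h : IsCoordTower p m) {y : P2 K}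
    (hR : localRing y ∈ towerSurface p m) (hy : IsClosedPoint (planeModel K) (localRing y))
    (hne : y ≠ basePoint K) : IsClosedPoint (towerSurface p m) (localRing y) := by
  refine ⟨hR, fun S hS hSy => ?_⟩
  rcases mem_towerSurface hS with ⟨h1, -⟩ | ⟨i, h1, h2, h3, -⟩
  · exact hy.2 S h1 hSy
  · exact absurd (localRing_injective (hy.2 _ ⟨basePoint K, rfl⟩
      ((h.base_le_of_mem h1 h2 h3).1.trans hSy))).symm hne

/-- All other points are closed: a plane point that is neither generic nor on a curve, or a point of
an exceptional fibre with algebraic residue field. -/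
theorem curve_cases (h : IsCoordTower p m) (hm : 1 ≤ m) {R : LocalSubring (FunField K)}
    (hR : IsCurveOn (towerSurface p m) R) :
    (∃ C : PlaneCurve K, R = localRing C.genericPoint) ∨
      ∃ i, 1 ≤ i ∧ i ≤ m ∧ IsExceptionalCurve (p i) R := by
  rcases mem_towerSurface hR.1 with ⟨⟨y, rfl⟩, hne⟩ | ⟨i, h1, h2, h3, -⟩
  · rcases point_cases y with h4 | ⟨C, rfl⟩ | h4
    · exact absurd h4 hR.2.1
    · exact Or.inl ⟨C, rfl⟩
    · refine absurd (h.isClosedPoint_of_plane hR.1 h4 ?_) hR.2.2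
      rintro rfl
      exact hne hm h.base.symm
  · obtain ⟨s, t, hst, he⟩ := h.coord i h1 h2
    have h4 := he ▸ h3
    rcases hst.isAlg_or_isExceptionalCurve h4 with h5 | h5
    · exact absurd (h.isClosedPoint_of_isAlg hR.1 h5) hR.2.2
    · exact Or.inr ⟨i, h1, h2, he ▸ h5⟩

theorem localRing_mem (h : IsCoordTower p m) {y : P2 K} (hy : y ≠ basePoint K) :
    localRing y ∈ towerSurface p m := by
  have key : ∀ j, j ≤ m → localRing y ∈ towerSurface p j := by
    intro j
    induction j with
    | zero => exact fun _ => ⟨y, rfl⟩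
    | succ j ih =>
      refine fun hj => Or.inl ⟨ih (by omega), fun he => ?_⟩
      have h1 := h.base_le (i := j + 1) (by omega) hj
      rw [← show localRing y = p (j + 1) from he] at h1
      exact hy (point_eq_of_le le_rfl h1)
  exact key m le_rfl

theorem genericPoint_ne_basePoint (C : PlaneCurve K) : C.genericPoint ≠ basePoint K := by
  intro he
  obtain ⟨y, hy, -⟩ := exists_lt_point C
  exact hy.ne (congrArg pIdeal (isClosedPoint_iff.mp isClosedPoint_basePoint y (he ▸ hy.le) |>.trans
    he.symm).symm)

/-- The strict transform of a plane curve. -/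
theorem isCurveOn (h : IsCoordTower p m) (C : PlaneCurve K) :
    IsCurveOn (towerSurface p m) (localRing C.genericPoint) := by
  refine ⟨h.localRing_mem (genericPoint_ne_basePoint C), localRing_genericPoint_ne_top C,
    fun hcl => ?_⟩
  -- A closed point of C other than the base point is needed, since the base point no longer belongs
  -- to the blown-up surface.
  obtain ⟨y, hy, hX⟩ := exists_lt_point C
  have hyb : y ≠ basePoint K := by
    rintro rfl
    rcases hX with hX | hX
    · exact hX (X_mem_basePoint (by decide))
    · exact hX (X_mem_basePoint (by decide))
  have h1 := hcl.2 _ (h.localRing_mem hyb) (localRing_toSubring_le_iff.mpr hy.le)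
  exact hy.ne (congrArg pIdeal (localRing_injective h1).symm)

theorem not_isExceptionalCurve (h : IsCoordTower p m) (C : PlaneCurve K) {i : ℕ} (h1 : 1 ≤ i)
    (hm : i ≤ m) : ¬ IsExceptionalCurve (p i) (localRing C.genericPoint) := fun hE =>
  genericPoint_ne_basePoint C (point_eq_of_le le_rfl (h.base_le_of_mem h1 hm hE.1))

end IsCoordTower

/-! ### The coordinates of the points of the tower -/

theorem isCoord_vw : IsCoord (vFun K) (wFun K) := by
  refine isCoord_uv.of_mem ?_ (IntermediateField.mem_adjoin_pair_left _ _ _)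
  have h1 := add_mem (IntermediateField.mem_adjoin_pair_right K (vFun K) (wFun K))
    (pow_mem (IntermediateField.mem_adjoin_pair_left K (vFun K) (wFun K)) 2)
  rwa [wFun, sub_add_cancel] at h1

theorem isCoord_v_div (i : ℕ) : IsCoord (vFun K) (wFun K / vFun K ^ i) := by
  induction i with
  | zero => simpa using isCoord_vw
  | succ i ih => simpa [pow_succ, div_div] using ih.div

theorem isCoord_xv : IsCoord (xFun K) (vFun K) := (isCoord_v_div 4).symm

/-- The constants of the tower: `0` for the points on the curve `E₄`, then `a₁, a₂, …`. -/
def towerConst (n : ℕ) (a : ℕ → K) (k : ℕ) : K := if k + 1 < n then 0 else a (k + 2 - n)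

/-- The second coordinate at the point `p_{5 + k}`. -/
def towerCoord (n : ℕ) (a : ℕ → K) : ℕ → FunField K
  | 0 => vFun K
  | k + 1 => towerCoord n a k / xFun K - algebraMap K _ (towerConst n a k)

theorem isCoord_towerCoord (n : ℕ) (a : ℕ → K) (k : ℕ) : IsCoord (xFun K) (towerCoord n a k) := by
  induction k with
  | zero => exact isCoord_xv
  | succ k ih => exact ih.div_sub _

theorem towerCoord_of_lt (n : ℕ) (a : ℕ → K) {k : ℕ} (hk : k < n) :
    towerCoord n a k = vFun K / xFun K ^ k := by
  induction k with
  | zero => simp [towerCoord]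
  | succ k ih =>
    rw [towerCoord, ih (by omega), towerConst, if_pos (by omega), map_zero, sub_zero, div_div,
      pow_succ]

/-- The recursion t ↦ t / X - c telescopes to the closed formula of `towerPoint`. The constant used
to pass from index n - 1 to index n is a₁. -/
theorem towerCoord_add {n : ℕ} (hn : 1 ≤ n) (a : ℕ → K) (j : ℕ) :
    towerCoord n a (n + j) = (vFun K / xFun K ^ n -
      ∑ k ∈ Finset.Icc 1 (j + 1), algebraMap K (FunField K) (a k) * xFun K ^ (k - 1)) /
        xFun K ^ j := by
  have hX := (isCoord_xv (K := K)).ne_zero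
  induction j with
  | zero =>
    obtain ⟨m, rfl⟩ : ∃ m, n = m + 1 := ⟨n - 1, by omega⟩
    rw [add_zero, towerCoord, towerCoord_of_lt _ _ (by omega), towerConst, if_neg (by omega),
      show m + 2 - (m + 1) = 1 by omega]
    simp [pow_succ, div_div]
  | succ j ih =>
    rw [← add_assoc, towerCoord, ih, towerConst, if_neg (by omega),
      show n + j + 2 - n = j + 2 by omega, Finset.sum_Icc_succ_top (a := 1) (b := j + 1) (by omega),
      show j + 1 + 1 - 1 = j + 1 by omega]
    field_simp
    ring

/-- The coordinates are exchanged so that v, by which the next blow-up divides, comes first. -/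
theorem towerPoint_of_le (n : ℕ) (a : ℕ → K) {i : ℕ} (hi : i ≤ 4) :
    towerPoint n a i = originRing (vFun K) (wFun K / vFun K ^ (i - 1)) := by
  rw [towerPoint, if_pos hi]
  exact (isCoord_v_div _).symm.originRing_comm

theorem towerPoint_add {n : ℕ} (hn : 1 ≤ n) (a : ℕ → K) (k : ℕ) :
    towerPoint n a (5 + k) = originRing (xFun K) (towerCoord n a k) := by
  rw [towerPoint, if_neg (by omega)]
  by_cases hk : k < n
  · rw [if_pos (by omega), towerCoord_of_lt _ _ hk, show 5 + k - 5 = k by omega]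
  · obtain ⟨j, rfl⟩ := Nat.exists_eq_add_of_le (not_lt.mp hk)
    rw [if_neg (by omega), towerCoord_add hn, show 5 + (n + j) - (4 + n) = j + 1 by omega,
      show j + 1 - 1 = j by omega]

/-- A uniform description of one blow-up: s is kept and t becomes t / s - c. -/
theorem exists_towerPoint_succ {n : ℕ} (hn : 1 ≤ n) (a : ℕ → K) {i : ℕ} (hi : 1 ≤ i) :
    ∃ s t, ∃ c : K, IsCoord s t ∧ towerPoint n a i = originRing s t ∧
      towerPoint n a (i + 1) = originRing s (t / s - algebraMap K _ c) := by
  rcases Nat.lt_or_ge i 5 with h | h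
  · refine ⟨_, _, 0, isCoord_v_div (i - 1), towerPoint_of_le n a (by omega), ?_⟩
    have h1 : wFun K / vFun K ^ (i - 1) / vFun K - algebraMap K (FunField K) 0 =
        wFun K / vFun K ^ i := by
      rw [map_zero, sub_zero, div_div, ← pow_succ, show i - 1 + 1 = i by omega]
    rw [h1]
    rcases Nat.lt_or_ge i 4 with h2 | h2
    · exact towerPoint_of_le n a (by omega)
    -- At p₅ the roles change: up to here v is the divisor, from here on X is.
    · obtain rfl : i = 4 := by omega
      exact (towerPoint_add hn a 0).trans isCoord_xv.originRing_comm
  · obtain ⟨k, rfl⟩ := Nat.exists_eq_add_of_le h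
    exact ⟨_, _, _, isCoord_towerCoord n a k, towerPoint_add hn a k, towerPoint_add hn a (k + 1)⟩

theorem towerPoint_one (n : ℕ) (a : ℕ → K) : towerPoint n a 1 = localRing (basePoint K) := by
  rw [towerPoint_of_le n a (by omega), Nat.sub_self, pow_zero, div_one]
  have hc := isCoord_vw (K := K)
  have hu : MM (originRing (vFun K) (wFun K)) (uFun K) := by
    have h1 := hc.MM_right.add (hc.MM_left.pow two_ne_zero)
    rwa [wFun, sub_add_cancel] at h1
  -- The identity map, evaluated at the origin of the (v, w)-plane with coordinates (u, v, 1), has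
  -- value (0 : 0 : 1).
  obtain ⟨y, hy, hG⟩ := exists_mapsTo_of_coords (θ := ⟨AlgEquiv.refl⟩) hc.algebraMap_mem
    (f := fun i => dehom K (X i)) (h := 1)
    (fun i => by
      fin_cases i
      · simpa using hu.mem
      · simpa using hc.MM_left.mem
      · simp)
    ⟨2, by simpa using MM.not_one _⟩ (fun i => by simp)
  have hyb : y = basePoint K := eq_basePoint ((hG _ 1 (isHomogeneous_X K 0)).mpr (by simpa using hu))
    ((hG _ 1 (isHomogeneous_X K 1)).mpr (by simpa using hc.MM_left))
  have h1 : localRing (basePoint K) ≤ originRing (vFun K) (wFun K) := by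
    rw [← hyb]
    refine le_iff_MM.mpr ?_
    exact Bir.mapsTo_iff.mp hy
  refine le_antisymm (hc.originRing_le (algebraMap_mem_localRing _) ?_ ?_) h1
  · have h2 := (MM_localRing (y := basePoint K) (isHomogeneous_X K 1) (isHomogeneous_X K 2)
      (fun h => by simpa using (mem_basePoint (isHomogeneous_X K 2)).mp h)).mpr
      (X_mem_basePoint (by decide))
    simpa using h2
  · have h2 := (MM_localRing (y := basePoint K) wForm_isHomogeneous ((isHomogeneous_X K 2).pow 2)
      (fun h => by simpa using (mem_basePoint ((isHomogeneous_X K 2).pow 2)).mp h)).mpr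
      ((mem_basePoint wForm_isHomogeneous).mpr (by simp [wForm_eq]))
    simpa [wForm_eq, wFun] using h2

theorem isCoordTower_towerPoint {n : ℕ} (hn : 1 ≤ n) (a : ℕ → K) (m : ℕ) :
    IsCoordTower (towerPoint n a) m where
  isTower := by
    refine ⟨⟨basePoint K, (towerPoint_one n a).symm⟩, fun i hi _ => ?_⟩
    obtain ⟨s, t, c, hst, h1, h2⟩ := exists_towerPoint_succ hn a hi
    rw [h1, h2]
    exact hst.originRing_mem_exceptionalFibre c
  base := towerPoint_one n a
  coord := fun i hi _ => by
    obtain ⟨s, t, c, hst, h1, -⟩ := exists_towerPoint_succ hn a hi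
    exact ⟨s, t, hst, h1⟩

end CoordTower

/-! ### The unipotent maps at the points over the base point -/

section LocalMaps

variable {K : Type u} [Field K]

open MvPolynomial

/-- The function `r = sForm n b / w ^ n`. -/
def rFun (n : ℕ) (b : ℕ → K) : FunField K :=
  ∑ k ∈ Finset.range n, algebraMap K _ (b k) * (uFun K ^ 2 / wFun K) ^ (n - k)

theorem dehom_wForm : dehom K (wForm K) = wFun K := by
  simp [wForm_eq, wFun]

theorem uFun_eq : uFun K = wFun K + vFun K ^ 2 := by
  rw [wFun, sub_add_cancel]

theorem wFun_ne_zero : wFun K ≠ 0 := isCoord_vw.symm.ne_zero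

theorem vFun_ne_zero : vFun K ≠ 0 := isCoord_vw.ne_zero

theorem uFun_ne_zero : uFun K ≠ 0 := isCoord_uv.ne_zero

theorem xFun_ne_zero : xFun K ≠ 0 := isCoord_xv.ne_zero

theorem dehom_sForm (n : ℕ) (b : ℕ → K) : dehom K (sForm n b) = rFun n b * wFun K ^ n := by
  rw [sForm, rFun, map_sum, Finset.sum_mul]
  refine Finset.sum_congr rfl fun k hk => ?_
  obtain ⟨j, rfl⟩ := Nat.exists_eq_add_of_lt (Finset.mem_range.mp hk)
  have hw := wFun_ne_zero (K := K)
  rw [map_mul, map_mul, map_pow, map_pow, dehom_wForm, dehom_X_zero, dehom_C,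
    show k + j + 1 - k = j + 1 by omega, div_pow]
  field_simp
  ring

theorem exists_dehom_phiForm {n : ℕ} {b : ℕ → K} {θ : Bir K}
    (hθ : θ.GivenBy (phiForm n b) (4 * n + 1)) : ∃ h : FunField K,
      uFun K = h * θ.pull (dehom K (X 0)) ∧
      vFun K - uFun K * rFun n b = h * θ.pull (dehom K (X 1)) ∧
      1 - 2 * vFun K * rFun n b + uFun K * rFun n b ^ 2 = h * θ.pull (dehom K (X 2)) := by
  obtain ⟨h, -, hh⟩ := hθ.exists_factor
  have hw := wFun_ne_zero (K := K)
  refine ⟨h / wFun K ^ (2 * n), ?_, ?_, ?_⟩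
  · rw [div_mul_eq_mul_div, ← hh 0, phiForm_zero, map_mul, map_pow, dehom_wForm, dehom_X_zero]
    field_simp
  · rw [div_mul_eq_mul_div, ← hh 1, phiForm_one]
    simp only [map_mul, map_sub, map_pow, dehom_wForm, dehom_X_one, dehom_X_zero, dehom_sForm]
    field_simp
    ring
  · rw [div_mul_eq_mul_div, ← hh 2, phiForm_two]
    simp only [map_mul, map_sub, map_add, map_pow, dehom_wForm, dehom_X_one, dehom_X_zero,
      dehom_X_two, dehom_sForm, map_ofNat]
    field_simp
    ring

section

variable {n : ℕ} {b : ℕ → K} {θ : Bir K} {S : LocalSubring (FunField K)}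

/-- Where r is regular and u, v vanish, the components (u, v - u r, 1 - 2 v r + u r²) reduce to (0,
0, 1). -/
theorem mapsTo_basePoint_of_mem (hθ : θ.GivenBy (phiForm n b) (4 * n + 1))
    (hK : ∀ c : K, algebraMap K _ c ∈ S.toSubring) (hu : MM S (uFun K)) (hv : MM S (vFun K))
    (hr : rFun n b ∈ S.toSubring) : θ.MapsTo S (basePoint K) := by
  obtain ⟨h, h0, h1, h2⟩ := exists_dehom_phiForm hθ
  have hM1 : MM S (vFun K - uFun K * rFun n b) := hv.sub (hu.mul_right hr)
  have hM2 : MM S (-(2 * vFun K * rFun n b) + uFun K * rFun n b ^ 2) :=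
    (((hv.mul_left (show (2 : FunField K) ∈ _ by simp)).mul_right hr).neg).add
      (hu.mul_right (Subring.pow_mem _ hr 2))
  have h3 : ¬ MM S (1 - 2 * vFun K * rFun n b + uFun K * rFun n b ^ 2) := by
    have h4 := not_MM_add_left (MM.not_one S) hM2
    rwa [← add_assoc, ← sub_eq_add_neg] at h4
  obtain ⟨y, hy, hG⟩ := exists_mapsTo_of_coords hK
    (f := ![uFun K, vFun K - uFun K * rFun n b, 1 - 2 * vFun K * rFun n b + uFun K * rFun n b ^ 2])
    (θ := θ) (h := h) (fun i => by
      fin_cases i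
      · exact hu.mem
      · exact hM1.mem
      · have h4 := Subring.add_mem _ (Subring.one_mem _) hM2.mem
        rwa [← add_assoc, ← sub_eq_add_neg] at h4)
    ⟨2, h3⟩ (fun i => by
      fin_cases i
      exacts [h0, h1, h2])
  rwa [← eq_basePoint ((hG _ 1 (isHomogeneous_X K 0)).mpr (by simpa using hu))
    ((hG _ 1 (isHomogeneous_X K 1)).mpr (by simpa using hM1))]

variable (n b) in
/-- The image of the coordinate `y / x`. -/
def yFun : FunField K := vFun K / uFun K - rFun n b

/-- Invariance of x and w determines the third coordinate from the second: z/x = (y/x)² + w/x². -/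
theorem exists_yFun (hθ : θ.GivenBy (phiForm n b) (4 * n + 1)) : ∃ h : FunField K,
      1 = h * θ.pull (dehom K (X 0)) ∧ yFun n b = h * θ.pull (dehom K (X 1)) ∧
      yFun n b ^ 2 + wFun K / uFun K ^ 2 = h * θ.pull (dehom K (X 2)) := by
  obtain ⟨h, h0, h1, h2⟩ := exists_dehom_phiForm hθ
  have hu := uFun_ne_zero (K := K)
  refine ⟨h / uFun K, ?_, ?_, ?_⟩
  · rw [div_mul_eq_mul_div, ← h0, div_self hu]
  · rw [div_mul_eq_mul_div, ← h1, yFun, sub_div, mul_div_cancel_left₀ _ hu]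
  · rw [div_mul_eq_mul_div, ← h2, yFun]
    have h3 : wFun K = uFun K - vFun K ^ 2 := rfl
    rw [h3]
    field_simp
    ring

theorem exists_mapsTo_of_yFun_mem (hθ : θ.GivenBy (phiForm n b) (4 * n + 1))
    (hK : ∀ c : K, algebraMap K _ c ∈ S.toSubring) (hc : wFun K / uFun K ^ 2 ∈ S.toSubring)
    (hY : yFun n b ∈ S.toSubring) :
    ∃ y : P2 K, θ.MapsTo S y ∧ ∀ (G : HomRing K) (d : ℕ), G.IsHomogeneous d →
      (G ∈ pIdeal y ↔
        MM S (aeval ![1, yFun n b, yFun n b ^ 2 + wFun K / uFun K ^ 2] G)) := by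
  obtain ⟨h, h0, h1, h2⟩ := exists_yFun hθ
  refine exists_mapsTo_of_coords (h := h) hK (fun i => ?_) ⟨0, MM.not_one S⟩ fun i => ?_
  · fin_cases i
    exacts [Subring.one_mem _, hY, Subring.add_mem _ (Subring.pow_mem _ hY 2) hc]
  · fin_cases i
    exacts [h0, h1, h2]

/-- At a pole of Y the coordinates (1 : Y : Y² + w/u²) are multiplied by Y⁻², and they reduce to (0
: 0 : 1). -/
theorem mapsTo_basePoint_of_inv_yFun (hθ : θ.GivenBy (phiForm n b) (4 * n + 1))
    (hK : ∀ c : K, algebraMap K _ c ∈ S.toSubring) (hc : wFun K / uFun K ^ 2 ∈ S.toSubring)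
    (hY0 : yFun n b ≠ 0) (hY : MM S (yFun n b)⁻¹) : θ.MapsTo S (basePoint K) := by
  obtain ⟨h, h0, h1, h2⟩ := exists_yFun hθ
  have hM : MM S (wFun K / uFun K ^ 2 * (yFun n b)⁻¹ ^ 2) := (hY.pow two_ne_zero).mul_left hc
  obtain ⟨y, hy, hG⟩ := exists_mapsTo_of_coords hK
    (f := ![(yFun n b)⁻¹ ^ 2, (yFun n b)⁻¹, 1 + wFun K / uFun K ^ 2 * (yFun n b)⁻¹ ^ 2])
    (θ := θ) (h := h * (yFun n b)⁻¹ ^ 2) (fun i => by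
      fin_cases i
      · exact (hY.pow two_ne_zero).mem
      · exact hY.mem
      · exact Subring.add_mem _ (Subring.one_mem _) hM.mem)
    ⟨2, not_MM_add_left (MM.not_one S) hM⟩ (fun i => by
      fin_cases i
      · change (yFun n b)⁻¹ ^ 2 = h * (yFun n b)⁻¹ ^ 2 * θ.pull (dehom K (X 0))
        rw [mul_right_comm, ← h0, one_mul]
      · change (yFun n b)⁻¹ = h * (yFun n b)⁻¹ ^ 2 * θ.pull (dehom K (X 1))
        rw [mul_right_comm, ← h1]
        field_simp
      · change 1 + wFun K / uFun K ^ 2 * (yFun n b)⁻¹ ^ 2 =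
          h * (yFun n b)⁻¹ ^ 2 * θ.pull (dehom K (X 2))
        rw [mul_right_comm, ← h2]
        field_simp)
  rwa [← eq_basePoint ((hG _ 1 (isHomogeneous_X K 0)).mpr
    (by rw [aeval_X]; exact hY.pow two_ne_zero))
    ((hG _ 1 (isHomogeneous_X K 1)).mpr (by rw [aeval_X]; exact hY))]

end

end LocalMaps

/-! ### The unipotent maps at the points of the tower -/

section TowerMaps

variable {K : Type u} [Field K]

open Polynomial

/-- The polynomial `b₀ + b₁ X + ⋯ + b_{n-1} X ^ (n-1)`. -/
def truncPoly (n : ℕ) (b : ℕ → K) : K[X] := ∑ k ∈ Finset.range n, C (b k) * X ^ k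

variable (K) in
/-- `e = 1 + X v²`, so that `u = v² e`. -/
def eFun : FunField K := 1 + xFun K * vFun K ^ 2

theorem wFun_eq : wFun K = xFun K * vFun K ^ 4 := by
  rw [xFun, div_mul_cancel₀ _ (pow_ne_zero 4 vFun_ne_zero)]

theorem uFun_eq_mul : uFun K = vFun K ^ 2 * eFun K := by
  rw [uFun_eq, wFun_eq, eFun]
  ring

theorem eFun_ne_zero : eFun K ≠ 0 := fun h => by
  have h1 := uFun_eq_mul (K := K)
  rw [h, mul_zero] at h1
  exact uFun_ne_zero h1

theorem wFun_div : wFun K / uFun K ^ 2 = xFun K / eFun K ^ 2 := by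
  have hv := vFun_ne_zero (K := K)
  have he := eFun_ne_zero (K := K)
  rw [uFun_eq_mul, wFun_eq]
  field_simp

/-- The function `β` with `e y' = 1 / v - β / X ^ n`. -/
def betaFun (n : ℕ) (b : ℕ → K) : FunField K :=
  eFun K ^ (2 * n + 1) * aeval (xFun K / eFun K ^ 2) (truncPoly n b)

/-- Here u = v² e and w = X v⁴, so v/u = 1/(v e) and u²/w = e²/X; hence e r = β / X^n. -/
theorem eFun_mul_yFun (n : ℕ) (b : ℕ → K) :
    eFun K * yFun n b = (vFun K)⁻¹ - betaFun n b / xFun K ^ n := by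
  have hv := vFun_ne_zero (K := K)
  have he := eFun_ne_zero (K := K)
  have hX := xFun_ne_zero (K := K)
  have h1 : rFun n b = betaFun n b / (eFun K * xFun K ^ n) := by
    rw [rFun, betaFun, truncPoly, map_sum, Finset.mul_sum, Finset.sum_div]
    refine Finset.sum_congr rfl fun k hk => ?_
    obtain ⟨j, rfl⟩ := Nat.exists_eq_add_of_lt (Finset.mem_range.mp hk)
    rw [show k + j + 1 - k = j + 1 by omega, uFun_eq_mul, wFun_eq, map_mul, aeval_C, map_pow,
      aeval_X]
    have h2 : (vFun K ^ 2 * eFun K) ^ 2 / (xFun K * vFun K ^ 4) = eFun K ^ 2 / xFun K := by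
      field_simp
    rw [h2, div_pow, div_pow]
    field_simp
    ring
  rw [yFun, h1, uFun_eq_mul]
  field_simp

section

variable {n : ℕ} {b : ℕ → K} {S : LocalSubring (FunField K)}

theorem MM_aeval_sub (hK : ∀ c : K, algebraMap K _ c ∈ S.toSubring) {g : FunField K} (hg : MM S g)
    (π : K[X]) : MM S (aeval g π - algebraMap K _ (π.coeff 0)) := by
  have h1 : aeval g π - algebraMap K _ (π.coeff 0) = aeval g π.divX * g := by
    conv_lhs => rw [← divX_mul_X_add π]
    simp
  rw [h1]
  exact hg.mul_left (polynomial_aeval_mem hK hg.mem _)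

theorem not_MM_eFun (hX : MM S (xFun K)) (hv : MM S (vFun K)) : ¬ MM S (eFun K) :=
  not_MM_add_left (MM.not_one S) (hX.mul_right (Subring.pow_mem _ hv.mem 2))

theorem eFun_mem (hX : MM S (xFun K)) (hv : MM S (vFun K)) : eFun K ∈ S.toSubring :=
  Subring.add_mem _ (Subring.one_mem _) (Subring.mul_mem _ hX.mem (Subring.pow_mem _ hv.mem 2))

theorem MM_wFun_div (hX : MM S (xFun K)) (hv : MM S (vFun K)) : MM S (wFun K / uFun K ^ 2) := by
  rw [wFun_div, div_eq_mul_inv, ← inv_pow]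
  exact hX.mul_right (Subring.pow_mem _ (inv_mem_of_not_MM (eFun_mem hX hv) (not_MM_eFun hX hv)).2 2)

-- Both e and its powers are 1 modulo X v², so β may be replaced by the polynomial b₀ + b₁ X + ⋯ up
-- to a multiple of X v². The congruences are taken in the subring S, as divisibility by X v².
variable (n b) in
theorem exists_betaFun_eq (hK : ∀ c : K, algebraMap K _ c ∈ S.toSubring) (hX : MM S (xFun K))
    (hv : MM S (vFun K)) : ∃ σ ∈ S.toSubring,
      betaFun n b = aeval (xFun K) (truncPoly n b) + xFun K * vFun K ^ 2 * σ := by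
  have he := eFun_mem hX hv
  have hi := (inv_mem_of_not_MM he (not_MM_eFun hX hv)).2
  have he0 := eFun_ne_zero (K := K)
  let e' : S.toSubring := ⟨eFun K, he⟩
  let i' : S.toSubring := ⟨(eFun K)⁻¹, hi⟩
  let x' : S.toSubring := ⟨xFun K, hX.mem⟩
  let ε : S.toSubring := ⟨xFun K * vFun K ^ 2, Subring.mul_mem _ hX.mem (Subring.pow_mem _ hv.mem 2)⟩
  have hei : e' * i' = 1 := Subtype.ext (mul_inv_cancel₀ he0)
  have hε : e' - 1 = ε := Subtype.ext (by simp [e', ε, eFun])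
  have h1 : ε ∣ e' ^ (2 * n + 1) - 1 := by
    rw [← hε]
    exact sub_one_dvd_pow_sub_one e' _
  have h2 : ε ∣ x' * i' ^ 2 - x' := by
    refine ⟨-(x' * i' ^ 2 * (e' + 1)), ?_⟩
    rw [← hε]
    linear_combination x' * (1 + e' * i') * hei
  let f : ℕ → S.toSubring := fun k => ⟨algebraMap K _ (b k), hK (b k)⟩
  have h3 : ε ∣ ∑ k ∈ Finset.range n, f k * (x' * i' ^ 2) ^ k -
      ∑ k ∈ Finset.range n, f k * x' ^ k := by
    rw [← Finset.sum_sub_distrib]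
    refine Finset.dvd_sum fun k _ => ?_
    rw [← mul_sub]
    exact (h2.trans (sub_dvd_pow_sub_pow _ _ k)).mul_left _
  obtain ⟨s, hs⟩ := h1
  obtain ⟨t, ht⟩ := h3
  refine ⟨_, (s * ∑ k ∈ Finset.range n, f k * (x' * i' ^ 2) ^ k + t).2, ?_⟩
  have h4 : e' ^ (2 * n + 1) * ∑ k ∈ Finset.range n, f k * (x' * i' ^ 2) ^ k =
      ∑ k ∈ Finset.range n, f k * x' ^ k +
        ε * (s * ∑ k ∈ Finset.range n, f k * (x' * i' ^ 2) ^ k + t) := by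
    linear_combination (∑ k ∈ Finset.range n, f k * (x' * i' ^ 2) ^ k) * hs + ht
  have h5 := congrArg (fun r : S.toSubring => (r : FunField K)) h4
  have h6 : ∀ z : S.toSubring, ((∑ k ∈ Finset.range n, f k * z ^ k : S.toSubring) : FunField K) =
      aeval (z : FunField K) (truncPoly n b) := fun z => by
    rw [truncPoly, map_sum, AddSubmonoidClass.coe_finsetSum]
    refine Finset.sum_congr rfl fun k _ => ?_
    simp [f]
  have h7 : ((x' * i' ^ 2 : S.toSubring) : FunField K) = xFun K / eFun K ^ 2 := by
    simp [x', i', div_eq_mul_inv]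
  rw [betaFun, ← h7, ← h6]
  exact h5.trans (by rw [Subring.coe_add, h6]; rfl)

theorem coeff_truncPoly_zero (hn : 1 ≤ n) : (truncPoly n b).coeff 0 = b 0 := by
  rw [truncPoly, finsetSum_coeff]
  simp only [coeff_C_mul, coeff_X_pow, mul_ite, mul_one, mul_zero]
  rw [Finset.sum_ite_eq]
  simp; omega

theorem betaFun_mem_and_MM (hn : 1 ≤ n) (hK : ∀ c : K, algebraMap K _ c ∈ S.toSubring)
    (hX : MM S (xFun K)) (hv : MM S (vFun K)) :
    betaFun n b ∈ S.toSubring ∧ MM S (betaFun n b - algebraMap K _ (b 0)) := by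
  obtain ⟨σ, hσ, he⟩ := exists_betaFun_eq n b hK hX hv
  have h1 : MM S (betaFun n b - algebraMap K _ (b 0)) := by
    have h2 := (MM_aeval_sub hK hX (truncPoly n b)).add
      ((hX.mul_right (Subring.pow_mem _ hv.mem 2)).mul_right hσ)
    rw [coeff_truncPoly_zero hn] at h2
    rw [he]
    convert h2 using 1
    ring
  refine ⟨?_, h1⟩
  have h2 := Subring.add_mem _ h1.mem (hK (b 0))
  rwa [sub_add_cancel] at h2

/-- Regime of the points whose strict transforms lie on `E₄`. -/
theorem inv_yFun_of_inv_mem (hn : 1 ≤ n) (hK : ∀ c : K, algebraMap K _ c ∈ S.toSubring)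
    (hX : MM S (xFun K)) (hv : MM S (vFun K)) {a₁ : K} (hab : b 0 * a₁ = 1)
    (h0 : vFun K / xFun K ^ n - algebraMap K _ a₁ ≠ 0)
    (hh : (vFun K / xFun K ^ n - algebraMap K _ a₁)⁻¹ ∈ S.toSubring) :
    yFun n b ≠ 0 ∧ MM S (yFun n b)⁻¹ := by
  obtain ⟨hβ, hβM⟩ := betaFun_mem_and_MM (b := b) hn hK hX hv
  set h := (vFun K / xFun K ^ n - algebraMap K _ a₁)⁻¹
  set β := betaFun n b
  have hab' : algebraMap K (FunField K) (b 0) * algebraMap K (FunField K) a₁ = 1 := by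
    rw [← map_mul, hab, map_one]
  have hb0 : b 0 ≠ 0 := left_ne_zero_of_mul_eq_one hab
  -- With y = v/X^n = a₁ + 1/h, the product e Y X^n (a₁ h + 1) equals h (1 - β a₁) - β. Since β is
  -- b₀ and b₀ a₁ = 1 modulo the maximal ideal, this is -b₀, a unit; so Y⁻¹ is X^n times a regular
  -- function.
  have hD1 : MM S (h * (1 - β * algebraMap K _ a₁) - (β - algebraMap K _ (b 0))) := by
    refine MM.sub (MM.mul_left hh ?_) hβM
    have h1 := (hβM.mul_right (hK a₁)).neg
    convert h1 using 1
    rw [sub_mul, hab']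
    ring
  have hD : ¬ MM S (h * (1 - β * algebraMap K _ a₁) - β) := by
    have h1 := not_MM_add_right hD1 (not_MM_algebraMap hK (neg_ne_zero.mpr hb0))
    convert h1 using 2
    rw [map_neg]
    ring
  have hDmem : h * (1 - β * algebraMap K _ a₁) - β ∈ S.toSubring :=
    Subring.sub_mem _ (Subring.mul_mem _ hh (Subring.sub_mem _ (Subring.one_mem _)
      (Subring.mul_mem _ hβ (hK _)))) hβ
  obtain ⟨hD0, hDi⟩ := inv_mem_of_not_MM hDmem hD
  have hX0 := xFun_ne_zero (K := K)
  have hv0 := vFun_ne_zero (K := K)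
  have hprod : eFun K * yFun n b * (xFun K ^ n * (algebraMap K _ a₁ * h + 1)) =
      h * (1 - β * algebraMap K _ a₁) - β := by
    have h1 : h * (vFun K / xFun K ^ n) = algebraMap K _ a₁ * h + 1 := by
      have h2 : h * (vFun K / xFun K ^ n - algebraMap K _ a₁) = 1 := inv_mul_cancel₀ h0
      linear_combination h2
    have h3 : (vFun K)⁻¹ * (xFun K ^ n * (h * (vFun K / xFun K ^ n))) = h := by
      field_simp
    have h4 : β / xFun K ^ n * (xFun K ^ n * (algebraMap K _ a₁ * h + 1)) =
        β * (algebraMap K _ a₁ * h + 1) := by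
      field_simp
    rw [eFun_mul_yFun, sub_mul, h4, ← h1, h3, h1]
    ring
  have hY0 : yFun n b ≠ 0 := by
    intro h1
    rw [h1, mul_zero, zero_mul] at hprod
    exact hD0 hprod.symm
  refine ⟨hY0, ?_⟩
  have h5 : (yFun n b)⁻¹ = xFun K ^ n * (eFun K * (algebraMap K _ a₁ * h + 1) *
      (h * (1 - β * algebraMap K _ a₁) - β)⁻¹) := by
    rw [← hprod] at hD0 ⊢
    have h6 := right_ne_zero_of_mul (right_ne_zero_of_mul hD0)
    have he0 := eFun_ne_zero (K := K)
    field_simp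
  rw [h5]
  exact (hX.pow (by omega)).mul_right (Subring.mul_mem _ (Subring.mul_mem _ (eFun_mem hX hv)
    (Subring.add_mem _ (Subring.mul_mem _ (hK _) hh) (Subring.one_mem _))) hDi)

/-- Regime of the last points: with `y = v / X ^ n = P(X) + X ^ n G` and `s - β G`. -/
theorem exists_yFun_eq (hK : ∀ c : K, algebraMap K _ c ∈ S.toSubring)
    (hX : MM S (xFun K)) (hv : MM S (vFun K)) {P : K[X]} (hP : X ^ n ∣ 1 - truncPoly n b * P)
    {G : FunField K} (hy : vFun K / xFun K ^ n ∈ S.toSubring)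
    (hG : vFun K / xFun K ^ n = aeval (xFun K) P + xFun K ^ n * G) :
    ∃ σ : K, ∃ s, MM S (s - algebraMap K _ σ) ∧
      eFun K * (vFun K / xFun K ^ n) * yFun n b =
        s - aeval (xFun K) (truncPoly n b) * G := by
  obtain ⟨τ, hτ, he⟩ := exists_betaFun_eq n b hK hX hv
  obtain ⟨q, hq⟩ := hP
  have hX0 := xFun_ne_zero (K := K)
  have hv0 := vFun_ne_zero (K := K)
  set y := vFun K / xFun K ^ n
  refine ⟨q.coeff 0, aeval (xFun K) q - xFun K * (vFun K * (y ^ 2 * τ)), ?_, ?_⟩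
  · have h1 := (MM_aeval_sub hK hX q).sub (hX.mul_right (Subring.mul_mem _ hv.mem
      (Subring.mul_mem _ (Subring.pow_mem _ hy 2) hτ)))
    convert h1 using 1
    ring
  · have h1 := congrArg (aeval (xFun K)) hq
    simp only [map_sub, map_one, map_mul, map_pow, aeval_X] at h1
    have hvy : vFun K = y * xFun K ^ n := (div_mul_cancel₀ _ (pow_ne_zero n hX0)).symm
    have h2 : eFun K * yFun n b * y * xFun K ^ n = 1 - betaFun n b * y := by
      rw [eFun_mul_yFun]
      simp only [y]
      field_simp
    refine mul_right_cancel₀ (pow_ne_zero n hX0) ?_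
    -- The error term X v² τ y is divisible by X^n because v = y X^n; the quotient still contains
    -- the factor X and so vanishes at S.
    have h3 : xFun K * vFun K ^ 2 * τ * y = xFun K * (vFun K * (y ^ 2 * τ)) * xFun K ^ n := by
      conv_lhs => rw [pow_two, hvy]
      conv_rhs => rw [hvy]
      ring
    calc _ = eFun K * yFun n b * y * xFun K ^ n := by ring
      _ = 1 - betaFun n b * y := h2
      _ = _ := by
        rw [he]
        linear_combination h1 - h3 - aeval (xFun K) (truncPoly n b) * hG

end

end TowerMaps

/-! ### The tower map -/

section TowerMap

variable {K : Type u} [Field K]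

open Polynomial

theorem MM_aeval_sub_aeval {S : LocalSubring (FunField K)}
    (hK : ∀ c : K, algebraMap K _ c ∈ S.toSubring) {x y : FunField K} (hx : x ∈ S.toSubring)
    (hy : y ∈ S.toSubring) (h : MM S (x - y)) (π : K[X]) : MM S (aeval x π - aeval y π) := by
  induction π using Polynomial.induction_on with
  | C c => simpa using MM.zero S
  | add p q hp hq =>
    rw [map_add, map_add, add_sub_add_comm]
    exact hp.add hq
  | monomial k c ih =>
    have h1 := (ih.mul_right hx).add (h.mul_left (polynomial_aeval_mem hK hy (C c * X ^ k)))
    convert h1 using 1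
    simp only [map_mul, map_pow, aeval_C, aeval_X]
    ring

theorem MM_mvPolynomial_aeval_sub_aeval {S : LocalSubring (FunField K)} {σ : Type*}
    (hK : ∀ c : K, algebraMap K _ c ∈ S.toSubring) {f g : σ → FunField K}
    (hf : ∀ i, f i ∈ S.toSubring) (hg : ∀ i, g i ∈ S.toSubring) (h : ∀ i, MM S (f i - g i))
    (A : MvPolynomial σ K) : MM S (MvPolynomial.aeval f A - MvPolynomial.aeval g A) := by
  induction A using MvPolynomial.induction_on with
  | C c => simpa using MM.zero S
  | add p q hp hq =>
    rw [map_add, map_add, add_sub_add_comm]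
    exact hp.add hq
  | mul_X p i ih =>
    have h1 := (ih.mul_right (hf i)).add ((h i).mul_left (aeval_mem_of_mem hK hg p))
    convert h1 using 1
    simp only [map_mul, MvPolynomial.aeval_X]
    ring

/-- The forms that vanish on the conic. -/
theorem wForm_dvd {A : HomRing K} {d : ℕ} (hA : A.IsHomogeneous d)
    (h : MvPolynomial.aeval (R := K) ![1, X, X ^ 2] A = (0 : K[X])) : wForm K ∣ A := by
  let x : HomRing K := MvPolynomial.X 0
  let y : HomRing K := MvPolynomial.X 1
  let z : HomRing K := MvPolynomial.X 2
  -- The homogeneous version of the parametrization (1 : t : t²).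
  have h1 : MvPolynomial.aeval (R := K) ![x ^ 2, x * y, y ^ 2] A = 0 := by
    by_contra h0
    refine dehom_ne_zero (isHomogeneous_aeval (d := 2) (fun i => ?_) hA) h0 ?_
    · fin_cases i
      · exact (MvPolynomial.isHomogeneous_X K 0).pow 2
      · exact (MvPolynomial.isHomogeneous_X K 0).mul (MvPolynomial.isHomogeneous_X K 1)
      · exact (MvPolynomial.isHomogeneous_X K 1).pow 2
    have hu := uFun_ne_zero (K := K)
    have h2 : (fun i => dehom K ((![x ^ 2, x * y, y ^ 2] : Fin 3 → HomRing K) i)) =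
        fun i => uFun K ^ 2 * aeval (vFun K / uFun K) ((![1, X, X ^ 2] : Fin 3 → K[X]) i) := by
      funext i
      fin_cases i
      · simp [x]
      · simp [x, y]
        field_simp
      · simp [y]
        field_simp
    rw [← AlgHom.comp_apply, MvPolynomial.comp_aeval, h2, aeval_mul_of_isHomogeneous hA,
      ← MvPolynomial.comp_aeval, AlgHom.comp_apply, h, map_zero, mul_zero]
  -- Modulo w the triples (x², x y, y²) and (x², x y, x z) agree, and the second one is x (x, y, z).
  -- So w divides x^d A, hence A.
  have h2 : MvPolynomial.aeval (R := K) ![x ^ 2, x * y, x * z] A = x ^ d * A := by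
    have h3 : (![x ^ 2, x * y, x * z] : Fin 3 → HomRing K) = fun i => x * MvPolynomial.X i := by
      funext i
      fin_cases i
      · exact pow_two x
      · rfl
      · rfl
    rw [h3, aeval_mul_of_isHomogeneous hA, MvPolynomial.aeval_X_left_apply]
  let I := Ideal.span {wForm K}
  have h3 : Ideal.Quotient.mk I (MvPolynomial.aeval (R := K) ![x ^ 2, x * y, x * z] A) =
      Ideal.Quotient.mk I (MvPolynomial.aeval (R := K) ![x ^ 2, x * y, y ^ 2] A) := by
    rw [MvPolynomial.aeval_def, MvPolynomial.aeval_def, MvPolynomial.hom_eval₂,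
      MvPolynomial.hom_eval₂]
    congr 1
    funext i
    fin_cases i
    · change Ideal.Quotient.mk I (x ^ 2) = Ideal.Quotient.mk I (x ^ 2)
      rfl
    · change Ideal.Quotient.mk I (x * y) = Ideal.Quotient.mk I (x * y)
      rfl
    · change Ideal.Quotient.mk I (x * z) = Ideal.Quotient.mk I (y ^ 2)
      rw [Ideal.Quotient.eq, Ideal.mem_span_singleton, wForm_eq]
  rw [h1, map_zero, h2, Ideal.Quotient.eq_zero_iff_mem, Ideal.mem_span_singleton] at h3
  refine ((PlaneCurve.conicQ K).prime.dvd_or_dvd h3).resolve_left fun h4 => ?_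
  obtain ⟨q, hq⟩ := (PlaneCurve.conicQ K).prime.dvd_of_dvd_pow h4
  have h5 := congrArg (MvPolynomial.aeval (R := K) (fun _ => (1 : K))) hq
  simp [x, PlaneCurve.conicQ] at h5

theorem towerPoint_le {n : ℕ} (hn : 1 ≤ n) (a : ℕ → K) {i j : ℕ} (hi : 1 ≤ i) (hij : i ≤ j) :
    towerPoint n a i ≤ towerPoint n a j := by
  induction j, hij using Nat.le_induction with
  | base => exact le_rfl
  | succ j hij ih =>
    exact ih.trans (mem_exceptionalFibre_iff.mp
      ((isCoordTower_towerPoint hn a (j + 1)).isTower.2 j (by omega) (by omega))).1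

theorem sum_Icc_eq_sum_range {M : Type*} [AddCommMonoid M] (f : ℕ → M) (m : ℕ) :
    ∑ k ∈ Finset.Icc 1 m, f k = ∑ k ∈ Finset.range m, f (k + 1) := by
  induction m with
  | zero => simp
  | succ m ih => rw [Finset.sum_Icc_succ_top (by omega), ih, Finset.sum_range_succ]

variable {n : ℕ} {a b : ℕ → K} {θ : Bir K} {S : LocalSubring (FunField K)}

/-- Away from the next point of the tower v^i / w is regular, with i ≤ 4. Then u²/w = w + 2 v² +
v⁴/w is regular, and so is r. -/
theorem mapsTo_basePoint_low (hθ : θ.GivenBy (phiForm n b) (4 * n + 1)) (hn : 1 ≤ n) {i : ℕ}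
    (h1 : 1 ≤ i) (h4 : i ≤ 4) (hS : S ∈ exceptionalFibre (towerPoint n a i))
    (hne : S ≠ towerPoint n a (i + 1)) : θ.MapsTo S (basePoint K) := by
  rw [towerPoint_of_le n a h4] at hS
  have hco := isCoord_v_div (K := K) (i - 1)
  have hle := (mem_exceptionalFibre_iff.mp hS).1
  have hK : ∀ c : K, algebraMap K _ c ∈ S.toSubring := fun c => hle.1 (hco.algebraMap_mem c)
  have h2 : wFun K / vFun K ^ (i - 1) / vFun K - algebraMap K (FunField K) 0 =
      wFun K / vFun K ^ i := by
    rw [map_zero, sub_zero, div_div, ← pow_succ, show i - 1 + 1 = i by omega]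
  have h3 : towerPoint n a (i + 1) = originRing (vFun K)
      (wFun K / vFun K ^ (i - 1) / vFun K - algebraMap K (FunField K) 0) := by
    rw [h2]
    rcases Nat.lt_or_ge i 4 with h5 | h5
    · exact towerPoint_of_le n a (by omega)
    · obtain rfl : i = 4 := by omega
      exact (towerPoint_add hn a 0).trans isCoord_xv.originRing_comm
  rw [h3] at hne
  have hinv := hco.inv_mem_of_ne hS 0 hne
  rw [h2, inv_div] at hinv
  have hv : MM S (vFun K) := hco.MM_left.of_le hle
  have hv0 := vFun_ne_zero (K := K)
  have hw0 := wFun_ne_zero (K := K)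
  have hw : MM S (wFun K) := by
    have h5 := (hco.MM_right.of_le hle).mul_right (Subring.pow_mem _ hv.mem (i - 1))
    rwa [div_mul_cancel₀ _ (pow_ne_zero _ hv0)] at h5
  have hu : MM S (uFun K) := by
    rw [uFun_eq]
    exact hw.add (hv.pow two_ne_zero)
  have hq : uFun K ^ 2 / wFun K ∈ S.toSubring := by
    obtain ⟨j, hj⟩ := Nat.exists_eq_add_of_le h4
    have h5 : uFun K ^ 2 / wFun K = wFun K + (vFun K ^ 2 + vFun K ^ 2) +
        vFun K ^ j * (vFun K ^ i / wFun K) := by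
      rw [mul_div_assoc', ← pow_add, add_comm j i, ← hj, uFun_eq]
      field_simp
      ring
    rw [h5]
    exact Subring.add_mem _ (Subring.add_mem _ hw.mem (Subring.add_mem _
      (Subring.pow_mem _ hv.mem 2) (Subring.pow_mem _ hv.mem 2)))
      (Subring.mul_mem _ (Subring.pow_mem _ hv.mem j) hinv)
  exact mapsTo_basePoint_of_mem hθ hK hu hv (Subring.sum_mem _ fun k _ =>
    Subring.mul_mem _ (hK _) (Subring.pow_mem _ hq _))

/-- From t_(j+1) = t_j / X - c one gets 1/t_(j+1) = (X/t_j) (1 - c X/t_j)⁻¹. So a point that leaves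
the tower early can be treated with a later coordinate. -/
theorem inv_towerCoord_mem (hK : ∀ c : K, algebraMap K _ c ∈ S.toSubring) (hX : MM S (xFun K))
    {i j : ℕ} (hi : (towerCoord n a i)⁻¹ ∈ S.toSubring) (hij : i ≤ j) :
    (towerCoord n a j)⁻¹ ∈ S.toSubring := by
  induction j, hij using Nat.le_induction with
  | base => exact hi
  | succ j hij ih =>
    have ht0 := (isCoord_towerCoord n a j).symm.ne_zero
    have hX0 := xFun_ne_zero (K := K)
    have h1 : ¬ MM S (1 + -(algebraMap K _ (towerConst n a j) * (xFun K * (towerCoord n a j)⁻¹))) :=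
      not_MM_add_left (MM.not_one S) ((hX.mul_right ih).mul_left (hK _)).neg
    have h2 := inv_mem_of_not_MM (Subring.add_mem _ (Subring.one_mem _)
      ((hX.mul_right ih).mul_left (hK _)).neg.mem) h1
    have h3 : (towerCoord n a (j + 1))⁻¹ = xFun K * (towerCoord n a j)⁻¹ *
        (1 + -(algebraMap K _ (towerConst n a j) * (xFun K * (towerCoord n a j)⁻¹)))⁻¹ := by
      rw [← inv_inv (xFun K * (towerCoord n a j)⁻¹), ← mul_inv]
      congr 1
      rw [towerCoord]
      field_simp
      ring
    rw [h3]
    exact Subring.mul_mem _ (Subring.mul_mem _ hX.mem ih) h2.2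

variable (n a) in
/-- The last coordinate. -/
def lastCoord : FunField K := towerCoord n a (2 * n - 1) / xFun K

theorem div_pow_eq_add_lastCoord (hn : 1 ≤ n) : vFun K / xFun K ^ n =
    aeval (xFun K) (truncPoly n fun k => a (k + 1)) + xFun K ^ n * lastCoord n a := by
  have hX0 := xFun_ne_zero (K := K)
  obtain ⟨m, rfl⟩ : ∃ m, n = m + 1 := ⟨n - 1, by omega⟩
  rw [lastCoord, show 2 * (m + 1) - 1 = m + 1 + m by omega, towerCoord_add (by omega),
    sum_Icc_eq_sum_range, truncPoly, map_sum]
  simp only [map_mul, map_pow, aeval_X, aeval_C, Nat.add_sub_cancel]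
  field_simp
  ring

theorem coeff_zero_mul (hn : 1 ≤ n)
    (hab : X ^ n ∣ 1 - truncPoly n b * truncPoly n fun k => a (k + 1)) : b 0 * a 1 = 1 := by
  have h1 := X_pow_dvd_iff.mp hab 0 (by omega)
  rw [coeff_sub, coeff_one_zero, mul_coeff_zero, coeff_truncPoly_zero hn,
    coeff_truncPoly_zero hn] at h1
  exact (sub_eq_zero.mp h1).symm

theorem MM_of_mem_exceptionalFibre (hn : 1 ≤ n) {k : ℕ}
    (hS : S ∈ exceptionalFibre (towerPoint n a (5 + k))) :
    (∀ c : K, algebraMap K _ c ∈ S.toSubring) ∧ MM S (xFun K) ∧ MM S (vFun K) ∧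
      (n ≤ k → MM S (towerCoord n a n)) := by
  have hle := (mem_exceptionalFibre_iff.mp hS).1
  have key : ∀ j, j ≤ k → originRing (xFun K) (towerCoord n a j) ≤ S := fun j hj => by
    rw [← towerPoint_add hn]
    exact (towerPoint_le hn a (by omega) (by omega)).trans hle
  refine ⟨fun c => (key k le_rfl).1 ((isCoord_towerCoord n a k).algebraMap_mem c),
    (isCoord_towerCoord n a k).MM_left.of_le (key k le_rfl),
    (isCoord_towerCoord n a 0).MM_right.of_le (key 0 (by omega)), fun h => ?_⟩
  exact (isCoord_towerCoord n a n).MM_right.of_le (key n h)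

/-- The outcome of the cancellation: g Y = s - β G, where g, s, β have constant residues a₁, σ, b₀.
Poles and values of Y are then read off from those of G. -/
theorem exists_eq_sub_mul_lastCoord (hn : 1 ≤ n)
    (hK : ∀ c : K, algebraMap K _ c ∈ S.toSubring) (hX : MM S (xFun K)) (hv : MM S (vFun K))
    (ht : MM S (towerCoord n a n))
    (hab : X ^ n ∣ 1 - truncPoly n b * truncPoly n fun k => a (k + 1)) : ∃ (σ : K) (g s β : FunField K),
    MM S (g - algebraMap K _ (a 1)) ∧ MM S (s - algebraMap K _ σ) ∧
      MM S (β - algebraMap K _ (b 0)) ∧ g * yFun n b = s - β * lastCoord n a := by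
  have h0 := towerCoord_add hn a 0
  have hy1 : MM S (vFun K / xFun K ^ n - algebraMap K _ (a 1)) := by
    rw [add_zero] at h0
    simpa [h0] using ht
  have hy := Subring.add_mem _ hy1.mem (hK (a 1))
  rw [sub_add_cancel] at hy
  obtain ⟨σ, s, hs, he⟩ := exists_yFun_eq hK hX hv hab hy (div_pow_eq_add_lastCoord hn)
  refine ⟨σ, _, s, _, ?_, hs, ?_, he⟩
  · have h1 := hy1.add ((hX.mul_right (Subring.pow_mem _ hv.mem 2)).mul_right hy)
    convert h1 using 1
    rw [eFun]
    ring
  · have h1 := MM_aeval_sub hK hX (truncPoly n b)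
    rwa [coeff_truncPoly_zero hn] at h1

/-- Since g Y = (s/G - β) G and s/G - β has the nonzero residue -b₀, a pole of G is a pole of Y. -/
theorem inv_yFun_of_inv_lastCoord (hn : 1 ≤ n)
    (hK : ∀ c : K, algebraMap K _ c ∈ S.toSubring) (hX : MM S (xFun K)) (hv : MM S (vFun K))
    (ht : MM S (towerCoord n a n))
    (hab : X ^ n ∣ 1 - truncPoly n b * truncPoly n fun k => a (k + 1))
    (hG0 : lastCoord n a ≠ 0) (hG : MM S (lastCoord n a)⁻¹) :
    yFun n b ≠ 0 ∧ MM S (yFun n b)⁻¹ := by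
  obtain ⟨σ, g, s, β, hg, hs, hβ, he⟩ := exists_eq_sub_mul_lastCoord hn hK hX hv ht hab
  have hb0 : b 0 ≠ 0 := left_ne_zero_of_mul_eq_one (coeff_zero_mul hn hab)
  have hmem : ∀ {r : FunField K} {c : K}, MM S (r - algebraMap K _ c) → r ∈ S.toSubring :=
    fun {r c} h => by
      have h1 := Subring.add_mem _ h.mem (hK c)
      rwa [sub_add_cancel] at h1
  have hβ' : ¬ MM S β := fun h => by
    have h1 := h.sub hβ
    rw [sub_sub_cancel] at h1
    exact not_MM_algebraMap hK hb0 h1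
  have hD : ¬ MM S (s * (lastCoord n a)⁻¹ + -β) :=
    not_MM_add_right (hG.mul_left (hmem hs)) fun h => hβ' (by simpa using h.neg)
  obtain ⟨hD0, hDi⟩ := inv_mem_of_not_MM (Subring.add_mem _ (Subring.mul_mem _ (hmem hs) hG.mem)
    (Subring.neg_mem _ (hmem hβ))) hD
  have he' : g * yFun n b = (s * (lastCoord n a)⁻¹ + -β) * lastCoord n a := by
    rw [he]
    field_simp
    ring
  have hne := mul_ne_zero hD0 hG0
  rw [← he'] at hne
  have hY0 := right_ne_zero_of_mul hne
  have hg0 := left_ne_zero_of_mul hne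
  refine ⟨hY0, ?_⟩
  have h5 : (yFun n b)⁻¹ = (lastCoord n a)⁻¹ * (g * (s * (lastCoord n a)⁻¹ + -β)⁻¹) := by
    have h6 : (s * (lastCoord n a)⁻¹ + -β) = g * yFun n b * (lastCoord n a)⁻¹ := by
      rw [he', mul_inv_cancel_right₀ hG0]
    rw [h6]
    field_simp
  rw [h5]
  exact hG.mul_right (Subring.mul_mem _ (hmem hg) hDi)

/-- Here a₁ has inverse b₀, so division of s - β G by g gives the residue b₀ σ - b₀² G. -/
theorem yFun_mem_and_MM (hn : 1 ≤ n)
    (hK : ∀ c : K, algebraMap K _ c ∈ S.toSubring) (hX : MM S (xFun K)) (hv : MM S (vFun K))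
    (ht : MM S (towerCoord n a n))
    (hab : X ^ n ∣ 1 - truncPoly n b * truncPoly n fun k => a (k + 1))
    (hG : lastCoord n a ∈ S.toSubring) : yFun n b ∈ S.toSubring ∧
    ∃ σ : K, MM S (yFun n b - aeval (lastCoord n a) (C (-(b 0 * b 0)) * X + C σ)) := by
  obtain ⟨σ, g, s, β, hg, hs, hβ, he⟩ := exists_eq_sub_mul_lastCoord hn hK hX hv ht hab
  have hab' := coeff_zero_mul hn hab
  have hmem : ∀ {r : FunField K} {c : K}, MM S (r - algebraMap K _ c) → r ∈ S.toSubring :=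
    fun {r c} h => by
      have h1 := Subring.add_mem _ h.mem (hK c)
      rwa [sub_add_cancel] at h1
  have hgM : ¬ MM S g := fun h => by
    have h1 := h.sub hg
    rw [sub_sub_cancel] at h1
    exact not_MM_algebraMap hK (right_ne_zero_of_mul_eq_one hab') h1
  obtain ⟨hg0, hgi⟩ := inv_mem_of_not_MM (hmem hg) hgM
  have hY : yFun n b ∈ S.toSubring := by
    have h1 : yFun n b = (s - β * lastCoord n a) * g⁻¹ := by
      rw [← he]
      field_simp
    rw [h1]
    exact Subring.mul_mem _ (Subring.sub_mem _ (hmem hs) (Subring.mul_mem _ (hmem hβ) hG)) hgi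
  refine ⟨hY, b 0 * σ, ?_⟩
  have h1 := (((hs.sub (hβ.mul_right hG)).sub (hg.mul_right hY)).mul_left (hK (b 0)))
  have hab2 : algebraMap K (FunField K) (b 0) * algebraMap K (FunField K) (a 1) = 1 := by
    rw [← map_mul, hab', map_one]
  convert h1 using 1
  simp only [map_add, map_mul, aeval_C, aeval_X, map_neg]
  linear_combination (-yFun n b) * hab2 + algebraMap K (FunField K) (b 0) * he

/-- In both regimes Y has a pole. A point leaving the tower at stage k < n is handled through v/X^n
- a₁, a later one through G. -/
theorem mapsTo_basePoint_high (hθ : θ.GivenBy (phiForm n b) (4 * n + 1)) (hn : 1 ≤ n)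
    (hab : X ^ n ∣ 1 - truncPoly n b * truncPoly n fun k => a (k + 1)) {k : ℕ}
    (hk : k + 1 < 2 * n) (hS : S ∈ exceptionalFibre (towerPoint n a (5 + k)))
    (hne : S ≠ towerPoint n a (5 + k + 1)) : θ.MapsTo S (basePoint K) := by
  obtain ⟨hK, hX, hv, ht⟩ := MM_of_mem_exceptionalFibre hn hS
  rw [towerPoint_add hn] at hS
  rw [add_assoc, towerPoint_add hn] at hne
  have hinv : (towerCoord n a (k + 1))⁻¹ ∈ S.toSubring :=
    (isCoord_towerCoord n a k).inv_mem_of_ne hS _ hne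
  have key : yFun n b ≠ 0 ∧ MM S (yFun n b)⁻¹ := by
    rcases Nat.lt_or_ge k n with h | h
    · have h1 := inv_towerCoord_mem hK hX hinv (show k + 1 ≤ n by omega)
      have h2 := (isCoord_towerCoord n a n).symm.ne_zero
      have h3 : towerCoord n a n = vFun K / xFun K ^ n - algebraMap K _ (a 1) := by
        simpa using towerCoord_add hn a 0
      rw [h3] at h1 h2
      exact inv_yFun_of_inv_mem hn hK hX hv (coeff_zero_mul hn hab) h2 h1
    · have h1 := inv_towerCoord_mem hK hX hinv (show k + 1 ≤ 2 * n - 1 by omega)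
      refine inv_yFun_of_inv_lastCoord hn hK hX hv (ht h) hab
        (div_ne_zero (isCoord_towerCoord n a _).symm.ne_zero xFun_ne_zero) ?_
      -- The inverse of G is X over the coordinate of index 2n - 1, so the factor X puts it in the
      -- maximal ideal.
      rw [lastCoord, inv_div, div_eq_mul_inv]
      exact hX.mul_right h1
  exact mapsTo_basePoint_of_inv_yFun hθ hK (MM_wFun_div hX hv).mem key.1 key.2

/-- Where G is regular, Y is an affine function of G with nonzero slope, and w/u² vanishes, so the
image is (1 : Y : Y²). On the exceptional curve G is transcendental, hence so is Y, and the image is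
the generic point of Q. -/
theorem exists_mapsTo_last (hθ : θ.GivenBy (phiForm n b) (4 * n + 1)) (hn : 1 ≤ n)
    (hab : X ^ n ∣ 1 - truncPoly n b * truncPoly n fun k => a (k + 1))
    (hS : S ∈ exceptionalFibre (towerPoint n a (4 + 2 * n))) :
    (∃ y, θ.MapsTo S y) ∧ (IsExceptionalCurve (towerPoint n a (4 + 2 * n)) S →
      θ.MapsTo S (PlaneCurve.conicQ K).genericPoint) := by
  have h5 : 4 + 2 * n = 5 + (2 * n - 1) := by omega
  rw [h5] at hS ⊢
  obtain ⟨hK, hX, hv, ht⟩ := MM_of_mem_exceptionalFibre hn hS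
  have ht' := ht (by omega)
  rw [towerPoint_add hn] at hS ⊢
  have hco := isCoord_towerCoord n a (2 * n - 1)
  have hc := MM_wFun_div hX hv
  by_cases hG : lastCoord n a ∈ S.toSubring
  · obtain ⟨hY, σ, hσ⟩ := yFun_mem_and_MM hn hK hX hv ht' hab hG
    obtain ⟨y, hy, hyG⟩ := exists_mapsTo_of_yFun_mem hθ hK hc.mem hY
    refine ⟨⟨y, hy⟩, fun hE => ?_⟩
    have hgen : IsGeneric S (lastCoord n a) := hco.isGeneric_of_isExceptionalCurve hE
    have hb0 : b 0 ≠ 0 := left_ne_zero_of_mul_eq_one (coeff_zero_mul hn hab)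
    -- A relation for Y becomes one for G after composition with a polynomial of degree one, and
    -- composition with it is injective.
    have hYgen : ∀ π : K[X], MM S (aeval (yFun n b) π) → π = 0 := fun π hπ => by
      have h1 := MM_aeval_sub_aeval hK hY (polynomial_aeval_mem hK hG _) hσ π
      have h2 := hπ.sub h1
      rw [sub_sub_cancel, ← aeval_comp] at h2
      by_contra hπ0
      refine hgen.2 _ ?_ h2
      intro h3
      rcases comp_eq_zero_iff.mp h3 with h4 | ⟨-, h4⟩
      · exact hπ0 h4
      · have h5 := congrArg (fun p => coeff p 1) h4
        simp [coeff_C, hb0] at h5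
    have hyQ : (PlaneCurve.conicQ K).genericPoint = y := by
      refine pIdeal_injective (le_antisymm ?_ ?_)
      · rw [pIdeal_genericPoint_le, hyG _ 2 wForm_isHomogeneous]
        simpa [wForm_eq, pow_two] using hc
      · rw [pIdeal_le_iff]
        intro d A hA hAy
        rw [hyG A d hA] at hAy
        refine mem_genericPoint.mpr (wForm_dvd hA (hYgen _ ?_))
        have h1 := MM_mvPolynomial_aeval_sub_aeval hK
          (f := ![1, yFun n b, yFun n b ^ 2 + wFun K / uFun K ^ 2])
          (g := ![1, yFun n b, yFun n b ^ 2]) (fun i => by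
            fin_cases i
            exacts [Subring.one_mem _, hY, Subring.add_mem _ (Subring.pow_mem _ hY 2) hc.mem])
          (fun i => by
            fin_cases i
            exacts [Subring.one_mem _, hY, Subring.pow_mem _ hY 2])
          (fun i => by
            fin_cases i
            · simpa using MM.zero S
            · simpa using MM.zero S
            · simpa using hc) A
        have h2 := hAy.sub h1
        rw [sub_sub_cancel] at h2
        convert h2 using 1
        rw [← AlgHom.comp_apply, MvPolynomial.comp_aeval]
        congr 2
        funext i
        fin_cases i <;> simp
    rw [hyQ]
    exact hy
  -- The point at infinity of the last fibre: Y has a pole and the image is the base point. This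
  -- point is not the generic point of the fibre.
  · have hGi := (hco.div_mem_of_exceptionalFibre hS).resolve_left hG
    rw [← inv_div] at hGi
    have hGM : MM S (lastCoord n a)⁻¹ := ⟨hGi, Or.inr (by rwa [inv_inv])⟩
    have key := inv_yFun_of_inv_lastCoord hn hK hX hv ht' hab
      (div_ne_zero hco.symm.ne_zero xFun_ne_zero) hGM
    exact ⟨⟨_, mapsTo_basePoint_of_inv_yFun hθ hK hc.mem key.1 key.2⟩, fun hE =>
      absurd (hco.isGeneric_of_isExceptionalCurve hE).1 hG⟩

end TowerMap

/-! ### The unipotent maps are associated with the towers -/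

section TowerMapExists

variable {K : Type u} [Field K]

open MvPolynomial

theorem not_isClosedPoint_genericPoint (C : PlaneCurve K) :
    ¬ IsClosedPoint (planeModel K) (localRing C.genericPoint) := fun h => by
  obtain ⟨y, hy, -⟩ := exists_lt_point C
  exact hy.ne (congrArg pIdeal (isClosedPoint_iff.mp h y hy.le).symm)

variable {n : ℕ} {a b : ℕ → K} {θ : Bir K}

theorem dvd_sForm_sub (n : ℕ) (hn : 1 ≤ n) (b : ℕ → K) :
    wForm K ∣ sForm n b - C (b 0) * X 0 ^ (2 * n) := by
  obtain ⟨m, rfl⟩ : ∃ m, n = m + 1 := ⟨n - 1, by omega⟩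
  rw [sForm, Finset.sum_range_succ', pow_zero, mul_one, Nat.sub_zero, add_sub_cancel_right]
  exact Finset.dvd_sum fun k _ => (dvd_pow_self _ (Nat.succ_ne_zero k)).mul_left _

/-- The only base point of the unipotent map. -/
theorem exists_phiForm_notMem (hn : 1 ≤ n) (hb : b 0 ≠ 0) {y : P2 K} (hy : y ≠ basePoint K) :
    ∃ i, phiForm n b i ∉ pIdeal y := by
  by_contra! h
  have hP := y.isPrime
  have hpow : ∀ {A : HomRing K} {k : ℕ}, A ^ k ∈ pIdeal y → A ∈ pIdeal y :=
    fun h => hP.mem_of_pow_mem _ h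
  -- Off the conic, vanishing of the first component gives x = 0 and then the second gives y = 0;
  -- but then w = 0.
  have hw : wForm K ∈ pIdeal y := by
    by_contra hw
    have hx : X 0 ∈ pIdeal y := (hP.mem_or_mem (phiForm_zero n b ▸ h 0)).resolve_right
      fun h1 => hw (hpow h1)
    have h1 := h 1
    rw [phiForm_one] at h1
    have h2 := (hP.mem_or_mem h1).resolve_right fun h1 => hw (hpow h1)
    have h3 := (pIdeal y).add_mem h2 ((pIdeal y).mul_mem_right (sForm n b) hx)
    rw [sub_add_cancel] at h3
    have h4 : X 1 ∈ pIdeal y := (hP.mem_or_mem h3).resolve_right fun h1 => hw (hpow h1)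
    refine hw ?_
    rw [wForm_eq]
    exact (pIdeal y).sub_mem ((pIdeal y).mul_mem_right _ hx) ((pIdeal y).pow_mem_of_mem h4 2 two_pos)
  have hwn : wForm K ^ n ∈ pIdeal y := (pIdeal y).pow_mem_of_mem hw n (by omega)
  have h2 := h 2
  rw [phiForm_two, mul_comm 2 n, pow_mul, pow_two] at h2
  -- On the conic the third component reduces to x s², with s congruent to b₀ x^(2n) modulo w. So x
  -- = 0, and y² = x z = 0.
  have h3 : X 0 * sForm n b ^ 2 ∈ pIdeal y := by
    have h4 := (pIdeal y).sub_mem h2 ((pIdeal y).sub_mem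
      ((pIdeal y).mul_mem_left (X 2) ((pIdeal y).mul_mem_left (wForm K ^ n) hwn))
      ((pIdeal y).mul_mem_right (sForm n b) ((pIdeal y).mul_mem_left (2 * X 1) hwn)))
    convert h4 using 1
    ring
  have hx : X 0 ∈ pIdeal y := by
    rcases hP.mem_or_mem h3 with h4 | h4
    · exact h4
    · obtain ⟨q, hq⟩ := dvd_sForm_sub n hn b
      have h5 := (pIdeal y).sub_mem (hpow h4) ((pIdeal y).mul_mem_right q hw)
      rw [← hq, sub_sub_cancel] at h5
      rcases hP.mem_or_mem h5 with h6 | h6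
      · exact absurd (Ideal.eq_top_of_isUnit_mem _ h6 ((isUnit_iff_ne_zero.mpr hb).map C)) hP.ne_top
      · exact hpow h6
  refine hy (eq_basePoint hx (hpow (k := 2) ?_))
  have h4 := (pIdeal y).sub_mem ((pIdeal y).mul_mem_right (X 2) hx) hw
  rwa [wForm_eq, sub_sub_cancel] at h4

/-- The first two components are divisible by w, and the third one is not. -/
theorem mapsTo_conicQ (hθ : θ.GivenBy (phiForm n b) (4 * n + 1)) (hn : 1 ≤ n) (hb : b 0 ≠ 0) :
    θ.MapsTo (localRing (PlaneCurve.conicQ K).genericPoint) (basePoint K) := by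
  obtain ⟨z, hz, hG⟩ := hθ.exists_mapsTo
    (exists_phiForm_notMem hn hb (IsCoordTower.genericPoint_ne_basePoint (PlaneCurve.conicQ K)))
  have hw : ∀ k, k ≠ 0 → wForm K ^ k ∈ pIdeal (PlaneCurve.conicQ K).genericPoint := fun k hk =>
    mem_genericPoint.mpr (dvd_pow_self _ hk)
  rwa [← eq_basePoint ((hG 1 _ (isHomogeneous_X K 0)).mpr ?_)
    ((hG 1 _ (isHomogeneous_X K 1)).mpr ?_)]
  · rw [aeval_X, phiForm_zero]
    exact Ideal.mul_mem_left _ _ (hw _ (by omega))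
  · rw [aeval_X, phiForm_one]
    exact Ideal.mul_mem_left _ _ (hw _ (by omega))

theorem genericPoint_eq_of_dvd_wForm {C : PlaneCurve K} (h : C.poly ∣ wForm K) :
    C.genericPoint = (PlaneCurve.conicQ K).genericPoint :=
  PlaneCurve.genericPoint_eq_of_dvd (D := PlaneCurve.conicQ K) h

/-- Curves other than Q go to curves because the shear is an isomorphism off Q; Q and the first
exceptional curves go to (0 : 0 : 1), and the last one goes to Q. -/
theorem isTowerMap_of_givenBy (hθ : θ.GivenBy (phiForm n b) (4 * n + 1)) (hn : 1 ≤ n)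
    (hab : Polynomial.X ^ n ∣ 1 - truncPoly n b * truncPoly n fun k => a (k + 1)) :
    IsTowerMap (towerPoint n a) (4 + 2 * n) θ := by
  have hb : b 0 ≠ 0 := left_ne_zero_of_mul_eq_one (coeff_zero_mul hn hab)
  have htow := isCoordTower_towerPoint hn a (4 + 2 * n)
  have key : ∀ {S : LocalSubring (FunField K)} {i : ℕ}, 1 ≤ i → i < 4 + 2 * n →
      S ∈ exceptionalFibre (towerPoint n a i) → S ≠ towerPoint n a (i + 1) →
      θ.MapsTo S (basePoint K) := by
    intro S i h1 hi hS hne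
    rcases Nat.lt_or_ge i 5 with h | h
    · exact mapsTo_basePoint_low hθ hn h1 (by omega) hS hne
    · obtain ⟨k, rfl⟩ := Nat.exists_eq_add_of_le h
      exact mapsTo_basePoint_high hθ hn hab (by omega) hS hne
  refine ⟨fun R hR => ?_, fun R hR => ⟨?_, ?_⟩, fun E hE => (exists_mapsTo_last hθ hn hab hE.1).2 hE⟩
  · rcases mem_towerSurface hR with ⟨⟨y, rfl⟩, hne⟩ | ⟨i, h1, h2, h3, hne⟩
    · obtain ⟨z, hz, -⟩ := hθ.exists_mapsTo (exists_phiForm_notMem (y := y) hn hb (by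
        rintro rfl
        exact hne (by omega) htow.base.symm))
      exact ⟨z, hz⟩
    · rcases h2.lt_or_eq with h4 | rfl
      · exact ⟨_, key h1 h4 h3 (hne h4)⟩
      · exact (exists_mapsTo_last hθ hn hab h3).1
  · rintro ⟨y, hyc, hy⟩
    rcases htow.curve_cases (by omega) hR with ⟨C, rfl⟩ | ⟨i, h1, h2, h3⟩
    · by_cases hC : C.poly ∣ wForm K
      · rw [genericPoint_eq_of_dvd_wForm hC]
        exact Or.inl rfl
      · obtain ⟨D, -, -, hD⟩ := (isPairOff_phiForm n b).exists_push_eq hθ hC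
        have h4 : y = D.genericPoint := point_eq_of_le hy hD.ge
        rw [h4] at hyc
        exact absurd hyc (not_isClosedPoint_genericPoint D)
    · rcases h2.lt_or_eq with h4 | rfl
      · exact Or.inr ⟨i, h1, h4, h3⟩
      · have h4 := point_eq_of_le hy ((exists_mapsTo_last hθ hn hab h3.1).2 h3)
        rw [h4] at hyc
        exact absurd hyc (not_isClosedPoint_genericPoint _)
  · rintro (rfl | ⟨i, h1, h2, h3⟩)
    · exact ⟨_, isClosedPoint_basePoint, mapsTo_conicQ hθ hn hb⟩
    · refine ⟨_, isClosedPoint_basePoint, key h1 h2 h3.1 ?_⟩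
      rintro rfl
      -- The curve R cannot be the next point of the tower, which has an algebraic residue field and
      -- would be a closed point.
      exact hR.2.2 (htow.isClosedPoint_of_isAlg hR.1 (htow.isAlg (by omega) (by omega)))

/-- The coefficients of the inverse of `a₁ + a₂ X + ⋯`. -/
def invCoeff (a : ℕ → K) (k : ℕ) : K :=
  PowerSeries.coeff k (PowerSeries.mk fun k => a (k + 1))⁻¹

theorem coeff_truncPoly (n : ℕ) (b : ℕ → K) (k : ℕ) :
    (truncPoly n b).coeff k = if k < n then b k else 0 := by
  rw [truncPoly, Polynomial.finsetSum_coeff]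
  simp only [Polynomial.coeff_C_mul, Polynomial.coeff_X_pow, mul_ite, mul_one, mul_zero]
  rw [Finset.sum_ite_eq]
  simp

theorem X_pow_dvd_invCoeff (n : ℕ) {a : ℕ → K} (ha : a 1 ≠ 0) :
    Polynomial.X ^ n ∣ 1 - truncPoly n (invCoeff a) * truncPoly n fun k => a (k + 1) := by
  rw [Polynomial.X_pow_dvd_iff]
  intro d hd
  have h1 : (PowerSeries.mk fun k => a (k + 1))⁻¹ * (PowerSeries.mk fun k => a (k + 1)) = 1 :=
    PowerSeries.inv_mul_cancel _ (by simpa using ha)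
  have h2 := congrArg (PowerSeries.coeff d) h1
  rw [PowerSeries.coeff_mul, PowerSeries.coeff_one] at h2
  rw [Polynomial.coeff_sub, Polynomial.coeff_one, Polynomial.coeff_mul, sub_eq_zero]
  rw [← h2]
  refine Finset.sum_congr rfl fun x hx => ?_
  have hx' := Finset.HasAntidiagonal.mem_antidiagonal.mp hx
  rw [coeff_truncPoly, coeff_truncPoly, if_pos (by omega), if_pos (by omega), PowerSeries.coeff_mk,
    invCoeff]

variable (n a) in
/-- The unipotent map associated with the tower. -/
def towerBir : Bir K := (isPairOff_phiForm n (invCoeff a)).toBir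

theorem towerBir_givenBy : (towerBir n a).GivenBy (phiForm n (invCoeff a)) (4 * n + 1) :=
  (isPairOff_phiForm n (invCoeff a)).toBir_givenBy

theorem isTowerMap_towerBir (hn : 1 ≤ n) (ha : a 1 ≠ 0) :
    IsTowerMap (towerPoint n a) (4 + 2 * n) (towerBir n a) :=
  isTowerMap_of_givenBy towerBir_givenBy hn (X_pow_dvd_invCoeff n ha)

end TowerMapExists

/-! ### Uniqueness of the tower maps -/

section Uniqueness

variable {K : Type u} [Field K]

open MvPolynomial

/-- With g = 1 the exceptional locus is empty. -/
theorem Bir.IsLinear.isPairOff {θ : Bir K} {A B : Fin 3 → HomRing K} (h : θ.IsLinear A B) :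
    IsPairOff A B 1 1 1 where
  left_isHomogeneous := h.givenBy.isHomogeneous
  right_isHomogeneous := h.symm_givenBy.isHomogeneous
  left_pos := one_ne_zero
  right_pos := one_ne_zero
  ne_zero := one_ne_zero
  comp_left := ⟨0, fun i => by simpa using h.aeval_left i⟩
  comp_right := ⟨0, fun i => by simpa using h.aeval_right i⟩
  aeval_left := ⟨0, by simp⟩
  aeval_right := ⟨0, by simp⟩

theorem Bir.IsLinear.symm {θ : Bir K} {A B : Fin 3 → HomRing K} (h : θ.IsLinear A B) :
    θ.symm.IsLinear B A :=
  ⟨h.symm_givenBy, h.givenBy, h.aeval_right, h.aeval_left⟩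

theorem Bir.IsLinear.aeval_aeval {θ : Bir K} {A B : Fin 3 → HomRing K} (h : θ.IsLinear A B)
    (F : HomRing K) : aeval A (aeval B F) = F := by
  rw [← AlgHom.comp_apply, comp_aeval]
  simp only [h.aeval_left]
  exact aeval_X_left_apply F

theorem Bir.IsLinear.exists_push_eq {θ : Bir K} {A B : Fin 3 → HomRing K} (h : θ.IsLinear A B)
    (C : PlaneCurve K) : ∃ D : PlaneCurve K, D.poly ∣ aeval B C.poly ∧
      θ.push (localRing C.genericPoint) = localRing D.genericPoint := by
  obtain ⟨D, -, h1, h2⟩ := h.isPairOff.exists_push_eq h.givenBy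
    (fun hC => C.irreducible.not_isUnit (isUnit_of_dvd_one hC))
  exact ⟨D, h1, h2⟩

/-- The equation of the image of a curve by a linear map. -/
theorem Bir.IsLinear.dvd_iff {θ : Bir K} {A B : Fin 3 → HomRing K} (h : θ.IsLinear A B)
    {C D : PlaneCurve K} (hCD : θ.push (localRing C.genericPoint) = localRing D.genericPoint)
    (F : HomRing K) : D.poly ∣ F ↔ C.poly ∣ aeval A F := by
  have key : ∀ {θ : Bir K} {A B : Fin 3 → HomRing K} (_ : θ.IsLinear A B) {C D : PlaneCurve K},
      θ.push (localRing C.genericPoint) = localRing D.genericPoint → D.poly ∣ aeval B C.poly := by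
    intro θ A B h C D hCD
    obtain ⟨D', h1, h2⟩ := h.exists_push_eq C
    exact (genericPoint_eq_iff.mp (localRing_injective (hCD.symm.trans h2))).dvd.trans h1
  have h1 := key h hCD
  have h2 : C.poly ∣ aeval A D.poly := key h.symm (by rw [← hCD, Bir.push_symm_push])
  constructor
  · intro hF
    exact h2.trans (map_dvd (aeval A) hF)
  · intro hF
    have h3 := h1.trans (map_dvd (aeval B) hF)
    rwa [h.symm.aeval_aeval] at h3

theorem Bir.MapsTo.push_eq {θ : Bir K} {R : LocalSubring (FunField K)} {C : PlaneCurve K}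
    (h : θ.MapsTo R C.genericPoint) : θ.push R = localRing C.genericPoint :=
  (localRing_genericPoint_eq_of_le h).symm

variable {n : ℕ} {a : ℕ → K} {φ : Bir K}

theorem conicQ_not_dvd {C : PlaneCurve K} (hC : ¬ C.poly ∣ wForm K) :
    C.genericPoint ≠ (PlaneCurve.conicQ K).genericPoint := fun h =>
  hC (genericPoint_eq_iff.mp h).dvd

/-- A tower map sends the curves other than the conic to curves. -/
theorem IsTowerMap.exists_push_eq (hn : 1 ≤ n) (hφ : IsTowerMap (towerPoint n a) (4 + 2 * n) φ)
    {C : PlaneCurve K} (hC : ¬ C.poly ∣ wForm K) :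
    ∃ D : PlaneCurve K, φ.push (localRing C.genericPoint) = localRing D.genericPoint := by
  have htow := isCoordTower_towerPoint hn a (4 + 2 * n)
  have hcurve := htow.isCurveOn C
  obtain ⟨y, hy⟩ := hφ.morphism _ hcurve.1
  -- The image cannot be the generic point of the plane, since then every rational function would be
  -- regular along C. It cannot be a closed point, since C is neither Q nor an exceptional curve.
  rcases point_cases y with h | ⟨D, rfl⟩ | h
  · exfalso
    apply localRing_genericPoint_ne_top C
    rw [eq_top_iff]
    intro r _
    have h1 : φ.symm.pull r ∈ (localRing y).toSubring := by
      rw [h]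
      trivial
    have h2 := (Bir.mapsTo_iff.mp hy).1 _ h1
    rwa [Bir.pull_symm_pull] at h2
  · exact ⟨D, hy.push_eq⟩
  · rcases (hφ.contracts_iff _ hcurve).mp ⟨y, h, hy⟩ with h1 | ⟨i, h1, h2, h3⟩
    · exact absurd (localRing_injective h1) (conicQ_not_dvd hC)
    · exact absurd h3 (htow.not_isExceptionalCurve C h1 h2.le)

theorem exists_isExceptionalCurve_last (n : ℕ) (hn : 1 ≤ n) (a : ℕ → K) :
    ∃ E, IsExceptionalCurve (towerPoint n a (4 + 2 * n)) E := by
  obtain ⟨s, t, hst, he⟩ :=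
    (isCoordTower_towerPoint hn a (4 + 2 * n)).coord (4 + 2 * n) (by omega) le_rfl
  rw [he]
  exact hst.exists_isExceptionalCurve

/-- Two maps associated with the same tower differ by a linear map. -/
theorem IsTowerMap.exists_isLinear (hn : 1 ≤ n) (ha : a 1 ≠ 0)
    (hφ : IsTowerMap (towerPoint n a) (4 + 2 * n) φ) :
    ∃ (θ : Bir K) (A B : Fin 3 → HomRing K), θ.IsLinear A B ∧ φ = θ.comp (towerBir n a) := by
  have hcomp : φ = (φ.comp (towerBir n a).symm).comp (towerBir n a) := by
    refine Bir.ext_pull fun r => ?_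
    exact (Bir.pull_symm_pull (towerBir n a) (φ.pull r)).symm
  suffices h : ∃ A B, (φ.comp (towerBir n a).symm).IsLinear A B by
    obtain ⟨A, B, h⟩ := h
    exact ⟨_, A, B, h, hcomp⟩
  refine Bir.exists_isLinear _ fun C => ?_
  suffices h : ∃ D : PlaneCurve K, localRing D.genericPoint =
      φ.push ((towerBir n a).symm.push (localRing C.genericPoint)) by
    obtain ⟨D, hD⟩ := h
    refine ⟨D, ?_⟩
    rw [Bir.MapsTo, Bir.push_comp]
    exact hD.le
  -- The conic comes from the last exceptional curve, which φ sends back to the conic. Every other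
  -- curve comes from a curve other than the conic, which φ does not contract.
  by_cases hC : C.poly ∣ wForm K
  · obtain ⟨E, hE⟩ := exists_isExceptionalCurve_last n hn a
    have h1 := ((isTowerMap_towerBir hn ha).last_to_conic E hE).push_eq
    rw [genericPoint_eq_of_dvd_wForm hC, ← h1, Bir.push_symm_push]
    exact ⟨_, (hφ.last_to_conic E hE).push_eq.symm⟩
  · obtain ⟨D, hD, -, h1⟩ := (isPairOff_phiForm n (invCoeff a)).symm.exists_push_eq
      (θ := (towerBir n a).symm) (isPairOff_phiForm n (invCoeff a)).symm.toBir_givenBy hC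
    rw [h1]
    obtain ⟨D', h2⟩ := hφ.exists_push_eq hn hD
    exact ⟨D', h2.symm⟩

end Uniqueness

/-! ### The image of the line -/

section LineImage

variable {K : Type u} [Field K]

open Polynomial

variable (K) in
/-- The parametrization `t ↦ (t : 1 : 0)` of the line. -/
def lineEval : HomRing K →ₐ[K] K[X] := MvPolynomial.aeval ![X, 1, 0]

@[simp] theorem lineEval_X_zero : lineEval K (MvPolynomial.X 0) = X := by simp [lineEval]

@[simp] theorem lineEval_X_one : lineEval K (MvPolynomial.X 1) = 1 := by simp [lineEval]

@[simp] theorem lineEval_X_two : lineEval K (MvPolynomial.X 2) = 0 := by simp [lineEval]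

@[simp] theorem lineEval_wForm : lineEval K (wForm K) = -1 := by simp [wForm_eq]

/-- Vanishing on (t : 1 : 0) gives, after homogenization, vanishing on (x : y : 0). -/
theorem X_two_dvd {F : HomRing K} {d : ℕ} (hF : F.IsHomogeneous d) (h : lineEval K F = 0) :
    MvPolynomial.X 2 ∣ F := by
  let x : HomRing K := MvPolynomial.X 0
  let y : HomRing K := MvPolynomial.X 1
  have h1 : MvPolynomial.aeval (R := K) ![x, y, 0] F = 0 := by
    by_contra h0
    refine dehom_ne_zero (isHomogeneous_aeval (d := 1) (fun i => ?_) hF) h0 ?_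
    · fin_cases i
      · exact MvPolynomial.isHomogeneous_X K 0
      · exact MvPolynomial.isHomogeneous_X K 1
      · exact MvPolynomial.isHomogeneous_zero _ _ _
    have hv := vFun_ne_zero (K := K)
    have h2 : (fun i => dehom K ((![x, y, 0] : Fin 3 → HomRing K) i)) =
        fun i => vFun K * aeval (uFun K / vFun K) ((![X, 1, 0] : Fin 3 → K[X]) i) := by
      funext i
      fin_cases i
      · simp [x]
        field_simp
      · simp [y]
      · simp
    rw [← AlgHom.comp_apply, MvPolynomial.comp_aeval, h2, aeval_mul_of_isHomogeneous hF,
      ← MvPolynomial.comp_aeval, AlgHom.comp_apply]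
    rw [show MvPolynomial.aeval (R := K) (![X, 1, 0] : Fin 3 → K[X]) F = 0 from h, map_zero, mul_zero]
  let I := Ideal.span {(MvPolynomial.X 2 : HomRing K)}
  have h2 : Ideal.Quotient.mk I F =
      Ideal.Quotient.mk I (MvPolynomial.aeval (R := K) ![x, y, 0] F) := by
    conv_lhs => rw [← MvPolynomial.aeval_X_left_apply (R := K) F]
    rw [MvPolynomial.aeval_def, MvPolynomial.aeval_def, MvPolynomial.hom_eval₂,
      MvPolynomial.hom_eval₂]
    congr 1
    funext i
    fin_cases i
    · change Ideal.Quotient.mk I x = Ideal.Quotient.mk I x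
      rfl
    · change Ideal.Quotient.mk I y = Ideal.Quotient.mk I y
      rfl
    · change Ideal.Quotient.mk I (MvPolynomial.X 2) = Ideal.Quotient.mk I 0
      rw [Ideal.Quotient.eq, sub_zero, Ideal.mem_span_singleton]
  rwa [h1, map_zero, Ideal.Quotient.eq_zero_iff_mem, Ideal.mem_span_singleton] at h2

variable (n : ℕ) (b : ℕ → K)

/-- The parametrization of the image of the line by the unipotent map. -/
def curveParam (i : Fin 3) : K[X] := lineEval K (phiForm n b i)

/-- The evaluation of forms along the parametrization. -/
def curveEval : HomRing K →ₐ[K] K[X] := MvPolynomial.aeval (curveParam n b)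

theorem curveEval_eq (F : HomRing K) :
    curveEval n b F = lineEval K (MvPolynomial.aeval (phiForm n b) F) := by
  rw [curveEval, ← AlgHom.comp_apply, MvPolynomial.comp_aeval]
  rfl

/-- The equation of the image of the line by the unipotent map. -/
def curveForm : HomRing K := phiForm n (-b) 2

theorem curveForm_isHomogeneous : (curveForm n b).IsHomogeneous (4 * n + 1) :=
  phiForm_isHomogeneous n (-b) 2

@[simp] theorem curveEval_wForm : curveEval n b (wForm K) = -1 := by
  rw [curveEval_eq, aeval_phiForm_wForm, map_pow, lineEval_wForm]
  exact Odd.neg_one_pow ⟨2 * n, by ring⟩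

theorem curveEval_phiForm (i : Fin 3) :
    curveEval n b (phiForm n (-b) i) = lineEval K (MvPolynomial.X i) := by
  rw [curveEval_eq, aeval_phiForm_phiForm, map_mul, map_pow, lineEval_wForm]
  rw [Even.neg_one_pow ⟨4 * n * n + 2 * n, by ring⟩, one_mul]

@[simp] theorem curveEval_curveForm : curveEval n b (curveForm n b) = 0 := by
  rw [curveForm, curveEval_phiForm, lineEval_X_two]

theorem not_wForm_dvd_X : ¬ wForm K ∣ MvPolynomial.X 0 := by
  rintro ⟨q, hq⟩
  rw [wForm_eq] at hq
  have h5 := congrArg (MvPolynomial.aeval (R := K) (fun _ => (1 : K))) hq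
  simp at h5

variable {n b}

/-- If F vanishes along the image of L, its pull-back is divisible by z. The inverse shear turns z
into `curveForm` and gives back F times a power of w. -/
theorem curveForm_dvd_pow_mul {F : HomRing K} {d : ℕ} (hF : F.IsHomogeneous d)
    (h : curveEval n b F = 0) : ∃ N, curveForm n b ∣ wForm K ^ N * F := by
  rw [curveEval_eq] at h
  obtain ⟨E, hE⟩ := X_two_dvd (isHomogeneous_aeval (phiForm_isHomogeneous n b) hF) h
  obtain ⟨k, hk⟩ := (isPairOff_phiForm n b).symm.exists_aeval_aeval
  refine ⟨k * d, ?_⟩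
  rw [← hk d F hF, hE, map_mul, MvPolynomial.aeval_X]
  exact dvd_mul_right _ _

/-- Modulo w the equation is x s², and s is b₀ x^(2n). -/
theorem not_wForm_dvd_curveForm (hn : 1 ≤ n) (hb : b 0 ≠ 0) : ¬ wForm K ∣ curveForm n b := by
  intro h
  have hw := (PlaneCurve.conicQ K).prime
  rw [curveForm, phiForm_two, sForm_neg] at h
  have h1 : wForm K ∣ MvPolynomial.X 0 * sForm n b ^ 2 := by
    have h2 : wForm K ∣ wForm K ^ n := dvd_pow_self _ (by omega)
    have h3 := dvd_sub h (dvd_mul_of_dvd_left h2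
      (MvPolynomial.X 2 * wForm K ^ n + 2 * MvPolynomial.X 1 * sForm n b))
    convert h3 using 1
    ring
  rcases hw.dvd_or_dvd h1 with h2 | h2
  · exact not_wForm_dvd_X h2
  · have h3 := dvd_sub (hw.dvd_of_dvd_pow h2) (dvd_sForm_sub n hn b)
    rw [sub_sub_cancel] at h3
    rcases hw.dvd_or_dvd h3 with h4 | h4
    · exact hw.not_isUnit (isUnit_of_dvd_unit h4 ((isUnit_iff_ne_zero.mpr hb).map MvPolynomial.C))
    · exact not_wForm_dvd_X (hw.dvd_of_dvd_pow h4)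

/-- In a factorization A B, one factor, say A, vanishes on the parametrized curve. Then A B divides
w^N A, so B divides w^N; as w does not divide A B, B is a unit. -/
theorem curveForm_irreducible (hn : 1 ≤ n) (hb : b 0 ≠ 0) : Irreducible (curveForm n b) := by
  have hw := (PlaneCurve.conicQ K).prime
  have hG0 : curveForm n b ≠ 0 := fun h => not_wForm_dvd_curveForm hn hb (h ▸ dvd_zero _)
  have key : ∀ A B : HomRing K, curveForm n b = A * B → curveEval n b A = 0 → IsUnit B := by
    intro A B hAB hA
    obtain ⟨d, hAd⟩ : ∃ d, A.IsHomogeneous d :=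
      isHomogeneous_of_dvd (curveForm_isHomogeneous n b) hG0 ⟨B, hAB⟩
    obtain ⟨N, hN⟩ := curveForm_dvd_pow_mul hAd hA
    have hA0 : A ≠ 0 := left_ne_zero_of_mul (hAB ▸ hG0)
    rw [hAB, mul_comm A B] at hN
    obtain ⟨i, -, hi⟩ := (dvd_prime_pow hw N).mp ((mul_dvd_mul_iff_right hA0).mp (hN))
    rcases Nat.eq_zero_or_pos i with rfl | hi0
    · rw [pow_zero] at hi
      exact hi.symm.isUnit isUnit_one
    · refine absurd ?_ (not_wForm_dvd_curveForm hn hb)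
      rw [hAB]
      exact ((dvd_pow_self _ hi0.ne').trans hi.symm.dvd).mul_left A
  refine ⟨fun hu => (hu.map (curveEval n b)).ne_zero (curveEval_curveForm n b), fun A B hAB => ?_⟩
  have h1 := curveEval_curveForm n b
  rw [hAB, map_mul, mul_eq_zero] at h1
  rcases h1 with h1 | h1
  · exact Or.inr (key A B hAB h1)
  · exact Or.inl (key B A (hAB.trans (mul_comm _ _)) h1)

theorem curveEval_eq_zero_iff (hn : 1 ≤ n) (hb : b 0 ≠ 0) {F : HomRing K} {d : ℕ}
    (hF : F.IsHomogeneous d) : curveEval n b F = 0 ↔ curveForm n b ∣ F := by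
  constructor
  · intro h
    obtain ⟨N, hN⟩ := curveForm_dvd_pow_mul hF h
    have hG := (curveForm_irreducible hn hb).prime
    refine (hG.dvd_or_dvd hN).resolve_left fun h1 => not_wForm_dvd_curveForm hn hb ?_
    exact ((curveForm_irreducible hn hb).associated_of_dvd (PlaneCurve.conicQ K).irreducible
      (hG.dvd_of_dvd_pow h1)).symm.dvd
  · rintro ⟨E, rfl⟩
    rw [map_mul, curveEval_curveForm, zero_mul]

/-- The image of the line by the unipotent map. -/
def towerCurve (hn : 1 ≤ n) (hb : b 0 ≠ 0) : PlaneCurve K where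
  poly := curveForm n b
  deg := 4 * n + 1
  isHomogeneous := curveForm_isHomogeneous n b
  irreducible := curveForm_irreducible hn hb

theorem invCoeff_zero_ne_zero {a : ℕ → K} (ha : a 1 ≠ 0) : invCoeff a 0 ≠ 0 :=
  left_ne_zero_of_mul_eq_one (coeff_zero_mul le_rfl (X_pow_dvd_invCoeff 1 ha))

theorem towerBir_push_lineL {a : ℕ → K} (hn : 1 ≤ n) (ha : a 1 ≠ 0) :
    (towerBir n a).push (localRing (PlaneCurve.lineL K).genericPoint) =
      localRing (towerCurve hn (invCoeff_zero_ne_zero ha)).genericPoint := by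
  have hL : ¬ (PlaneCurve.lineL K).poly ∣ wForm K := by
    rintro ⟨q, hq⟩
    have h1 := congrArg (lineEval K) hq
    rw [lineEval_wForm, map_mul, show lineEval K (PlaneCurve.lineL K).poly = 0 from lineEval_X_two,
      zero_mul] at h1
    exact neg_ne_zero.mpr one_ne_zero h1
  obtain ⟨D, -, hD, he⟩ := (isPairOff_phiForm n (invCoeff a)).exists_push_eq towerBir_givenBy hL
  rw [show MvPolynomial.aeval (phiForm n (-invCoeff a)) (PlaneCurve.lineL K).poly =
    curveForm n (invCoeff a) from MvPolynomial.aeval_X _ _] at hD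
  rw [he, PlaneCurve.genericPoint_eq_of_dvd
    (D := towerCurve hn (invCoeff_zero_ne_zero ha)) hD]

theorem exists_curveEval_eq (s : K[X]) : ∃ (k : ℕ) (A : HomRing K), A.IsHomogeneous (2 * k) ∧
    curveEval n b A = s * curveEval n b (wForm K) ^ k := by
  have hw : ∀ k, (wForm K ^ k).IsHomogeneous (2 * k) := fun k => wForm_isHomogeneous.pow k
  induction s using Polynomial.induction_on with
  | C c => exact ⟨0, MvPolynomial.C c, MvPolynomial.isHomogeneous_C _ _, by
      rw [MvPolynomial.algHom_C, pow_zero, mul_one]; rfl⟩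
  | add p q hp hq =>
    obtain ⟨k, A, hA, hA'⟩ := hp
    obtain ⟨l, B, hB, hB'⟩ := hq
    refine ⟨k + l, A * wForm K ^ l + B * wForm K ^ k, ?_, ?_⟩
    · exact (isHomogeneous_of_eq (hA.mul (hw l)) (by ring)).add
        (isHomogeneous_of_eq (hB.mul (hw k)) (by ring))
    · rw [map_add, map_mul, map_mul, map_pow, map_pow, hA', hB']
      ring
  | monomial m c ih =>
    obtain ⟨k, A, hA, hA'⟩ := ih
    -- The inverse shear recovers t and 1 from its first two components. Their product is used for t
    -- because its degree 2 (4n + 1) is that of a power of w; the sign compensates (-1)^(4n+1), the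
    -- value of that power.
    refine ⟨k + (4 * n + 1), A * -(phiForm n (-b) 0 * phiForm n (-b) 1), ?_, ?_⟩
    · exact isHomogeneous_of_eq (hA.mul (((phiForm_isHomogeneous n (-b) 0).mul
        (phiForm_isHomogeneous n (-b) 1)).neg)) (by ring)
    · have h := Odd.neg_one_pow (α := K[X]) (n := 4 * n + 1) ⟨2 * n, by ring⟩
      rw [map_mul, hA', map_neg, map_mul, curveEval_phiForm, curveEval_phiForm, lineEval_X_zero,
        lineEval_X_one, mul_one, curveEval_wForm, pow_add (-1 : K[X]) k, h]
      ring

variable (n b)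

/-- The polynomial `r (t, 1, 0)`. -/
def rPoly : K[X] := ∑ k ∈ Finset.range n, C (b k) * (-X ^ 2) ^ (n - k)

theorem lineEval_sForm : lineEval K (sForm n b) = (-1) ^ n * rPoly n b := by
  rw [sForm, rPoly, map_sum, Finset.mul_sum]
  refine Finset.sum_congr rfl fun k hk => ?_
  obtain ⟨j, rfl⟩ := Nat.exists_eq_add_of_lt (Finset.mem_range.mp hk)
  rw [map_mul, map_mul, map_pow, map_pow, lineEval_wForm, lineEval_X_zero, MvPolynomial.algHom_C,
    show k + j + 1 - k = j + 1 by omega, neg_pow (X ^ 2 : K[X]), ← pow_mul]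
  have h : ((-1 : K[X]) ^ (k + j + 1)) * (-1) ^ (j + 1) = (-1) ^ k := by
    rw [← pow_add, show k + j + 1 + (j + 1) = k + 2 * (j + 1) by ring, pow_add, pow_mul]
    simp
  change C (b k) * _ * _ = _
  linear_combination (-C (b k) * X ^ (2 * (j + 1))) * h

theorem curveParam_zero : curveParam n b 0 = X := by
  rw [curveParam, phiForm_zero, map_mul, map_pow, lineEval_wForm, lineEval_X_zero, pow_mul]
  simp

theorem curveParam_one : curveParam n b 1 = 1 - X * rPoly n b := by
  have h : ((-1 : K[X]) ^ n) * (-1) ^ n = 1 := by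
    rw [← mul_pow]
    simp
  rw [curveParam, phiForm_one, map_mul, map_sub, map_mul, map_mul, map_pow, lineEval_wForm,
    lineEval_sForm, lineEval_X_zero, lineEval_X_one]
  linear_combination (1 - X * rPoly n b) * h

theorem curveParam_two : curveParam n b 2 = -2 * rPoly n b + X * rPoly n b ^ 2 := by
  have h : ((-1 : K[X]) ^ n) * (-1) ^ n = 1 := by
    rw [← mul_pow]
    simp
  rw [curveParam, phiForm_two]
  simp only [map_mul, map_sub, map_add, map_pow, lineEval_wForm, lineEval_sForm, lineEval_X_zero,
    lineEval_X_one, lineEval_X_two, map_ofNat]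
  linear_combination (-2 * rPoly n b + X * rPoly n b ^ 2) * h

variable {n b}

theorem natDegree_rPoly (hn : 1 ≤ n) (hb : b 0 ≠ 0) : (rPoly n b).natDegree = 2 * n := by
  obtain ⟨m, rfl⟩ : ∃ m, n = m + 1 := ⟨n - 1, by omega⟩
  have hX : (-X ^ 2 : K[X]).natDegree = 2 := by rw [natDegree_neg, natDegree_X_pow]
  rw [rPoly, Finset.sum_range_succ', natDegree_add_eq_right_of_natDegree_lt]
  · rw [natDegree_C_mul hb, natDegree_pow, hX, Nat.sub_zero, mul_comm]
  · rw [natDegree_C_mul hb, natDegree_pow, hX, Nat.sub_zero]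
    refine lt_of_le_of_lt (natDegree_sum_le_of_forall_le (n := m * 2) _ _ fun k hk => ?_) (by omega)
    refine (natDegree_C_mul_le _ _).trans ?_
    rw [natDegree_pow, hX]
    exact Nat.mul_le_mul_right 2 (by omega)

theorem natDegree_curveParam_one (hn : 1 ≤ n) (hb : b 0 ≠ 0) :
    (curveParam n b 1).natDegree = 2 * n + 1 := by
  have h := natDegree_rPoly hn hb
  have h0 : rPoly n b ≠ 0 := by
    rintro h0
    rw [h0, natDegree_zero] at h
    omega
  have h1 : (X * rPoly n b).natDegree = 2 * n + 1 := by
    rw [natDegree_X_mul h0, h]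
  rw [curveParam_one, natDegree_sub_eq_right_of_natDegree_lt, h1]
  rw [h1, natDegree_one]
  omega

theorem natDegree_curveParam_two (hn : 1 ≤ n) (hb : b 0 ≠ 0) :
    (curveParam n b 2).natDegree = 4 * n + 1 := by
  have h := natDegree_rPoly hn hb
  have h0 : rPoly n b ≠ 0 := by
    rintro h0
    rw [h0, natDegree_zero] at h
    omega
  have h1 : (X * rPoly n b ^ 2).natDegree = 4 * n + 1 := by
    rw [natDegree_X_mul (pow_ne_zero 2 h0), natDegree_pow, h]
    ring
  rw [curveParam_two, natDegree_add_eq_right_of_natDegree_lt, h1]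
  rw [h1]
  refine lt_of_le_of_lt natDegree_mul_le ?_
  rw [h, natDegree_neg, show (2 : K[X]) = C 2 from (map_ofNat C 2).symm, natDegree_C]
  omega

end LineImage

/-! ### The type of the image of the line -/

section ImageType

variable {K : Type u} [Field K]

open Polynomial

/-- Transport of a chart along an isomorphism of algebras. -/
def PlaneCurve.Chart.congr {C : PlaneCurve K} {S T : Type u} [CommRing S] [Algebra K S]
    [CommRing T] [Algebra K T] (c : C.Chart S) (e : S ≃ₐ[K] T) : C.Chart T where
  g := c.g
  m := c.m
  isHomogeneous := c.isHomogeneous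
  pos := c.pos
  χ := e.toAlgHom.comp c.χ
  isUnit := c.isUnit.map e
  eq_zero_iff A d hA := (map_eq_zero_iff e e.injective).trans (c.eq_zero_iff A d hA)
  surjective s := by
    obtain ⟨k, A, hA, h⟩ := c.surjective (e.symm s)
    refine ⟨k, A, hA, ?_⟩
    change e (c.χ A) = s * e (c.χ c.g) ^ k
    rw [h, map_mul, map_pow, e.apply_symm_apply]

theorem mem_iff_of_X_mem {I : Ideal (HomRing K)} [hI : I.IsPrime] (h0 : MvPolynomial.X 0 ∈ I)
    (h1 : MvPolynomial.X 1 ∈ I) (h2 : MvPolynomial.X 2 ∉ I) {G : HomRing K} {d : ℕ}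
    (hG : G.IsHomogeneous d) : G ∈ I ↔ MvPolynomial.aeval (R := K) ![(0 : K), 0, 1] G = 0 := by
  have h3 := sub_mem_of_X_mem h0 h1 hG
  constructor
  · intro hGI
    have h4 := I.sub_mem hGI h3
    rw [sub_sub_cancel] at h4
    have h5 := (hI.mem_or_mem h4).resolve_right fun h => h2 (hI.mem_of_pow_mem _ h)
    by_contra h6
    exact hI.ne_top (Ideal.eq_top_of_isUnit_mem _ h5 ((isUnit_iff_ne_zero.mpr h6).map
      MvPolynomial.C))
  · intro h
    rwa [h, map_zero, zero_mul, sub_zero] at h3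

variable {n : ℕ} {b : ℕ → K}

theorem dvd_curveForm_sub (hn : 1 ≤ n) :
    wForm K ∣ curveForm n b - MvPolynomial.X 0 * sForm n b ^ 2 := by
  have h2 : wForm K ∣ wForm K ^ n := dvd_pow_self _ (by omega)
  rw [curveForm, phiForm_two, sForm_neg]
  refine (dvd_mul_of_dvd_left h2
    (MvPolynomial.X 2 * wForm K ^ n + 2 * MvPolynomial.X 1 * sForm n b)).trans (dvd_of_eq ?_)
  ring

theorem X_mem_of_curveForm_mem (hn : 1 ≤ n) (hb : b 0 ≠ 0) {I : Ideal (HomRing K)}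
    [hI : I.IsPrime] (hw : wForm K ∈ I) (hG : curveForm n b ∈ I) :
    MvPolynomial.X 0 ∈ I ∧ MvPolynomial.X 1 ∈ I := by
  have hx : MvPolynomial.X 0 ∈ I := by
    have h1 := I.sub_mem hG (I.mem_of_dvd (dvd_curveForm_sub (b := b) hn) hw)
    rw [sub_sub_cancel] at h1
    rcases hI.mem_or_mem h1 with h2 | h2
    · exact h2
    · have h3 := I.sub_mem (hI.mem_of_pow_mem _ h2) (I.mem_of_dvd (dvd_sForm_sub n hn b) hw)
      rw [sub_sub_cancel] at h3
      rcases hI.mem_or_mem h3 with h4 | h4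
      · exact absurd (Ideal.eq_top_of_isUnit_mem _ h4
          ((isUnit_iff_ne_zero.mpr hb).map MvPolynomial.C)) hI.ne_top
      · exact hI.mem_of_pow_mem _ h4
  refine ⟨hx, hI.mem_of_pow_mem 2 ?_⟩
  have h4 := I.sub_mem (I.mul_mem_right (MvPolynomial.X 2) hx) hw
  rwa [wForm_eq, sub_sub_cancel] at h4

/-- Forms that vanish at the cusp have a pole of smaller order at infinity, by at least two. -/
theorem natDegree_curveEval_add_two_le (hn : 1 ≤ n) (hb : b 0 ≠ 0) {H : HomRing K} {d : ℕ}
    (hH : H.IsHomogeneous d) (h0 : MvPolynomial.aeval (R := K) ![(0 : K), 0, 1] H = 0) :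
    curveEval n b H = 0 ∨ (curveEval n b H).natDegree + 2 ≤ d * (4 * n + 1) := by
  have hsum : ∀ e ∈ H.support, e 0 + e 1 + e 2 = d := by
    intro e he
    have := hH (MvPolynomial.mem_support_iff.mp he)
    simpa [Finsupp.weight_apply, Finsupp.sum_fintype, Fin.sum_univ_three] using this
  -- The value of H at (0 : 0 : 1) is the coefficient of z^d, so every monomial of H contains x or
  -- y.
  have hpos : ∀ e ∈ H.support, 1 ≤ e 0 + e 1 := by
    intro e he
    by_contra hlt
    rw [MvPolynomial.aeval_def, MvPolynomial.eval₂_eq', Finset.sum_eq_single_of_mem e he] at h0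
    · refine MvPolynomial.mem_support_iff.mp he ?_
      simpa [Fin.prod_univ_three, show e 0 = 0 by omega, show e 1 = 0 by omega] using h0
    · intro e' he' hne
      have h1 : e' 0 ≠ 0 ∨ e' 1 ≠ 0 := by
        by_contra! h1
        refine hne (Finsupp.ext fun i => ?_)
        have h2 := hsum e he
        have h3 := hsum e' he'
        fin_cases i
        · change e' 0 = e 0
          omega
        · change e' 1 = e 1
          omega
        · change e' 2 = e 2
          omega
      rcases h1 with h1 | h1 <;> simp [Fin.prod_univ_three, h1]
  rcases H.support.eq_empty_or_nonempty with h1 | ⟨e, he⟩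
  · left
    rw [MvPolynomial.support_eq_empty.mp h1, map_zero]
  right
  have hd : 1 * (4 * n + 1) ≤ d * (4 * n + 1) :=
    Nat.mul_le_mul_right _ ((hpos e he).trans (by have := hsum e he; omega))
  suffices h : (curveEval n b H).natDegree ≤ d * (4 * n + 1) - 2 by omega
  rw [curveEval, MvPolynomial.aeval_def, MvPolynomial.eval₂_eq']
  refine natDegree_sum_le_of_forall_le _ _ fun e he => ?_
  have h2 := hpos e he
  have h3 := hsum e he
  rw [Fin.prod_univ_three]
  have hdeg : ∀ i : Fin 3, ∀ m, (curveParam n b i).natDegree = m →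
      (curveParam n b i ^ e i).natDegree = e i * m := by
    rintro i m rfl
    exact natDegree_pow _ _
  have h4 : (curveParam n b 0 ^ e 0 * curveParam n b 1 ^ e 1 * curveParam n b 2 ^ e 2).natDegree ≤
      e 0 * 1 + e 1 * (2 * n + 1) + e 2 * (4 * n + 1) := by
    refine natDegree_mul_le.trans (add_le_add (natDegree_mul_le.trans (add_le_add ?_ ?_)) ?_)
    · exact (hdeg 0 1 (by rw [curveParam_zero, natDegree_X])).le
    · exact (hdeg 1 _ (natDegree_curveParam_one hn hb)).le
    · exact (hdeg 2 _ (natDegree_curveParam_two hn hb)).le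
  refine (natDegree_C_mul_le _ _).trans (h4.trans ?_)
  rw [← h3]
  -- Compared with z, a factor x lowers the degree by 4n and a factor y by 2n; both are at least
  -- two.
  have h5 : (e 0 + e 1) * 2 ≤ e 0 * (4 * n) + e 1 * (2 * n) := by
    rw [add_mul]
    exact add_le_add (Nat.mul_le_mul_left _ (by omega)) (Nat.mul_le_mul_left _ (by omega))
  have h6 : (e 0 + e 1 + e 2) * (4 * n + 1) = e 0 * 1 + e 1 * (2 * n + 1) + e 2 * (4 * n + 1) +
      (e 0 * (4 * n) + e 1 * (2 * n)) := by ring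
  omega

variable {θ : Bir K} {A B : Fin 3 → HomRing K} {C : PlaneCurve K}

/-- The parametrization of the part of the curve where the image of the conic does not meet it. -/
def towerChart (h : θ.IsLinear A B) (hn : 1 ≤ n) (hb : b 0 ≠ 0)
    (hC : θ.push (localRing (towerCurve hn hb).genericPoint) = localRing C.genericPoint) :
    C.Chart K[X] where
  g := MvPolynomial.aeval B (wForm K)
  m := 2
  isHomogeneous := isHomogeneous_of_eq
    (isHomogeneous_aeval h.symm_givenBy.isHomogeneous wForm_isHomogeneous) (by norm_num)
  pos := two_pos
  χ := (curveEval n b).comp (MvPolynomial.aeval A)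
  isUnit := by
    rw [AlgHom.comp_apply, h.aeval_aeval, curveEval_wForm]
    exact isUnit_one.neg
  eq_zero_iff F d hF := (curveEval_eq_zero_iff hn hb
    (isHomogeneous_aeval h.givenBy.isHomogeneous hF)).trans (h.dvd_iff hC F).symm
  surjective s := by
    obtain ⟨k, F, hF, h1⟩ := exists_curveEval_eq (n := n) (b := b) s
    refine ⟨k, MvPolynomial.aeval B F, isHomogeneous_of_eq
      (isHomogeneous_aeval h.symm_givenBy.isHomogeneous hF) (by ring), ?_⟩
    rw [AlgHom.comp_apply, h.aeval_aeval, AlgHom.comp_apply, h.aeval_aeval, h1]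

/-- The properties of the image of the line. -/
theorem image_properties (h : θ.IsLinear A B) (hn : 1 ≤ n) (hb : b 0 ≠ 0)
    (hC : θ.push (localRing (towerCurve hn hb).genericPoint) = localRing C.genericPoint) :
    C.deg = 4 * n + 1 ∧ C.IsTypeI ∧ C.IsUnicuspidal := by
  have hAhom := h.givenBy.isHomogeneous
  have hBhom := h.symm_givenBy.isHomogeneous
  have hdvd : C.poly ∣ MvPolynomial.aeval B (curveForm n b) := by
    rw [h.dvd_iff hC, h.aeval_aeval]
    exact dvd_rfl
  have hdvd' : curveForm n b ∣ MvPolynomial.aeval A C.poly := (h.dvd_iff hC C.poly).mp dvd_rfl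
  have hdeg : C.deg = 4 * n + 1 := by
    have h1 := map_dvd (MvPolynomial.aeval B) hdvd'
    rw [h.symm.aeval_aeval] at h1
    rw [← one_mul (4 * n + 1)]
    exact PlaneCurve.deg_eq_of_associated (isHomogeneous_aeval hBhom
      (curveForm_isHomogeneous n b)) (associated_of_dvd_dvd hdvd h1)
  -- Evaluation at θ(0 : 0 : 1), the future cusp.
  let ev : HomRing K →ₐ[K] K :=
    (MvPolynomial.aeval (R := K) ![(0 : K), 0, 1]).comp (MvPolynomial.aeval A)
  have hevB : ev (B 2) = 1 := by
    change MvPolynomial.aeval _ (MvPolynomial.aeval A (B 2)) = _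
    rw [h.aeval_left, MvPolynomial.aeval_X]
    rfl
  have hne : ∃ i : Fin 3, ev.toRingHom (MvPolynomial.X i) ≠ 0 := by
    by_contra! h0
    have h1 : ev = MvPolynomial.aeval (fun i => 0 * (0 : K)) := by
      refine MvPolynomial.algHom_ext fun i => ?_
      rw [MvPolynomial.aeval_X, zero_mul]
      exact h0 i
    rw [h1, aeval_mul_of_isHomogeneous (hBhom 2), zero_pow one_ne_zero, zero_mul] at hevB
    exact zero_ne_one hevB
  let y : P2 K := pointOf ev.toRingHom hne
  have hmem : ∀ {F : HomRing K} {d : ℕ}, F.IsHomogeneous d → (F ∈ pIdeal y ↔ ev F = 0) :=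
    fun hF => mem_pointOf hF
  have hyC : y ∈ C.points := by
    rw [PlaneCurve.mem_points, hmem C.isHomogeneous]
    obtain ⟨E, hE⟩ := hdvd'
    change MvPolynomial.aeval _ (MvPolynomial.aeval A C.poly) = _
    rw [hE, map_mul, curveForm, phiForm_two, wForm_eq]
    simp [show n ≠ 0 by omega]
  have hrange : Set.range C.ι = (C.points : Set (P2 K)) :=
    (Scheme.IdealSheafData.vanishingIdeal C.points).range_subschemeι.trans
      (Scheme.IdealSheafData.coe_support_vanishingIdeal C.points)
  obtain ⟨p, hp⟩ : y ∈ Set.range C.ι := hrange ▸ hyC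
  -- In the coordinates before θ, the curve meets the conic only where x = y = 0; hence only the
  -- cusp lies outside of the chart.
  have huniq : ∀ x : C.scheme, MvPolynomial.aeval B (wForm K) ∈ pIdeal (C.ι x) → x = p := by
    intro x hx
    refine (Scheme.Hom.isClosedEmbedding C.ι).injective (hp ▸ ?_)
    have := (C.ι x).isPrime
    let I := (pIdeal (C.ι x)).comap (MvPolynomial.aeval (R := K) B)
    have hI : I.IsPrime := Ideal.comap_isPrime _ _
    have hG : curveForm n b ∈ I := Ideal.mem_comap.mpr
      (Ideal.mem_of_dvd (pIdeal (C.ι x)) hdvd (PlaneCurve.mem_points.mp (C.ι_mem_points x)))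
    obtain ⟨h0, h1⟩ := X_mem_of_curveForm_mem hn hb (Ideal.mem_comap.mpr hx) hG
    have hAI : ∀ F : HomRing K, MvPolynomial.aeval A F ∈ I ↔ F ∈ pIdeal (C.ι x) := by
      intro F
      rw [Ideal.mem_comap, h.symm.aeval_aeval]
    have h2 : MvPolynomial.X 2 ∉ I := by
      intro h2
      obtain ⟨i, hi⟩ := exists_X_notMem (C.ι x)
      refine hi ((hAI _).mp ?_)
      rw [MvPolynomial.aeval_X]
      have h3 := sub_mem_of_X_mem h0 h1 (hAhom i)
      have h4 := I.add_mem h3 (I.mul_mem_left (MvPolynomial.C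
        (MvPolynomial.aeval (R := K) ![(0 : K), 0, 1] (A i))) (I.pow_mem_of_mem h2 1 one_pos))
      rwa [sub_add_cancel] at h4
    have key : ∀ {F : HomRing K} {d : ℕ}, F.IsHomogeneous d →
        (F ∈ pIdeal (C.ι x) ↔ F ∈ pIdeal y) := fun {F d} hF =>
      (hAI F).symm.trans ((mem_iff_of_X_mem h0 h1 h2 (isHomogeneous_aeval hAhom hF)).trans
        (hmem hF).symm)
    exact pIdeal_injective (le_antisymm
      (pIdeal_le_iff.mpr fun d F hF hx => (key hF).mp hx)
      (pIdeal_le_iff.mpr fun d F hF hx => (key hF).mpr hx))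
  let c := towerChart h hn hb hC
  have hopen : ∀ x : C.scheme, x ∈ c.opens ↔ x ≠ p := by
    intro x
    have h1 : x ∈ c.opens ↔ MvPolynomial.aeval B (wForm K) ∉ pIdeal (C.ι x) := Iff.rfl
    rw [h1, not_iff_comm, not_ne_iff]
    refine ⟨?_, fun h2 => huniq x h2⟩
    rintro rfl
    change c.g ∈ _
    rw [hp, hmem c.isHomogeneous]
    change MvPolynomial.aeval _ (MvPolynomial.aeval A (MvPolynomial.aeval B _)) = _
    rw [h.aeval_aeval, wForm_eq]
    simp
  have hℓ : (B 2).IsHomogeneous 1 := hBhom 2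
  have hχ : c.χ (B 2) = curveParam n b 2 := by
    change curveEval n b (MvPolynomial.aeval A (B 2)) = _
    rw [h.aeval_left, curveEval, MvPolynomial.aeval_X]
  refine ⟨hdeg, (c.congr (MvPolynomial.uniqueAlgEquiv K PUnit.{u + 1}).symm).isTypeI p hopen,
    c.isUnicuspidal p hopen hℓ ?_ ?_ ?_⟩
  · rw [hp, hmem hℓ, hevB]
    exact one_ne_zero
  · intro d F hF
    refine ⟨ev F, ?_⟩
    rw [hp, hmem (hF.sub (isHomogeneous_of_eq ((MvPolynomial.isHomogeneous_C _ _).mul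
      (hℓ.pow d)) (by ring))), map_sub, map_mul, map_pow, hevB, one_pow, mul_one,
      MvPolynomial.algHom_C]
    exact sub_self _
  · intro d F hF hFp
    rw [hp, hmem hF] at hFp
    rw [hχ, natDegree_curveParam_two hn hb]
    have h1 := natDegree_curveEval_add_two_le hn hb (isHomogeneous_aeval hAhom hF) hFp
    rwa [one_mul] at h1

end ImageType

/-! ### Linear equivalences between the parametrized curves -/

section LinearEquivalence

variable {K : Type u} [Field K]

open Polynomial

theorem exists_aeval_eq_sum {F : HomRing K} (hF : F.IsHomogeneous 1) :
    ∃ c : Fin 3 → K, ∀ g : Fin 3 → K[X],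
      MvPolynomial.aeval g F = C (c 0) * g 0 + C (c 1) * g 1 + C (c 2) * g 2 := by
  have h1 : F ∈ MvPolynomial.homogeneousSubmodule (Fin 3) K 1 := hF
  rw [MvPolynomial.homogeneousSubmodule_one_eq_span_X, Submodule.mem_span_range_iff_exists_fun] at h1
  obtain ⟨c, rfl⟩ := h1
  refine ⟨c, fun g => ?_⟩
  simp [Fin.sum_univ_three, MvPolynomial.aeval_X, smul_eq_C_mul]

variable {n : ℕ} {b b' : ℕ → K}

/-- The value of the unipotent map at the point `(p : q : 0)`. -/
def unipEval (n : ℕ) (b : ℕ → K) (p q : K[X]) (i : Fin 3) : K[X] :=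
  MvPolynomial.aeval ![p, q, 0] (phiForm n b i)

section

variable {p q : K[X]}

theorem aeval_wForm_line : MvPolynomial.aeval (R := K) ![p, q, 0] (wForm K) = -q ^ 2 := by
  simp [wForm_eq]

theorem unipEval_zero : unipEval n b p q 0 = p * (-q ^ 2) ^ (2 * n) := by
  rw [unipEval, phiForm_zero, map_mul, map_pow, aeval_wForm_line, MvPolynomial.aeval_X]
  rfl

theorem unipEval_one : unipEval n b p q 1 =
    (q * (-q ^ 2) ^ n - p * MvPolynomial.aeval ![p, q, 0] (sForm n b)) * (-q ^ 2) ^ n := by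
  simp [unipEval, phiForm_one, aeval_wForm_line]

theorem unipEval_two : unipEval n b p q 2 =
    -(2 * q * (-q ^ 2) ^ n * MvPolynomial.aeval ![p, q, 0] (sForm n b)) +
      p * MvPolynomial.aeval ![p, q, 0] (sForm n b) ^ 2 := by
  simp [unipEval, phiForm_two, aeval_wForm_line]

/-- Modulo a divisor π of q only p s² survives, with s congruent to b₀ p^(2n), and p is prime to π.
-/
theorem not_dvd_unipEval_two (hn : 1 ≤ n) (hb : b 0 ≠ 0) (hpq : IsCoprime p q) {π : K[X]}
    (hπ : Prime π) (h : π ∣ q) : ¬ π ∣ unipEval n b p q 2 := by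
  intro h2
  have hp : ¬ π ∣ p := fun hp => hπ.not_isUnit (hpq.isUnit_of_dvd' hp h)
  have hq : π ∣ -q ^ 2 := (dvd_neg.mpr (dvd_pow h two_ne_zero))
  rw [unipEval_two, dvd_add_right (dvd_neg.mpr (((h.mul_left 2).mul_right _).mul_right _))] at h2
  have h3 := hπ.dvd_of_dvd_pow ((hπ.dvd_or_dvd h2).resolve_left hp)
  have h4 := map_dvd (MvPolynomial.aeval (R := K) ![p, q, 0]) (dvd_sForm_sub n hn b)
  rw [aeval_wForm_line, map_sub] at h4
  have h5 := dvd_sub h3 (hq.trans h4)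
  rw [sub_sub_cancel, map_mul, map_pow, MvPolynomial.aeval_X, MvPolynomial.algHom_C] at h5
  rcases hπ.dvd_or_dvd h5 with h6 | h6
  · exact hπ.not_isUnit (isUnit_of_dvd_unit h6 ((isUnit_iff_ne_zero.mpr hb).map (algebraMap K K[X])))
  · exact hp (hπ.dvd_of_dvd_pow h6)

/-- The shear has only the base point (0 : 0 : 1), not on L. So it sends coprime coordinates on L to
coordinates without common factor. -/
theorem exists_not_dvd_unipEval (hn : 1 ≤ n) (hb : b 0 ≠ 0) (hpq : IsCoprime p q) {π : K[X]}
    (hπ : Prime π) : ∃ i, ¬ π ∣ unipEval n b p q i := by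
  by_contra! h
  by_cases hq : π ∣ q
  · exact not_dvd_unipEval_two hn hb hpq hπ hq (h 2)
  have hq2 : ∀ k, ¬ π ∣ (-q ^ 2) ^ k := fun k h1 =>
    hq (hπ.dvd_of_dvd_pow (dvd_neg.mp (hπ.dvd_of_dvd_pow h1)))
  have h0 := h 0
  have h1 := h 1
  rw [unipEval_zero] at h0
  rw [unipEval_one] at h1
  have hp := (hπ.dvd_or_dvd h0).resolve_right (hq2 _)
  have h2 := (hπ.dvd_or_dvd h1).resolve_right (hq2 _)
  rw [dvd_sub_left (hp.mul_right _)] at h2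
  exact (hπ.dvd_or_dvd h2).elim hq (hq2 n)

end

/-- A primitive parametrization of the curve is the image of a primitive parametrization of the
line. -/
theorem exists_eq_unipEval (hn : 1 ≤ n) (hb : b 0 ≠ 0) {m u : Fin 3 → K[X]}
    (hu : u 0 * m 0 + u 1 * m 1 + u 2 * m 2 = 1)
    (hm : MvPolynomial.aeval m (phiForm n (-b) 2) = 0)
    (hw : MvPolynomial.aeval (R := K) m (wForm K) ≠ 0) :
    ∃ (p q : K[X]) (c : K), IsCoprime p q ∧ c ≠ 0 ∧ ∀ i, m i = C c * unipEval n b p q i := by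
  classical
  let W := MvPolynomial.aeval (R := K) m (wForm K)
  let p0 := MvPolynomial.aeval m (phiForm n (-b) 0)
  let q0 := MvPolynomial.aeval m (phiForm n (-b) 1)
  let N := 8 * n * n + 4 * n
  -- The inverse shear brings m to a point (p0 : q0 : 0) of the line, since m satisfies the equation
  -- of the curve; the shear then returns m up to a power of w(m).
  have h1 : ∀ i, unipEval n b p0 q0 i = W ^ N * m i := by
    intro i
    have h2 := congrArg (MvPolynomial.aeval (R := K) m) (aeval_phiForm_phiForm n (-b) i)
    rw [neg_neg, map_mul, map_pow, MvPolynomial.aeval_X, ← AlgHom.comp_apply,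
      MvPolynomial.comp_aeval] at h2
    rw [← h2, unipEval]
    congr 2
    funext j
    fin_cases j
    · rfl
    · rfl
    · exact hm.symm
  have hscale : ∀ g p q : K[X], ∀ i,
      unipEval n b (g * p) (g * q) i = g ^ (4 * n + 1) * unipEval n b p q i := by
    intro g p q i
    rw [unipEval, unipEval, ← aeval_mul_of_isHomogeneous (phiForm_isHomogeneous n b i)]
    congr 2
    funext j
    fin_cases j <;> simp
  have hW : W ^ N ≠ 0 := pow_ne_zero _ hw
  have hg0 : gcd p0 q0 ≠ 0 := by
    intro hg
    obtain ⟨hp, hq⟩ := (gcd_eq_zero_iff _ _).mp hg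
    have h2 : ∀ i, m i = 0 := by
      intro i
      have h3 := h1 i
      rw [hp, hq, ← zero_mul (0 : K[X]), hscale, zero_pow (by omega), zero_mul] at h3
      exact (mul_eq_zero.mp h3.symm).resolve_left hW
    rw [h2, h2, h2] at hu
    simp at hu
  let g := gcd p0 q0
  let p := p0 / g
  let q := q0 / g
  have hpq : IsCoprime p q := isCoprime_div_gcd_div_gcd_of_gcd_ne_zero hg0
  have hp : g * p = p0 := EuclideanDomain.mul_div_cancel' hg0 (gcd_dvd_left _ _)
  have hq : g * q = q0 := EuclideanDomain.mul_div_cancel' hg0 (gcd_dvd_right _ _)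
  have h2 : ∀ i, g ^ (4 * n + 1) * unipEval n b p q i = W ^ N * m i := by
    intro i
    rw [← hscale, hp, hq, h1]
  let v := u 0 * unipEval n b p q 0 + u 1 * unipEval n b p q 1 + u 2 * unipEval n b p q 2
  -- The Bézout relation for m, applied to the image of the reduced pair (p, q), produces the factor
  -- v by which that image differs from m.
  have h3 : W ^ N = g ^ (4 * n + 1) * v := by
    linear_combination (-W ^ N) * hu - u 0 * h2 0 - u 1 * h2 1 - u 2 * h2 2
  have hv0 : v ≠ 0 := right_ne_zero_of_mul (h3 ▸ hW)
  have h4 : ∀ i, unipEval n b p q i = v * m i := by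
    intro i
    refine mul_left_cancel₀ (pow_ne_zero (4 * n + 1) hg0) ?_
    rw [h2, h3, mul_assoc]
  -- An irreducible factor of v would divide all three components of the image of a coprime pair.
  have hv : IsUnit v := by
    by_contra hv
    obtain ⟨π, hπ, hπv⟩ := WfDvdMonoid.exists_irreducible_factor hv hv0
    obtain ⟨i, hi⟩ := exists_not_dvd_unipEval hn hb hpq hπ.prime
    exact hi (h4 i ▸ hπv.mul_right _)
  obtain ⟨c, hc, hcv⟩ := Polynomial.isUnit_iff.mp hv
  refine ⟨p, q, c⁻¹, hpq, inv_ne_zero hc.ne_zero, fun i => ?_⟩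
  rw [h4, ← hcv, ← mul_assoc, ← C_mul, inv_mul_cancel₀ hc.ne_zero, C_1, one_mul]

/-- A Bézout relation: the three polynomials have no common factor. It survives linear changes of
coordinates. -/
theorem curveParam_eq_one : curveParam n b 1 + rPoly n b * curveParam n b 0 = 1 := by
  rw [curveParam_one, curveParam_zero]
  ring

/-- No coordinates have two linear forms divisible by the square of a nonconstant polynomial. -/
theorem not_sq_dvd {m : Fin 3 → K[X]} {B : Fin 3 → HomRing K} (hB : ∀ i, (B i).IsHomogeneous 1)
    (hm : ∀ i, MvPolynomial.aeval m (B i) = curveParam n b i) {π : K[X]} (hπ : 0 < π.natDegree)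
    (h0 : π ^ 2 ∣ m 0) (h1 : π ^ 2 ∣ m 1) : False := by
  choose c hc using fun i => exists_aeval_eq_sum (hB i)
  -- Modulo π² the parametrization γ is a multiple μ (c₀, c₁, c₂) of a constant vector, so it would
  -- be ramified at the roots of π. The polynomial identities below exclude this.
  have h2 : ∀ i, π ^ 2 ∣ curveParam n b i - C (c i 2) * m 2 := by
    intro i
    rw [← hm i, hc, add_sub_cancel_right]
    exact (h0.mul_left _).add (h1.mul_left _)
  have hdeg : 1 < (π ^ 2).natDegree := by
    rw [natDegree_pow]
    omega
  have hnot : ∀ e : K, π ^ 2 ∣ C e → e = 0 := fun e he => by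
    have := eq_zero_of_dvd_of_natDegree_lt he (by rw [natDegree_C]; omega)
    simpa using this
  have hw : curveParam n b 0 * curveParam n b 2 - curveParam n b 1 ^ 2 = -1 := by
    rw [← curveEval_wForm (n := n) (b := b), wForm_eq, curveEval]
    simp
  have h20 := h2 0
  have h21 := h2 1
  have h22 := h2 2
  have hγ0 := curveParam_zero n b
  have hγ1 := curveParam_one n b
  set γ0 := curveParam n b 0
  set γ1 := curveParam n b 1
  set γ2 := curveParam n b 2
  set μ := m 2
  let e := c 0 2 * c 2 2 - c 1 2 ^ 2
  -- Evaluate the quadratic form w, which is -1 on γ, at the constant vector.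
  have h3 : π ^ 2 ∣ 1 + C e * μ ^ 2 := by
    have h4 := ((h20.mul_left (-γ2)).add (h21.mul_left (γ1 + C (c 1 2) * μ))).add
      (h22.mul_left (-(C (c 0 2) * μ)))
    refine h4.trans (dvd_of_eq ?_)
    simp only [e, C_sub, C_mul, C_pow]
    linear_combination -hw
  have he : e ≠ 0 := by
    intro he
    rw [he, C_0, zero_mul, add_zero, ← C_1] at h3
    exact one_ne_zero (hnot 1 h3)
  let τ := c 0 2 ^ 2 * e⁻¹
  -- Since γ₀ = X is c₀ μ and μ² is constant modulo π², so is X², and with it r.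
  have h5 : π ^ 2 ∣ -X ^ 2 - C τ := by
    have hee : C e * C e⁻¹ = (1 : K[X]) := by rw [← C_mul, mul_inv_cancel₀ he, C_1]
    have h4 := (h20.mul_left (-(X + C (c 0 2) * μ))).add (h3.mul_left (-(C (c 0 2) ^ 2 * C e⁻¹)))
    refine h4.trans (dvd_of_eq ?_)
    simp only [τ, C_mul, C_pow, hγ0]
    linear_combination (-C (c 0 2) ^ 2 * μ ^ 2) * hee
  let r := ∑ k ∈ Finset.range n, b k * τ ^ (n - k)
  have h6 : π ^ 2 ∣ rPoly n b - C r := by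
    rw [rPoly, map_sum, ← Finset.sum_sub_distrib]
    refine Finset.dvd_sum fun k _ => ?_
    rw [C_mul, C_pow, ← mul_sub]
    exact (h5.trans (sub_dvd_pow_sub_pow _ _ _)).mul_left _
  -- Eliminating μ between X = c₀ μ and 1 - r X = c₁ μ leaves a polynomial of degree at most one
  -- divisible by π², hence zero. So c₀ = 0 and π² would divide X.
  have h7 : π ^ 2 ∣ C (c 0 2) - X * C (c 0 2 * r + c 1 2) := by
    have h4 := ((h21.mul_left (C (c 0 2))).add (h6.mul_left (C (c 0 2) * X))).sub
      (h20.mul_left (C (c 1 2)))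
    refine h4.trans (dvd_of_eq ?_)
    simp only [C_add, C_mul, hγ0, hγ1]
    ring
  have h8 := eq_zero_of_dvd_of_natDegree_lt h7 (lt_of_le_of_lt (by compute_degree) hdeg)
  have h9 := congrArg (fun F => F.coeff 0) h8
  have h10 : c 0 2 = 0 := by simpa using h9
  rw [h10, C_0, zero_mul, sub_zero, hγ0] at h20
  exact X_ne_zero (eq_zero_of_dvd_of_natDegree_lt h20 (by rwa [natDegree_X]))

end LinearEquivalence

/-! ### Coefficients of linearly equivalent parametrizations -/

section LinearEquivalence

variable {K : Type u} [Field K]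

open Polynomial

variable {n : ℕ} {b b' : ℕ → K}

theorem rPoly_coeff_two_mul {k : ℕ} (hk : k < n) :
    (rPoly n b).coeff (2 * (n - k)) = (-1) ^ (n - k) * b k := by
  rw [rPoly, finsetSum_coeff, Finset.sum_eq_single_of_mem k (Finset.mem_range.mpr hk)]
  · rw [coeff_C_mul, neg_pow, ← pow_mul, ← C_1, ← C_neg, ← C_pow, coeff_C_mul, coeff_X_pow_self]
    ring
  · intro j hj hjk
    have hj' := Finset.mem_range.mp hj
    rw [coeff_C_mul, neg_pow, ← pow_mul, ← C_1, ← C_neg, ← C_pow, coeff_C_mul, coeff_X_pow,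
      if_neg (by omega)]
    simp

theorem rPoly_coeff_zero : (rPoly n b).coeff 0 = 0 := by
  rw [rPoly, finsetSum_coeff]
  refine Finset.sum_eq_zero fun k hk => ?_
  have hk' := Finset.mem_range.mp hk
  rw [coeff_C_mul, neg_pow, ← pow_mul, ← C_1, ← C_neg, ← C_pow, coeff_C_mul, coeff_X_pow,
    if_neg (by omega)]
  simp

/-- For constant q = c the point (p : c : 0) has parameter t = p / c. -/
theorem unipEval_C (p : K[X]) {c : K} (hc : c ≠ 0) (i : Fin 3) :
    unipEval n b p (C c) i = C (c ^ (4 * n + 1)) * (curveParam n b i).comp (C c⁻¹ * p) := by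
  have h1 : (![p, C c, 0] : Fin 3 → K[X]) =
      fun i => C c * aeval (C c⁻¹ * p) ((![X, 1, 0] : Fin 3 → K[X]) i) := by
    have h2 : C c * C c⁻¹ = (1 : K[X]) := by rw [← C_mul, mul_inv_cancel₀ hc, C_1]
    funext j
    fin_cases j
    · change p = C c * aeval (C c⁻¹ * p) X
      rw [aeval_X]
      linear_combination (-p) * h2
    · change C c = C c * aeval (C c⁻¹ * p) 1
      rw [map_one, mul_one]
    · change 0 = C c * aeval (C c⁻¹ * p) 0
      rw [map_zero, mul_zero]
  rw [unipEval, h1, aeval_mul_of_isHomogeneous (phiForm_isHomogeneous n b i), C_pow]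
  congr 1
  rw [← MvPolynomial.comp_aeval, AlgHom.comp_apply]
  rfl

/-- A linear equivalence of the parametrized curves is a substitution. -/
theorem exists_eq_comp_of_linear (hn : 1 ≤ n) (hb' : b' 0 ≠ 0)
    {A B : Fin 3 → HomRing K} (hB : ∀ i, (B i).IsHomogeneous 1)
    (hBA : ∀ i, MvPolynomial.aeval A (B i) = MvPolynomial.X i)
    (hm : curveEval n b (MvPolynomial.aeval A (curveForm n b')) = 0)
    (hw : curveEval n b (MvPolynomial.aeval A (wForm K)) ≠ 0) :
    ∃ (P : K[X]) (e : K), e ≠ 0 ∧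
      ∀ i, curveEval n b (A i) = C e * (curveParam n b' i).comp P := by
  let m : Fin 3 → K[X] := fun i => curveEval n b (A i)
  have haeval : ∀ F : HomRing K, MvPolynomial.aeval m F = curveEval n b (MvPolynomial.aeval A F) :=
    fun F => by rw [← AlgHom.comp_apply, MvPolynomial.comp_aeval]
  have hmB : ∀ i, MvPolynomial.aeval m (B i) = curveParam n b i := fun i => by
    rw [haeval, hBA, curveEval, MvPolynomial.aeval_X]
  choose c hc using fun i => exists_aeval_eq_sum (hB i)
  -- The Bézout relation for the curve, rewritten in the coordinates m.
  let u : Fin 3 → K[X] := fun j => C (c 1 j) + rPoly n b * C (c 0 j)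
  have hu : u 0 * m 0 + u 1 * m 1 + u 2 * m 2 = 1 := by
    rw [← curveParam_eq_one (n := n) (b := b), ← hmB, ← hmB, hc, hc]
    ring
  have hm' : MvPolynomial.aeval m (phiForm n (-b') 2) = 0 := by
    rw [haeval]
    exact hm
  have hw' : MvPolynomial.aeval (R := K) m (wForm K) ≠ 0 := by rwa [haeval]
  obtain ⟨p, q, e, -, he, hV⟩ := exists_eq_unipEval (u := u) hn hb' hu hm' hw'
  -- A nonconstant factor of q would appear squared in the first two components; so q is constant
  -- and the parameter change is polynomial.
  have hnot : ∀ π : K[X], 0 < π.natDegree → ¬ π ∣ q := by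
    intro π hπ hπq
    have h1 : π ^ 2 ∣ -q ^ 2 := dvd_neg.mpr (pow_dvd_pow_of_dvd hπq 2)
    refine not_sq_dvd hB hmB hπ ?_ ?_
    · rw [hV, unipEval_zero]
      exact ((h1.trans (dvd_pow_self _ (by omega))).mul_left _).mul_left _
    · rw [hV, unipEval_one]
      exact ((h1.trans (dvd_pow_self _ (by omega))).mul_left _).mul_left _
  obtain ⟨q1, rfl⟩ : ∃ q1, q = C q1 := by
    refine ⟨q.coeff 0, eq_C_of_natDegree_eq_zero ?_⟩
    by_contra h
    exact hnot q (Nat.pos_of_ne_zero h) dvd_rfl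
  have hq1 : q1 ≠ 0 := by
    rintro rfl
    exact hnot X (by rw [natDegree_X]; exact one_pos) (by rw [C_0]; exact dvd_zero X)
  exact ⟨C q1⁻¹ * p, e * q1 ^ (4 * n + 1), mul_ne_zero he (pow_ne_zero _ hq1), fun i => (hV i).trans (by
    rw [unipEval_C p hq1, C_mul, mul_assoc])⟩

/-- The coefficients of linearly equivalent parametrized curves. -/
theorem coeff_eq_of_comp (hn : 1 ≤ n) (hb : b 0 ≠ 0) (hb' : b' 0 ≠ 0)
    {A : Fin 3 → HomRing K} (hA : ∀ i, (A i).IsHomogeneous 1) {P : K[X]} {e' : K} (he' : e' ≠ 0)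
    (hP : ∀ i, curveEval n b (A i) = C e' * (curveParam n b' i).comp P) :
    ∃ α : K, α ≠ 0 ∧ ∀ k < n, b k = α ^ (2 * (n - k) + 1) * b' k := by
  set m : Fin 3 → K[X] := fun i => curveEval n b (A i) with hm
  replace hP : ∀ i, m i = C e' * (curveParam n b' i).comp P := hP
  choose f hf using fun i => exists_aeval_eq_sum (hA i)
  have hsum : ∀ i, m i = C (f i 0) * X + C (f i 1) * curveParam n b 1 +
      C (f i 2) * curveParam n b 2 := fun i => by
    rw [← curveParam_zero n b]
    exact hf i (curveParam n b)
  have hd1 := natDegree_curveParam_one hn hb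
  have hd2 := natDegree_curveParam_two hn hb
  -- The component m₂ has degree (4n + 1) deg P, and it is a combination of polynomials of degree at
  -- most 4n + 1.
  have hPdeg : P.natDegree ≤ 1 := by
    have h1 : (m 2).natDegree ≤ 4 * n + 1 := by
      rw [hsum]
      refine natDegree_add_le_of_degree_le (natDegree_add_le_of_degree_le ?_ ?_) ?_
      · exact (natDegree_C_mul_le _ _).trans (natDegree_X_le.trans (by omega))
      · exact (natDegree_C_mul_le _ _).trans (by omega)
      · exact (natDegree_C_mul_le _ _).trans hd2.le
    rw [hP, natDegree_C_mul he', natDegree_comp, natDegree_curveParam_two hn hb'] at h1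
    exact Nat.le_of_mul_le_mul_left (h1.trans (mul_one _).ge) (by omega)
  have hlead : ∀ {F : K[X]} {d : ℕ}, F.natDegree = d → 0 < d → F.coeff d ≠ 0 := by
    rintro F d rfl hd h
    rw [coeff_natDegree, leadingCoeff_eq_zero] at h
    rw [h, natDegree_zero] at hd
    exact lt_irrefl 0 hd
  -- The degrees 1, 2n+1, 4n+1 are distinct, so the linear map is triangular and m₀ is a multiple of
  -- X alone.
  have hf2 : ∀ i, (m i).natDegree < 4 * n + 1 → f i 2 = 0 := by
    intro i hi
    have h1 := coeff_eq_zero_of_natDegree_lt hi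
    rw [hsum, coeff_add, coeff_add, coeff_C_mul, coeff_C_mul, coeff_C_mul,
      coeff_eq_zero_of_natDegree_lt (p := X) (lt_of_le_of_lt natDegree_X_le (by omega)),
      coeff_eq_zero_of_natDegree_lt (p := curveParam n b 1) (by omega)] at h1
    simpa [hlead hd2 (by omega)] using h1
  have hf1 : ∀ i, f i 2 = 0 → (m i).natDegree < 2 * n + 1 → f i 1 = 0 := by
    intro i hi2 hi
    have h1 := coeff_eq_zero_of_natDegree_lt hi
    rw [hsum, hi2, coeff_add, coeff_add, coeff_C_mul, coeff_C_mul, coeff_C_mul,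
      coeff_eq_zero_of_natDegree_lt (p := X) (lt_of_le_of_lt natDegree_X_le (by omega))] at h1
    simpa [hlead hd1 (by omega)] using h1
  have h0 := hP 0
  rw [curveParam_zero, X_comp] at h0
  have h0deg : (m 0).natDegree ≤ 1 := by
    rw [h0]
    exact (natDegree_C_mul_le _ _).trans hPdeg
  have h02 := hf2 0 (by omega)
  have h01 := hf1 0 h02 (by omega)
  have h1 := hsum 0
  rw [h02, h01, h0, C_0, zero_mul, zero_mul, add_zero, add_zero] at h1
  obtain ⟨s, hs⟩ : ∃ s : K, P = C s * X := by
    refine ⟨e'⁻¹ * f 0 0, ?_⟩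
    rw [C_mul, mul_assoc, ← h1, ← mul_assoc, ← C_mul, inv_mul_cancel₀ he', C_1, one_mul]
  have h2 := hP 1
  have h1deg : (m 1).natDegree ≤ 2 * n + 1 := by
    rw [h2]
    refine (natDegree_C_mul_le _ _).trans ?_
    rw [natDegree_comp, natDegree_curveParam_one hn hb']
    exact (Nat.mul_le_mul_left _ hPdeg).trans (mul_one _).le
  have h3 := hsum 1
  rw [hf2 1 (by omega), h2, curveParam_one, curveParam_one, sub_comp, mul_comp, X_comp, one_comp, hs,
    C_0, zero_mul, add_zero] at h3
  have h4 : e' = f 1 1 := by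
    have h4 := congrArg (fun F => F.coeff 0) h3
    simpa using h4
  -- Both polynomials r vanish at 0, so 1 - X r has no linear term.
  have h5 : f 1 0 = 0 := by
    have h5 := congrArg (fun F => F.coeff 1) h3
    have h6 : ∀ (c : K) (F G : K[X]), (C c * (1 - C s * X * F.comp (C s * X))).coeff 1 =
        -(c * (s * F.coeff 0)) := by
      intro c F G
      rw [coeff_C_mul, coeff_sub, mul_assoc, coeff_C_mul, coeff_X_mul, comp_C_mul_X_coeff,
        coeff_one]
      simp
    rw [h6 _ _ 0, rPoly_coeff_zero] at h5
    simpa [coeff_one, coeff_X_mul, rPoly_coeff_zero] using h5.symm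
  have h6 : C s * (rPoly n b').comp (C s * X) = rPoly n b := by
    rw [h5, ← h4, C_0, zero_mul, zero_add] at h3
    have h7 := mul_left_cancel₀ (C_ne_zero.mpr he') h3
    refine mul_left_cancel₀ X_ne_zero ?_
    linear_combination -h7
  have h7 : ∀ k < n, b k = s ^ (2 * (n - k) + 1) * b' k := by
    intro k hk
    have h8 := congrArg (fun F => F.coeff (2 * (n - k))) h6
    change (C s * (rPoly n b').comp (C s * X)).coeff _ = (rPoly n b).coeff _ at h8
    rw [coeff_C_mul, comp_C_mul_X_coeff, rPoly_coeff_two_mul hk, rPoly_coeff_two_mul hk] at h8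
    refine mul_left_cancel₀ (pow_ne_zero (n - k) (neg_ne_zero.mpr (one_ne_zero (α := K)))) ?_
    rw [← h8]
    ring
  refine ⟨s, ?_, h7⟩
  rintro rfl
  exact hb (by rw [h7 0 (by omega), zero_pow (by omega), zero_mul])

theorem X_pow_dvd_truncPoly_sub {a : ℕ → K} (ha : a 1 ≠ 0) {F : K[X]}
    (hF : X ^ n ∣ 1 - truncPoly n (invCoeff a) * F) :
    X ^ n ∣ F - truncPoly n fun k => a (k + 1) := by
  have h1 := X_pow_dvd_invCoeff n ha
  have h2 := (h1.mul_right F).sub (hF.mul_right (truncPoly n fun k => a (k + 1)))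
  refine h2.trans (dvd_of_eq ?_)
  ring

/-- The coefficients of the towers of linearly equivalent curves. -/
theorem coeff_eq_of_invCoeff_eq {a a' : ℕ → K} (ha : a 1 ≠ 0) (ha' : a' 1 ≠ 0) {α : K}
    (h : ∀ k < n, invCoeff a k = α ^ (2 * (n - k) + 1) * invCoeff a' k) :
    ∀ k < n, a' (k + 1) = α ^ (2 * n + 2 * k + 1) * a (k + 1) := by
  -- The hypothesis says that X ↦ α² X multiplies the truncated inverse series of a by α^(2n+1) and
  -- turns it into that of a'. The claimed coefficients are those of the other factor under the same
  -- substitution, and inverses modulo X^n are unique.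
  have h1 : truncPoly n (invCoeff a') * truncPoly n (fun k => α ^ (2 * n + 2 * k + 1) * a (k + 1)) =
      (truncPoly n (invCoeff a) * truncPoly n fun k => a (k + 1)).comp (C (α ^ 2) * X) := by
    have h2 : (truncPoly n (invCoeff a)).comp (C (α ^ 2) * X) =
        C (α ^ (2 * n + 1)) * truncPoly n (invCoeff a') := by
      ext k
      rw [comp_C_mul_X_coeff, coeff_C_mul, coeff_truncPoly, coeff_truncPoly]
      split_ifs with hk
      · obtain ⟨j, rfl⟩ := Nat.exists_eq_add_of_lt hk
        rw [h k hk, show k + j + 1 - k = j + 1 by omega]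
        ring
      · simp
    have h3 : truncPoly n (fun k => α ^ (2 * n + 2 * k + 1) * a (k + 1)) =
        C (α ^ (2 * n + 1)) * (truncPoly n fun k => a (k + 1)).comp (C (α ^ 2) * X) := by
      ext k
      rw [coeff_C_mul, comp_C_mul_X_coeff, coeff_truncPoly, coeff_truncPoly]
      split_ifs with hk
      · ring
      · simp
    rw [mul_comp, h2, h3]
    ring
  have h2 : X ^ n ∣ 1 - truncPoly n (invCoeff a') *
      truncPoly n (fun k => α ^ (2 * n + 2 * k + 1) * a (k + 1)) := by
    rw [h1]
    obtain ⟨F, hF⟩ := X_pow_dvd_invCoeff n ha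
    have h3 := congrArg (fun G => G.comp (C (α ^ 2) * X)) hF
    simp only [sub_comp, one_comp] at h3
    rw [h3, mul_comp, pow_comp, X_comp, mul_pow]
    exact ((dvd_refl _).mul_left _).mul_right _
  have h3 := X_pow_dvd_iff.mp (X_pow_dvd_truncPoly_sub ha' h2)
  intro k hk
  have h4 := h3 k hk
  rw [coeff_sub, coeff_truncPoly, coeff_truncPoly, if_pos hk, if_pos hk, sub_eq_zero] at h4
  exact h4.symm

end LinearEquivalence

/-! ### Transport of towers by birational maps -/

section Transport

variable {K : Type u} [Field K] {θ : Bir K}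

theorem Bir.push_blowUpChart {R : LocalSubring (FunField K)} {x a : FunField K}
    (ha : a ∈ blowUpChart R x) :
    θ.symm.pull a ∈ blowUpChart (θ.push R) (θ.symm.pull x) := by
  let T : Subring (FunField K) :=
    (blowUpChart (θ.push R) (θ.symm.pull x)).comap (θ.symm.pull : FunField K →+* FunField K)
  have h : blowUpChart R x ≤ T := by
    refine blowUpChart_le (fun r hr => ?_) fun y hy => ?_
    · refine le_blowUpChart _ _ (Bir.mem_push.mpr ?_)
      change θ.pull (θ.symm.pull r) ∈ R.toSubring
      rwa [Bir.pull_symm_pull]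
    · change θ.symm.pull (y / x) ∈ blowUpChart (θ.push R) (θ.symm.pull x)
      rw [map_div₀]
      exact mem_blowUpChart_of_MM (Bir.MM_push.mpr (by rwa [Bir.pull_symm_pull]))
  exact h ha

theorem Bir.push_mem_exceptionalFibre {R S : LocalSubring (FunField K)}
    (h : S ∈ exceptionalFibre R) : θ.push S ∈ exceptionalFibre (θ.push R) := by
  obtain ⟨hRS, x, hx, hx0, hS, hfrac⟩ := mem_exceptionalFibre_iff.mp h
  refine mem_exceptionalFibre_iff.mpr ⟨Bir.push_mono hRS, θ.symm.pull x,
    Bir.MM_push.mpr (by rwa [Bir.pull_symm_pull]), by simpa using hx0, fun y hy => ?_, fun r hr => ?_⟩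
  · rw [Bir.mem_push, map_div₀, Bir.pull_symm_pull]
    exact hS _ (Bir.MM_push.mp hy)
  · obtain ⟨a, ha, b, hb, hb0, hbS, he⟩ := hfrac _ (Bir.mem_push.mp hr)
    refine ⟨_, Bir.push_blowUpChart ha, _, Bir.push_blowUpChart hb, by simpa using hb0, ?_, ?_⟩
    · rwa [Bir.mem_push, map_inv₀, Bir.pull_symm_pull]
    · rw [← map_div₀, ← he, Bir.symm_pull_pull]

theorem Bir.push_isExceptionalCurve {R E : LocalSubring (FunField K)}
    (h : IsExceptionalCurve R E) : IsExceptionalCurve (θ.push R) (θ.push E) := by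
  refine ⟨Bir.push_mem_exceptionalFibre h.1, fun S hS r hr => ?_⟩
  have h1 := Bir.push_mem_exceptionalFibre (θ := θ.symm) hS
  rw [Bir.push_symm_push] at h1
  refine Bir.mem_push.mpr (h.2 _ h1 (Bir.mem_push.mpr ?_))
  rwa [Bir.symm_pull_pull]

theorem IsCoord.push_originRing {s t s' t' : FunField K} (h : IsCoord s t) (h' : IsCoord s' t')
    {c d : K} (hc : c ≠ 0) (hd : d ≠ 0) (hs : θ.pull s' = algebraMap K _ c * s)
    (ht : θ.pull t' = algebraMap K _ d * t) : θ.push (originRing s t) = originRing s' t' := by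
  have key : ∀ {θ : Bir K} {s t s' t' : FunField K} (_ : IsCoord s t) (_ : IsCoord s' t') {c d : K}
      (_ : θ.pull s' = algebraMap K _ c * s) (_ : θ.pull t' = algebraMap K _ d * t),
      originRing s' t' ≤ θ.push (originRing s t) := by
    intro θ s t s' t' h h' c d hs ht
    refine h'.originRing_le (fun e => ?_) ?_ ?_
    · rw [Bir.mem_push, AlgEquiv.commutes]
      exact h.algebraMap_mem e
    · rw [Bir.MM_push, hs]
      exact h.MM_left.mul_left (h.algebraMap_mem c)
    · rw [Bir.MM_push, ht]
      exact h.MM_right.mul_left (h.algebraMap_mem d)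
  refine le_antisymm ?_ (key h h' hs ht)
  have hinv : ∀ {e : K} {r r' : FunField K}, e ≠ 0 → θ.pull r' = algebraMap K _ e * r →
      θ.symm.pull r = algebraMap K _ e⁻¹ * r' := by
    intro e r r' he hr
    have h1 := congrArg θ.symm.pull hr
    rw [Bir.symm_pull_pull, map_mul, AlgEquiv.commutes] at h1
    rw [h1, ← mul_assoc, ← map_mul, inv_mul_cancel₀ he, map_one, one_mul]
  have h1 := Bir.push_mono (θ := θ) (key (θ := θ.symm) h' h (hinv hc hs) (hinv hd ht))
  rwa [Bir.push_push_symm] at h1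

variable (l μ : Kˣ)

theorem fMap_pull_u : (fMap l μ).pull (uFun K) = algebraMap K _ (μ : K) ^ 2 *
    (algebraMap K _ (l : K) * uFun K + (1 - algebraMap K _ (l : K)) * vFun K ^ 2) := by
  simp [(fMap_pull l μ).1, dehom, MvPolynomial.algHom_C]

theorem fMap_pull_v : (fMap l μ).pull (vFun K) = algebraMap K _ (μ : K) * vFun K := by
  simp [(fMap_pull l μ).2, dehom, MvPolynomial.algHom_C]

theorem fMap_pull_w : (fMap l μ).pull (wFun K) = algebraMap K _ ((μ : K) ^ 2 * l) * wFun K := by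
  rw [wFun, map_sub, map_pow, fMap_pull_u, fMap_pull_v, map_mul, map_pow]
  ring

theorem fMap_pull_x : (fMap l μ).pull (xFun K) = algebraMap K _ ((l : K) / (μ : K) ^ 2) * xFun K := by
  have hμ : algebraMap K (FunField K) (μ : K) ≠ 0 := by simp
  have hv := vFun_ne_zero (K := K)
  rw [xFun, map_div₀, map_pow, fMap_pull_w, fMap_pull_v, map_div₀, map_mul, map_pow]
  field_simp

/-- The coefficients of the image tower. -/
def mapCoeff (n : ℕ) (a : ℕ → K) (j : ℕ) : K :=
  (μ : K) * ((μ : K) ^ 2 / (l : K)) ^ (n + j - 1) * a j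

variable {n : ℕ} (a : ℕ → K)

theorem mapCoeff_ne_zero {j : ℕ} (h : a j ≠ 0) : mapCoeff l μ n a j ≠ 0 := by
  simp [mapCoeff, h]

/-- Under f the functions v and X have weights μ and λ/μ². Each blow-up divides by X, so the
constant subtracted at step k has weight μ (μ²/λ)^(k+1); for a_j this is the exponent n + j - 1 of
`mapCoeff`. -/
theorem fMap_pull_towerCoord (hn : 1 ≤ n) (k : ℕ) :
    (fMap l μ).pull (towerCoord n (mapCoeff l μ n a) k) =
      algebraMap K _ ((μ : K) * ((μ : K) ^ 2 / (l : K)) ^ k) * towerCoord n a k := by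
  induction k with
  | zero => rw [pow_zero, mul_one, towerCoord, towerCoord, fMap_pull_v]
  | succ k ih =>
    have hconst : towerConst n (mapCoeff l μ n a) k =
        (μ : K) * ((μ : K) ^ 2 / (l : K)) ^ (k + 1) * towerConst n a k := by
      rw [towerConst, towerConst]
      split_ifs with h
      · rw [mul_zero]
      · rw [mapCoeff, show n + (k + 2 - n) - 1 = k + 1 by omega]
    have hμ : algebraMap K (FunField K) (μ : K) ≠ 0 := by simp
    have hl : algebraMap K (FunField K) (l : K) ≠ 0 := by simp
    have hx := xFun_ne_zero (K := K)
    rw [towerCoord, towerCoord, map_sub, map_div₀, ih, fMap_pull_x, AlgEquiv.commutes, hconst]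
    simp only [map_mul, map_pow, map_div₀, pow_succ]
    field_simp

theorem fMap_push_towerPoint (hn : 1 ≤ n) (i : ℕ) :
    (fMap l μ).push (towerPoint n a i) = towerPoint n (mapCoeff l μ n a) i := by
  have hμ : (μ : K) ≠ 0 := μ.ne_zero
  have hl : (l : K) ≠ 0 := l.ne_zero
  rcases Nat.lt_or_ge i 5 with hi | hi
  · rw [towerPoint_of_le _ _ (by omega), towerPoint_of_le _ _ (by omega)]
    refine (isCoord_v_div _).push_originRing (isCoord_v_div _) hμ
      (d := (μ : K) ^ 2 * l / (μ : K) ^ (i - 1)) (by positivity) (fMap_pull_v l μ) ?_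
    rw [map_div₀, map_pow, fMap_pull_w, fMap_pull_v, mul_pow, map_div₀ (algebraMap K (FunField K)),
      map_pow (algebraMap K (FunField K)), mul_div_mul_comm]
  · obtain ⟨k, rfl⟩ := Nat.exists_eq_add_of_le hi
    rw [towerPoint_add hn, towerPoint_add hn]
    exact (isCoord_towerCoord n a k).push_originRing (isCoord_towerCoord n _ k)
      (div_ne_zero hl (pow_ne_zero 2 hμ))
      (mul_ne_zero hμ (pow_ne_zero k (div_ne_zero (pow_ne_zero 2 hμ) hl)))
      (fMap_pull_x l μ) (fMap_pull_towerCoord l μ a hn k)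

/-! ### The map f and its inverse as triples of forms -/

open MvPolynomial

/-- The components of the map `f`. -/
def fForm : Fin 3 → HomRing K :=
  ![C (μ : K) ^ 2 * (C (l : K) * X 0 * X 2 + (1 - C (l : K)) * X 1 ^ 2), C (μ : K) * X 1 * X 2,
    X 2 ^ 2]

/-- The components of the inverse of the map `f`. -/
def fFormInv : Fin 3 → HomRing K :=
  ![C (l : K)⁻¹ * (C (μ : K)⁻¹ ^ 2 * (X 0 * X 2 - (1 - C (l : K)) * X 1 ^ 2)),
    C (μ : K)⁻¹ * X 1 * X 2, X 2 ^ 2]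

theorem fForm_zero : fForm l μ 0 =
    C (μ : K) ^ 2 * (C (l : K) * X 0 * X 2 + (1 - C (l : K)) * X 1 ^ 2) := rfl

theorem fForm_one : fForm l μ 1 = C (μ : K) * X 1 * X 2 := rfl

theorem fForm_two : fForm l μ 2 = X 2 ^ 2 := rfl

theorem fFormInv_zero : fFormInv l μ 0 =
    C (l : K)⁻¹ * (C (μ : K)⁻¹ ^ 2 * (X 0 * X 2 - (1 - C (l : K)) * X 1 ^ 2)) := rfl

theorem fFormInv_one : fFormInv l μ 1 = C (μ : K)⁻¹ * X 1 * X 2 := rfl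

theorem fFormInv_two : fFormInv l μ 2 = X 2 ^ 2 := rfl

theorem C_mul_C_inv_homRing (c : Kˣ) : (C (c : K) * C (c : K)⁻¹ : HomRing K) = 1 := by
  rw [← C_mul, mul_inv_cancel₀ c.ne_zero, C_1]

theorem fMap_givenBy : (fMap l μ).GivenBy (fForm l μ) 2 where
  isHomogeneous i := by
    have hX : ∀ i : Fin 3, (X i : HomRing K).IsHomogeneous 1 := isHomogeneous_X K
    have hC : ∀ c : K, (C c : HomRing K).IsHomogeneous 0 := isHomogeneous_C (Fin 3)
    fin_cases i
    · exact ((hC _).pow 2).mul ((((hC _).mul (hX 0)).mul (hX 2)).add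
        (((isHomogeneous_one (Fin 3) K).sub (hC _)).mul ((hX 1).pow 2)))
    · exact ((hC _).mul (hX 1)).mul (hX 2)
    · exact (hX 2).pow 2
  exists_factor := by
    refine ⟨1, one_ne_zero, fun i => ?_⟩
    rw [one_mul]
    fin_cases i
    · change dehom K (C (μ : K) ^ 2 * (C (l : K) * X 0 * X 2 + (1 - C (l : K)) * X 1 ^ 2)) =
        (fMap l μ).pull (dehom K (X 0))
      simp [dehom, fMap_pull_u, algHom_C]
    · change dehom K (C (μ : K) * X 1 * X 2) = (fMap l μ).pull (dehom K (X 1))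
      simp [dehom, fMap_pull_v, algHom_C]
    · change dehom K (X 2 ^ 2) = (fMap l μ).pull (dehom K (X 2))
      simp [dehom]

theorem isPairOff_fForm : IsPairOff (fForm l μ) (fFormInv l μ) 2 2 (X 2) where
  left_isHomogeneous := (fMap_givenBy l μ).isHomogeneous
  right_isHomogeneous i := by
    have hX : ∀ i : Fin 3, (X i : HomRing K).IsHomogeneous 1 := isHomogeneous_X K
    have hC : ∀ c : K, (C c : HomRing K).IsHomogeneous 0 := isHomogeneous_C (Fin 3)
    fin_cases i
    · exact (hC _).mul (((hC _).pow 2).mul (((hX 0).mul (hX 2)).sub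
        (((isHomogeneous_one (Fin 3) K).sub (hC _)).mul ((hX 1).pow 2))))
    · exact ((hC _).mul (hX 1)).mul (hX 2)
    · exact (hX 2).pow 2
  left_pos := two_ne_zero
  right_pos := two_ne_zero
  ne_zero := X_ne_zero 2
  comp_left := by
    have h1 := C_mul_C_inv_homRing μ
    have h2 := C_mul_C_inv_homRing l
    refine ⟨3, fun i => ?_⟩
    fin_cases i
    · change aeval (fForm l μ) (fFormInv l μ 0) = X 2 ^ 3 * X 0
      simp only [fFormInv_zero, map_mul, map_sub, map_pow, map_one, aeval_X, algHom_C,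
        algebraMap_eq, fForm_zero, fForm_one, fForm_two]
      linear_combination X 0 * X 2 ^ 3 * (C (l : K)⁻¹ * C (l : K) *
        (C (μ : K) * C (μ : K)⁻¹ + 1)) * h1 + X 0 * X 2 ^ 3 * h2
    · change aeval (fForm l μ) (fFormInv l μ 1) = X 2 ^ 3 * X 1
      simp only [fFormInv_one, map_mul, aeval_X, algHom_C, algebraMap_eq, fForm_one, fForm_two]
      linear_combination X 1 * X 2 ^ 3 * h1
    · change aeval (fForm l μ) (fFormInv l μ 2) = X 2 ^ 3 * X 2
      simp only [fFormInv_two, map_pow, aeval_X, fForm_two]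
      ring
  comp_right := by
    have h1 := C_mul_C_inv_homRing μ
    have h2 := C_mul_C_inv_homRing l
    refine ⟨3, fun i => ?_⟩
    fin_cases i
    · change aeval (fFormInv l μ) (fForm l μ 0) = X 2 ^ 3 * X 0
      simp only [fForm_zero, map_mul, map_sub, map_add, map_pow, map_one, aeval_X, algHom_C,
        algebraMap_eq, fFormInv_zero, fFormInv_one, fFormInv_two]
      linear_combination X 0 * X 2 ^ 3 * (C (μ : K) * C (μ : K)⁻¹ + 1) * h1 +
        C (μ : K) ^ 2 * C (μ : K)⁻¹ ^ 2 * X 2 ^ 2 * (X 0 * X 2 - (1 - C (l : K)) * X 1 ^ 2) * h2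
    · change aeval (fFormInv l μ) (fForm l μ 1) = X 2 ^ 3 * X 1
      simp only [fForm_one, map_mul, aeval_X, algHom_C, algebraMap_eq, fFormInv_one, fFormInv_two]
      linear_combination X 1 * X 2 ^ 3 * h1
    · change aeval (fFormInv l μ) (fForm l μ 2) = X 2 ^ 3 * X 2
      simp only [fForm_two, map_pow, aeval_X, fFormInv_two]
      ring
  aeval_left := ⟨2, aeval_X _ _⟩
  aeval_right := ⟨2, aeval_X _ _⟩

end Transport

/-! ### The complements of the images of the line -/

section Complements

variable {K : Type u} [Field K]

open MvPolynomial

theorem Bir.push_injective (θ : Bir K) : Function.Injective θ.push :=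
  Function.LeftInverse.injective θ.push_symm_push

/-- The isomorphism `f` of the complement of the line preserves the conic. -/
theorem fMap_push_conicQ (l μ : Kˣ) :
    (fMap l μ).push (localRing (PlaneCurve.conicQ K).genericPoint) =
      localRing (PlaneCurve.conicQ K).genericPoint := by
  have hQ : ¬ wForm K ∣ X 2 := by
    rintro ⟨q, hq⟩
    rw [wForm_eq] at hq
    have h1 := congrArg (aeval (R := K) (fun _ => (1 : K))) hq
    simp at h1
  obtain ⟨D, hD2, hD, he⟩ := (isPairOff_fForm l μ).exists_push_eq (fMap_givenBy l μ)
    (C := PlaneCurve.conicQ K) hQ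
  have h1 : aeval (fFormInv l μ) (PlaneCurve.conicQ K).poly =
      C (l : K)⁻¹ * C (μ : K)⁻¹ ^ 2 * X 2 ^ 2 * wForm K := by
    change aeval (fFormInv l μ) (X 0 * X 2 - X 1 ^ 2) = _
    have h2 := C_mul_C_inv_homRing l
    simp only [map_sub, map_mul, map_pow, aeval_X, fFormInv_zero, fFormInv_one, fFormInv_two]
    rw [wForm_eq]
    linear_combination C (μ : K)⁻¹ ^ 2 * X 2 ^ 2 * X 1 ^ 2 * h2
  have hunit : ∀ c : Kˣ, ¬ D.poly ∣ C (c : K)⁻¹ := fun c hc =>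
    D.irreducible.not_isUnit (isUnit_of_dvd_unit hc
      ((isUnit_iff_ne_zero.mpr (inv_ne_zero c.ne_zero)).map C))
  rw [h1] at hD
  -- The transformed equation of Q is a constant times z² w, and D is not the line z = 0.
  have h3 : D.poly ∣ wForm K := by
    rcases D.prime.dvd_or_dvd hD with h | h
    · rcases D.prime.dvd_or_dvd h with h | h
      · rcases D.prime.dvd_or_dvd h with h | h
        · exact absurd h (hunit l)
        · exact absurd (D.prime.dvd_of_dvd_pow h) (hunit μ)
      · exact absurd (D.prime.dvd_of_dvd_pow h) hD2
    · exact h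
  rw [he, genericPoint_eq_of_dvd_wForm h3]

/-- The property of a birational map of permuting the curves other than the line, with the conic
fixed. -/
structure Bir.PermutesCurves (f : Bir K) : Prop where
  conic : f.push (localRing (PlaneCurve.conicQ K).genericPoint) =
    localRing (PlaneCurve.conicQ K).genericPoint
  exists_push_eq : ∀ G : PlaneCurve K, ¬ G.poly ∣ X 2 → ∃ H : PlaneCurve K, ¬ H.poly ∣ X 2 ∧
    f.push (localRing G.genericPoint) = localRing H.genericPoint

theorem permutesCurves_fMap (l μ : Kˣ) : (fMap l μ).PermutesCurves where
  conic := fMap_push_conicQ l μ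
  exists_push_eq G hG := by
    obtain ⟨D, hD2, -, he⟩ := (isPairOff_fForm l μ).exists_push_eq (fMap_givenBy l μ) hG
    exact ⟨D, hD2, he⟩

theorem permutesCurves_fMap_symm (l μ : Kˣ) : (fMap l μ).symm.PermutesCurves where
  conic := by
    conv_lhs => rw [← fMap_push_conicQ l μ]
    exact Bir.push_symm_push _ _
  exists_push_eq G hG := by
    have h : fMap l μ = (isPairOff_fForm l μ).toBir := by
      refine Bir.ext_pull fun r => ?_
      obtain ⟨m, F, H, hF, hH, hH0, rfl⟩ := exists_fraction r
      rw [(fMap_givenBy l μ).pull_div hF hH, (isPairOff_fForm l μ).toBir_givenBy.pull_div hF hH]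
    obtain ⟨D, hD2, -, he⟩ := (isPairOff_fForm l μ).symm.exists_push_eq
      (isPairOff_fForm l μ).symm.toBir_givenBy hG
    exact ⟨D, hD2, by rw [h]; exact he⟩

/-! ### Curves and regular functions on the two complements -/

variable {n : ℕ} {a a' : ℕ → K} {φ φ' f : Bir K}

/-- In lowest terms, poles occur only along the factors of the denominator; a function regular along
all curves but C has a power of C as denominator. -/
theorem mem_regular_iff {C : PlaneCurve K} {r : FunField K} : r ∈ C.regular ↔
    ∀ G : PlaneCurve K, localRing G.genericPoint ≠ localRing C.genericPoint →
      r ∈ (localRing G.genericPoint).toSubring := by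
  have hne : ∀ G : PlaneCurve K, localRing G.genericPoint ≠ localRing C.genericPoint ↔
      ¬ G.poly ∣ C.poly := by
    intro G
    rw [not_iff_not]
    constructor
    · intro h
      exact (genericPoint_eq_iff.mp (localRing_injective h)).dvd
    · intro h
      rw [PlaneCurve.genericPoint_eq_of_dvd h]
  rw [PlaneCurve.mem_regular]
  constructor
  · rintro ⟨k, A, hA, rfl⟩ G hG
    refine mem_localRing.mpr ⟨C.deg * k, A, C.poly ^ k, hA, C.isHomogeneous.pow k, fun h => ?_, rfl⟩
    exact (hne G).mp hG (G.prime.dvd_of_dvd_pow (mem_genericPoint.mp h))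
  · intro h
    exact exists_eq_div_pow C.isHomogeneous C.irreducible fun G hG => h G ((hne G).mpr hG)

/-- A map induced by a map of towers sends the curves other than the image of the line to curves. -/
theorem exists_push_eq_of_ne (hn : 1 ≤ n) (ha : a 1 ≠ 0)
    (hφ : IsTowerMap (towerPoint n a) (4 + 2 * n) φ)
    (hφ' : IsTowerMap (towerPoint n a') (4 + 2 * n) φ')
    (hf : f.PermutesCurves)
    (hp : f.push (towerPoint n a (4 + 2 * n)) = towerPoint n a' (4 + 2 * n))
    {G : PlaneCurve K} (hG : localRing G.genericPoint ≠
      φ.push (localRing (PlaneCurve.lineL K).genericPoint)) :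
    ∃ H : PlaneCurve K, (φ'.comp (f.comp φ.symm)).push (localRing G.genericPoint) =
      localRing H.genericPoint ∧
      localRing H.genericPoint ≠ φ'.push (localRing (PlaneCurve.lineL K).genericPoint) := by
  rw [Bir.push_comp, Bir.push_comp]
  have hQL : ∀ G : PlaneCurve K, G.poly ∣ X 2 →
      localRing G.genericPoint = localRing (PlaneCurve.lineL K).genericPoint := fun G h => by
    rw [PlaneCurve.genericPoint_eq_of_dvd (D := PlaneCurve.lineL K) h]
  obtain ⟨θ, A, B, hθ, rfl⟩ := hφ.exists_isLinear hn ha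
  obtain ⟨G1, -, hG1⟩ := hθ.symm.exists_push_eq G
  have h1 : (θ.comp (towerBir n a)).symm.push (localRing G.genericPoint) =
      (towerBir n a).symm.push (localRing G1.genericPoint) := by
    rw [← hG1, ← Bir.push_comp]
    rfl
  -- After removal of the linear part, the conic is the image of the last exceptional curve. That
  -- curve is carried by f to the last exceptional curve of the other tower, and by φ' to the conic.
  by_cases hG1w : G1.poly ∣ wForm K
  · obtain ⟨E, hE⟩ := exists_isExceptionalCurve_last n hn a
    have h2 : (towerBir n a).symm.push (localRing G1.genericPoint) = E := by
      rw [genericPoint_eq_of_dvd_wForm hG1w,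
        ← ((isTowerMap_towerBir hn ha).last_to_conic E hE).push_eq, Bir.push_symm_push]
    have hE' : IsExceptionalCurve (towerPoint n a' (4 + 2 * n)) (f.push E) :=
      hp ▸ Bir.push_isExceptionalCurve hE
    refine ⟨PlaneCurve.conicQ K, by rw [h1, h2, (hφ'.last_to_conic _ hE').push_eq], fun h => ?_⟩
    rw [← (hφ'.last_to_conic _ hE').push_eq] at h
    rw [φ'.push_injective h] at hE'
    exact (isCoordTower_towerPoint hn a' (4 + 2 * n)).not_isExceptionalCurve _ (by omega) le_rfl hE'
  · obtain ⟨G2, hG2, -, he2⟩ := (isPairOff_phiForm n (invCoeff a)).symm.exists_push_eq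
      (θ := (towerBir n a).symm) (isPairOff_phiForm n (invCoeff a)).symm.toBir_givenBy hG1w
    have hG2L : ¬ G2.poly ∣ X 2 := fun h => hG (by
      rw [← hQL G2 h, ← he2, ← h1, Bir.push_push_symm])
    obtain ⟨G3, hG3, he3⟩ := hf.exists_push_eq G2 hG2L
    -- The map f fixes Q and is injective on local rings, so a curve other than Q does not become Q,
    -- which φ' would contract.
    have hG3w : ¬ G3.poly ∣ wForm K := fun h => by
      rw [genericPoint_eq_of_dvd_wForm h, ← hf.conic] at he3
      exact conicQ_not_dvd hG2 (localRing_injective (f.push_injective he3))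
    obtain ⟨H, hH⟩ := hφ'.exists_push_eq hn hG3w
    refine ⟨H, by rw [h1, he2, he3, hH], fun h => hG3 ?_⟩
    rw [← hH] at h
    exact (genericPoint_eq_iff.mp (localRing_injective (φ'.push_injective h))).dvd

/-- Regularity off C is regularity along all other curves, and these correspond to the curves other
than D. The hypotheses are symmetric, so the inverse map gives the other implication. -/
theorem complIsoVia_of_isTowerMap (hn : 1 ≤ n) (ha : a 1 ≠ 0) (ha' : a' 1 ≠ 0)
    (hφ : IsTowerMap (towerPoint n a) (4 + 2 * n) φ)
    (hφ' : IsTowerMap (towerPoint n a') (4 + 2 * n) φ')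
    (hf : f.PermutesCurves) (hf' : f.symm.PermutesCurves)
    (hp : f.push (towerPoint n a (4 + 2 * n)) = towerPoint n a' (4 + 2 * n)) {C D : PlaneCurve K}
    (hC : φ.push (localRing (PlaneCurve.lineL K).genericPoint) = localRing C.genericPoint)
    (hD : φ'.push (localRing (PlaneCurve.lineL K).genericPoint) = localRing D.genericPoint) :
    PlaneCurve.ComplIsoVia (φ'.comp (f.comp φ.symm)) C D := by
  refine PlaneCurve.complIsoVia fun r => ?_
  rw [mem_regular_iff, mem_regular_iff, ← hC, ← hD]
  constructor
  · intro h G hG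
    obtain ⟨H, hH, hne⟩ := exists_push_eq_of_ne hn ha hφ hφ' hf hp hG
    exact Bir.mem_push.mp (hH ▸ h H hne)
  · intro h G hG
    obtain ⟨H, hH, hne⟩ := exists_push_eq_of_ne hn ha' hφ' hφ hf'
      (by rw [← hp, Bir.push_symm_push]) hG
    have h1 := h H hne
    rw [← hH, Bir.mem_push] at h1
    have h2 : (φ.comp (f.symm.comp φ'.symm)).pull ((φ'.comp (f.comp φ.symm)).pull r) = r :=
      Bir.symm_pull_pull (φ'.comp (f.comp φ.symm)) r
    rwa [h2] at h1

theorem exists_isLinear_push_eq (hn : 1 ≤ n) (ha : a 1 ≠ 0)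
    (hφ : IsTowerMap (towerPoint n a) (4 + 2 * n) φ) : ∃ (θ : Bir K) (A B : Fin 3 → HomRing K),
    θ.IsLinear A B ∧ φ.push (localRing (PlaneCurve.lineL K).genericPoint) =
      θ.push (localRing (towerCurve hn (invCoeff_zero_ne_zero ha)).genericPoint) := by
  obtain ⟨θ, A, B, hθ, rfl⟩ := hφ.exists_isLinear hn ha
  exact ⟨θ, A, B, hθ, by rw [Bir.push_comp, towerBir_push_lineL hn ha]⟩

theorem exists_isImage_lineL (hn : 1 ≤ n) (ha : a 1 ≠ 0)
    (hφ : IsTowerMap (towerPoint n a) (4 + 2 * n) φ) :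
    ∃ C, PlaneCurve.IsImage φ (PlaneCurve.lineL K) C := by
  obtain ⟨θ, A, B, hθ, h⟩ := exists_isLinear_push_eq hn ha hφ
  obtain ⟨C, -, hC⟩ := hθ.exists_push_eq (towerCurve hn (invCoeff_zero_ne_zero ha))
  exact ⟨C, (h.trans hC).ge⟩

theorem image_lineL_properties (hn : 1 ≤ n) (ha : a 1 ≠ 0)
    (hφ : IsTowerMap (towerPoint n a) (4 + 2 * n) φ) {C : PlaneCurve K}
    (hC : φ.push (localRing (PlaneCurve.lineL K).genericPoint) = localRing C.genericPoint) :
    C.deg = 4 * n + 1 ∧ C.IsTypeI ∧ C.IsUnicuspidal := by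
  obtain ⟨θ, A, B, hθ, h⟩ := exists_isLinear_push_eq hn ha hφ
  exact image_properties hθ hn (invCoeff_zero_ne_zero ha) (h.symm.trans hC)

/-- The coefficients of towers with projectively equivalent images of the line. -/
theorem coeff_eq_of_projectivelyEquivalent (hn : 1 ≤ n) (ha : a 1 ≠ 0) (ha' : a' 1 ≠ 0)
    (hφ : IsTowerMap (towerPoint n a) (4 + 2 * n) φ)
    (hφ' : IsTowerMap (towerPoint n a') (4 + 2 * n) φ') {C D : PlaneCurve K}
    (hC : φ.push (localRing (PlaneCurve.lineL K).genericPoint) = localRing C.genericPoint)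
    (hD : φ'.push (localRing (PlaneCurve.lineL K).genericPoint) = localRing D.genericPoint)
    (h : C.ProjectivelyEquivalent D) :
    ∃ α : K, α ≠ 0 ∧ ∀ k < n, a' (k + 1) = α ^ (2 * n + 2 * k + 1) * a (k + 1) := by
  have hb := invCoeff_zero_ne_zero ha
  have hb' := invCoeff_zero_ne_zero ha'
  obtain ⟨θ, A, B, hθ, h1⟩ := exists_isLinear_push_eq hn ha hφ
  obtain ⟨θ', A', B', hθ', h1'⟩ := exists_isLinear_push_eq hn ha' hφ'
  obtain ⟨τ, S, T, hτ, h2⟩ := h.exists_isLinear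
  rw [hC] at h1
  have h3 : θ'.symm.push (localRing D.genericPoint) =
      localRing (towerCurve hn hb').genericPoint := by
    rw [← hD, h1', Bir.push_symm_push]
  have hdvd : ∀ F : HomRing K, curveForm n (invCoeff a') ∣ F ↔
      curveForm n (invCoeff a) ∣ aeval A (aeval S (aeval B' F)) := fun F =>
    (hθ'.symm.dvd_iff h3 F).trans ((hτ.dvd_iff h2.push_eq _).trans (hθ.dvd_iff h1.symm _))
  -- The equivalence of C and D, moved to one between the two curves obtained by shears.
  let R : Fin 3 → HomRing K := fun i => aeval A (aeval S (B' i))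
  let R' : Fin 3 → HomRing K := fun i => aeval A' (aeval T (B i))
  have hR : ∀ F, aeval R F = aeval A (aeval S (aeval B' F)) := fun F => by
    rw [← AlgHom.comp_apply, ← AlgHom.comp_apply, MvPolynomial.comp_aeval]
    rfl
  have hRhom : ∀ i, (R i).IsHomogeneous 1 := fun i =>
    isHomogeneous_of_eq (isHomogeneous_aeval hθ.givenBy.isHomogeneous
      (isHomogeneous_aeval hτ.givenBy.isHomogeneous (hθ'.symm_givenBy.isHomogeneous i))) rfl
  have hRhom' : ∀ i, (R' i).IsHomogeneous 1 := fun i =>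
    isHomogeneous_of_eq (isHomogeneous_aeval hθ'.givenBy.isHomogeneous
      (isHomogeneous_aeval hτ.symm_givenBy.isHomogeneous (hθ.symm_givenBy.isHomogeneous i))) rfl
  have hRR : ∀ i, aeval R (R' i) = X i := fun i => by
    rw [hR, hθ'.symm.aeval_aeval, hτ.aeval_aeval, hθ.aeval_left]
  have hm : curveEval n (invCoeff a) (aeval R (curveForm n (invCoeff a'))) = 0 := by
    rw [curveEval_eq_zero_iff hn hb (isHomogeneous_aeval hRhom (curveForm_isHomogeneous n _)), hR,
      ← hdvd]
  -- Otherwise the second curve would be the conic.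
  have hw : curveEval n (invCoeff a) (aeval R (wForm K)) ≠ 0 := by
    rw [Ne, curveEval_eq_zero_iff hn hb (isHomogeneous_aeval hRhom wForm_isHomogeneous), hR, ← hdvd]
    intro h4
    exact not_wForm_dvd_curveForm hn hb' ((curveForm_irreducible hn hb').associated_of_dvd
      (PlaneCurve.conicQ K).irreducible h4).symm.dvd
  obtain ⟨P, e, he, hP⟩ := exists_eq_comp_of_linear hn hb' hRhom' hRR hm hw
  obtain ⟨α, hα, hcoeff⟩ := coeff_eq_of_comp hn hb hb' hRhom he hP
  exact ⟨α, hα, coeff_eq_of_invCoeff_eq ha ha' hcoeff⟩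

/-- With κ = μ²/λ, nonvanishing of a_(k+1) gives μ κ^(n+k) = α^(2n+2k+1). The quotient of two
consecutive relations is κ = α²; substituted back, it gives μ = α, and then λ = μ²/κ = 1. -/
theorem eq_one_of_mapCoeff_eq {l μ : Kˣ} (ha : ∃ j, 1 ≤ j ∧ j < n ∧ a j ≠ 0 ∧ a (j + 1) ≠ 0) {α : K}
    (h : ∀ k < n, mapCoeff l μ n a (k + 1) = α ^ (2 * n + 2 * k + 1) * a (k + 1)) : l = 1 := by
  obtain ⟨j, hj1, hjn, hj, hj'⟩ := ha
  obtain ⟨k, rfl⟩ : ∃ k, j = k + 1 := ⟨j - 1, by omega⟩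
  set κ := (μ : K) ^ 2 / (l : K)
  have hl := l.ne_zero
  have hμ := μ.ne_zero
  have hκ : κ ≠ 0 := div_ne_zero (pow_ne_zero 2 hμ) hl
  have key : ∀ i < n, a (i + 1) ≠ 0 → (μ : K) * κ ^ (n + i) = α ^ (2 * n + 2 * i + 1) := by
    intro i hi h0
    exact mul_right_cancel₀ h0 (h i hi)
  have h1 := key k (by omega) hj
  have h2 := key (k + 1) hjn hj'
  have h3 : κ = α ^ 2 := by
    refine mul_left_cancel₀ (mul_ne_zero hμ (pow_ne_zero (n + k) hκ)) ?_
    conv_rhs => rw [h1]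
    linear_combination h2
  have hα : α ≠ 0 := by
    rintro rfl
    exact hκ (h3.trans (zero_pow two_ne_zero))
  have h4 : (μ : K) = α := by
    refine mul_right_cancel₀ (pow_ne_zero (n + k) hκ) (h1.trans ?_)
    rw [h3, ← pow_mul]
    ring
  have h5 : (l : K) * (μ : K) ^ 2 = 1 * (μ : K) ^ 2 := by
    have h6 : κ * l = (μ : K) ^ 2 := div_mul_cancel₀ _ hl
    have h7 : κ = (μ : K) ^ 2 := by rw [h3, h4]
    linear_combination h6 - l * h7
  exact Units.ext (mul_right_cancel₀ (pow_ne_zero 2 hμ) h5)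

end Complements

end PlaneBirational

end

open PlaneBirational

theorem mainTheorem1 {K : Type*} [Field K] (n : ℕ) (hn : 2 ≤ n) (a : ℕ → K) (ha1 : a 1 ≠ 0)
    (ha : ∃ j, 1 ≤ j ∧ j < n ∧ a j ≠ 0 ∧ a (j + 1) ≠ 0)
    (l μ : Kˣ) (hl : l ≠ 1)
    (p p' : ℕ → LocalSubring (PlaneBirational.FunField K))
    (hp : ∀ i, p i = PlaneBirational.towerPoint n a i)
    (hp' : ∀ i, p' i = (PlaneBirational.fMap l μ).push (p i)) :
    PlaneBirational.IsTower p (4 + 2 * n) ∧ PlaneBirational.IsTower p' (4 + 2 * n) ∧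
    (∃ φ, PlaneBirational.IsTowerMap p (4 + 2 * n) φ) ∧
    (∃ φ', PlaneBirational.IsTowerMap p' (4 + 2 * n) φ') ∧
    ∀ φ φ' : PlaneBirational.Bir K,
      PlaneBirational.IsTowerMap p (4 + 2 * n) φ →
      PlaneBirational.IsTowerMap p' (4 + 2 * n) φ' →
      (∃ C, PlaneBirational.PlaneCurve.IsImage φ (PlaneBirational.PlaneCurve.lineL K) C) ∧
      (∃ D, PlaneBirational.PlaneCurve.IsImage φ' (PlaneBirational.PlaneCurve.lineL K) D) ∧
      ∀ C D : PlaneBirational.PlaneCurve K,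
        PlaneBirational.PlaneCurve.IsImage φ (PlaneBirational.PlaneCurve.lineL K) C →
        PlaneBirational.PlaneCurve.IsImage φ' (PlaneBirational.PlaneCurve.lineL K) D →
        (C.deg = 4 * n + 1 ∧ C.IsTypeI ∧ C.IsUnicuspidal) ∧
        (D.deg = 4 * n + 1 ∧ D.IsTypeI ∧ D.IsUnicuspidal) ∧
        PlaneBirational.PlaneCurve.ComplIsoVia
          (φ'.comp ((PlaneBirational.fMap l μ).comp φ.symm)) C D ∧
        ¬ PlaneBirational.PlaneCurve.ProjectivelyEquivalent C D := by
  have hn1 : 1 ≤ n := by omega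
  obtain rfl : p = towerPoint n a := funext hp
  obtain rfl : p' = towerPoint n (mapCoeff l μ n a) := funext fun i => by
    rw [hp', fMap_push_towerPoint l μ a hn1]
  have ha1' : mapCoeff l μ n a 1 ≠ 0 := mapCoeff_ne_zero l μ a ha1
  refine ⟨(isCoordTower_towerPoint hn1 _ _).isTower, (isCoordTower_towerPoint hn1 _ _).isTower,
    ⟨_, isTowerMap_towerBir hn1 ha1⟩, ⟨_, isTowerMap_towerBir hn1 ha1'⟩, fun φ φ' hφ hφ' => ?_⟩
  refine ⟨exists_isImage_lineL hn1 ha1 hφ, exists_isImage_lineL hn1 ha1' hφ',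
    fun C D hC hD => ?_⟩
  refine ⟨image_lineL_properties hn1 ha1 hφ hC.push_eq,
    image_lineL_properties hn1 ha1' hφ' hD.push_eq, ?_, fun h => ?_⟩
  · exact complIsoVia_of_isTowerMap hn1 ha1 ha1' hφ hφ' (permutesCurves_fMap l μ)
      (permutesCurves_fMap_symm l μ) (fMap_push_towerPoint l μ a hn1 _) hC.push_eq hD.push_eq
  · obtain ⟨α, -, hα⟩ := coeff_eq_of_projectivelyEquivalent hn1 ha1 ha1' hφ hφ' hC.push_eq
      hD.push_eq h
    exact hl (eq_one_of_mapCoeff_eq ha hα)
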